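/- **Setting.** Let $n\ge 1$. Let $\mathcal F$ be the Fourier transform with kernel $e^{-ix\cdot\xi}$, write $m(D)=\mathcal F^{-1}m\,\mathcal F$, and fix radial smooth $\chi,\varphi:\mathbb R^n\to[0,1]$ with $\operatorname{supp}\chi\subset B(0,4/3)$, $\operatorname{supp}\varphi\subset\{3/4<|\xi|<8/3\}$, $\chi(\xi)+\sum_{j\ge0}\varphi(2^{-j}\xi)=1$ for all $\xi$, and $\sum_{j\in\mathbb Z}\varphi(2^{-j}\xi)=1$ for $\xi\ne0$. Put $\dot S_j=\chi(2^{-j}D)$, $\dot\Delta_j=\varphi(2^{-j}D)$ on $\mathcal S'(\mathbb R^n)$, and let $\mathcal S'_h$ be the set of $u\in\mathcal S'(\mathbb R^n)$ with $\|\dot S_ju\|_{L^\infty}\to0$ as $j\to-\infty$. The space $\dot B^s_{p,q}$ consists of the $u\in\mathcal S_h'$ with $\big\|2^{js}\|\dot\Delta_ju\|_{L^p}\big\|_{\ell^q(\mathbb Z)}<\infty$. For $T\in(0,\infty)$, $L^\alpha_TL^p$ consists of the weakly* measurable $u$ on $(0,T)$ (i.e. $t\mapsto\langle u(t),\phi\rangle$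 is measurable for every test function $\phi$) with values in $L^p$ for a.e. $t$ and $\big\|\|u(t)\|_{L^p}\big\|_{L^\alpha(0,T)}<\infty$; $\widetilde L^\alpha_T\dot B^s_{p,q}$ consists of the weakly* measurable $u$ with $u(t)\in\mathcal S'_h$ for a.e. $t$ and $\big\|2^{js}\|\dot\Delta_ju\|_{L^\alpha_TL^p}\big\|_{\ell^q(\mathbb Z)}<\infty$. Functions of $t$ are identified if they agree for a.e. $t$; all distributions are real-valued, and vector or matrix fields belong to a space if all their components do. Put $(u\otimes v)_{ij}=u_iv_j$ (pointwise product of functions) and $$\mathsf{Bony}(u,v)_{ij}=\sum_{l}\dot S_{l-1}u_i\,\dot\Delta_lv_j+\sum_l\dot S_{l-1}v_j\,\dot\Delta_lu_i+\sum_l\sum_{|\nu|\le1}\dot\Delta_lu_i\,\dot\Delta_{l-\nu}v_j,$$ with convergence in $\mathcal S'$. Let $\mathbb P_{ij}$ have the symbol $\delta_{ij}-\xi_i\xi_j/|\xi|^2$, and define (summing over repeated indices) $\langle(\mathbb P\nabla\cdot W)_i,\phi\rangle=-\langle W_{jk},\mathbb P_{ij}\nabla_k\phi\rangle$ for $\phi\in\mathcal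 S$, $\langle G[w](t),\phi\rangle=\int_0^t\langle e^{(t-s)\Delta}w(s),\phi\rangle\,ds$, $$B[u,v]=G\,\mathbb P\nabla\cdot(u\otimes v),\qquad \widetilde B[u,v]=G\Big(\sum_{l\in\mathbb Z}\mathbb P\nabla\cdot\dot\Delta_l\mathsf{Bony}(u,v)\Big).$$ Let $s_\ell=-1+\frac n\ell$, and call $(\alpha,\ell,\epsilon)\in[1,\infty]^2\times(0,1]$ admissible if either $s_\ell+\epsilon+\frac2\alpha=0$ and $-s_2\le\epsilon+\frac2\alpha\le1$, or $s_\ell+\epsilon+\frac2\alpha>0$ and $-s_2<\epsilon+\frac2\alpha<1$. Put $p_{\alpha,\epsilon}=n(1-\epsilon-\frac2\alpha)^{-1}\in[2,\infty]$. In the first case (equivalently $\ell=p_{\alpha,\epsilon}$) put $X^\alpha_{\ell,\epsilon}(T)=L^\alpha_TL^\ell$ and $B_{\alpha,\ell,\epsilon}=B$; in the second case (equivalently $\ell<p_{\alpha,\epsilon}$) put $X^\alpha_{\ell,\epsilon}(T)=\widetilde L^\alpha_T\dot B^{s_\ell+\epsilon+2/\alpha}_{\ell,\infty}$ and $B_{\alpha,\ell,\epsilon}=\widetilde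 B$. **Proposition.** (i) Let $T\in(0,\infty)$, let $(\alpha,\ell,\epsilon)$ be admissible, let $p=p_{\alpha,\epsilon}$, $p_0\in[2,\infty]$ and $s_0\in(-1,0)$. If $f\in\dot B^{s_0}_{p_0,\infty}(\mathbb R^n;\mathbb R^n)$, then any $u\in X^\alpha_{\ell,\epsilon}(T)$ with $u(t)=e^{t\Delta}f-B_{\alpha,\ell,\epsilon}[u,u](t)$ in $\mathcal S'$ for all $t\in(0,T)$ belongs to $\widetilde L^2_T\dot B^0_{p_0,1}+\widetilde L^\alpha_T\dot B^0_{p,1}$. Moreover, for any vector fields $u,v\in\widetilde L^2_T\dot B^0_{p_0,1}+\widetilde L^\alpha_T\dot B^0_{p,1}$ we have, for a.e. $t\in(0,T)$, $$u\otimes v=\mathsf{Bony}(u,v),\qquad \mathbb P\nabla\cdot(u\otimes v)=\sum_{l\in\mathbb Z}\mathbb P\nabla\cdot\dot\Delta_l(u\otimes v)\quad\text{in }\mathcal S',$$ all the objects in these identities being well defined; consequently $B[u,v]$ and $\widetilde B[u,v]$ are well defined on $(0,T)$ and coincide. (ii) Let $T\in(0,\infty)$, $p\in[1,\infty]$ and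 $W\in L^1_TL^p(\mathbb R^n;\mathbb R^{n\times n})$. Then $G\,\mathbb P\nabla\cdot W$ is well defined, belongs to $L^1_TL^p(\mathbb R^n;\mathbb R^n)$, and its $i$-th component is represented, for a.e. $t$, by the measurable function on $(0,T)\times\mathbb R^n$ given by $$\int_0^t\Big(\int_{\mathbb R^n}\nabla_k\mathcal T_{ij}(t-s,x-y)\,[W_{jk}(s)](y)\,dy\Big)ds,$$ the integrals being convergent for a.e. $(t,x)$, where $\mathcal T_{ij}=\mathbb P_{ij}\Phi$ is the Oseen kernel and $\Phi(t,x)=(4\pi t)^{-n/2}e^{-|x|^2/4t}$ is the heat kernel. -/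

import Mathlib

open MeasureTheory Filter Topology
open scoped ENNReal SchwartzMap FourierTransform

noncomputable section

namespace BesovNS

/-- The space `ℝⁿ` with its Euclidean norm. -/
abbrev Rn (n : ℕ) : Type := EuclideanSpace ℝ (Fin n)

/-- (Complex) tempered distributions on `ℝⁿ`, with the topology of pointwise convergence. -/
abbrev TD (n : ℕ) : Type := 𝓢'(Rn n, ℂ)

/-- Lebesgue measure on the time interval `(0,T)`. -/
def timeMeasure (T : ℝ) : Measure ℝ := volume.restrict (Set.Ioo 0 T)

/-! ### Littlewood-Paley cutoffs and Fourier multipliers -/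

/-- A dyadic partition of unity. The other usual properties of such a pair (disjointness of the
supports of `φ (2⁻ʲ ·)` and `φ (2⁻ᵏ ·)` for `|j - k| ≥ 2`, the bounds on the sums of squares, and so
on) follow from the ones listed here. -/
structure LPPair (n : ℕ) where
  χ : Rn n → ℝ
  φ : Rn n → ℝ
  smooth_χ : ContDiff ℝ (⊤ : ℕ∞) χ
  smooth_φ : ContDiff ℝ (⊤ : ℕ∞) φ
  supp_χ : tsupport χ ⊆ {ξ | ‖ξ‖ < 4 / 3}
  supp_φ : tsupport φ ⊆ {ξ | 3 / 4 < ‖ξ‖ ∧ ‖ξ‖ < 8 / 3}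
  radial_χ : ∀ ξ η : Rn n, ‖ξ‖ = ‖η‖ → χ ξ = χ η
  radial_φ : ∀ ξ η : Rn n, ‖ξ‖ = ‖η‖ → φ ξ = φ η
  range_χ : ∀ ξ, χ ξ ∈ Set.Icc (0 : ℝ) 1
  range_φ : ∀ ξ, φ ξ ∈ Set.Icc (0 : ℝ) 1
  sum_nat : ∀ ξ, HasSum (fun j : ℕ => φ ((2 : ℝ) ^ (-(j : ℤ)) • ξ)) (1 - χ ξ)
  sum_int : ∀ ξ, ξ ≠ 0 → HasSum (fun j : ℤ => φ ((2 : ℝ) ^ (-j) • ξ)) 1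

/-- The operator `m(D)` on tempered distributions, for the convention in which `D = -i∇`.
Mathlib's Fourier transform has the kernel `exp (-2πi x·ξ)`, so that `D` has the symbol `2πξ`. -/
def multiplier {n : ℕ} (m : Rn n → ℝ) : TD n →L[ℂ] TD n :=
  TemperedDistribution.fourierMultiplierCLM ℂ
    (fun ξ : Rn n => ((m ((2 * Real.pi) • ξ) : ℝ) : ℂ))

/-- The low-frequency cutoff `Ṡ_j = χ(2⁻ʲD)`. -/
def lowFreq {n : ℕ} (P : LPPair n) (j : ℤ) : TD n →L[ℂ] TD n :=
  multiplier (fun ξ => P.χ ((2 : ℝ) ^ (-j) • ξ))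

/-- The Littlewood-Paley projection `Δ̇_j = φ(2⁻ʲD)`. -/
def lpProj {n : ℕ} (P : LPPair n) (j : ℤ) : TD n →L[ℂ] TD n :=
  multiplier (fun ξ => P.φ ((2 : ℝ) ^ (-j) • ξ))

/-- The heat semigroup `e^{tΔ}` (used for `t ≥ 0`). -/
def heat {n : ℕ} (t : ℝ) : TD n →L[ℂ] TD n :=
  multiplier (fun ξ => Real.exp (-t * ‖ξ‖ ^ 2))

/-! ### Distributions given by functions, Lebesgue norms -/

/-- A distribution is real-valued if it takes real values on real test functions. -/
def IsReal {n : ℕ} (u : TD n) : Prop :=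
  ∀ ψ : 𝓢(Rn n, ℂ), (∀ x, (ψ x).im = 0) → (u ψ).im = 0

/-- The tempered distribution `u` is (integration against) the function `g`. -/
def Represents {n : ℕ} (u : TD n) (g : Rn n → ℂ) : Prop :=
  LocallyIntegrable g ∧
    ∀ ψ : 𝓢(Rn n, ℂ), Integrable (fun x => g x * ψ x) ∧ u ψ = ∫ x, g x * ψ x

/-- The norm `‖u‖_{Lᵖ}` of a tempered distribution; it is `∞` unless `u` is given by a function
in `Lᵖ`. -/
def lpNorm {n : ℕ} (p : ℝ≥0∞) (u : TD n) : ℝ≥0∞ :=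
  ⨅ (g : Rn n → ℂ) (_ : Represents u g), eLpNorm g p volume

/-! ### Besov, Lebesgue-Bochner and Chemin-Lerner spaces -/

/-- The class `𝓢'_h`. -/
def IsSh {n : ℕ} (P : LPPair n) (u : TD n) : Prop :=
  Tendsto (fun j : ℤ => lpNorm ∞ (lowFreq P j u)) atBot (𝓝 0)

/-- The homogeneous Besov seminorm. -/
def besovNorm {n : ℕ} (P : LPPair n) (s : ℝ) (p q : ℝ≥0∞) (u : TD n) : ℝ≥0∞ :=
  eLpNorm (fun j : ℤ => (2 : ℝ≥0∞) ^ ((j : ℝ) * s) * lpNorm p (lpProj P j u)) q Measure.count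

/-- Membership of a real-valued distribution in the homogeneous Besov space `Ḃ^s_{p,q}(ℝⁿ)`. -/
def MemBesov {n : ℕ} (P : LPPair n) (s : ℝ) (p q : ℝ≥0∞) (u : TD n) : Prop :=
  IsReal u ∧ IsSh P u ∧ besovNorm P s p q u < ∞

/-- `u` is a weakly* measurable function from `(0,T)` to real-valued tempered distributions
(only the values of `u` on `(0,T)` matter). -/
def WeakStarMeasurable {n : ℕ} (T : ℝ) (u : ℝ → TD n) : Prop :=
  (∀ t ∈ Set.Ioo 0 T, IsReal (u t)) ∧
    ∀ ψ : 𝓢(Rn n, ℂ), Measurable (fun t : Set.Ioo (0 : ℝ) T => u t ψ)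

/-- The norm of `L^α(0,T; Lᵖ(ℝⁿ))`. -/
def timeLpNorm {n : ℕ} (T : ℝ) (α p : ℝ≥0∞) (u : ℝ → TD n) : ℝ≥0∞ :=
  eLpNorm (fun t => lpNorm p (u t)) α (timeMeasure T)

/-- Membership in `L^α_T Lᵖ(ℝⁿ)`. -/
def MemTimeLp {n : ℕ} (T : ℝ) (α p : ℝ≥0∞) (u : ℝ → TD n) : Prop :=
  WeakStarMeasurable T u ∧ (∀ᵐ t ∂(timeMeasure T), lpNorm p (u t) < ∞) ∧ timeLpNorm T α p u < ∞

/-- The Chemin-Lerner seminorm. -/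
def cheminLernerNorm {n : ℕ} (P : LPPair n) (T : ℝ) (α : ℝ≥0∞) (s : ℝ) (p q : ℝ≥0∞)
    (u : ℝ → TD n) : ℝ≥0∞ :=
  eLpNorm (fun j : ℤ => (2 : ℝ≥0∞) ^ ((j : ℝ) * s) * timeLpNorm T α p (fun t => lpProj P j (u t)))
    q Measure.count

/-- Membership (of the class modulo equality for almost every `t`) in the Chemin-Lerner space
`L̃^α_T Ḃ^s_{p,q}(ℝⁿ)`. -/
def MemCheminLerner {n : ℕ} (P : LPPair n) (T : ℝ) (α : ℝ≥0∞) (s : ℝ) (p q : ℝ≥0∞)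
    (u : ℝ → TD n) : Prop :=
  WeakStarMeasurable T u ∧ (∀ᵐ t ∂(timeMeasure T), IsSh P (u t)) ∧
    (∀ j : ℤ, ∀ᵐ t ∂(timeMeasure T), lpNorm p (lpProj P j (u t)) < ∞) ∧
    cheminLernerNorm P T α s p q u < ∞

/-- Membership of a vector field, depending on time, in
`L̃^{α₁}_T Ḃ^0_{p₁,1}(ℝⁿ) + L̃^{α₂}_T Ḃ^0_{p₂,1}(ℝⁿ)`. -/
def MemSum {n : ℕ} (P : LPPair n) (T : ℝ) (α₁ p₁ α₂ p₂ : ℝ≥0∞) (u : ℝ → Fin n → TD n) : Prop :=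
  (∀ i, WeakStarMeasurable T (fun t => u t i)) ∧
    ∃ a b : ℝ → Fin n → TD n,
      (∀ i, MemCheminLerner P T α₁ 0 p₁ 1 (fun t => a t i)) ∧
      (∀ i, MemCheminLerner P T α₂ 0 p₂ 1 (fun t => b t i)) ∧
      ∀ᵐ t ∂(timeMeasure T), u t = a t + b t

/-! ### Exponents and the path space `X` -/

/-- `s_ℓ = -1 + n/ℓ`. -/
def sExp (n : ℕ) (l : ℝ≥0∞) : ℝ := -1 + ((n : ℝ≥0∞) / l).toReal

/-- `ε + 2/α`. -/
def aExp (α : ℝ≥0∞) (ε : ℝ) : ℝ := ε + ((2 : ℝ≥0∞) / α).toReal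

/-- The conditions on `(α, ℓ, ε)`. -/
def Admissible (n : ℕ) (α l : ℝ≥0∞) (ε : ℝ) : Prop :=
  1 ≤ α ∧ 1 ≤ l ∧ 0 < ε ∧ ε ≤ 1 ∧
    ((sExp n l + aExp α ε = 0 ∧ -sExp n 2 ≤ aExp α ε ∧ aExp α ε ≤ 1) ∨
      (0 < sExp n l + aExp α ε ∧ -sExp n 2 < aExp α ε ∧ aExp α ε < 1))

/-- `p_{α,ε} = n (1 - ε - 2/α)⁻¹ ∈ [1,∞]`, equal to `∞` when `ε + 2/α = 1`. -/
def pExp (n : ℕ) (α : ℝ≥0∞) (ε : ℝ) : ℝ≥0∞ := (n : ℝ≥0∞) / ENNReal.ofReal (1 - aExp α ε)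

/-- Membership of a vector field, depending on time, in the path space `X^α_{ℓ,ε}(T)`. -/
def MemX {n : ℕ} (P : LPPair n) (T : ℝ) (α l : ℝ≥0∞) (ε : ℝ) (u : ℝ → Fin n → TD n) : Prop :=
  (sExp n l + aExp α ε = 0 ∧ ∀ i, MemTimeLp T α l (fun t => u t i)) ∨
    (0 < sExp n l + aExp α ε ∧
      ∀ i, MemCheminLerner P T α (sExp n l + aExp α ε) l ∞ (fun t => u t i))

/-! ### Products

The operators below are only partially defined; each is given by its graph. -/

/-- `w` is the pointwise product of `u` and `v` (all three being given by functions). -/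
def IsPointwiseProduct {n : ℕ} (u v w : TD n) : Prop :=
  ∃ g h : Rn n → ℂ, Represents u g ∧ Represents v h ∧ Represents w (fun x => g x * h x)

/-- `w = Ṫ_u v = ∑_j Ṡ_{j-1}u Δ̇_j v`, with convergence in `𝓢'`. -/
def IsParaproduct {n : ℕ} (P : LPPair n) (u v w : TD n) : Prop :=
  ∃ τ : ℤ → TD n,
    (∀ j, IsPointwiseProduct (lowFreq P (j - 1) u) (lpProj P j v) (τ j)) ∧ HasSum τ w

/-- `w = Ṙ(u,v) = ∑_j ∑_{|ν| ≤ 1} Δ̇_j u Δ̇_{j-ν} v`, with convergence in `𝓢'`. -/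
def IsRemainder {n : ℕ} (P : LPPair n) (u v w : TD n) : Prop :=
  ∃ ρ : ℤ → ℤ → TD n,
    (∀ j, ∀ ν ∈ Finset.Icc (-1 : ℤ) 1,
        IsPointwiseProduct (lpProj P j u) (lpProj P (j - ν) v) (ρ j ν)) ∧
      HasSum (fun j => ∑ ν ∈ Finset.Icc (-1 : ℤ) 1, ρ j ν) w

/-- `w = Bony(u,v) = Ṫ_u v + Ṫ_v u + Ṙ(u,v)`. -/
def IsBony {n : ℕ} (P : LPPair n) (u v w : TD n) : Prop :=
  ∃ a b c : TD n,
    IsParaproduct P u v a ∧ IsParaproduct P v u b ∧ IsRemainder P u v c ∧ w = a + b + c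

/-! ### The operators `ℙ∇·`, `G`, `B` and `B̃` -/

/-- The symbol `δ_{ij} - ξ_i ξ_j / |ξ|²` of `ℙ_{ij}` (homogeneous of degree `0`, so that the factor
`2π` in the frequency variable plays no role). -/
def leraySymbol {n : ℕ} (i j : Fin n) (ξ : Rn n) : ℂ :=
  (((if i = j then 1 else 0) - ξ i * ξ j / ‖ξ‖ ^ 2 : ℝ) : ℂ)

/-- The function `ℙ_{ij}∇_k ψ` for a test function `ψ`. -/
def lerayGrad {n : ℕ} (i j k : Fin n) (ψ : 𝓢(Rn n, ℂ)) : Rn n → ℂ :=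
  𝓕⁻ (fun ξ : Rn n =>
    Complex.I * ((2 * Real.pi * ξ k : ℝ) : ℂ) * leraySymbol i j ξ * 𝓕 (fun x => ψ x) ξ)

/-- `w = ℙ∇·W`, that is `⟨w_i, ψ⟩ = -∑_{j,k} ⟨W_{jk}, ℙ_{ij}∇_k ψ⟩`, for `W` given by functions. -/
def IsLerayDiv {n : ℕ} (W : Fin n → Fin n → TD n) (w : Fin n → TD n) : Prop :=
  ∃ g : Fin n → Fin n → Rn n → ℂ, (∀ j k, Represents (W j k) (g j k)) ∧
    ∀ (i : Fin n) (ψ : 𝓢(Rn n, ℂ)),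
      (∀ j k, Integrable (fun y => g j k y * lerayGrad i j k ψ y)) ∧
        w i ψ = -∑ j, ∑ k, ∫ y, g j k y * lerayGrad i j k ψ y

/-- `w = ∑_l ℙ∇·Δ̇_l W`, with convergence in `𝓢'`. -/
def IsLerayDivLP {n : ℕ} (P : LPPair n) (W : Fin n → Fin n → TD n) (w : Fin n → TD n) : Prop :=
  ∃ z : ℤ → Fin n → TD n, (∀ l, IsLerayDiv (fun j k => lpProj P l (W j k)) (z l)) ∧
    ∀ i, HasSum (fun l => z l i) (w i)

/-- `g = G[w]` on `(0,T)`, that is `⟨g(t), ψ⟩ = ∫₀ᵗ ⟨e^{(t-s)Δ} w(s), ψ⟩ ds`. -/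
def IsDuhamel {n : ℕ} (T : ℝ) (w g : ℝ → TD n) : Prop :=
  ∀ t ∈ Set.Ioo 0 T, ∀ ψ : 𝓢(Rn n, ℂ),
    IntervalIntegrable (fun s => heat (t - s) (w s) ψ) volume 0 t ∧
      g t ψ = ∫ s in (0 : ℝ)..t, heat (t - s) (w s) ψ

/-- `g = G ℙ∇·W` on `(0,T)`. -/
def IsDuhamelLerayDiv {n : ℕ} (T : ℝ) (W : ℝ → Fin n → Fin n → TD n) (g : ℝ → Fin n → TD n) :
    Prop :=
  ∃ w : ℝ → Fin n → TD n, (∀ᵐ t ∂(timeMeasure T), IsLerayDiv (W t) (w t)) ∧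
    ∀ i, IsDuhamel T (fun t => w t i) (fun t => g t i)

/-- `b = B[u,v] = G ℙ∇·(u ⊗ v)` on `(0,T)`. -/
def IsB {n : ℕ} (T : ℝ) (u v b : ℝ → Fin n → TD n) : Prop :=
  ∃ W : ℝ → Fin n → Fin n → TD n,
    (∀ᵐ t ∂(timeMeasure T), ∀ i j, IsPointwiseProduct (u t i) (v t j) (W t i j)) ∧
      IsDuhamelLerayDiv T W b

/-- `b = B̃[u,v] = G (∑_l ℙ∇·Δ̇_l Bony(u,v))` on `(0,T)`. -/
def IsBTilde {n : ℕ} (P : LPPair n) (T : ℝ) (u v b : ℝ → Fin n → TD n) : Prop :=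
  ∃ (W : ℝ → Fin n → Fin n → TD n) (w : ℝ → Fin n → TD n),
    (∀ᵐ t ∂(timeMeasure T), ∀ i j, IsBony P (u t i) (v t j) (W t i j)) ∧
      (∀ᵐ t ∂(timeMeasure T), IsLerayDivLP P (W t) (w t)) ∧
      ∀ i, IsDuhamel T (fun t => w t i) (fun t => b t i)

/-- `u(t) = e^{tΔ}f - B_{α,ℓ,ε}[u,u](t)` in `𝓢'` for all `t ∈ (0,T)`, where `B_{α,ℓ,ε}` is `B` if
`ℓ = p_{α,ε}`, and `B̃` if `ℓ < p_{α,ε}`. -/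
def IsMildSolution {n : ℕ} (P : LPPair n) (T : ℝ) (α l : ℝ≥0∞) (ε : ℝ) (f : Fin n → TD n)
    (u : ℝ → Fin n → TD n) : Prop :=
  ∃ b : ℝ → Fin n → TD n,
    ((l = pExp n α ε ∧ IsB T u u b) ∨ (l < pExp n α ε ∧ IsBTilde P T u u b)) ∧
      ∀ t ∈ Set.Ioo 0 T, ∀ i, u t i = heat t (f i) - b t i

/-! ### The Oseen kernel -/

/-- The heat kernel `Φ(t,x) = (4πt)^{-n/2} exp(-|x|²/(4t))`. -/
def heatKernel {n : ℕ} (t : ℝ) (x : Rn n) : ℂ :=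
  (((4 * Real.pi * t) ^ (-(n : ℝ) / 2) * Real.exp (-‖x‖ ^ 2 / (4 * t)) : ℝ) : ℂ)

/-- The Oseen kernel `𝒯_{ij}(t) = ℙ_{ij}Φ(t)`. -/
def oseenKernel {n : ℕ} (i j : Fin n) (t : ℝ) : Rn n → ℂ :=
  𝓕⁻ (fun ξ : Rn n => leraySymbol i j ξ * 𝓕 (heatKernel (n := n) t) ξ)

/-- The partial derivative `∇_k 𝒯_{ij}(t,x)`. -/
def gradOseen {n : ℕ} (i j k : Fin n) (t : ℝ) (x : Rn n) : ℂ :=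
  fderiv ℝ (oseenKernel i j t) x (EuclideanSpace.single k 1)

/-- `∑_{j,k} ∫ ∇_k 𝒯_{ij}(t-s,x-y) ω_{jk}(s,y) dy`. -/
def oseenInner {n : ℕ} (ω : ℝ → Fin n → Fin n → Rn n → ℂ) (i : Fin n) (t : ℝ) (x : Rn n) (s : ℝ) :
    ℂ :=
  ∑ j, ∑ k, ∫ y, gradOseen i j k (t - s) (x - y) * ω s j k y

/-- `∫₀ᵗ ∑_{j,k} ∫ ∇_k 𝒯_{ij}(t-s,x-y) ω_{jk}(s,y) dy ds`. -/
def oseenIntegral {n : ℕ} (ω : ℝ → Fin n → Fin n → Rn n → ℂ) (i : Fin n) (t : ℝ) (x : Rn n) : ℂ :=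
  ∫ s in (0 : ℝ)..t, oseenInner ω i t x s

end BesovNS

end

open BesovNS

open MeasureTheory Filter Topology
open scoped ENNReal SchwartzMap FourierTransform

noncomputable section

namespace BesovNS

/-! ### Integral inequalities for `[0,∞]`-valued functions -/

section Inequalities

variable {X Y : Type*} [MeasurableSpace X] [MeasurableSpace Y]

/-! Everything rests on kernel bounds for one scalar symbol `D`, smooth off the origin and
homogeneous of degree one (`Sym1`); the entries of `ℙ∇·` are of this type. Localised to frequencies
of size `2^l` and multiplied by the symbol of `e^{τΔ}`, it has a kernel with `L¹` norm at most `C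
2^l κ(τ4^l)` and sup norm at most `2^{ln}` times that, where `κ(x) = min(1, x⁻²)` is `kap`
(`kerBound_locSym`). Young's inequality in space turns this into `L^a → L^b` bounds with the
Bernstein factor `2^{ln(1/a-1/b)}`. Young's inequality in time, with `∫₀ᵀ κ(τ4^l) dτ ≤ min(T,
C4^{-l})`, turns it into bounds for Duhamel integrals.

Regularity of mild solutions. If `u ⊗ u` lies in `L^{α/2}_T L^r`, block `l` of `B[u,u]` has norm in
`L^α_T L^p` at most a constant times `2^{l(1+n(1/r-1/p))} min(T, C4^{-l})^{1-1/α}`. This is summable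
as `l → -∞` since `1+n(1/r-1/p) > 0`, and as `l → ∞` if `1+n(1/r-1/p) < 2(1-1/α)`
(`IsScalarDuhamel.cheminLernerNorm_lt_top`). For `u` in `L^α_T L^p` one has `r = p/2`, and the
difference of the two sides is `n/p+2/α-1 = -ε`: the problem is subcritical. If `ℓ < p`, Bernstein
only puts `u` in a space of regularity `0` and third index `∞` over `L^p`, just short of `L^p`. So
`u` is cut at frequency `1`, and the low and high parts are placed in `L^q` with `1/q = 1/p ∓ δ`,
where their blocks are summable (`MemCheminLerner.low`, `MemCheminLerner.high`). The four products
cost only `2nδ < ε`. The free evolution has blocks of size `2^{-ls₀} min(T, C4^{-l})^{1/2}` in `L²_T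
L^{p₀}`, summable in both directions because `-1 < s₀ < 0`.

The identities. With third index `1` the Littlewood-Paley series converges absolutely in `L^q` for
almost every `t`, and Bony's formula is the rearrangement of an absolutely convergent double series
(`tsum_bony`). All exponents are at least `2`, so products lie in some `L^r` with `r ≥ 1`. The
function `ℙ∇ψ` is not Schwartz, but its dyadic blocks are bounded in `L^q` both by `2^l‖ψ‖` and by
`2^{-l}‖Δψ‖`, hence summable for every `q` in `[1,∞]` (`Sym1.tsum_eLpNorm_dual_le`). This makes
`ℙ∇·` meaningful on `L^r`, gives its dyadic decomposition, and shows that Duhamel integrals are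
tempered distributions.

Part (ii). Summing over `l`, the kernel of `D e^{τΔ}` has `L¹` norm at most `C ∑ 2^l κ(τ4^l)`, which
is integrable on `(0,T)`. Young and Tonelli give the convergence and the norm, once `gradOseen` is
recognised as this kernel (`gradOseen_eq`). Joint measurability in `(t,x)` comes from mollification
(`exists_measurable_represents`). -/

theorem eLpNorm_ennreal_eq {μ : Measure X} {p : ℝ≥0∞} (h0 : p ≠ 0) (ht : p ≠ ∞) (f : X → ℝ≥0∞) :
    eLpNorm f p μ = (∫⁻ x, f x ^ p.toReal ∂μ) ^ (1 / p.toReal) := by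
  rw [eLpNorm_eq_lintegral_rpow_enorm_toReal h0 ht]; simp

theorem eLpNorm_ennreal_mono_ae {μ : Measure X} (p : ℝ≥0∞) {f g : X → ℝ≥0∞}
    (h : ∀ᵐ x ∂μ, f x ≤ g x) : eLpNorm f p μ ≤ eLpNorm g p μ :=
  eLpNorm_mono_enorm_ae (by simpa using h)

theorem eLpNorm_ennreal_const_mul {μ : Measure X} {p : ℝ≥0∞} (c : ℝ≥0∞)
    {f : X → ℝ≥0∞} (hf : AEMeasurable f μ) :
    eLpNorm (fun x => c * f x) p μ ≤ c * eLpNorm f p μ := by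
  rcases eq_or_ne p 0 with rfl | h0
  · simp
  rcases eq_or_ne p ∞ with rfl | ht
  · simp only [eLpNorm_exponent_top, eLpNormEssSup, enorm_eq_self]
    exact (ENNReal.essSup_const_mul).le
  · have hp := ENNReal.toReal_pos h0 ht
    rw [eLpNorm_ennreal_eq h0 ht, eLpNorm_ennreal_eq h0 ht]
    simp_rw [ENNReal.mul_rpow_of_nonneg _ _ hp.le]
    rw [lintegral_const_mul'' _ (hf.pow_const _), ENNReal.mul_rpow_of_nonneg _ _ (by positivity),
      ← ENNReal.rpow_mul, mul_one_div_cancel hp.ne', ENNReal.rpow_one]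

/-- For `p = ∞` the essential supremum exceeds `c` exactly when `{F s > c}` has positive measure,
and the measure of a section depends measurably on `s`. For finite `p` this is Tonelli. -/
theorem measurable_eLpNorm_of_uncurry {F : Y → X → ℝ≥0∞} {ν : Measure X} [SFinite ν]
    (hF : Measurable (Function.uncurry F)) (p : ℝ≥0∞) :
    Measurable (fun s => eLpNorm (F s) p ν) := by
  rcases eq_or_ne p 0 with rfl | h0
  · simp
  rcases eq_or_ne p ∞ with rfl | ht
  · refine measurable_of_Ioi fun c => ?_
    have : (fun s => eLpNorm (F s) ∞ ν) ⁻¹' Set.Ioi c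
        = {s | 0 < ν {x | c < F s x}} := by
      ext s
      simp only [Set.mem_preimage, Set.mem_Ioi, Set.mem_ofPred_eq, eLpNorm_exponent_top,
        eLpNormEssSup, enorm_eq_self]
      rw [← not_iff_not, not_lt, not_lt, nonpos_iff_eq_zero]
      constructor
      · intro h
        have := (ae_le_essSup (f := F s) (μ := ν)).mono fun x hx => hx.trans h
        simpa [ae_iff] using this
      · intro h
        exact essSup_le_of_ae_le _ (by
          rw [EventuallyLE, ae_iff]; simpa using h)
    rw [this]
    have hm : Measurable (fun s => ν (Prod.mk s ⁻¹' {z : Y × X | c < F z.1 z.2})) :=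
      measurable_measure_prodMk_left (measurableSet_lt measurable_const hF)
    exact measurableSet_lt measurable_const hm
  · simp_rw [eLpNorm_ennreal_eq h0 ht]
    exact ((hF.pow_const _).lintegral_prod_right').pow_const _

/-- Minkowski's integral inequality. -/
theorem eLpNorm_lintegral_le {μ : Measure Y} {ν : Measure X} [SFinite μ] [SFinite ν]
    {F : Y → X → ℝ≥0∞} (hF : Measurable (Function.uncurry F)) {p : ℝ≥0∞} (hp : 1 ≤ p) :
    eLpNorm (fun x => ∫⁻ s, F s x ∂μ) p ν ≤ ∫⁻ s, eLpNorm (F s) p ν ∂μ := by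
  have hN : Measurable (fun s => eLpNorm (F s) p ν) := measurable_eLpNorm_of_uncurry hF p
  have h0 : p ≠ 0 := (zero_lt_one.trans_le hp).ne'
  rcases eq_or_ne p ∞ with rfl | ht
  · have h1 : ∀ᵐ s ∂μ, ∀ᵐ x ∂ν, F s x ≤ eLpNorm (F s) ∞ ν := by
      refine Eventually.of_forall fun s => ?_
      simpa [eLpNorm_exponent_top, eLpNormEssSup] using ae_le_essSup (f := F s) (μ := ν)
    have h2 : ∀ᵐ x ∂ν, ∀ᵐ s ∂μ, F s x ≤ eLpNorm (F s) ∞ ν := by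
      refine (Measure.ae_ae_comm ?_).1 h1
      exact measurableSet_le hF (hN.comp measurable_fst)
    rw [eLpNorm_exponent_top]
    refine eLpNormEssSup_le_of_ae_enorm_bound ?_
    filter_upwards [h2] with x hx
    simpa using lintegral_mono_ae hx
  have hq : 1 ≤ p.toReal := by
    rw [← ENNReal.toReal_one]; exact ENNReal.toReal_mono ht hp
  set q := p.toReal with hqdef
  have hq0 : 0 < q := by linarith
  set N := fun s => eLpNorm (F s) p ν with hNdef
  by_cases hA : ∫⁻ s, N s ∂μ = ∞
  · simp [hA, N]
  have hNtop : ∀ᵐ s ∂μ, N s < ∞ := ae_lt_top hN hA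
  have hNq : ∀ s, ∫⁻ x, F s x ^ q ∂ν = N s ^ q := by
    intro s
    simp only [N]
    rw [eLpNorm_ennreal_eq h0 ht, ← ENNReal.rpow_mul, one_div_mul_cancel hq0.ne', ENNReal.rpow_one]
  -- Minkowski without duality: split off the weight `N s`, apply Hölder in `s` with exponents `q`
  -- and `q'`, then integrate in `x`. Since `∫ F^q = N^q`, the weighted inner integral is at most
  -- `N^q N^{1-q} = N`. Where `N s = 0` the function `F s` vanishes almost everywhere, so an
  -- inequality suffices there.
  have h1 : ∀ᵐ s ∂μ, ∀ᵐ x ∂ν, F s x ≤ (F s x ^ q * N s ^ (1 - q)) ^ (1 / q) * N s ^ (1 - 1 / q) := by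
    filter_upwards [hNtop] with s hs
    by_cases hN0 : N s = 0
    · have : F s =ᵐ[ν] 0 := by
        have hz : ∫⁻ x, F s x ^ q ∂ν = 0 := by rw [hNq, hN0, ENNReal.zero_rpow_of_pos hq0]
        exact ENNReal.ae_eq_zero_of_lintegral_rpow_eq_zero hq0.le
          (hF.of_uncurry_left).aemeasurable hz
      filter_upwards [this] with x hx
      simp [hx]
    · refine Eventually.of_forall fun x => le_of_eq ?_
      rw [ENNReal.mul_rpow_of_nonneg _ _ (by positivity), ← ENNReal.rpow_mul,
        mul_one_div_cancel hq0.ne', ENNReal.rpow_one, ← ENNReal.rpow_mul, mul_assoc,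
        ← ENNReal.rpow_add _ _ hN0 hs.ne]
      have : (1 - q) * (1 / q) + (1 - 1 / q) = 0 := by field_simp; ring
      rw [this]; simp
  have h2 : ∀ᵐ x ∂ν, ∀ᵐ s ∂μ,
      F s x ≤ (F s x ^ q * N s ^ (1 - q)) ^ (1 / q) * N s ^ (1 - 1 / q) := by
    refine (Measure.ae_ae_comm ?_).1 h1
    have hN' : Measurable (fun z : Y × X => N z.1) := hN.comp measurable_fst
    exact measurableSet_le hF
      ((((hF.pow_const q).mul (hN'.pow_const _)).pow_const _).mul (hN'.pow_const _))
  have hinv : 0 ≤ 1 - 1 / q := by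
    have : 1 / q ≤ 1 := by rw [div_le_one hq0]; exact hq
    linarith
  have h3 : ∀ᵐ x ∂ν, (∫⁻ s, F s x ∂μ) ^ q ≤
      (∫⁻ s, F s x ^ q * N s ^ (1 - q) ∂μ) * (∫⁻ s, N s ∂μ) ^ (q - 1) := by
    filter_upwards [h2] with x hx
    have hFx : Measurable (fun s => F s x) := hF.of_uncurry_right
    calc (∫⁻ s, F s x ∂μ) ^ q
        ≤ (∫⁻ s, (F s x ^ q * N s ^ (1 - q)) ^ (1 / q) * N s ^ (1 - 1 / q) ∂μ) ^ q := by
          gcongr ?_ ^ q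
          exact lintegral_mono_ae hx
      _ ≤ ((∫⁻ s, F s x ^ q * N s ^ (1 - q) ∂μ) ^ (1 / q) * (∫⁻ s, N s ∂μ) ^ (1 - 1 / q)) ^ q := by
          gcongr ?_ ^ q
          exact ENNReal.lintegral_mul_norm_pow_le
            (((hFx.pow_const q).mul (hN.pow_const _)).aemeasurable) hN.aemeasurable
            (by positivity) hinv (by ring)
      _ = _ := by
          rw [ENNReal.mul_rpow_of_nonneg _ _ hq0.le, ← ENNReal.rpow_mul, ← ENNReal.rpow_mul,
            one_div_mul_cancel hq0.ne', ENNReal.rpow_one]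
          congr 2
          field_simp
  have hmeas : Measurable (Function.uncurry fun s x => F s x ^ q * N s ^ (1 - q)) :=
    (hF.pow_const q).mul ((hN.comp measurable_fst).pow_const _)
  have hle1 : (∫⁻ s, N s ∂μ) ^ (q - 1) ≠ ∞ := ENNReal.rpow_ne_top_of_nonneg (by linarith) hA
  rw [eLpNorm_ennreal_eq h0 ht, ← hqdef]
  calc (∫⁻ x, (∫⁻ s, F s x ∂μ) ^ q ∂ν) ^ (1 / q)
      ≤ (∫⁻ x, (∫⁻ s, F s x ^ q * N s ^ (1 - q) ∂μ) * (∫⁻ s, N s ∂μ) ^ (q - 1) ∂ν) ^ (1 / q) := by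
        gcongr ?_ ^ (1 / q)
        exact lintegral_mono_ae h3
    _ = ((∫⁻ s, ∫⁻ x, F s x ^ q * N s ^ (1 - q) ∂ν ∂μ) * (∫⁻ s, N s ∂μ) ^ (q - 1)) ^ (1 / q) := by
        rw [lintegral_mul_const' _ _ hle1, lintegral_lintegral_swap hmeas.aemeasurable]
    _ ≤ ((∫⁻ s, N s ∂μ) * (∫⁻ s, N s ∂μ) ^ (q - 1)) ^ (1 / q) := by
        gcongr ?_ ^ (1 / q)
        gcongr ?_ * _
        refine lintegral_mono_ae ?_
        filter_upwards [hNtop] with s hs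
        have hFs : Measurable (F s) := hF.of_uncurry_left
        rw [lintegral_mul_const _ (hFs.pow_const _), hNq]
        by_cases hN0 : N s = 0
        · simp [hN0, ENNReal.zero_rpow_of_pos hq0]
        · rw [← ENNReal.rpow_add _ _ hN0 hs.ne]
          simp
    _ = ∫⁻ s, N s ∂μ := by
        conv_lhs => enter [1, 1]; rw [← ENNReal.rpow_one (∫⁻ s, N s ∂μ)]
        rw [← ENNReal.rpow_add_of_nonneg _ _ zero_le_one (by linarith), ← ENNReal.rpow_mul]
        have : (1 + (q - 1)) * (1 / q) = 1 := by field_simp; ring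
        rw [this, ENNReal.rpow_one]

theorem eLpNorm_ennreal_congr_ae {ν : Measure X} {p : ℝ≥0∞} {f g : X → ℝ≥0∞} (h : f =ᵐ[ν] g) :
    eLpNorm f p ν = eLpNorm g p ν :=
  le_antisymm (eLpNorm_ennreal_mono_ae p (h.mono fun _ hx => hx.le))
    (eLpNorm_ennreal_mono_ae p (h.mono fun _ hx => hx.ge))

theorem ae_lt_top_of_eLpNorm_lt_top {ν : Measure X} {p : ℝ≥0∞} (h0 : p ≠ 0) {f : X → ℝ≥0∞}
    (hf : AEMeasurable f ν) (h : eLpNorm f p ν < ∞) : ∀ᵐ x ∂ν, f x < ∞ := by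
  rcases eq_or_ne p ∞ with rfl | ht
  · have hle : ∀ᵐ x ∂ν, f x ≤ eLpNorm f ∞ ν := by
      simpa [eLpNorm_exponent_top, eLpNormEssSup] using ae_le_essSup (f := f) (μ := ν)
    exact hle.mono fun x hx => hx.trans_lt h
  · have hp := ENNReal.toReal_pos h0 ht
    rw [eLpNorm_ennreal_eq h0 ht] at h
    have h2 : ∫⁻ x, f x ^ p.toReal ∂ν ≠ ∞ := by
      intro hc
      rw [hc, ENNReal.top_rpow_of_pos (by positivity)] at h
      exact lt_irrefl _ h
    filter_upwards [ae_lt_top' (hf.pow_const _) h2] with x hx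
    by_contra hc
    rw [not_lt_top_iff.1 hc, ENNReal.top_rpow_of_pos hp] at hx
    exact lt_irrefl _ hx

/-- The triangle inequality for countable sums. -/
theorem eLpNorm_tsum_le {ι : Type*} [Countable ι] {ν : Measure X} [SFinite ν]
    {f : ι → X → ℝ≥0∞} (hf : ∀ i, AEMeasurable (f i) ν) {p : ℝ≥0∞} (hp : 1 ≤ p) :
    eLpNorm (fun x => ∑' i, f i x) p ν ≤ ∑' i, eLpNorm (f i) p ν := by
  -- A sum is an integral against counting measure for the discrete σ-algebra, so Minkowski's
  -- integral inequality applies to measurable versions of the terms.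
  let _ : MeasurableSpace ι := ⊤
  have : DiscreteMeasurableSpace ι := ⟨fun _ => trivial⟩
  have hg : ∀ᵐ x ∂ν, ∀ i, f i x = (hf i).mk _ x := ae_all_iff.2 fun i => (hf i).ae_eq_mk
  have hu : Measurable (Function.uncurry fun i => (hf i).mk (f i)) :=
    measurable_from_prod_countable_right fun i => (hf i).measurable_mk
  have key := eLpNorm_lintegral_le (μ := Measure.count) (ν := ν) hu hp
  simp_rw [lintegral_count] at key
  refine le_trans (eLpNorm_ennreal_mono_ae p ?_) (key.trans (le_of_eq ?_))
  · filter_upwards [hg] with x hx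
    exact le_of_eq (tsum_congr hx)
  · exact tsum_congr fun i => (eLpNorm_ennreal_congr_ae (hf i).ae_eq_mk).symm

/-- Hölder's inequality. -/
theorem eLpNorm_ennreal_mul_le {ν : Measure X} {p q r : ℝ≥0∞} (hp : 1 ≤ p) (hq : 1 ≤ q)
    (hr : 1 ≤ r) (hpqr : r⁻¹ = p⁻¹ + q⁻¹)
    {f g : X → ℝ≥0∞} (hf : AEMeasurable f ν) (hg : AEMeasurable g ν) :
    eLpNorm (fun x => f x * g x) r ν ≤ eLpNorm f p ν * eLpNorm g q ν := by
  have top_case : ∀ {f g : X → ℝ≥0∞} {r : ℝ≥0∞}, AEMeasurable g ν → 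
      eLpNorm (fun x => f x * g x) r ν ≤ eLpNorm f ∞ ν * eLpNorm g r ν := by
    intro f g r hg
    refine le_trans (eLpNorm_ennreal_mono_ae r (g := fun x => eLpNorm f ∞ ν * g x) ?_)
      (eLpNorm_ennreal_const_mul _ hg)
    have : ∀ᵐ x ∂ν, f x ≤ eLpNorm f ∞ ν := by
      simpa [eLpNorm_exponent_top, eLpNormEssSup] using ae_le_essSup (f := f) (μ := ν)
    filter_upwards [this] with x hx
    gcongr
  rcases eq_or_ne p ∞ with rfl | hpt
  · have : r = q := by simpa using hpqr
    subst this
    exact top_case hg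
  rcases eq_or_ne q ∞ with rfl | hqt
  · have : r = p := by simpa using hpqr
    subst this
    simpa [mul_comm] using top_case (g := f) (f := g) hf
  have hp0 : p ≠ 0 := (zero_lt_one.trans_le hp).ne'
  have hq0 : q ≠ 0 := (zero_lt_one.trans_le hq).ne'
  have hr0 : r ≠ 0 := (zero_lt_one.trans_le hr).ne'
  have hrt : r ≠ ∞ := by
    rintro rfl
    have := hpqr.symm
    simp [hpt] at this
  have hR : 1 / r.toReal = 1 / p.toReal + 1 / q.toReal := by
    have := congrArg ENNReal.toReal hpqr
    rw [ENNReal.toReal_add (by simp [hp0]) (by simp [hq0])] at this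
    simpa [ENNReal.toReal_inv] using this
  have hp' := ENNReal.toReal_pos hp0 hpt
  have hq' := ENNReal.toReal_pos hq0 hqt
  have hr' := ENNReal.toReal_pos hr0 hrt
  rw [eLpNorm_ennreal_eq hp0 hpt, eLpNorm_ennreal_eq hq0 hqt, eLpNorm_ennreal_eq hr0 hrt]
  refine ENNReal.lintegral_Lp_mul_le_Lq_mul_Lr hr' ?_ hR ν hf hg
  rw [← one_div_lt_one_div hp' hr', hR]
  have : 0 < 1 / q.toReal := by positivity
  linarith

/-- Interpolation between `L^a` and `L^∞`. -/
theorem eLpNorm_interpolate_top {ν : Measure X} {a b : ℝ≥0∞} (ha : 1 ≤ a) (hat : a ≠ ∞) (hab : a ≤ b)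
    {f : X → ℝ≥0∞} (hf : AEMeasurable f ν) :
    eLpNorm f b ν ≤ eLpNorm f a ν ^ (a.toReal * (b⁻¹).toReal) *
      eLpNorm f ∞ ν ^ (1 - a.toReal * (b⁻¹).toReal) := by
  rcases eq_or_ne b ∞ with rfl | hbt
  · simp
  have ha0 : a ≠ 0 := (zero_lt_one.trans_le ha).ne'
  have hb0 : b ≠ 0 := (zero_lt_one.trans_le (ha.trans hab)).ne'
  have ha' := ENNReal.toReal_pos ha0 hat
  have hb' := ENNReal.toReal_pos hb0 hbt
  have hab' : a.toReal ≤ b.toReal := ENNReal.toReal_mono hbt hab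
  have hle : ∀ᵐ x ∂ν, f x ≤ eLpNorm f ∞ ν := by
    simpa [eLpNorm_exponent_top, eLpNormEssSup] using ae_le_essSup (f := f) (μ := ν)
  rw [eLpNorm_ennreal_eq ha0 hat, eLpNorm_ennreal_eq hb0 hbt]
  calc (∫⁻ x, f x ^ b.toReal ∂ν) ^ (1 / b.toReal)
      ≤ (∫⁻ x, f x ^ a.toReal * eLpNorm f ∞ ν ^ (b.toReal - a.toReal) ∂ν) ^ (1 / b.toReal) := by
        gcongr ?_ ^ (1 / b.toReal)
        refine lintegral_mono_ae ?_
        filter_upwards [hle] with x hx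
        calc f x ^ b.toReal = f x ^ a.toReal * f x ^ (b.toReal - a.toReal) := by
              rw [← ENNReal.rpow_add_of_nonneg _ _ ha'.le (by linarith)]; congr 1; ring
          _ ≤ _ := by gcongr
    _ = _ := by
        rw [lintegral_mul_const'' _ (hf.pow_const _), ENNReal.mul_rpow_of_nonneg _ _ (by positivity),
          ← ENNReal.rpow_mul, ← ENNReal.rpow_mul, ENNReal.toReal_inv]
        congr 2 <;> field_simp

end Inequalities

/-! ### Young's inequality with a bounded kernel -/

section Young

set_option linter.unusedSectionVars false

variable {G : Type*} [MeasurableSpace G] [AddCommGroup G] [MeasurableAdd₂ G] [MeasurableNeg G]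
  [MeasurableSub₂ G]
  {μ : Measure G} [SFinite μ] [μ.IsAddLeftInvariant] [μ.IsNegInvariant]

theorem measurable_lconv {f k : G → ℝ≥0∞} (hf : Measurable f) (hk : Measurable k) :
    Measurable (fun x => ∫⁻ y, k (x - y) * f y ∂μ) := by
  refine Measurable.lintegral_prod_right' (f := fun z : G × G => k (z.1 - z.2) * f z.2) ?_
  exact (hk.comp (measurable_fst.sub measurable_snd)).mul (hf.comp measurable_snd)

theorem lconv_comm (f k : G → ℝ≥0∞) (x : G) :
    ∫⁻ y, k (x - y) * f y ∂μ = ∫⁻ y, k y * f (x - y) ∂μ := by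
  rw [← lintegral_sub_left_eq_self _ x]
  simp

/-- After the substitution `y ↦ x - y` the convolution is a superposition of translates of `f` with
weights `k y`. Minkowski and translation invariance finish the argument. -/
theorem eLpNorm_lconv_le_lintegral_mul {f k : G → ℝ≥0∞} (hf : Measurable f) (hk : Measurable k)
    {a : ℝ≥0∞} (ha : 1 ≤ a) :
    eLpNorm (fun x => ∫⁻ y, k (x - y) * f y ∂μ) a μ ≤ (∫⁻ y, k y ∂μ) * eLpNorm f a μ := by
  simp_rw [lconv_comm f k]
  have hm : Measurable (Function.uncurry fun y x => k y * f (x - y)) :=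
    (hk.comp measurable_fst).mul (hf.comp (measurable_snd.sub measurable_fst))
  refine (eLpNorm_lintegral_le hm ha).trans ?_
  calc ∫⁻ y, eLpNorm (fun x => k y * f (x - y)) a μ ∂μ
      ≤ ∫⁻ y, k y * eLpNorm f a μ ∂μ := by
        refine lintegral_mono fun y => ?_
        refine (eLpNorm_ennreal_const_mul _
          (hf.comp (measurable_id.sub_const y)).aemeasurable).trans (le_of_eq ?_)
        congr 1
        exact eLpNorm_comp_measurePreserving (p := a) (g := f) hf.aestronglyMeasurable
          (measurePreserving_sub_right μ y)
    _ = _ := lintegral_mul_const _ hk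

/-- The endpoint `b = ∞` of Young's inequality. Write `k f = k^{1-1/a} (k f^a)^{1/a}`, apply Hölder,
and bound `k` by `M` in the second factor only. -/
theorem lconv_le_of_le {f k : G → ℝ≥0∞} (hf : Measurable f) (hk : Measurable k)
    {a M : ℝ≥0∞} (ha : 1 ≤ a) (hM : ∀ y, k y ≤ M) (x : G) :
    ∫⁻ y, k (x - y) * f y ∂μ ≤
      (∫⁻ y, k y ∂μ) ^ (1 - (a⁻¹).toReal) * M ^ (a⁻¹).toReal * eLpNorm f a μ := by
  have hkx : Measurable fun y => k (x - y) := hk.comp (measurable_const.sub measurable_id)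
  have hk1 : ∫⁻ y, k (x - y) ∂μ = ∫⁻ y, k y ∂μ := lintegral_sub_left_eq_self k x
  rcases eq_or_ne a ∞ with rfl | hat
  · have hle : ∀ᵐ x ∂μ, f x ≤ eLpNorm f ∞ μ := by
      simpa [eLpNorm_exponent_top, eLpNormEssSup] using ae_le_essSup (f := f) (μ := μ)
    calc ∫⁻ y, k (x - y) * f y ∂μ ≤ ∫⁻ y, k (x - y) * eLpNorm f ∞ μ ∂μ := by
          refine lintegral_mono_ae ?_
          filter_upwards [hle] with y hy
          gcongr
      _ = _ := by rw [lintegral_mul_const _ hkx, hk1]; simp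
  have ha0 : a ≠ 0 := (zero_lt_one.trans_le ha).ne'
  have ha' := ENNReal.toReal_pos ha0 hat
  have ha1 : 1 ≤ a.toReal := by
    rw [← ENNReal.toReal_one]; exact ENNReal.toReal_mono hat ha
  have hinv : a.toReal⁻¹ ≤ 1 := inv_le_one_of_one_le₀ ha1
  rw [ENNReal.toReal_inv, eLpNorm_ennreal_eq ha0 hat]
  calc ∫⁻ y, k (x - y) * f y ∂μ
      = ∫⁻ y, k (x - y) ^ (1 - a.toReal⁻¹) * (k (x - y) * f y ^ a.toReal) ^ a.toReal⁻¹ ∂μ := by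
        refine lintegral_congr fun y => ?_
        rw [ENNReal.mul_rpow_of_nonneg _ _ (by positivity), ← ENNReal.rpow_mul,
          mul_inv_cancel₀ ha'.ne', ENNReal.rpow_one, ← mul_assoc,
          ← ENNReal.rpow_add_of_nonneg _ _ (by linarith) (by positivity)]
        simp
    _ ≤ (∫⁻ y, k (x - y) ∂μ) ^ (1 - a.toReal⁻¹) *
          (∫⁻ y, k (x - y) * f y ^ a.toReal ∂μ) ^ a.toReal⁻¹ :=
        ENNReal.lintegral_mul_norm_pow_le hkx.aemeasurable
          (hkx.mul (hf.pow_const _)).aemeasurable (by linarith) (by positivity) (by ring)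
    _ ≤ (∫⁻ y, k y ∂μ) ^ (1 - a.toReal⁻¹) *
          (M * ∫⁻ y, f y ^ a.toReal ∂μ) ^ a.toReal⁻¹ := by
        rw [hk1]
        gcongr
        rw [← lintegral_const_mul _ (hf.pow_const _)]
        refine lintegral_mono fun y => ?_
        gcongr
        exact hM _
    _ = _ := by
        rw [ENNReal.mul_rpow_of_nonneg _ _ (by positivity), mul_assoc, one_div]

/-- Young's inequality `L^a → L^b` for convolution with an integrable kernel bounded by `M`. -/
theorem eLpNorm_lconv_le {f k : G → ℝ≥0∞} (hf : Measurable f) (hk : Measurable k)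
    {a b M : ℝ≥0∞} (ha : 1 ≤ a) (hab : a ≤ b) (hM : ∀ y, k y ≤ M) :
    eLpNorm (fun x => ∫⁻ y, k (x - y) * f y ∂μ) b μ ≤
      (∫⁻ y, k y ∂μ) ^ (1 - ((a⁻¹).toReal - (b⁻¹).toReal)) *
        M ^ ((a⁻¹).toReal - (b⁻¹).toReal) * eLpNorm f a μ := by
  rcases eq_or_ne a ∞ with rfl | hat
  · have : b = ∞ := top_le_iff.1 hab
    subst this
    simpa using eLpNorm_lconv_le_lintegral_mul hf hk (μ := μ) le_top
  have ha0 : a ≠ 0 := (zero_lt_one.trans_le ha).ne'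
  have ha' := ENNReal.toReal_pos ha0 hat
  have ha1 : 1 ≤ a.toReal := by
    rw [← ENNReal.toReal_one]; exact ENNReal.toReal_mono hat ha
  have hbinv : (b⁻¹).toReal ≤ (a⁻¹).toReal :=
    ENNReal.toReal_mono (by simpa using ha0) (ENNReal.inv_le_inv.2 hab)
  have hainv : (a⁻¹).toReal = a.toReal⁻¹ := ENNReal.toReal_inv a
  have hinv : a.toReal⁻¹ ≤ 1 := inv_le_one_of_one_le₀ ha1
  -- The weight `t = a/b` interpolates `L^b` between `L^a` and `L^∞`, where the two endpoint
  -- estimates are available.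
  set t := a.toReal * (b⁻¹).toReal with ht
  have ht0 : 0 ≤ t := by positivity
  have ht1 : t ≤ 1 := by
    rw [hainv] at hbinv
    calc t ≤ a.toReal * a.toReal⁻¹ := by rw [ht]; gcongr
      _ = 1 := mul_inv_cancel₀ ha'.ne'
  refine (eLpNorm_interpolate_top ha hat hab (measurable_lconv hf hk).aemeasurable).trans ?_
  have hsup : eLpNorm (fun x => ∫⁻ y, k (x - y) * f y ∂μ) ∞ μ ≤
      (∫⁻ y, k y ∂μ) ^ (1 - (a⁻¹).toReal) * M ^ (a⁻¹).toReal * eLpNorm f a μ := by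
    rw [eLpNorm_exponent_top]
    exact eLpNormEssSup_le_of_ae_enorm_bound
      (Eventually.of_forall fun x => by simpa using lconv_le_of_le hf hk ha hM x)
  calc _ ≤ ((∫⁻ y, k y ∂μ) * eLpNorm f a μ) ^ t *
        ((∫⁻ y, k y ∂μ) ^ (1 - (a⁻¹).toReal) * M ^ (a⁻¹).toReal * eLpNorm f a μ) ^ (1 - t) := by
        gcongr
        exact eLpNorm_lconv_le_lintegral_mul hf hk ha
    _ = ((∫⁻ y, k y ∂μ) ^ t * (∫⁻ y, k y ∂μ) ^ ((1 - (a⁻¹).toReal) * (1 - t))) *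
          M ^ ((a⁻¹).toReal * (1 - t)) * (eLpNorm f a μ ^ t * eLpNorm f a μ ^ (1 - t)) := by
        have h1t : 0 ≤ 1 - t := by linarith
        rw [ENNReal.mul_rpow_of_nonneg _ _ ht0, ENNReal.mul_rpow_of_nonneg _ _ h1t,
          ENNReal.mul_rpow_of_nonneg _ _ h1t, ← ENNReal.rpow_mul, ← ENNReal.rpow_mul]
        ring
    _ = _ := by
        have h1t : 0 ≤ 1 - t := by linarith
        have h1a : 0 ≤ 1 - (a⁻¹).toReal := by rw [hainv]; linarith
        rw [← ENNReal.rpow_add_of_nonneg _ _ ht0 (by positivity),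
          ← ENNReal.rpow_add_of_nonneg _ _ ht0 h1t]
        have e : (a⁻¹).toReal * t = (b⁻¹).toReal := by
          rw [ht, hainv, ← mul_assoc, inv_mul_cancel₀ ha'.ne', one_mul]
        have e1 : t + (1 - (a⁻¹).toReal) * (1 - t) = 1 - ((a⁻¹).toReal - (b⁻¹).toReal) := by
          rw [← e]; ring
        have e2 : (a⁻¹).toReal * (1 - t) = (a⁻¹).toReal - (b⁻¹).toReal := by
          rw [← e]; ring
        rw [e1, e2]
        simp

end Young

/-! ### Distributions represented by functions -/

/-- The conjugate exponent. -/
def conjExp (r : ℝ≥0∞) : ℝ≥0∞ := (1 - r⁻¹)⁻¹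

theorem one_le_conjExp (r : ℝ≥0∞) : 1 ≤ conjExp r := by
  simp [conjExp]

theorem inv_add_inv_conjExp {r : ℝ≥0∞} (hr : 1 ≤ r) : r⁻¹ + (conjExp r)⁻¹ = 1 := by
  rw [conjExp, inv_inv, add_tsub_cancel_of_le]
  simpa using hr

theorem lintegral_mul_le_eLpNorm_mul_eLpNorm {X : Type*} [MeasurableSpace X] {μ : Measure X}
    {r : ℝ≥0∞} (hr : 1 ≤ r) {f g : X → ℂ} (hf : AEStronglyMeasurable f μ)
    (hg : AEStronglyMeasurable g μ) :
    ∫⁻ x, ‖f x * g x‖ₑ ∂μ ≤ eLpNorm f r μ * eLpNorm g (conjExp r) μ := by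
  have := eLpNorm_ennreal_mul_le (ν := μ) hr (one_le_conjExp r) le_rfl
    (by rw [inv_add_inv_conjExp hr, inv_one]) hf.enorm hg.enorm
  simpa [eLpNorm_one_eq_lintegral_enorm, eLpNorm_enorm] using this

theorem integrable_mul_of_eLpNorm {X : Type*} [MeasurableSpace X] {μ : Measure X}
    {r : ℝ≥0∞} (hr : 1 ≤ r) {f g : X → ℂ} (hf : MemLp f r μ) (hg : MemLp g (conjExp r) μ) :
    Integrable (fun x => f x * g x) μ :=
  ⟨hf.1.mul hg.1, (lintegral_mul_le_eLpNorm_mul_eLpNorm hr hf.1 hg.1).trans_lt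
    (ENNReal.mul_lt_top hf.2 hg.2)⟩

theorem enorm_integral_mul_le {X : Type*} [MeasurableSpace X] {μ : Measure X}
    {r : ℝ≥0∞} (hr : 1 ≤ r) {f g : X → ℂ} (hf : AEStronglyMeasurable f μ)
    (hg : AEStronglyMeasurable g μ) :
    ‖∫ x, f x * g x ∂μ‖ₑ ≤ eLpNorm f r μ * eLpNorm g (conjExp r) μ :=
  (enorm_integral_le_lintegral_enorm _).trans (lintegral_mul_le_eLpNorm_mul_eLpNorm hr hf hg)

section Basics

variable {n : ℕ} {u v w : TD n} {f g h : Rn n → ℂ}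

theorem hasSum_TD_iff {ι : Type*} {a : ι → TD n} {w : TD n} :
    HasSum a w ↔ ∀ ψ, HasSum (fun k => a k ψ) (w ψ) := by
  unfold HasSum
  rw [PointwiseConvergenceCLM.tendsto_iff_forall_tendsto]
  refine forall_congr' fun ψ => ?_
  congr! 2
  simp

theorem Represents.congr_ae (hu : Represents u g) (h : g =ᵐ[volume] f) : Represents u f := by
  refine ⟨hu.1.congr h, fun ψ => ?_⟩
  have e : (fun x => g x * ψ x) =ᵐ[volume] fun x => f x * ψ x := by
    filter_upwards [h] with x hx; rw [hx]
  exact ⟨(hu.2 ψ).1.congr e, (hu.2 ψ).2.trans (integral_congr_ae e)⟩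

/-- Smooth compactly supported functions are Schwartz functions, so two locally integrable
representatives have the same integrals against them. -/
theorem Represents.ae_eq (hg : Represents u g) (hf : Represents u f) : g =ᵐ[volume] f := by
  refine ae_eq_of_integral_contDiff_smul_eq hg.1 hf.1 fun k hk hc => ?_
  have hg₁ : HasCompactSupport (Complex.ofRealCLM ∘ k) := hc.comp_left rfl
  have hg₂ : ContDiff ℝ (⊤ : ℕ∞) (Complex.ofRealCLM ∘ k) := by fun_prop
  have e1 := (hg.2 (hg₁.toSchwartzMap hg₂)).2
  have e2 := (hf.2 (hg₁.toSchwartzMap hg₂)).2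
  rw [e1] at e2
  simpa [mul_comm] using e2

theorem Represents.eq (hu : Represents u g) (hv : Represents v g) : u = v := by
  ext ψ
  rw [(hu.2 ψ).2, (hv.2 ψ).2]

/-- The infimum in `lpNorm` runs over almost everywhere equal functions, so any representative
attains it. -/
theorem lpNorm_eq (hu : Represents u g) (p : ℝ≥0∞) : lpNorm p u = eLpNorm g p volume := by
  refine le_antisymm (iInf₂_le g hu) (le_iInf₂ fun f hf => ?_)
  exact (eLpNorm_congr_ae (hu.ae_eq hf)).le

theorem exists_represents {p : ℝ≥0∞} (hu : lpNorm p u < ∞) :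
    ∃ g, Represents u g ∧ MemLp g p volume := by
  obtain ⟨g, hg⟩ : ∃ g, Represents u g := by
    by_contra hcon
    push Not at hcon
    simp [lpNorm, hcon] at hu
  refine ⟨g, hg, hg.1.aestronglyMeasurable, ?_⟩
  rwa [← lpNorm_eq hg]

theorem represents_zero : Represents (0 : TD n) (fun _ => 0) :=
  ⟨locallyIntegrable_zero, fun ψ => by simp⟩

theorem Represents.add (hu : Represents u g) (hv : Represents v f) :
    Represents (u + v) (fun x => g x + f x) := by
  refine ⟨hu.1.add hv.1, fun ψ => ?_⟩
  simp_rw [add_mul]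
  exact ⟨(hu.2 ψ).1.add (hv.2 ψ).1, by
    rw [integral_add (hu.2 ψ).1 (hv.2 ψ).1, ← (hu.2 ψ).2, ← (hv.2 ψ).2]; rfl⟩

theorem Represents.neg (hu : Represents u g) : Represents (-u) (fun x => -g x) := by
  refine ⟨hu.1.neg, fun ψ => ?_⟩
  simp_rw [neg_mul]
  exact ⟨(hu.2 ψ).1.neg, by rw [integral_neg, ← (hu.2 ψ).2]; rfl⟩

theorem Represents.sum {ι : Type*} (s : Finset ι) {a : ι → TD n} {G : ι → Rn n → ℂ}
    (hs : ∀ i ∈ s, Represents (a i) (G i)) :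
    Represents (∑ i ∈ s, a i) (fun x => ∑ i ∈ s, G i x) := by
  classical
  induction s using Finset.induction_on with
  | empty => simpa using represents_zero
  | insert i s hi ih =>
    simp only [Finset.sum_insert hi]
    exact (hs i (by simp)).add (ih fun j hj => hs j (by simp [hj]))

/-- For a function in `L^p` with `p ≥ 1`, local integrability and integrability against test
functions are automatic by Hölder. Only the formula for the pairing has to be checked. -/
theorem represents_of_memLp {p : ℝ≥0∞} (hp : 1 ≤ p) (hg : MemLp g p volume)
    (hu : ∀ ψ : 𝓢(Rn n, ℂ), u ψ = ∫ x, g x * ψ x) : Represents u g :=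
  ⟨hg.locallyIntegrable hp, fun ψ => ⟨integrable_mul_of_eLpNorm hp hg (ψ.memLp _), hu ψ⟩⟩

theorem exists_TD_of_memLp {p : ℝ≥0∞} (hp : 1 ≤ p) (hg : MemLp g p volume) :
    ∃ u : TD n, Represents u g := by
  have : Fact (1 ≤ p) := ⟨hp⟩
  refine ⟨(hg.toLp g : Lp ℂ p volume), represents_of_memLp hp hg fun ψ => ?_⟩
  rw [Lp.toTemperedDistribution_apply]
  refine integral_congr_ae ?_
  filter_upwards [hg.coeFn_toLp] with x hx
  rw [hx, smul_eq_mul, mul_comm]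

theorem lpNorm_zero (p : ℝ≥0∞) : lpNorm p (0 : TD n) = 0 := by
  rw [lpNorm_eq represents_zero]; exact eLpNorm_zero

theorem lpNorm_add_le {p : ℝ≥0∞} (hp : 1 ≤ p) (u v : TD n) :
    lpNorm p (u + v) ≤ lpNorm p u + lpNorm p v := by
  by_cases hu : lpNorm p u < ∞; swap
  · simp [not_lt_top_iff.1 hu]
  by_cases hv : lpNorm p v < ∞; swap
  · simp [not_lt_top_iff.1 hv]
  obtain ⟨g, hg, hg'⟩ := exists_represents hu
  obtain ⟨f, hf, hf'⟩ := exists_represents hv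
  rw [lpNorm_eq hg, lpNorm_eq hf, lpNorm_eq (hg.add hf)]
  exact eLpNorm_add_le hg'.1 hf'.1 hp

theorem lpNorm_neg (p : ℝ≥0∞) (u : TD n) : lpNorm p (-u) = lpNorm p u := by
  have key : ∀ u : TD n, lpNorm p (-u) ≤ lpNorm p u := fun u =>
    le_iInf₂ fun g hg => by
      rw [lpNorm_eq hg.neg]
      exact (eLpNorm_neg g p volume).le
  exact le_antisymm (key u) (by simpa using key (-u))

theorem lpNorm_sub_le {p : ℝ≥0∞} (hp : 1 ≤ p) (u v : TD n) :
    lpNorm p (u - v) ≤ lpNorm p u + lpNorm p v := by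
  simpa [sub_eq_add_neg, lpNorm_neg] using lpNorm_add_le hp u (-v)

theorem lpNorm_sum_le {p : ℝ≥0∞} (hp : 1 ≤ p) {ι : Type*} (s : Finset ι) (a : ι → TD n) :
    lpNorm p (∑ i ∈ s, a i) ≤ ∑ i ∈ s, lpNorm p (a i) :=
  Finset.le_sum_of_subadditive _ (lpNorm_zero p).le (lpNorm_add_le hp) _ _

/-- A series of distributions that converges absolutely in `L^q` is represented by the sum of the
representing functions. -/
theorem represents_of_hasSum {ι : Type*} [Countable ι] {q : ℝ≥0∞} (hq : 1 ≤ q)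
    {a : ι → TD n} {G : ι → Rn n → ℂ} (ha : ∀ k, Represents (a k) (G k))
    (hG : ∑' k, eLpNorm (G k) q volume < ∞) (hs : HasSum a u) :
    Represents u (fun x => ∑' k, G k x) ∧ MemLp (fun x => ∑' k, G k x) q volume ∧
      eLpNorm (fun x => ∑' k, G k x) q volume ≤ ∑' k, eLpNorm (G k) q volume ∧
      ∀ᵐ x, Summable (fun k => ‖G k x‖) := by
  have hm : ∀ k, AEStronglyMeasurable (G k) volume := fun k => (ha k).1.aestronglyMeasurable
  have h1 : eLpNorm (fun x => ∑' k, ‖G k x‖ₑ) q volume ≤ ∑' k, eLpNorm (G k) q volume := by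
    refine (eLpNorm_tsum_le (fun k => (hm k).enorm) hq).trans (le_of_eq ?_)
    exact tsum_congr fun k => eLpNorm_enorm _
  have hfin : ∀ᵐ x, ∑' k, ‖G k x‖ₑ < ∞ := by
    have : AEMeasurable (fun x => ∑' k, ‖G k x‖ₑ) volume :=
      AEMeasurable.tsum fun k => (hm k).enorm
    exact ae_lt_top_of_eLpNorm_lt_top (zero_lt_one.trans_le hq).ne' this (h1.trans_lt hG)
  have hsum : ∀ᵐ x, Summable (fun k => ‖G k x‖) := by
    filter_upwards [hfin] with x hx
    have : (∑' k, (‖G k x‖₊ : ℝ≥0∞)) ≠ ∞ := hx.ne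
    exact NNReal.summable_coe.2 (ENNReal.tsum_coe_ne_top_iff_summable.1 this)
  have hmeas : AEStronglyMeasurable (fun x => ∑' k, G k x) volume :=
    AEStronglyMeasurable.tsum hm
  have hle : eLpNorm (fun x => ∑' k, G k x) q volume ≤ ∑' k, eLpNorm (G k) q volume := by
    refine le_trans (eLpNorm_mono_enorm_ae ?_) h1
    filter_upwards [hsum] with x hx
    simpa using enorm_tsum_le_tsum_enorm (f := fun k => G k x)
  have hMem : MemLp (fun x => ∑' k, G k x) q volume := ⟨hmeas, hle.trans_lt hG⟩
  refine ⟨represents_of_memLp hq hMem fun ψ => ?_, hMem, hle, hsum⟩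
  have hint : ∀ k, Integrable (fun x => G k x * ψ x) := fun k => ((ha k).2 ψ).1
  have hS : Summable fun k => ∫ x, ‖G k x * ψ x‖ := by
    have h5 : eLpNorm (⇑ψ) (conjExp q) volume < ∞ := (ψ.memLp (conjExp q) volume).2
    have h2 : ∑' k, ∫⁻ x, ‖G k x * ψ x‖ₑ < ∞ := by
      refine lt_of_le_of_lt (ENNReal.tsum_le_tsum fun k =>
        lintegral_mul_le_eLpNorm_mul_eLpNorm hq (hm k) ψ.continuous.aestronglyMeasurable) ?_
      rw [ENNReal.tsum_mul_right]
      exact ENNReal.mul_lt_top hG h5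
    refine (ENNReal.summable_toReal h2.ne).congr fun k => ?_
    rw [integral_norm_eq_lintegral_enorm (hint k).1]
  have h3 := hasSum_integral_of_summable_integral_norm hint hS
  have h4 := hasSum_TD_iff.1 hs ψ
  simp_rw [fun k => ((ha k).2 ψ).2] at h4
  rw [h4.unique h3]
  exact integral_congr_ae (Eventually.of_forall fun x => by simp only [tsum_mul_right])

theorem lpNorm_le_tsum_of_hasSum {ι : Type*} [Countable ι] {q : ℝ≥0∞} (hq : 1 ≤ q)
    {a : ι → TD n} (hs : HasSum a u) : lpNorm q u ≤ ∑' k, lpNorm q (a k) := by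
  by_cases hfin : ∑' k, lpNorm q (a k) < ∞; swap
  · simp [not_lt_top_iff.1 hfin]
  have h1 : ∀ k, lpNorm q (a k) < ∞ := fun k => (ENNReal.le_tsum k).trans_lt hfin
  choose G hG hG' using fun k => exists_represents (h1 k)
  have e : ∀ k, lpNorm q (a k) = eLpNorm (G k) q volume := fun k => lpNorm_eq (hG k) q
  simp_rw [e] at hfin ⊢
  obtain ⟨h2, -, h3, -⟩ := represents_of_hasSum hq hG hfin hs
  rwa [lpNorm_eq h2]

theorem IsReal.ae_im_eq_zero (hu : IsReal u) (hg : Represents u g) : ∀ᵐ x, (g x).im = 0 := by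
  have hloc : LocallyIntegrable (fun x => (g x).im) volume := by
    intro x
    obtain ⟨s, hs, hi⟩ := hg.1 x
    exact ⟨s, hs, hi.im⟩
  refine ae_eq_zero_of_integral_contDiff_smul_eq_zero hloc fun k hk hc => ?_
  have hg₁ : HasCompactSupport (Complex.ofRealCLM ∘ k) := hc.comp_left rfl
  have hg₂ : ContDiff ℝ (⊤ : ℕ∞) (Complex.ofRealCLM ∘ k) := by fun_prop
  have e1 := hg.2 (hg₁.toSchwartzMap hg₂)
  have e2 := hu (hg₁.toSchwartzMap hg₂) (by simp)
  rw [e1.2] at e2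
  have e3 := integral_im e1.1
  simp only [RCLike.im_to_complex] at e3
  rw [e2] at e3
  rw [← e3]
  refine integral_congr_ae (Eventually.of_forall fun x => ?_)
  simp [mul_comm]

theorem IsReal.sub (hu : IsReal u) (hv : IsReal v) : IsReal (u - v) := fun ψ hψ => by
  have : (u - v) ψ = u ψ - v ψ := rfl
  simp [this, hu ψ hψ, hv ψ hψ]

theorem IsReal.add (hu : IsReal u) (hv : IsReal v) : IsReal (u + v) := fun ψ hψ => by
  have : (u + v) ψ = u ψ + v ψ := rfl
  simp [this, hu ψ hψ, hv ψ hψ]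

end Basics

/-! ### The Gaussian as a Schwartz function -/

section Gaussian

variable {n : ℕ}

/-- The symbol of `e^{τΔ}`. -/
def heatSymbol (τ : ℝ) (ξ : Rn n) : ℂ := ((Real.exp (-τ * ‖(2 * Real.pi) • ξ‖ ^ 2) : ℝ) : ℂ)

theorem norm_two_pi_smul_sq (ξ : Rn n) :
    ‖(2 * Real.pi) • ξ‖ ^ 2 = (2 * Real.pi) ^ 2 * ‖ξ‖ ^ 2 := by
  rw [norm_smul, mul_pow, Real.norm_eq_abs, sq_abs]

/-- All derivatives of the exponential are the exponential, and those of `-c|x|²` grow polynomially,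
so the chain rule for higher derivatives costs only a polynomial factor. -/
theorem norm_iteratedFDeriv_exp_neg_le (c : ℝ) (m : ℕ) :
    ∃ (k : ℕ) (C : ℝ), 0 ≤ C ∧ ∀ x : Rn n,
      ‖iteratedFDeriv ℝ m (fun x : Rn n => Real.exp (-c * ‖x‖ ^ 2)) x‖ ≤
        C * (1 + ‖x‖) ^ k * Real.exp (-c * ‖x‖ ^ 2) := by
  have hf : (fun x : Rn n => -c * ‖x‖ ^ 2).HasTemperateGrowth := by fun_prop
  obtain ⟨k, C, hC, h⟩ := hf.norm_iteratedFDeriv_le_uniform m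
  refine ⟨k * m, m.factorial * (1 + C) ^ m, by positivity, fun x => ?_⟩
  have key := norm_iteratedFDeriv_comp_le (𝕜 := ℝ) (g := Real.exp)
    (f := fun x : Rn n => -c * ‖x‖ ^ 2) (n := m) (N := (⊤ : ℕ∞)) Real.contDiff_exp hf.1
    (mod_cast le_top) x (C := Real.exp (-c * ‖x‖ ^ 2)) (D := (1 + C) * (1 + ‖x‖) ^ k)
    (fun i _ => by
      rw [norm_iteratedFDeriv_eq_norm_iteratedDeriv, iteratedDeriv_eq_iterate, Real.iter_deriv_exp,
        Real.norm_of_nonneg (Real.exp_pos _).le])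
    -- The chain rule asks for a bound by `D ^ i` with `i ≥ 1`. Replacing `C` by `1 + C` makes the
    -- base at least `1`, so that `D ≤ D ^ i`.
    (fun i hi him => by
      calc _ ≤ C * (1 + ‖x‖) ^ k := h i him x
        _ ≤ (1 + C) * (1 + ‖x‖) ^ k := by gcongr; simp
        _ ≤ _ := le_self_pow₀ (one_le_mul_of_one_le_of_one_le (by simp [hC])
            (by simp [one_le_pow₀])) (by omega))
  calc _ ≤ _ := key
    _ = _ := by rw [mul_pow, ← pow_mul]; ring

/-- Use `(1+r)^N ≤ N! e^{1+r}` and complete the square in the exponent. -/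
theorem pow_mul_exp_neg_sq_le {c : ℝ} (hc : 0 < c) (N : ℕ) :
    ∃ C : ℝ, 0 ≤ C ∧ ∀ r : ℝ, 0 ≤ r → (1 + r) ^ N * Real.exp (-c * r ^ 2) ≤ C := by
  refine ⟨N.factorial * Real.exp (1 + 1 / (4 * c)), by positivity, fun r hr => ?_⟩
  have h1 : (1 + r) ^ N ≤ N.factorial * Real.exp (1 + r) := by
    have := Real.pow_div_factorial_le_exp (x := 1 + r) (by linarith) N
    rw [div_le_iff₀ (by positivity)] at this
    linarith
  calc (1 + r) ^ N * Real.exp (-c * r ^ 2)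
      ≤ N.factorial * Real.exp (1 + r) * Real.exp (-c * r ^ 2) := by gcongr
    _ = N.factorial * Real.exp (1 + r + -c * r ^ 2) := by rw [mul_assoc, ← Real.exp_add]
    _ ≤ _ := by
      refine mul_le_mul_of_nonneg_left (Real.exp_le_exp.2 ?_) (by positivity)
      have : 0 ≤ c * (r - 1 / (2 * c)) ^ 2 := by positivity
      have e : c * (r - 1 / (2 * c)) ^ 2 = c * r ^ 2 - r + 1 / (4 * c) := by field_simp; ring
      linarith

/-- The Gaussian `exp (-c |x|²)`, `c > 0`. -/
def gaussianSchwartz (n : ℕ) (c : ℝ) (hc : 0 < c) : 𝓢(Rn n, ℝ) where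
  toFun x := Real.exp (-c * ‖x‖ ^ 2)
  smooth' := by
    have hf : (fun x : Rn n => -c * ‖x‖ ^ 2).HasTemperateGrowth := by fun_prop
    exact Real.contDiff_exp.comp hf.1
  decay' k m := by
    obtain ⟨j, C, hC, h⟩ := norm_iteratedFDeriv_exp_neg_le (n := n) c m
    obtain ⟨C', hC', h'⟩ := pow_mul_exp_neg_sq_le hc (k + j)
    refine ⟨C * C', fun x => ?_⟩
    calc _ ≤ (1 + ‖x‖) ^ k * (C * (1 + ‖x‖) ^ j * Real.exp (-c * ‖x‖ ^ 2)) := by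
          gcongr
          · linarith
          · exact h x
      _ = C * ((1 + ‖x‖) ^ (k + j) * Real.exp (-c * ‖x‖ ^ 2)) := by rw [pow_add]; ring
      _ ≤ _ := by gcongr; exact h' _ (norm_nonneg _)

theorem hasTemperateGrowth_heatSymbol {τ : ℝ} (hτ : 0 ≤ τ) :
    (heatSymbol (n := n) τ).HasTemperateGrowth := by
  rcases hτ.eq_or_lt with rfl | hτ
  · have : heatSymbol (n := n) 0 = fun _ => 1 := by ext; simp [heatSymbol]
    rw [this]; fun_prop
  · have h := (gaussianSchwartz n (τ * (2 * Real.pi) ^ 2) (by positivity)).hasTemperateGrowth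
    have e : heatSymbol (n := n) τ = fun ξ =>
        ((gaussianSchwartz n (τ * (2 * Real.pi) ^ 2) (by positivity) ξ : ℝ) : ℂ) := by
      ext ξ
      simp only [heatSymbol, gaussianSchwartz, norm_two_pi_smul_sq]
      change _ = ((Real.exp _ : ℝ) : ℂ)
      congr 2; ring
    rw [e]
    fun_prop

/-- The function `exp (-4π²|ξ|²)` as a Schwartz function. -/
def gauss (n : ℕ) : 𝓢(Rn n, ℂ) :=
  (gaussianSchwartz n ((2 * Real.pi) ^ 2) (by positivity)).postcompCLM (𝕜 := ℝ) Complex.ofRealCLM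

theorem gauss_apply (ξ : Rn n) : gauss n ξ = heatSymbol 1 ξ := by
  simp only [gauss, SchwartzMap.postcompCLM_apply, heatSymbol, norm_two_pi_smul_sq]
  change ((Real.exp _ : ℝ) : ℂ) = _
  congr 2; ring

/-- All heat symbols with `τ ≥ 0` are dilates of one Schwartz function; uniformity in `τ > 0` of the
later kernel bounds then follows from scaling. -/
theorem gauss_smul {τ : ℝ} (hτ : 0 ≤ τ) (ξ : Rn n) : gauss n (√τ • ξ) = heatSymbol τ ξ := by
  rw [gauss_apply]
  simp only [heatSymbol, norm_smul, mul_pow, Real.norm_eq_abs, sq_abs, Real.sq_sqrt hτ]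
  congr 2; ring

theorem heatSymbol_norm_le {τ : ℝ} (hτ : 0 ≤ τ) (ξ : Rn n) : ‖heatSymbol τ ξ‖ ≤ 1 := by
  simp only [heatSymbol, Complex.norm_real, Real.norm_eq_abs, abs_of_pos (Real.exp_pos _)]
  rw [Real.exp_le_one_iff]
  have : 0 ≤ ‖(2 * Real.pi) • ξ‖ ^ 2 := by positivity
  nlinarith

theorem continuous_heatSymbol_uncurry :
    Continuous (fun z : ℝ × Rn n => heatSymbol z.1 z.2) := by
  unfold heatSymbol; fun_prop

end Gaussian

/-! ### Kernels of Fourier multipliers -/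

section Kernels

variable {n : ℕ}

/-- The identity `∫ F̂ k = ∫ F k̂` applied to `F` times a character. The function `k̂` itself need
not be integrable, which matters when `k` is the kernel of a symbol. -/
theorem fourier_mul_fourier {F k : Rn n → ℂ} (hF : Integrable F) (hk : Integrable k) (y : Rn n) :
    𝓕 (fun ξ => F ξ * 𝓕 k ξ) y = ∫ x, 𝓕 F (x + y) * k x := by
  have hG : Integrable (fun ξ => Real.fourierChar (-inner ℝ ξ y) • F ξ) :=
    (Real.fourierIntegral_convergent_iff y).2 hF
  have key := VectorFourier.integral_fourierIntegral_smul_eq_flip (e := Real.fourierChar)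
    (L := innerₗ (Rn n)) (μ := volume) (ν := volume) (f := k)
    (g := fun ξ => Real.fourierChar (-inner ℝ ξ y) • F ξ) Real.continuous_fourierChar
    (by simpa using continuous_inner) hk hG
  rw [Real.fourier_eq]
  calc ∫ v, Real.fourierChar (-inner ℝ v y) • (F v * 𝓕 k v)
      = ∫ ξ, VectorFourier.fourierIntegral Real.fourierChar volume (innerₗ (Rn n)) k ξ •
          (Real.fourierChar (-inner ℝ ξ y) • F ξ) := by
        refine integral_congr_ae (Eventually.of_forall fun v => ?_)
        change _ = 𝓕 k v • _
        simp only [Circle.smul_def, smul_eq_mul]; ring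
    _ = _ := key
    _ = _ := by
        refine integral_congr_ae (Eventually.of_forall fun x => ?_)
        simp only [smul_eq_mul]
        rw [mul_comm, Real.fourier_eq]
        congr 1
        refine integral_congr_ae (Eventually.of_forall fun ξ => ?_)
        simp only [LinearMap.flip_apply, innerₗ_apply_apply, smul_smul,
          ← AddChar.map_add_eq_mul]
        congr 2
        rw [inner_add_right, real_inner_comm]; ring

theorem continuous_fourierInv {F : Rn n → ℂ} (hF : Integrable F) : Continuous (𝓕⁻ F) := by
  have h : Continuous (𝓕 F) := VectorFourier.fourierIntegral_continuous Real.continuous_fourierChar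
    (by simpa using continuous_inner) hF
  have e : 𝓕⁻ F = fun x => 𝓕 F (-x) := by ext x; exact Real.fourierInv_eq_fourier_neg F x
  rw [e]; fun_prop

/-- `𝓕 (m 𝓕⁻ψ)` is the convolution of `ψ` with the reflected kernel of `m`. -/
theorem fourier_mul_fourierInv {m ψ : Rn n → ℂ} (hm : Integrable m) (hψ : Integrable ψ) (y : Rn n) :
    𝓕 (fun ξ => m ξ * 𝓕⁻ ψ ξ) y = ∫ x, 𝓕⁻ m (x - y) * ψ x := by
  have h := fourier_mul_fourier hm hψ.comp_neg y
  rw [Real.fourierInv_eq_fourier_comp_neg, h, ← integral_neg_eq_self]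
  refine integral_congr_ae (Eventually.of_forall fun x => ?_)
  simp only [neg_neg, Real.fourierInv_eq_fourier_neg]
  rw [neg_sub, neg_add_eq_sub]

/-- The convolution `∫ K (x - y) f y dy`. -/
def kconv (K f : Rn n → ℂ) (x : Rn n) : ℂ := ∫ y, K (x - y) * f y

theorem fourierInv_mul_fourier {F k : Rn n → ℂ} (hF : Integrable F) (hk : Integrable k) (z : Rn n) :
    𝓕⁻ (fun ξ => F ξ * 𝓕 k ξ) z = kconv (𝓕⁻ F) k z := by
  rw [Real.fourierInv_eq_fourier_neg, fourier_mul_fourier hF hk, kconv]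
  refine integral_congr_ae (Eventually.of_forall fun x => ?_)
  simp only [Real.fourierInv_eq_fourier_neg]
  rw [neg_sub, ← sub_eq_add_neg]

theorem kconv_congr_ae {K f g : Rn n → ℂ} (h : f =ᵐ[volume] g) : kconv K f = kconv K g := by
  ext x
  refine integral_congr_ae ?_
  filter_upwards [h] with y hy
  rw [hy]

theorem enorm_kconv_le (K f : Rn n → ℂ) (x : Rn n) :
    ‖kconv K f x‖ₑ ≤ ∫⁻ y, ‖K (x - y)‖ₑ * ‖f y‖ₑ := by
  refine (enorm_integral_le_lintegral_enorm _).trans (le_of_eq ?_)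
  simp [enorm_mul]

theorem eLpNorm_kconv_le {K f : Rn n → ℂ} (hK : Measurable K) (hf : AEStronglyMeasurable f volume)
    {a b M : ℝ≥0∞} (ha : 1 ≤ a) (hab : a ≤ b) (hM : ∀ y, ‖K y‖ₑ ≤ M) :
    eLpNorm (kconv K f) b volume ≤ (∫⁻ y, ‖K y‖ₑ) ^ (1 - ((a⁻¹).toReal - (b⁻¹).toReal)) *
        M ^ ((a⁻¹).toReal - (b⁻¹).toReal) * eLpNorm f a volume := by
  rw [kconv_congr_ae hf.ae_eq_mk, eLpNorm_congr_ae hf.ae_eq_mk]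
  have hm : Measurable (hf.mk f) := hf.stronglyMeasurable_mk.measurable
  refine (eLpNorm_mono_enorm (g := fun x => ∫⁻ y, ‖K (x - y)‖ₑ * ‖hf.mk f y‖ₑ)
    fun x => by simpa using enorm_kconv_le K _ x).trans ?_
  refine (eLpNorm_lconv_le hm.enorm hK.enorm ha hab hM).trans (le_of_eq ?_)
  rw [eLpNorm_enorm]

theorem eLpNorm_kconv_le_same {K f : Rn n → ℂ} (hK : Measurable K)
    (hf : AEStronglyMeasurable f volume) {a : ℝ≥0∞} (ha : 1 ≤ a) :
    eLpNorm (kconv K f) a volume ≤ (∫⁻ y, ‖K y‖ₑ) * eLpNorm f a volume := by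
  simpa using eLpNorm_kconv_le (M := ∞) hK hf ha le_rfl (fun _ => le_top)

theorem stronglyMeasurable_kconv {K f : Rn n → ℂ} (hK : Measurable K)
    (hf : AEStronglyMeasurable f volume) : StronglyMeasurable (kconv K f) := by
  rw [kconv_congr_ae hf.ae_eq_mk]
  have hm : Measurable (hf.mk f) := hf.stronglyMeasurable_mk.measurable
  have : Measurable (fun z : Rn n × Rn n => K (z.1 - z.2) * hf.mk f z.2) :=
    (hK.comp (measurable_fst.sub measurable_snd)).mul (hm.comp measurable_snd)
  exact this.stronglyMeasurable.integral_prod_right'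

theorem lintegral_comp_sub_mul_le {K f ψ : Rn n → ℂ} (hK : Measurable K)
    (hf : AEStronglyMeasurable f volume) (hψ : AEStronglyMeasurable ψ volume)
    {r : ℝ≥0∞} (hr : 1 ≤ r) :
    ∫⁻ x, (∫⁻ y, ‖K (x - y)‖ₑ * ‖f y‖ₑ) * ‖ψ x‖ₑ ≤
      (∫⁻ y, ‖K y‖ₑ) * eLpNorm f r volume * eLpNorm ψ (conjExp r) volume := by
  have e1 : ∀ x, ∫⁻ y, ‖K (x - y)‖ₑ * ‖f y‖ₑ = ∫⁻ y, ‖K (x - y)‖ₑ * ‖hf.mk f y‖ₑ := fun x => by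
    refine lintegral_congr_ae ?_
    filter_upwards [hf.ae_eq_mk] with y hy
    rw [hy]
  have hm : Measurable (hf.mk f) := hf.stronglyMeasurable_mk.measurable
  simp_rw [e1]
  have h1 := eLpNorm_lconv_le_lintegral_mul (μ := (volume : Measure (Rn n))) hm.enorm hK.enorm hr
  have h2 := eLpNorm_ennreal_mul_le (ν := (volume : Measure (Rn n))) hr (one_le_conjExp r) le_rfl
    (by rw [inv_add_inv_conjExp hr, inv_one])
    (measurable_lconv (μ := (volume : Measure (Rn n))) hm.enorm hK.enorm).aemeasurable hψ.enorm
  rw [eLpNorm_one_eq_lintegral_enorm] at h2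
  simp only [enorm_eq_self, eLpNorm_enorm] at h2
  refine h2.trans ?_
  gcongr
  refine h1.trans (le_of_eq ?_)
  rw [eLpNorm_enorm, eLpNorm_congr_ae hf.ae_eq_mk]

/-- Fubini: the transpose of convolution with `K` is convolution with the reflected kernel. Young
and Hölder supply the absolute convergence for all `r` in `[1,∞]`. -/
theorem integral_kconv_mul {K f ψ : Rn n → ℂ} (hK : Measurable K) (hK1 : ∫⁻ y, ‖K y‖ₑ < ∞)
    {r : ℝ≥0∞} (hr : 1 ≤ r) (hf : MemLp f r volume) (hψ : MemLp ψ (conjExp r) volume) :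
    ∫ y, f y * (∫ x, K (x - y) * ψ x) = ∫ x, kconv K f x * ψ x := by
  have hbound := (lintegral_comp_sub_mul_le hK hf.1 hψ.1 hr).trans_lt
    (ENNReal.mul_lt_top (ENNReal.mul_lt_top hK1 hf.2) hψ.2)
  have hmeas : AEStronglyMeasurable (fun z : Rn n × Rn n => K (z.1 - z.2) * f z.2 * ψ z.1)
      (volume.prod volume) :=
    ((hK.comp (measurable_fst.sub measurable_snd)).aestronglyMeasurable.mul
      (hf.1.comp_quasiMeasurePreserving Measure.quasiMeasurePreserving_snd)).mul
      (hψ.1.comp_quasiMeasurePreserving Measure.quasiMeasurePreserving_fst)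
  have hint : Integrable (fun z : Rn n × Rn n => K (z.1 - z.2) * f z.2 * ψ z.1)
      (volume.prod volume) := by
    refine ⟨hmeas, ?_⟩
    rw [HasFiniteIntegral, lintegral_prod _ hmeas.enorm]
    refine lt_of_le_of_lt (lintegral_mono fun x => ?_) hbound
    simp only [enorm_mul]
    rw [lintegral_mul_const' _ _ (by simp)]
  have := integral_integral_swap (f := fun x y => K (x - y) * f y * ψ x) hint
  simp only [kconv]
  calc _ = ∫ y, ∫ x, K (x - y) * f y * ψ x := by
        refine integral_congr_ae (Eventually.of_forall fun y => ?_)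
        simp only
        rw [← integral_const_mul]
        refine integral_congr_ae (Eventually.of_forall fun x => ?_)
        simp only; ring
    _ = _ := this.symm
    _ = _ := by
        refine integral_congr_ae (Eventually.of_forall fun x => ?_)
        simp only
        rw [← integral_mul_const]

/-- `m` is integrable, and its kernel `𝓕⁻ m` is bounded by `A` in `L¹` and by `B` uniformly. -/
structure KerBound (m : Rn n → ℂ) (A B : ℝ≥0∞) : Prop where
  int : Integrable m
  one : ∫⁻ x, ‖𝓕⁻ m x‖ₑ ≤ A
  sup : ∀ x, ‖𝓕⁻ m x‖ₑ ≤ B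

namespace KerBound

variable {m : Rn n → ℂ} {A B A' B' : ℝ≥0∞}

theorem measurable (h : KerBound m A B) : Measurable (𝓕⁻ m) :=
  (continuous_fourierInv h.int).measurable

theorem mono (h : KerBound m A B) (hA : A ≤ A') (hB : B ≤ B') : KerBound m A' B' :=
  ⟨h.int, h.one.trans hA, fun x => (h.sup x).trans hB⟩

theorem const_mul (h : KerBound m A B) (c : ℂ) :
    KerBound (fun ξ => c * m ξ) (‖c‖ₑ * A) (‖c‖ₑ * B) := by
  have e : 𝓕⁻ (fun ξ => c * m ξ) = fun x => c * 𝓕⁻ m x := by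
    ext x
    rw [Real.fourierInv_eq, Real.fourierInv_eq, ← integral_const_mul]
    refine integral_congr_ae (Eventually.of_forall fun ξ => ?_)
    simp only [Circle.smul_def, smul_eq_mul]; ring
  refine ⟨h.int.const_mul c, ?_, fun x => ?_⟩
  · simp only [e, enorm_mul]
    rw [lintegral_const_mul' _ _ (by simp)]
    gcongr
    exact h.one
  · simp only [e, enorm_mul]
    gcongr
    exact h.sup x

/-- The kernel of the product is the convolution of the two kernels. Both bounds see the second
factor only through the `L¹` norm of its kernel, so a second factor that is a dilate contributes a
constant independent of the scale. -/
theorem mul_schwartz (h : KerBound m A B) (g : 𝓢(Rn n, ℂ)) (hg : KerBound g A' B') :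
    KerBound (fun ξ => m ξ * g ξ) (A * A') (B * A') := by
  have e : 𝓕⁻ (fun ξ => m ξ * g ξ) = kconv (𝓕⁻ m) (𝓕⁻ g : 𝓢(Rn n, ℂ)) := by
    have hg2 : (g : Rn n → ℂ) = 𝓕 ((𝓕⁻ g : 𝓢(Rn n, ℂ)) : Rn n → ℂ) := by
      rw [← SchwartzMap.fourier_coe, FourierTransform.fourier_fourierInv_eq]
    ext z
    conv_lhs => rw [hg2]
    rw [fourierInv_mul_fourier h.int (𝓕⁻ g : 𝓢(Rn n, ℂ)).integrable]
  have ek : ((𝓕⁻ g : 𝓢(Rn n, ℂ)) : Rn n → ℂ) = 𝓕⁻ (g : Rn n → ℂ) := SchwartzMap.fourierInv_coe g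
  have hgm : AEStronglyMeasurable (𝓕⁻ g : 𝓢(Rn n, ℂ)) volume :=
    (𝓕⁻ g : 𝓢(Rn n, ℂ)).continuous.aestronglyMeasurable
  have hA' : ∫⁻ x, ‖(𝓕⁻ g : 𝓢(Rn n, ℂ)) x‖ₑ ≤ A' := by rw [ek]; exact hg.one
  refine ⟨?_, ?_, fun x => ?_⟩
  · refine h.int.mul_bdd (c := SchwartzMap.seminorm ℝ 0 0 g) g.continuous.aestronglyMeasurable ?_
    exact Eventually.of_forall fun x => SchwartzMap.norm_le_seminorm ℝ g x
  · rw [e]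
    have := eLpNorm_kconv_le_same h.measurable hgm le_rfl
    rw [eLpNorm_one_eq_lintegral_enorm, eLpNorm_one_eq_lintegral_enorm] at this
    exact this.trans (mul_le_mul' h.one hA')
  · rw [e]
    refine (enorm_kconv_le _ _ x).trans ?_
    calc ∫⁻ y, ‖𝓕⁻ m (x - y)‖ₑ * ‖(𝓕⁻ g : 𝓢(Rn n, ℂ)) y‖ₑ
        ≤ ∫⁻ y, B * ‖(𝓕⁻ g : 𝓢(Rn n, ℂ)) y‖ₑ := lintegral_mono fun y => by gcongr; exact h.sup _
      _ = B * ∫⁻ y, ‖(𝓕⁻ g : 𝓢(Rn n, ℂ)) y‖ₑ :=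
          lintegral_const_mul _ (𝓕⁻ g : 𝓢(Rn n, ℂ)).continuous.measurable.enorm
      _ ≤ _ := by gcongr

end KerBound

/-- The dilation `ξ ↦ g (c ξ)` of a Schwartz function. -/
def dilate (c : ℝ) (hc : c ≠ 0) (g : 𝓢(Rn n, ℂ)) : 𝓢(Rn n, ℂ) :=
  SchwartzMap.compCLMOfContinuousLinearEquiv ℝ (ContinuousLinearEquiv.smulLeft (Units.mk0 c hc)) g

theorem dilate_apply (c : ℝ) (hc : c ≠ 0) (g : 𝓢(Rn n, ℂ)) (ξ : Rn n) :
    dilate c hc g ξ = g (c • ξ) := rfl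

theorem fourierInv_dilate {c : ℝ} (hc : 0 < c) (g : Rn n → ℂ) (x : Rn n) :
    𝓕⁻ (fun ξ => g (c • ξ)) x = ((c ^ n)⁻¹ : ℝ) • 𝓕⁻ g (c⁻¹ • x) := by
  rw [Real.fourierInv_eq, Real.fourierInv_eq]
  have := Measure.integral_comp_smul (μ := (volume : Measure (Rn n)))
    (fun ξ => Real.fourierChar (inner ℝ ξ (c⁻¹ • x)) • g ξ) c
  rw [finrank_euclideanSpace_fin, abs_of_pos (by positivity)] at this
  rw [← this]
  refine integral_congr_ae (Eventually.of_forall fun ξ => ?_)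
  simp only [inner_smul_left, inner_smul_right]
  congr 3
  simp only [conj_trivial]
  field_simp

/-- Dilating the symbol by `c` replaces the kernel `k` by `c⁻ⁿ k(x/c)`, which preserves the `L¹`
norm and multiplies the sup norm by `c⁻ⁿ`. -/
theorem kerBound_dilate (g : 𝓢(Rn n, ℂ)) : ∃ C : ℝ≥0∞, C < ∞ ∧ ∀ (c : ℝ) (_ : 0 < c),
    KerBound (fun ξ => g (c • ξ)) C (ENNReal.ofReal ((c ^ n)⁻¹) * C) := by
  set k : 𝓢(Rn n, ℂ) := 𝓕⁻ g with hk
  have ek : (k : Rn n → ℂ) = 𝓕⁻ (g : Rn n → ℂ) := SchwartzMap.fourierInv_coe g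
  have hA : ∫⁻ x, ‖k x‖ₑ < ∞ := k.integrable.2
  refine ⟨(∫⁻ x, ‖k x‖ₑ) + ENNReal.ofReal (SchwartzMap.seminorm ℝ 0 0 k),
    ENNReal.add_lt_top.2 ⟨hA, ENNReal.ofReal_lt_top⟩, fun c hc => ?_⟩
  have e : 𝓕⁻ (fun ξ => g (c • ξ)) = fun x => ((c ^ n)⁻¹ : ℝ) • k (c⁻¹ • x) := by
    ext x; rw [fourierInv_dilate hc, ek]
  refine ⟨(dilate c hc.ne' g).integrable, ?_, fun x => ?_⟩
  · refine le_trans (le_of_eq ?_) le_self_add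
    rw [e]
    have hint : Integrable (fun x => ((c ^ n)⁻¹ : ℝ) • k (c⁻¹ • x)) :=
      (k.integrable.comp_smul (inv_ne_zero hc.ne')).smul ((c ^ n)⁻¹ : ℝ)
    have h1 := ofReal_integral_norm_eq_lintegral_enorm hint
    have h2 := ofReal_integral_norm_eq_lintegral_enorm k.integrable (μ := volume)
    rw [← h1, ← h2]
    congr 1
    simp only [norm_smul]
    rw [integral_const_mul, Measure.integral_comp_smul volume (fun x => ‖k x‖),
      finrank_euclideanSpace_fin, Real.norm_of_nonneg (by positivity), abs_of_pos (by positivity)]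
    simp only [smul_eq_mul, inv_pow, inv_inv]
    field_simp
  · rw [e]
    simp only [enorm_smul]
    rw [Real.enorm_of_nonneg (by positivity)]
    gcongr
    refine le_trans ?_ le_add_self
    rw [← ofReal_norm]
    exact ENNReal.ofReal_le_ofReal (SchwartzMap.norm_le_seminorm ℝ k _)

end Kernels

/-! ### Dyadic sums -/

theorem ennreal_two_rpow_ne_top (x : ℝ) : (2 : ℝ≥0∞) ^ x ≠ ∞ := by simp

theorem ennreal_two_rpow_add (x y : ℝ) : (2 : ℝ≥0∞) ^ (x + y) = 2 ^ x * 2 ^ y :=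
  ENNReal.rpow_add _ _ (by simp) (by simp)

theorem ofReal_two_zpow (l : ℤ) : ENNReal.ofReal ((2 : ℝ) ^ l) = (2 : ℝ≥0∞) ^ (l : ℝ) := by
  rw [← Real.rpow_intCast, ← ENNReal.ofReal_rpow_of_pos (by norm_num)]
  simp

theorem tsum_nat_two_rpow_lt_top {b : ℝ} (hb : 0 < b) : ∑' k : ℕ, (2 : ℝ≥0∞) ^ (-(b * k)) < ∞ := by
  have e : ∀ k : ℕ, (2 : ℝ≥0∞) ^ (-(b * k)) = ((2 : ℝ≥0∞) ^ (-b)) ^ k := fun k => by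
    rw [← ENNReal.rpow_natCast, ← ENNReal.rpow_mul]; congr 1; ring
  simp_rw [e]
  rw [ENNReal.tsum_geometric]
  have h1 : (2 : ℝ≥0∞) ^ (-b) < 1 := ENNReal.rpow_lt_one_of_one_lt_of_neg (by norm_num) (by linarith)
  rw [ENNReal.inv_lt_top]
  exact tsub_pos_of_lt h1

/-- A series over `ℤ` whose terms decay geometrically in both directions. -/
theorem tsum_int_lt_top {f : ℤ → ℝ≥0∞} {C : ℝ≥0∞} {a b : ℝ} (hC : C < ∞) (ha : 0 < a) (hb : 0 < b)
    (h1 : ∀ l : ℤ, f l ≤ C * 2 ^ ((l : ℝ) * a)) (h2 : ∀ l : ℤ, f l ≤ C * 2 ^ (-((l : ℝ) * b))) :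
    ∑' l, f l < ∞ := by
  have hs : ∑' l, f l = (∑' k : ℕ, f k) + ∑' k : ℕ, f (-(k + 1 : ℕ)) := by
    rw [tsum_of_nat_of_neg_add_one (f := f) ENNReal.summable ENNReal.summable]
    push_cast; rfl
  rw [hs]
  refine ENNReal.add_lt_top.2 ⟨?_, ?_⟩
  · refine lt_of_le_of_lt (ENNReal.tsum_le_tsum fun k : ℕ => (h2 k)) ?_
    rw [ENNReal.tsum_mul_left]
    refine ENNReal.mul_lt_top hC ?_
    have := tsum_nat_two_rpow_lt_top hb
    simpa [mul_comm] using this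
  · refine lt_of_le_of_lt (ENNReal.tsum_le_tsum fun k : ℕ => (h1 _)) ?_
    rw [ENNReal.tsum_mul_left]
    refine ENNReal.mul_lt_top hC (lt_of_le_of_lt ?_ (tsum_nat_two_rpow_lt_top ha))
    refine ENNReal.tsum_le_tsum fun k => ENNReal.rpow_le_rpow_of_exponent_le (by norm_num) ?_
    push_cast
    nlinarith

/-- The decay factor `min (1, x⁻²)`. -/
def kap (x : ℝ) : ℝ≥0∞ := min 1 (ENNReal.ofReal x ^ 2)⁻¹

theorem kap_le_one (x : ℝ) : kap x ≤ 1 := min_le_left _ _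

theorem measurable_kap : Measurable kap :=
  measurable_const.min ((ENNReal.measurable_ofReal.pow_const 2).inv)

/-! ### Symbols supported in annuli -/

section Annular

variable {n : ℕ}

/-- Smooth symbols with compact support in `ℝⁿ \ {0}`. -/
structure IsAnnular (a : Rn n → ℂ) : Prop where
  smooth : ContDiff ℝ (⊤ : ℕ∞) a
  cpt : HasCompactSupport a
  zero : (0 : Rn n) ∉ tsupport a

/-- Functions that are smooth outside the origin. -/
def SmoothOff (f : Rn n → ℂ) : Prop := ∀ ξ ≠ 0, ContDiffAt ℝ (⊤ : ℕ∞) f ξ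

/-- Near the origin the annular factor vanishes identically, so a singularity of `f` there does no
harm. This is how homogeneous symbols and negative powers of `|ξ|` enter. -/
theorem IsAnnular.mul {a f : Rn n → ℂ} (ha : IsAnnular a) (hf : SmoothOff f) :
    IsAnnular (fun ξ => a ξ * f ξ) := by
  have hsub : tsupport (fun ξ => a ξ * f ξ) ⊆ tsupport a := tsupport_mul_subset_left
  refine ⟨contDiff_iff_contDiffAt.2 fun ξ => ?_, ha.cpt.mul_right, fun h => ha.zero (hsub h)⟩
  by_cases hξ : ξ ∈ tsupport a
  · have h0 : ξ ≠ 0 := fun h => ha.zero (h ▸ hξ)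
    exact ha.smooth.contDiffAt.mul (hf ξ h0)
  · have : (fun ξ => a ξ * f ξ) =ᶠ[𝓝 ξ] fun _ => 0 := by
      filter_upwards [notMem_tsupport_iff_eventuallyEq.1 hξ] with η hη
      simp [hη]
    exact contDiffAt_const.congr_of_eventuallyEq this

theorem smoothOff_norm_sq_inv : SmoothOff (fun ξ : Rn n => (((‖ξ‖ ^ 2)⁻¹ : ℝ) : ℂ)) := by
  intro ξ hξ
  have h1 : ContDiffAt ℝ (⊤ : ℕ∞) (fun ξ : Rn n => (‖ξ‖ ^ 2)⁻¹) ξ :=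
    (contDiff_norm_sq ℝ).contDiffAt.inv (by simpa using hξ)
  exact Complex.ofRealCLM.contDiff.contDiffAt.comp ξ h1

theorem SmoothOff.mul {f g : Rn n → ℂ} (hf : SmoothOff f) (hg : SmoothOff g) :
    SmoothOff (fun ξ => f ξ * g ξ) := fun ξ hξ => (hf ξ hξ).mul (hg ξ hξ)

theorem two_zpow_neg_pow_inv (l : ℤ) (n : ℕ) :
    ENNReal.ofReal ((((2 : ℝ) ^ (-l)) ^ n)⁻¹) = (2 : ℝ≥0∞) ^ ((l : ℝ) * n) := by
  have : (((2 : ℝ) ^ (-l)) ^ n)⁻¹ = (2 : ℝ) ^ (l * n) := by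
    rw [zpow_neg, inv_pow, inv_inv, zpow_mul, zpow_natCast]
  rw [this, ofReal_two_zpow]
  push_cast; rfl

/-- Uniform bounds without decay in `τ`; decay is obtained by applying this to suitable choices of
`a` and `g`. -/
theorem IsAnnular.kerBound_aux {a : Rn n → ℂ} (ha : IsAnnular a) (g : 𝓢(Rn n, ℂ)) :
    ∃ C : ℝ≥0∞, C < ∞ ∧ ∀ (l : ℤ) (τ : ℝ), 0 < τ →
      KerBound (fun ξ => a ((2 : ℝ) ^ (-l) • ξ) * g (√τ • ξ)) C (2 ^ ((l : ℝ) * n) * C) := by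
  obtain ⟨C, hC, h⟩ := kerBound_dilate (ha.cpt.toSchwartzMap ha.smooth)
  obtain ⟨C', hC', h'⟩ := kerBound_dilate g
  refine ⟨C * C', ENNReal.mul_lt_top hC hC', fun l τ hτ => ?_⟩
  have h1 := h ((2 : ℝ) ^ (-l)) (by positivity)
  rw [two_zpow_neg_pow_inv] at h1
  have hs : 0 < √τ := Real.sqrt_pos.2 hτ
  have h2 := h1.mul_schwartz (dilate √τ hs.ne' g) (h' √τ hs)
  rw [← mul_assoc]
  exact h2

/-- Kernel bounds for a dyadically dilated annular symbol times the heat symbol. -/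
theorem IsAnnular.kerBound {a : Rn n → ℂ} (ha : IsAnnular a) :
    ∃ C : ℝ≥0∞, C < ∞ ∧ ∀ (l : ℤ) (τ : ℝ), 0 ≤ τ →
      KerBound (fun ξ => a ((2 : ℝ) ^ (-l) • ξ) * heatSymbol τ ξ)
        (C * kap (τ * 4 ^ l)) (2 ^ ((l : ℝ) * n) * (C * kap (τ * 4 ^ l))) := by
  -- The decay `(τ4^l)⁻²` comes from inserting `1 = (τ4^l)⁻² |2⁻ˡξ|⁻⁴ |√τ ξ|⁴`: the negative power
  -- is absorbed by the annular symbol, the positive one by the Gaussian.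
  have ha1 : IsAnnular (fun ξ : Rn n => a ξ * ((((‖ξ‖ ^ 2)⁻¹ : ℝ) : ℂ) * (((‖ξ‖ ^ 2)⁻¹ : ℝ) : ℂ))) :=
    ha.mul (smoothOff_norm_sq_inv.mul smoothOff_norm_sq_inv)
  have hT : (fun ξ : Rn n => (((‖ξ‖ ^ 2) ^ 2 : ℝ) : ℂ)).HasTemperateGrowth := by fun_prop
  obtain ⟨C0, hC0, h0⟩ := kerBound_dilate (ha.cpt.toSchwartzMap ha.smooth)
  obtain ⟨C1, hC1, h1⟩ := ha.kerBound_aux (gauss n)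
  obtain ⟨C2, hC2, h2⟩ := ha1.kerBound_aux
    (SchwartzMap.smulLeftCLM ℂ (fun ξ : Rn n => (((‖ξ‖ ^ 2) ^ 2 : ℝ) : ℂ)) (gauss n))
  refine ⟨C0 + C1 + C2, by simp [hC0, hC1, hC2], fun l τ hτ => ?_⟩
  have l0 : C0 ≤ C0 + C1 + C2 := le_self_add.trans le_self_add
  have l1 : C1 ≤ C0 + C1 + C2 := le_add_self.trans le_self_add
  have l2 : C2 ≤ C0 + C1 + C2 := le_add_self
  -- At `τ = 0` the dilation by `√τ` degenerates, but the heat factor is `1` and so is `kap`.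
  rcases hτ.eq_or_lt with rfl | hτ
  · have h := h0 ((2 : ℝ) ^ (-l)) (by positivity)
    rw [two_zpow_neg_pow_inv] at h
    have hk : kap (0 * 4 ^ l) = 1 := by simp [kap]
    rw [hk, mul_one]
    have e : (fun ξ : Rn n => a ((2 : ℝ) ^ (-l) • ξ) * heatSymbol 0 ξ) =
        fun ξ => (ha.cpt.toSchwartzMap ha.smooth) ((2 : ℝ) ^ (-l) • ξ) := by
      ext ξ; simp [heatSymbol]
    rw [e]
    exact h.mono l0 (by gcongr)
  have b1 : KerBound (fun ξ => a ((2 : ℝ) ^ (-l) • ξ) * heatSymbol τ ξ)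
      (C0 + C1 + C2) (2 ^ ((l : ℝ) * n) * (C0 + C1 + C2)) := by
    have h := h1 l τ hτ
    simp_rw [gauss_smul hτ.le] at h
    exact h.mono l1 (by gcongr)
  have hx : 0 < τ * (4 : ℝ) ^ l := by positivity
  have b2 : KerBound (fun ξ => a ((2 : ℝ) ^ (-l) • ξ) * heatSymbol τ ξ)
      ((C0 + C1 + C2) * (ENNReal.ofReal (τ * 4 ^ l) ^ 2)⁻¹)
      (2 ^ ((l : ℝ) * n) * ((C0 + C1 + C2) * (ENNReal.ofReal (τ * 4 ^ l) ^ 2)⁻¹)) := by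
    have h := (h2 l τ hτ).const_mul ((((τ * 4 ^ l) ^ 2)⁻¹ : ℝ) : ℂ)
    have hc : ‖((((τ * 4 ^ l) ^ 2)⁻¹ : ℝ) : ℂ)‖ₑ = (ENNReal.ofReal (τ * 4 ^ l) ^ 2)⁻¹ := by
      rw [← ofReal_norm, Complex.norm_real, Real.norm_of_nonneg (by positivity),
        ENNReal.ofReal_inv_of_pos (by positivity), ENNReal.ofReal_pow hx.le]
    rw [hc] at h
    have e : (fun ξ : Rn n => a ((2 : ℝ) ^ (-l) • ξ) * heatSymbol τ ξ) = fun ξ =>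
        ((((τ * 4 ^ l) ^ 2)⁻¹ : ℝ) : ℂ) * (a ((2 : ℝ) ^ (-l) • ξ) *
          ((((‖(2 : ℝ) ^ (-l) • ξ‖ ^ 2)⁻¹ : ℝ) : ℂ) * (((‖(2 : ℝ) ^ (-l) • ξ‖ ^ 2)⁻¹ : ℝ) : ℂ)) *
          SchwartzMap.smulLeftCLM ℂ (fun ξ : Rn n => (((‖ξ‖ ^ 2) ^ 2 : ℝ) : ℂ)) (gauss n)
            (√τ • ξ)) := by
      ext ξ
      rw [SchwartzMap.smulLeftCLM_apply_apply hT, gauss_smul hτ.le]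
      by_cases hξ : ξ = 0
      · have hz : a 0 = 0 := image_eq_zero_of_notMem_tsupport ha.zero
        simp [hξ, hz]
      have hn : ‖ξ‖ ≠ 0 := by simpa using hξ
      have h4 : ((4 : ℝ) ^ l) = (2 : ℝ) ^ l * (2 : ℝ) ^ l := by
        rw [← mul_zpow]; norm_num
      have h2z : (2 : ℝ) ^ l ≠ 0 := by positivity
      have e2 : (((τ * 4 ^ l) ^ 2)⁻¹ : ℝ) * (((‖(2 : ℝ) ^ (-l) • ξ‖ ^ 2)⁻¹) *
          ((‖(2 : ℝ) ^ (-l) • ξ‖ ^ 2)⁻¹)) * (‖√τ • ξ‖ ^ 2) ^ 2 = 1 := by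
        have n1 : ‖(2 : ℝ) ^ (-l) • ξ‖ ^ 2 = (((2 : ℝ) ^ l)⁻¹) ^ 2 * ‖ξ‖ ^ 2 := by
          rw [norm_smul, mul_pow, Real.norm_eq_abs, sq_abs, zpow_neg]
        have n2 : ‖√τ • ξ‖ ^ 2 = τ * ‖ξ‖ ^ 2 := by
          rw [norm_smul, mul_pow, Real.norm_eq_abs, sq_abs, Real.sq_sqrt hτ.le]
        rw [n1, n2, h4]
        field_simp
      have e3 := congrArg (fun x : ℝ => (x : ℂ)) e2
      push_cast at e3
      push_cast
      simp only [smul_eq_mul]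
      linear_combination (-(a ((2 : ℝ) ^ (-l) • ξ) * heatSymbol τ ξ)) * e3
    rw [e]
    refine h.mono ?_ ?_
    · rw [mul_comm]; gcongr
    · rw [mul_comm, mul_assoc]; gcongr
  rcases min_choice 1 (ENNReal.ofReal (τ * 4 ^ l) ^ 2)⁻¹ with hk | hk
  · rw [kap, hk, mul_one]; exact b1
  · rw [kap, hk]; exact b2

/-- The bound `L^a → L^b` that follows from kernel bounds. -/
theorem KerBound.eLpNorm_kconv_le {m : Rn n → ℂ} {C k : ℝ≥0∞} {x : ℝ}
    (h : KerBound m (C * k) (2 ^ x * (C * k))) {f : Rn n → ℂ} (hf : AEStronglyMeasurable f volume)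
    {a b : ℝ≥0∞} (ha : 1 ≤ a) (hab : a ≤ b) :
    eLpNorm (kconv (𝓕⁻ m) f) b volume ≤
      C * k * 2 ^ (x * ((a⁻¹).toReal - (b⁻¹).toReal)) * eLpNorm f a volume := by
  refine (BesovNS.eLpNorm_kconv_le h.measurable hf ha hab h.sup).trans ?_
  have ha0 : a ≠ 0 := (zero_lt_one.trans_le ha).ne'
  have hb : (b⁻¹).toReal ≤ (a⁻¹).toReal :=
    ENNReal.toReal_mono (by simpa using ha0) (ENNReal.inv_le_inv.2 hab)
  have ha1 : (a⁻¹).toReal ≤ 1 := by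
    rw [← ENNReal.toReal_one]
    exact ENNReal.toReal_mono (by simp) (by simpa using ha)
  have hb0 : 0 ≤ (b⁻¹).toReal := ENNReal.toReal_nonneg
  set θ := (a⁻¹).toReal - (b⁻¹).toReal with hθ
  refine mul_le_mul' ?_ le_rfl
  calc (∫⁻ y, ‖𝓕⁻ m y‖ₑ) ^ (1 - θ) * (2 ^ x * (C * k)) ^ θ
      ≤ (C * k) ^ (1 - θ) * (2 ^ x * (C * k)) ^ θ := by
        refine mul_le_mul' (ENNReal.rpow_le_rpow h.one (by linarith)) le_rfl
    _ = (C * k) ^ (1 - θ) * (C * k) ^ θ * 2 ^ (x * θ) := by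
        rw [ENNReal.mul_rpow_of_nonneg (2 ^ x) (C * k) (z := θ) (by linarith), ← ENNReal.rpow_mul]
        ring
    _ = _ := by
        rw [← ENNReal.rpow_add_of_nonneg _ _ (by linarith) (by linarith)]
        simp

end Annular

/-! ### Littlewood-Paley symbols -/

section LittlewoodPaley

variable {n : ℕ} (P : LPPair n)

/-- The symbol of `Δ̇_l`. -/
def lpSym (l : ℤ) (ξ : Rn n) : ℂ := ((P.φ ((2 : ℝ) ^ (-l) • ((2 * Real.pi) • ξ)) : ℝ) : ℂ)

/-- The symbol of `Ṡ_l`. -/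
def lowSym (l : ℤ) (ξ : Rn n) : ℂ := ((P.χ ((2 : ℝ) ^ (-l) • ((2 * Real.pi) • ξ)) : ℝ) : ℂ)

/-- The Fourier multiplier with symbol `m`, in Mathlib's normalization. -/
abbrev op (m : Rn n → ℂ) : TD n →L[ℂ] TD n := TemperedDistribution.fourierMultiplierCLM ℂ m

theorem lpProj_eq (l : ℤ) : lpProj P l = op (lpSym P l) := rfl

theorem lowFreq_eq (l : ℤ) : lowFreq P l = op (lowSym P l) := rfl

theorem heat_eq (t : ℝ) : heat (n := n) t = op (heatSymbol t) := rfl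

theorem hasCompactSupport_φ : HasCompactSupport P.φ :=
  HasCompactSupport.of_support_subset_isCompact (isCompact_closedBall (0 : Rn n) (8 / 3))
    fun ξ hξ => by simpa using (P.supp_φ (subset_tsupport _ hξ)).2.le

theorem hasCompactSupport_χ : HasCompactSupport P.χ :=
  HasCompactSupport.of_support_subset_isCompact (isCompact_closedBall (0 : Rn n) (4 / 3))
    fun ξ hξ => by
      have : ‖ξ‖ < 4 / 3 := P.supp_χ (subset_tsupport _ hξ)
      simpa using this.le

theorem two_pi_ne_zero : (2 * Real.pi : ℝ) ≠ 0 := by positivity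

/-- The linear equivalence `ξ ↦ 2πξ`. -/
def twoPiEquiv (n : ℕ) : Rn n ≃L[ℝ] Rn n :=
  ContinuousLinearEquiv.smulLeft (Units.mk0 (2 * Real.pi) two_pi_ne_zero)

theorem isAnnular_lpSym_zero : IsAnnular (fun ξ : Rn n => ((P.φ ((2 * Real.pi) • ξ) : ℝ) : ℂ)) := by
  have e : (fun ξ : Rn n => ((P.φ ((2 * Real.pi) • ξ) : ℝ) : ℂ)) =
      Complex.ofRealCLM ∘ P.φ ∘ twoPiEquiv n := rfl
  have hcs : HasCompactSupport (P.φ ∘ twoPiEquiv n) :=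
    (hasCompactSupport_φ P).comp_homeomorph (twoPiEquiv n).toHomeomorph
  refine ⟨?_, ?_, ?_⟩
  · rw [e]
    exact Complex.ofRealCLM.contDiff.comp (P.smooth_φ.comp (twoPiEquiv n).contDiff)
  · rw [e]; exact hcs.comp_left rfl
  · have h0 : (0 : Rn n) ∉ tsupport P.φ := fun h => by
      have := (P.supp_φ h).1
      simp at this
      linarith
    rw [notMem_tsupport_iff_eventuallyEq] at h0 ⊢
    have hc : Tendsto (fun ξ : Rn n => (2 * Real.pi) • ξ) (𝓝 0) (𝓝 0) := by
      have : Continuous fun ξ : Rn n => (2 * Real.pi) • ξ := by fun_prop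
      simpa using this.tendsto 0
    filter_upwards [hc.eventually h0] with ξ hξ
    simp [hξ]

theorem lpSym_eq (l : ℤ) :
    lpSym P l = fun ξ => (fun η : Rn n => ((P.φ ((2 * Real.pi) • η) : ℝ) : ℂ))
      ((2 : ℝ) ^ (-l) • ξ) := by
  ext ξ
  simp only [lpSym]
  rw [smul_comm]

theorem isAnnular_lpSym (l : ℤ) : IsAnnular (lpSym P l) := by
  have h := isAnnular_lpSym_zero P
  have hc : (2 : ℝ) ^ (-l) ≠ 0 := by positivity
  rw [lpSym_eq]
  refine ⟨h.smooth.comp (by fun_prop), ?_, ?_⟩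
  · exact h.cpt.comp_homeomorph (ContinuousLinearEquiv.smulLeft (Units.mk0 _ hc)
      : Rn n ≃L[ℝ] Rn n).toHomeomorph
  · have h0 := h.zero
    rw [notMem_tsupport_iff_eventuallyEq] at h0 ⊢
    have hc : Tendsto (fun ξ : Rn n => (2 : ℝ) ^ (-l) • ξ) (𝓝 0) (𝓝 0) := by
      have : Continuous fun ξ : Rn n => (2 : ℝ) ^ (-l) • ξ := by fun_prop
      simpa using this.tendsto 0
    exact hc.eventually h0

theorem contDiff_lowSym (l : ℤ) : ContDiff ℝ (⊤ : ℕ∞) (lowSym P l) := by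
  have : ContDiff ℝ (⊤ : ℕ∞) fun ξ : Rn n => P.χ ((2 : ℝ) ^ (-l) • ((2 * Real.pi) • ξ)) :=
    P.smooth_χ.comp (by fun_prop)
  exact Complex.ofRealCLM.contDiff.comp this

theorem hasCompactSupport_lowSym (l : ℤ) : HasCompactSupport (lowSym P l) := by
  have hc : (2 : ℝ) ^ (-l) ≠ 0 := by positivity
  have h1 : HasCompactSupport (P.χ ∘ ((twoPiEquiv n).trans
      (ContinuousLinearEquiv.smulLeft (Units.mk0 _ hc) : Rn n ≃L[ℝ] Rn n))) :=
    (hasCompactSupport_χ P).comp_homeomorph (((twoPiEquiv n).trans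
      (ContinuousLinearEquiv.smulLeft (Units.mk0 _ hc) : Rn n ≃L[ℝ] Rn n))).toHomeomorph
  exact h1.comp_left (g := fun x : ℝ => (x : ℂ)) rfl

theorem IsAnnular.hasTemperateGrowth {a : Rn n → ℂ} (ha : IsAnnular a) : a.HasTemperateGrowth :=
  ha.cpt.hasTemperateGrowth ha.smooth

theorem hasTemperateGrowth_lpSym (l : ℤ) : (lpSym P l).HasTemperateGrowth :=
  (isAnnular_lpSym P l).hasTemperateGrowth

theorem hasTemperateGrowth_lowSym (l : ℤ) : (lowSym P l).HasTemperateGrowth :=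
  (hasCompactSupport_lowSym P l).hasTemperateGrowth (contDiff_lowSym P l)

theorem lpSym_ne_zero {l : ℤ} {ξ : Rn n} (h : lpSym P l ξ ≠ 0) :
    3 / 4 * (2 : ℝ) ^ l < ‖(2 * Real.pi) • ξ‖ ∧ ‖(2 * Real.pi) • ξ‖ < 8 / 3 * (2 : ℝ) ^ l := by
  have h1 : P.φ ((2 : ℝ) ^ (-l) • ((2 * Real.pi) • ξ)) ≠ 0 := fun h0 => h (by rw [lpSym, h0]; simp)
  obtain ⟨h2, h3⟩ := P.supp_φ (subset_tsupport _ h1)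
  have hp : (0 : ℝ) < 2 ^ l := by positivity
  rw [norm_smul, Real.norm_of_nonneg (by positivity), zpow_neg, inv_mul_eq_div] at h2 h3
  rw [lt_div_iff₀ hp] at h2
  rw [div_lt_iff₀ hp] at h3
  exact ⟨h2, h3⟩

theorem lowSym_ne_zero {l : ℤ} {ξ : Rn n} (h : lowSym P l ξ ≠ 0) :
    ‖(2 * Real.pi) • ξ‖ < 4 / 3 * (2 : ℝ) ^ l := by
  have h1 : P.χ ((2 : ℝ) ^ (-l) • ((2 * Real.pi) • ξ)) ≠ 0 := fun h0 => h (by rw [lowSym, h0]; simp)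
  have h2 := P.supp_χ (subset_tsupport _ h1)
  have hp : (0 : ℝ) < 2 ^ l := by positivity
  have h3 : ‖(2 : ℝ) ^ (-l) • ((2 * Real.pi) • ξ)‖ < 4 / 3 := h2
  rw [norm_smul, Real.norm_of_nonneg (by positivity), zpow_neg, inv_mul_eq_div,
    div_lt_iff₀ hp] at h3
  exact h3

/-- The supports are disjoint because `(3/4)·4 = 3 > 8/3`. -/
theorem lpSym_mul_lpSym {j k : ℤ} (h : j + 2 ≤ k) (ξ : Rn n) : lpSym P j ξ * lpSym P k ξ = 0 := by
  by_contra hne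
  have h1 := (lpSym_ne_zero P (left_ne_zero_of_mul hne)).2
  have h2 := (lpSym_ne_zero P (right_ne_zero_of_mul hne)).1
  have h3 : (2 : ℝ) ^ (j + 2) ≤ (2 : ℝ) ^ k := zpow_le_zpow_right₀ (by norm_num) h
  rw [zpow_add₀ (by norm_num)] at h3
  have : (0 : ℝ) < 2 ^ j := by positivity
  norm_num at h3
  linarith

/-- The supports are disjoint because `(3/4)·2 = 3/2 > 4/3`. -/
theorem lpSym_mul_lowSym {j k : ℤ} (h : k + 1 ≤ j) (ξ : Rn n) :
    lpSym P j ξ * lowSym P k ξ = 0 := by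
  by_contra hne
  have h1 := (lpSym_ne_zero P (left_ne_zero_of_mul hne)).1
  have h2 := (lowSym_ne_zero P (right_ne_zero_of_mul hne))
  have h3 : (2 : ℝ) ^ (k + 1) ≤ (2 : ℝ) ^ j := zpow_le_zpow_right₀ (by norm_num) h
  rw [zpow_add₀ (by norm_num)] at h3
  have : (0 : ℝ) < 2 ^ k := by positivity
  norm_num at h3
  linarith

/-- Compare the partition of unity at `η` with the one at `η/2`: the second series is the first
without its initial term `φ(η)`. -/
theorem lowSym_succ (j : ℤ) (ξ : Rn n) : lowSym P (j + 1) ξ = lowSym P j ξ + lpSym P j ξ := by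
  set η := (2 : ℝ) ^ (-j) • ((2 * Real.pi) • ξ) with hη
  have h1 := P.sum_nat η
  have h2 := P.sum_nat ((2 : ℝ) ^ (-(j + 1)) • ((2 * Real.pi) • ξ))
  have e : ∀ i : ℕ, (2 : ℝ) ^ (-(i : ℤ)) • ((2 : ℝ) ^ (-(j + 1)) • ((2 * Real.pi) • ξ)) =
      (2 : ℝ) ^ (-((i + 1 : ℕ) : ℤ)) • η := fun i => by
    rw [hη, smul_smul, smul_smul ((2 : ℝ) ^ (-((i + 1 : ℕ) : ℤ))), ← zpow_add₀ (by norm_num),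
      ← zpow_add₀ (by norm_num)]
    congr 2; push_cast; ring
  simp_rw [e] at h2
  have h3 := (hasSum_nat_add_iff' (f := fun i : ℕ => P.φ ((2 : ℝ) ^ (-(i : ℤ)) • η)) 1).2 h1
  have h4 := h3.unique h2
  simp only [Finset.range_one, Finset.sum_singleton, Nat.cast_zero, neg_zero, zpow_zero,
    one_smul] at h4
  simp only [lowSym, lpSym, ← hη]
  rw [← Complex.ofReal_add]
  congr 1
  linarith

theorem hasSum_lpSym {ξ : Rn n} (hξ : ξ ≠ 0) : HasSum (fun l => lpSym P l ξ) 1 := by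
  have h0 : (2 * Real.pi) • ξ ≠ 0 := smul_ne_zero two_pi_ne_zero hξ
  have := P.sum_int _ h0
  have h1 := Complex.hasSum_ofReal.2 this
  rwa [Complex.ofReal_one] at h1

/-- The symbol of `Δ̇_{l-1} + Δ̇_l + Δ̇_{l+1}`. -/
def fatSym (l : ℤ) (ξ : Rn n) : ℂ := lpSym P (l - 1) ξ + lpSym P l ξ + lpSym P (l + 1) ξ

/-- On the support of one dyadic piece only its two neighbours and itself are nonzero, so these
three already sum to `1`. -/
theorem lpSym_mul_fatSym (l : ℤ) (ξ : Rn n) : lpSym P l ξ * fatSym P l ξ = lpSym P l ξ := by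
  by_cases hl : lpSym P l ξ = 0
  · simp [hl]
  have hξ : ξ ≠ 0 := by
    rintro rfl
    have := (lpSym_ne_zero P hl).1
    have hp : (0 : ℝ) < 2 ^ l := by positivity
    simp at this
    linarith
  have h1 := hasSum_lpSym P hξ
  have h2 : HasSum (fun l => lpSym P l ξ) (∑ k ∈ {l - 1, l, l + 1}, lpSym P k ξ) := by
    refine hasSum_sum_of_ne_finset_zero fun k hk => ?_
    simp only [Finset.mem_insert, Finset.mem_singleton, not_or] at hk
    rcases lt_or_gt_of_ne hk.2.1 with h | h
    · have := lpSym_mul_lpSym P (j := k) (k := l) (by omega) ξ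
      exact (mul_eq_zero.1 this).resolve_right hl
    · have := lpSym_mul_lpSym P (j := l) (k := k) (by omega) ξ
      exact (mul_eq_zero.1 this).resolve_left hl
  have h3 := h2.unique h1
  rw [Finset.sum_insert (by simp; omega), Finset.sum_insert (by simp),
    Finset.sum_singleton] at h3
  rw [fatSym, add_assoc, h3, mul_one]

theorem lowSym_neg (l : ℤ) (ξ : Rn n) : lowSym P l (-ξ) = lowSym P l ξ := by
  rw [lowSym, lowSym, P.radial_χ _ ((2 : ℝ) ^ (-l) • ((2 * Real.pi) • ξ)) (by simp [norm_smul])]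

theorem heatSymbol_neg (t : ℝ) (ξ : Rn n) : heatSymbol t (-ξ) = heatSymbol t ξ := by
  simp [heatSymbol, norm_smul]

end LittlewoodPaley

/-! ### Fourier multipliers acting on test functions and on `Lᵖ` -/

section Dual

variable {n : ℕ} {m m' : Rn n → ℂ} {A B : ℝ≥0∞}

/-- The function `𝓕 (m 𝓕⁻ψ)`; the operator `ψ ↦ dual m ψ` is the transpose of `m(D)`. -/
def dual (m : Rn n → ℂ) (ψ : 𝓢(Rn n, ℂ)) : Rn n → ℂ :=
  𝓕 (fun ξ => m ξ * (𝓕⁻ ψ : 𝓢(Rn n, ℂ)) ξ)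

/-- `dual m ψ` as a Schwartz function, for symbols of temperate growth. -/
def dualS (m : Rn n → ℂ) (ψ : 𝓢(Rn n, ℂ)) : 𝓢(Rn n, ℂ) :=
  𝓕 (SchwartzMap.smulLeftCLM ℂ m (𝓕⁻ ψ))

theorem op_apply (m : Rn n → ℂ) (u : TD n) (ψ : 𝓢(Rn n, ℂ)) : op m u ψ = u (dualS m ψ) := by
  simp [op, dualS]

theorem dualS_coe (hm : m.HasTemperateGrowth) (ψ : 𝓢(Rn n, ℂ)) : ⇑(dualS m ψ) = dual m ψ := by
  rw [dualS, SchwartzMap.fourier_coe, dual]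
  congr 1
  ext ξ
  rw [SchwartzMap.smulLeftCLM_apply_apply hm, smul_eq_mul]

/-- Only the inner symbol has to preserve Schwartz functions; the outer one may be singular at the
origin, as the symbol of `ℙ∇` is. -/
theorem dual_dualS (hm : m.HasTemperateGrowth) (m' : Rn n → ℂ) (ψ : 𝓢(Rn n, ℂ)) :
    dual m' (dualS m ψ) = dual (fun ξ => m' ξ * m ξ) ψ := by
  rw [dual, dualS, FourierTransform.fourierInv_fourier_eq, dual]
  congr 1
  ext ξ
  rw [SchwartzMap.smulLeftCLM_apply_apply hm, smul_eq_mul, mul_assoc]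

theorem op_op (hm : m.HasTemperateGrowth) (hm' : m'.HasTemperateGrowth) (u : TD n) :
    op m' (op m u) = op (fun ξ => m ξ * m' ξ) u :=
  TemperedDistribution.fourierMultiplierCLM_fourierMultiplierCLM_apply hm hm' u

theorem dual_eq_integral (hm : Integrable m) (ψ : 𝓢(Rn n, ℂ)) (y : Rn n) :
    dual m ψ y = ∫ x, 𝓕⁻ m (x - y) * ψ x := by
  rw [dual, SchwartzMap.fourierInv_coe]
  exact fourier_mul_fourierInv hm ψ.integrable y

theorem dual_eq_kconv (hm : Integrable m) (ψ : 𝓢(Rn n, ℂ)) :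
    dual m ψ = kconv (fun x => 𝓕⁻ m (-x)) ψ := by
  ext y
  rw [dual_eq_integral hm, kconv]
  simp

theorem KerBound.eLpNorm_dual_le (h : KerBound m A B) (ψ : 𝓢(Rn n, ℂ)) {q : ℝ≥0∞} (hq : 1 ≤ q) :
    eLpNorm (dual m ψ) q volume ≤ A * eLpNorm ψ q volume := by
  rw [dual_eq_kconv h.int]
  refine (eLpNorm_kconv_le_same (h.measurable.comp measurable_neg)
    ψ.continuous.aestronglyMeasurable hq).trans ?_
  refine mul_le_mul' ?_ le_rfl
  exact (lintegral_neg_eq_self (μ := volume) (fun y => ‖𝓕⁻ m y‖ₑ)).trans_le h.one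

theorem continuous_dual (ψ : 𝓢(Rn n, ℂ))
    (h : Integrable (fun ξ => m ξ * (𝓕⁻ ψ : 𝓢(Rn n, ℂ)) ξ)) : Continuous (dual m ψ) :=
  VectorFourier.fourierIntegral_continuous Real.continuous_fourierChar
    (by simpa using continuous_inner) h

theorem KerBound.memLp_kconv (h : KerBound m A B) (hA : A < ∞) {r : ℝ≥0∞} (hr : 1 ≤ r)
    {f : Rn n → ℂ} (hf : MemLp f r volume) : MemLp (kconv (𝓕⁻ m) f) r volume :=
  ⟨(stronglyMeasurable_kconv h.measurable hf.1).aestronglyMeasurable,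
    (eLpNorm_kconv_le_same h.measurable hf.1 hr).trans_lt
      (ENNReal.mul_lt_top (h.one.trans_lt hA) hf.2)⟩

theorem KerBound.integral_mul_dual (h : KerBound m A B) (hA : A < ∞) {r : ℝ≥0∞} (hr : 1 ≤ r)
    {f : Rn n → ℂ} (hf : MemLp f r volume) (ψ : 𝓢(Rn n, ℂ)) :
    ∫ y, f y * dual m ψ y = ∫ x, kconv (𝓕⁻ m) f x * ψ x := by
  rw [← integral_kconv_mul h.measurable (h.one.trans_lt hA) hr hf (ψ.memLp _)]
  simp_rw [dual_eq_integral h.int]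

/-- A multiplier with integrable kernel acts on `L^r` by convolution. -/
theorem KerBound.represents_op (h : KerBound m A B) (hA : A < ∞) (hm : m.HasTemperateGrowth)
    {r : ℝ≥0∞} (hr : 1 ≤ r) {f : Rn n → ℂ} (hf : MemLp f r volume) {u : TD n}
    (hu : Represents u f) : Represents (op m u) (kconv (𝓕⁻ m) f) := by
  refine represents_of_memLp hr (h.memLp_kconv hA hr hf) fun ψ => ?_
  rw [op_apply, (hu.2 _).2, dualS_coe hm, h.integral_mul_dual hA hr hf]

theorem lpNorm_op_le {C k : ℝ≥0∞} {x : ℝ} (h : KerBound m (C * k) (2 ^ x * (C * k)))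
    (hC : C * k < ∞) (hm : m.HasTemperateGrowth) {a b : ℝ≥0∞} (ha : 1 ≤ a) (hab : a ≤ b)
    {u : TD n} (hu : lpNorm a u < ∞) :
    lpNorm b (op m u) ≤ C * k * 2 ^ (x * ((a⁻¹).toReal - (b⁻¹).toReal)) * lpNorm a u := by
  obtain ⟨f, hf, hf'⟩ := exists_represents hu
  rw [lpNorm_eq hf, lpNorm_eq (h.represents_op hC hm ha hf' hf)]
  exact h.eLpNorm_kconv_le hf'.1 ha hab

/-- A hermitian symbol commutes with conjugation: conjugating `𝓕⁻ψ` for real `ψ` reflects `ξ`, and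
the change of variable `ξ ↦ -ξ` undoes it. -/
theorem conj_dual (hm : ∀ ξ, m (-ξ) = starRingEnd ℂ (m ξ)) {ψ : 𝓢(Rn n, ℂ)}
    (hψ : ∀ x, (ψ x).im = 0) (y : Rn n) : (dual m ψ y).im = 0 := by
  have hψ' : ∀ x, starRingEnd ℂ (ψ x) = ψ x := fun x => Complex.conj_eq_iff_im.2 (hψ x)
  have e1 : ∀ ξ, starRingEnd ℂ ((𝓕⁻ ψ : 𝓢(Rn n, ℂ)) ξ) = (𝓕⁻ ψ : 𝓢(Rn n, ℂ)) (-ξ) := fun ξ => by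
    rw [SchwartzMap.fourierInv_coe, Real.fourierInv_eq', Real.fourierInv_eq', ← integral_conj]
    refine integral_congr_ae (Eventually.of_forall fun x => ?_)
    simp only [smul_eq_mul, map_mul, hψ', ← Complex.exp_conj, Complex.conj_ofReal, Complex.conj_I,
      inner_neg_right]
    congr 2
    push_cast; ring
  refine Complex.conj_eq_iff_im.1 ?_
  rw [dual, Real.fourier_eq', ← integral_conj, ← integral_neg_eq_self]
  refine integral_congr_ae (Eventually.of_forall fun ξ => ?_)
  simp only [smul_eq_mul, map_mul, ← Complex.exp_conj, Complex.conj_ofReal, Complex.conj_I, e1,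
    neg_neg, inner_neg_left, hm, Complex.conj_conj]
  congr 2
  push_cast; ring

theorem IsReal.op {u : TD n} (hu : IsReal u) (hm : m.HasTemperateGrowth)
    (hc : ∀ ξ, m (-ξ) = starRingEnd ℂ (m ξ)) : IsReal (op m u) := fun ψ hψ => by
  rw [op_apply]
  refine hu _ fun x => ?_
  rw [dualS_coe hm]
  exact conj_dual hc hψ x

end Dual

/-! ### Homogeneous symbols -/

section Homogeneous

variable {n : ℕ} (P : LPPair n)

/-- The symbol `φ(2⁻ˡ·) D e^{-τ|·|²}`. -/
def locSym (D : Rn n → ℂ) (l : ℤ) (τ : ℝ) (ξ : Rn n) : ℂ := lpSym P l ξ * D ξ * heatSymbol τ ξ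

theorem enorm_two_zpow (k : ℤ) : ‖((2 : ℝ) : ℂ) ^ k‖ₑ = (2 : ℝ≥0∞) ^ (k : ℝ) := by
  rw [← ofReal_norm, norm_zpow, Complex.norm_real, Real.norm_of_nonneg (by norm_num),
    ofReal_two_zpow]

/-- Kernel bounds for the dyadic pieces of a symbol that is homogeneous of degree `d`. -/
theorem kerBound_locSym {D : Rn n → ℂ} (hs : SmoothOff D) (d : ℤ)
    (hh : ∀ c : ℝ, 0 < c → ∀ ξ, D (c • ξ) = (c : ℂ) ^ d * D ξ) :
    ∃ C : ℝ≥0∞, C < ∞ ∧ ∀ (l : ℤ) (τ : ℝ), 0 ≤ τ →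
      KerBound (locSym P D l τ) (C * (2 ^ ((l : ℝ) * d) * kap (τ * 4 ^ l)))
        (2 ^ ((l : ℝ) * n) * (C * (2 ^ ((l : ℝ) * d) * kap (τ * 4 ^ l)))) := by
  obtain ⟨C, hC, h⟩ := ((isAnnular_lpSym_zero P).mul hs).kerBound
  refine ⟨C, hC, fun l τ hτ => ?_⟩
  have h1 := (h l τ hτ).const_mul (((2 : ℝ) : ℂ) ^ (l * d))
  rw [enorm_two_zpow] at h1
  have e : locSym P D l τ = fun ξ => ((2 : ℝ) : ℂ) ^ (l * d) *
      (((P.φ ((2 * Real.pi) • (2 : ℝ) ^ (-l) • ξ) : ℝ) : ℂ) * D ((2 : ℝ) ^ (-l) • ξ) *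
        heatSymbol τ ξ) := by
    ext ξ
    rw [hh _ (by positivity), locSym, lpSym_eq]
    have h2 : ((2 : ℝ) : ℂ) ^ (l * d) * (((2 : ℝ) ^ (-l) : ℝ) : ℂ) ^ d = 1 := by
      rw [Complex.ofReal_zpow, ← zpow_mul, ← zpow_add₀ (by norm_num)]
      simp
    linear_combination (-(((P.φ ((2 * Real.pi) • (2 : ℝ) ^ (-l) • ξ) : ℝ) : ℂ) * D ξ *
      heatSymbol τ ξ)) * h2
  rw [e]
  refine h1.mono (le_of_eq ?_) (le_of_eq ?_) <;> push_cast <;> ring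

/-- Symbols that are smooth outside the origin, homogeneous of degree one and hermitian. -/
structure Sym1 (D : Rn n → ℂ) : Prop where
  smooth : SmoothOff D
  homog : ∀ c : ℝ, 0 < c → ∀ ξ, D (c • ξ) = c * D ξ
  herm : ∀ ξ, D (-ξ) = starRingEnd ℂ (D ξ)
  bound : ∃ C : ℝ, ∀ ξ, ‖D ξ‖ ≤ C * ‖ξ‖
  meas : Measurable D

/-- The symbol `|ξ|²` of `-Δ`. -/
def lapSym (ξ : Rn n) : ℂ := ((‖ξ‖ ^ 2 : ℝ) : ℂ)

theorem hasTemperateGrowth_lapSym : (lapSym (n := n)).HasTemperateGrowth := by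
  unfold lapSym; fun_prop

/-- The norm in which the functionals below are continuous. -/
def testNorm (q : ℝ≥0∞) (ψ : 𝓢(Rn n, ℂ)) : ℝ≥0∞ :=
  eLpNorm ψ q volume + eLpNorm (dualS lapSym ψ) q volume

theorem testNorm_lt_top (q : ℝ≥0∞) (ψ : 𝓢(Rn n, ℂ)) : testNorm q ψ < ∞ := by
  have h1 : eLpNorm (⇑ψ) q volume < ∞ := (ψ.memLp q volume).2
  have h2 : eLpNorm (⇑(dualS lapSym ψ)) q volume < ∞ := ((dualS lapSym ψ).memLp q volume).2
  exact ENNReal.add_lt_top.2 ⟨h1, h2⟩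

/-- A linear functional bounded by `testNorm` is a tempered distribution. -/
theorem exists_TD_of_bound {q : ℝ≥0∞} (hq : 1 ≤ q) {Λ : 𝓢(Rn n, ℂ) → ℂ} {C : ℝ≥0∞} (hC : C < ∞)
    (hadd : ∀ ψ₁ ψ₂, Λ (ψ₁ + ψ₂) = Λ ψ₁ + Λ ψ₂) (hsmul : ∀ (c : ℂ) ψ, Λ (c • ψ) = c * Λ ψ)
    (hb : ∀ ψ, ‖Λ ψ‖ₑ ≤ C * testNorm q ψ) : ∃ w : TD n, ∀ ψ, w ψ = Λ ψ := by
  have : Fact (1 ≤ q) := ⟨hq⟩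
  let Λ' : 𝓢(Rn n, ℂ) →ₗ[ℂ] ℂ :=
    { toFun := Λ, map_add' := hadd, map_smul' := fun c ψ => by simp [hsmul] }
  -- `testNorm` written through continuous linear maps on the Schwartz space, so that the bound
  -- forces continuity of the functional at `0`.
  let N : 𝓢(Rn n, ℂ) → ℝ := fun ψ => C.toReal * (‖SchwartzMap.toLpCLM ℂ ℂ q volume ψ‖ +
    ‖SchwartzMap.toLpCLM ℂ ℂ q volume
      ((FourierTransform.fourierCLM ℂ 𝓢(Rn n, ℂ)) (SchwartzMap.smulLeftCLM ℂ lapSym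
        ((FourierTransform.fourierInvCLM ℂ 𝓢(Rn n, ℂ)) ψ)))‖)
  have hN : Continuous N := by fun_prop
  have hN0 : N 0 = 0 := by simp only [N, map_zero, norm_zero, add_zero, mul_zero]
  have hle : ∀ ψ, ‖Λ' ψ‖ ≤ N ψ := fun ψ => by
    have h1 := ENNReal.toReal_mono (ENNReal.mul_lt_top hC (testNorm_lt_top q ψ)).ne (hb ψ)
    rw [toReal_enorm, ENNReal.toReal_mul, testNorm, ENNReal.toReal_add] at h1
    · refine h1.trans (le_of_eq ?_)
      simp only [N, SchwartzMap.toLpCLM_apply, SchwartzMap.norm_toLp]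
      rfl
    · exact (ψ.memLp q volume).2.ne
    · exact ((dualS lapSym ψ).memLp q volume).2.ne
  have hcont : Continuous Λ' := by
    refine continuous_of_continuousAt_zero Λ' ?_
    rw [ContinuousAt, map_zero]
    refine squeeze_zero_norm hle ?_
    have := hN.tendsto 0
    rwa [hN0] at this
  exact ⟨ContinuousLinearMap.toPointwiseConvergenceCLM _ _ _ _ ⟨Λ', hcont⟩, fun ψ => rfl⟩

end Homogeneous

/-! ### Symbols of degree one: summability of their dyadic pieces and integrability in time -/

section DegreeOne

variable {n : ℕ} (P : LPPair n)

/-- The symbol `D e^{-τ|·|²}`. -/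
def heatMul (D : Rn n → ℂ) (τ : ℝ) (ξ : Rn n) : ℂ := D ξ * heatSymbol τ ξ

theorem hasSum_norm_lpSym {ξ : Rn n} (hξ : ξ ≠ 0) : HasSum (fun l => ‖lpSym P l ξ‖) 1 := by
  have h0 : (2 * Real.pi) • ξ ≠ 0 := smul_ne_zero two_pi_ne_zero hξ
  refine (P.sum_int _ h0).congr_fun fun l => ?_
  rw [lpSym, Complex.norm_real, Real.norm_of_nonneg (P.range_φ _).1]

/-- The dyadic decomposition of the Fourier transform of an integrable function. -/
theorem hasSum_fourier_lpSym_mul {G : Rn n → ℂ} (hG : Integrable G) (h0 : G 0 = 0) (y : Rn n) :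
    HasSum (fun l => 𝓕 (fun ξ => lpSym P l ξ * G ξ) y) (𝓕 G y) := by
  simp only [Real.fourier_eq]
  -- At `ξ = 0` every piece vanishes, so the partition of unity fails there; `G 0 = 0` makes the
  -- decomposition valid at every point. Nonnegativity of `φ` makes `|G|` the dominating sum.
  have hb : ∀ ξ, HasSum (fun l => ‖lpSym P l ξ‖ * ‖G ξ‖) ‖G ξ‖ := fun ξ => by
    rcases eq_or_ne ξ 0 with rfl | hξ
    · simp [h0]
    · simpa using (hasSum_norm_lpSym P hξ).mul_right ‖G ξ‖
  have hm : ∀ l, AEStronglyMeasurable (fun ξ => lpSym P l ξ * G ξ) volume := fun l =>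
    (isAnnular_lpSym P l).smooth.continuous.aestronglyMeasurable.mul hG.1
  have hc : Continuous fun ξ : Rn n => Real.fourierChar (-inner ℝ ξ y) :=
    Real.continuous_fourierChar.comp (by fun_prop)
  refine hasSum_integral_of_dominated_convergence (fun l ξ => ‖lpSym P l ξ‖ * ‖G ξ‖)
    (fun l => ?_) (fun l => Eventually.of_forall fun ξ => ?_)
    (Eventually.of_forall fun ξ => (hb ξ).summable) ?_ (Eventually.of_forall fun ξ => ?_)
  · exact hc.aestronglyMeasurable.smul (hm l)
  · rw [Circle.norm_smul, norm_mul]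
  · simp_rw [fun ξ => (hb ξ).tsum_eq]
    exact hG.norm
  · have h1 : HasSum (fun l => lpSym P l ξ * G ξ) (G ξ) := by
      rcases eq_or_ne ξ 0 with rfl | hξ
      · simp [h0]
      · simpa using (hasSum_lpSym P hξ).mul_right (G ξ)
    simpa [Circle.smul_def] using h1.mul_left ((Real.fourierChar (-inner ℝ ξ y) : Circle) : ℂ)

theorem hasSum_fourierInv_lpSym_mul {G : Rn n → ℂ} (hG : Integrable G) (h0 : G 0 = 0) (y : Rn n) :
    HasSum (fun l => 𝓕⁻ (fun ξ => lpSym P l ξ * G ξ) y) (𝓕⁻ G y) := by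
  simp only [Real.fourierInv_eq_fourier_neg]
  exact hasSum_fourier_lpSym_mul P hG h0 (-y)

theorem tsum_min_two_rpow_lt_top :
    ∑' l : ℤ, min ((2 : ℝ≥0∞) ^ (l : ℝ)) (2 ^ (-(l : ℝ))) < ∞ :=
  tsum_int_lt_top (C := 1) (a := 1) (b := 1) (by simp) one_pos one_pos
    (fun l => by simp) (fun l => by simp)

namespace Sym1

variable {P} {D : Rn n → ℂ} (hD : Sym1 D)
include hD

theorem apply_zero : D 0 = 0 := by
  obtain ⟨C, hC⟩ := hD.bound
  simpa using hC 0

theorem integrable_heatMul_mul {τ : ℝ} (hτ : 0 ≤ τ) (ψ : 𝓢(Rn n, ℂ)) :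
    Integrable (fun ξ => heatMul D τ ξ * ψ ξ) := by
  obtain ⟨C, hC⟩ := hD.bound
  have h1 : Integrable (fun ξ : Rn n => C * (‖ξ‖ ^ 1 * ‖ψ ξ‖)) :=
    (ψ.integrable_pow_mul volume 1).const_mul C
  have hcont : Continuous (heatSymbol (n := n) τ) :=
    continuous_heatSymbol_uncurry.comp (by fun_prop : Continuous fun ξ : Rn n => (τ, ξ))
  refine h1.mono' ((hD.meas.mul hcont.measurable).mul ψ.continuous.measurable).aestronglyMeasurable
    (Eventually.of_forall fun ξ => ?_)
  rw [heatMul, norm_mul, norm_mul, pow_one]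
  have h2 := heatSymbol_norm_le hτ ξ
  have h3 := hC ξ
  have h4 : ‖D ξ‖ * ‖heatSymbol τ ξ‖ ≤ C * ‖ξ‖ :=
    (mul_le_of_le_one_right (norm_nonneg _) h2).trans h3
  nlinarith [norm_nonneg (ψ ξ)]

theorem integrable_heatMul {τ : ℝ} (hτ : 0 < τ) : Integrable (heatMul D τ) := by
  -- The Gaussian is used as the test function, with heat time `0`.
  have h := hD.integrable_heatMul_mul le_rfl (dilate √τ (Real.sqrt_pos.2 hτ).ne' (gauss n))
  refine h.congr (Eventually.of_forall fun ξ => ?_)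
  simp only [heatMul, dilate_apply, gauss_smul hτ.le]
  simp [heatSymbol]

theorem smooth_div : SmoothOff (fun ξ => D ξ * (((‖ξ‖ ^ 2)⁻¹ : ℝ) : ℂ)) :=
  hD.smooth.mul smoothOff_norm_sq_inv

variable (P)

theorem kerBound : ∃ C : ℝ≥0∞, C < ∞ ∧ ∀ (l : ℤ) (τ : ℝ), 0 ≤ τ →
    KerBound (locSym P D l τ) (C * (2 ^ (l : ℝ) * kap (τ * 4 ^ l)))
      (2 ^ ((l : ℝ) * n) * (C * (2 ^ (l : ℝ) * kap (τ * 4 ^ l)))) := by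
  simpa using kerBound_locSym P hD.smooth 1 (by simpa using hD.homog)

theorem kerBound_div : ∃ C : ℝ≥0∞, C < ∞ ∧ ∀ (l : ℤ) (τ : ℝ), 0 ≤ τ →
    KerBound (locSym P (fun ξ => D ξ * (((‖ξ‖ ^ 2)⁻¹ : ℝ) : ℂ)) l τ)
      (C * (2 ^ (-(l : ℝ)) * kap (τ * 4 ^ l)))
      (2 ^ ((l : ℝ) * n) * (C * (2 ^ (-(l : ℝ)) * kap (τ * 4 ^ l)))) := by
  have := kerBound_locSym P hD.smooth_div (-1) fun c hc ξ => by
    rw [hD.homog c hc, norm_smul, Real.norm_of_nonneg hc.le]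
    have : (c : ℂ) ≠ 0 := by exact_mod_cast hc.ne'
    push_cast
    rw [mul_pow, mul_inv, zpow_neg_one]
    field_simp
  simpa using this

/-- Writing `D = (D/|ξ|²)|ξ|²` moves a Laplacian onto the test function and lowers the degree of the
symbol from `1` to `-1`, which gives decay at high frequencies. -/
theorem dual_locSym_eq (l : ℤ) (τ : ℝ) (ψ : 𝓢(Rn n, ℂ)) :
    dual (locSym P D l τ) ψ =
      dual (locSym P (fun ξ => D ξ * (((‖ξ‖ ^ 2)⁻¹ : ℝ) : ℂ)) l τ) (dualS lapSym ψ) := by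
  rw [dual_dualS hasTemperateGrowth_lapSym]
  congr 1
  ext ξ
  simp only [locSym, lapSym]
  rcases eq_or_ne ξ 0 with rfl | hξ
  · simp [hD.apply_zero]
  · have : (((‖ξ‖ ^ 2)⁻¹ : ℝ) : ℂ) * ((‖ξ‖ ^ 2 : ℝ) : ℂ) = 1 := by
      rw [← Complex.ofReal_mul, inv_mul_cancel₀ (by simpa using hξ), Complex.ofReal_one]
    linear_combination (-(lpSym P l ξ * D ξ * heatSymbol τ ξ)) * this

/-- The dyadic pieces of `dual (D e^{-τ|·|²}) ψ` are summable in `L^q`, uniformly in `τ`. -/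
theorem tsum_eLpNorm_dual_le : ∃ C : ℝ≥0∞, C < ∞ ∧ ∀ (τ : ℝ), 0 ≤ τ → ∀ q : ℝ≥0∞, 1 ≤ q →
    ∀ ψ : 𝓢(Rn n, ℂ),
      ∑' l, eLpNorm (dual (locSym P D l τ) ψ) q volume ≤ C * testNorm q ψ := by
  obtain ⟨C₁, hC₁, h₁⟩ := hD.kerBound P
  obtain ⟨C₂, hC₂, h₂⟩ := hD.kerBound_div P
  refine ⟨(C₁ + C₂) * ∑' l : ℤ, min ((2 : ℝ≥0∞) ^ (l : ℝ)) (2 ^ (-(l : ℝ))),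
    ENNReal.mul_lt_top (by simp [hC₁, hC₂]) tsum_min_two_rpow_lt_top, fun τ hτ q hq ψ => ?_⟩
  rw [mul_right_comm, ← ENNReal.tsum_mul_left]
  refine ENNReal.tsum_le_tsum fun l => ?_
  -- Two bounds for the same block: `2^l‖ψ‖`, good for `l → -∞`, and `2^{-l}` times the norm of the
  -- Laplacian, good for `l → ∞`. The smaller of the two is summable over `l`; this is why
  -- `testNorm` has two terms.
  have e1 := (h₁ l τ hτ).eLpNorm_dual_le ψ hq
  have e2 := (h₂ l τ hτ).eLpNorm_dual_le (dualS lapSym ψ) hq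
  rw [← hD.dual_locSym_eq P] at e2
  rcases min_choice ((2 : ℝ≥0∞) ^ (l : ℝ)) (2 ^ (-(l : ℝ))) with h | h
  · rw [h]
    refine e1.trans ?_
    calc C₁ * (2 ^ (l : ℝ) * kap (τ * 4 ^ l)) * eLpNorm ψ q volume
        ≤ (C₁ + C₂) * (2 ^ (l : ℝ) * 1) * testNorm q ψ := by
          gcongr
          · exact le_self_add
          · exact kap_le_one _
          · exact le_self_add
      _ = _ := by ring
  · rw [h]
    refine e2.trans ?_
    calc C₂ * (2 ^ (-(l : ℝ)) * kap (τ * 4 ^ l)) * eLpNorm (dualS lapSym ψ) q volume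
        ≤ (C₁ + C₂) * (2 ^ (-(l : ℝ)) * 1) * testNorm q ψ := by
          gcongr
          · exact le_add_self
          · exact kap_le_one _
          · exact le_add_self
      _ = _ := by ring

theorem hasSum_dual {τ : ℝ} (hτ : 0 ≤ τ) (ψ : 𝓢(Rn n, ℂ)) (y : Rn n) :
    HasSum (fun l => dual (locSym P D l τ) ψ y) (dual (heatMul D τ) ψ y) := by
  have h := hasSum_fourier_lpSym_mul P (hD.integrable_heatMul_mul hτ (𝓕⁻ ψ : 𝓢(Rn n, ℂ)))
    (by simp [heatMul, hD.apply_zero]) y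
  refine h.congr_fun fun l => ?_
  rw [dual, show (fun ξ => locSym P D l τ ξ * (𝓕⁻ ψ : 𝓢(Rn n, ℂ)) ξ) =
    fun ξ => lpSym P l ξ * (heatMul D τ ξ * (𝓕⁻ ψ : 𝓢(Rn n, ℂ)) ξ) from
      funext fun ξ => by simp only [locSym, heatMul]; ring]

theorem continuous_dual_heatMul {τ : ℝ} (hτ : 0 ≤ τ) (ψ : 𝓢(Rn n, ℂ)) :
    Continuous (dual (heatMul D τ) ψ) :=
  continuous_dual ψ (hD.integrable_heatMul_mul hτ _)

/-- The function `dual (heatMul D τ) ψ` need not be Schwartz, since `D` is not smooth at the origin,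
but it lies in every `L^q`, including `L¹`. It can therefore be paired with functions in any `L^r`,
including `L^∞`, uniformly in `τ ≥ 0`. -/
theorem eLpNorm_dual_heatMul_le (P : LPPair n) : ∃ C : ℝ≥0∞, C < ∞ ∧ ∀ (τ : ℝ), 0 ≤ τ → ∀ q : ℝ≥0∞, 1 ≤ q →
    ∀ ψ : 𝓢(Rn n, ℂ), eLpNorm (dual (heatMul D τ) ψ) q volume ≤ C * testNorm q ψ := by
  obtain ⟨C, hC, h⟩ := hD.tsum_eLpNorm_dual_le P
  obtain ⟨C₁, hC₁, h₁⟩ := hD.kerBound P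
  refine ⟨C, hC, fun τ hτ q hq ψ => le_trans ?_ (h τ hτ q hq ψ)⟩
  have hm : ∀ l, AEMeasurable (fun y => ‖dual (locSym P D l τ) ψ y‖ₑ) volume := fun l => by
    rw [dual_eq_kconv (h₁ l τ hτ).int]
    exact (stronglyMeasurable_kconv ((h₁ l τ hτ).measurable.comp measurable_neg)
      ψ.continuous.aestronglyMeasurable).aestronglyMeasurable.enorm
  have h2 := eLpNorm_tsum_le hm hq
  simp only [eLpNorm_enorm] at h2
  refine le_trans (eLpNorm_mono_enorm fun y => ?_) h2
  rw [← (hD.hasSum_dual P hτ ψ y).tsum_eq]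
  simpa using enorm_tsum_le_tsum_enorm (f := fun l => dual (locSym P D l τ) ψ y)

end Sym1

/-- The sum `∑_l 2ˡ min (1, (τ4ˡ)⁻²)`, which is comparable to `τ^{-1/2}`. -/
def kapSum (τ : ℝ) : ℝ≥0∞ := ∑' l : ℤ, 2 ^ (l : ℝ) * kap (τ * 4 ^ l)

theorem measurable_kapSum : Measurable kapSum :=
  Measurable.tsum fun _ => (measurable_kap.comp (measurable_id.mul_const _)).const_mul _

/-- Sum the `L¹` bounds of the dyadic kernels. Only the `L¹` norm is needed below, so the sup bound
is left infinite. -/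
theorem Sym1.kerBound_heatMul (P : LPPair n) {D : Rn n → ℂ} (hD : Sym1 D) : ∃ C : ℝ≥0∞, C < ∞ ∧ ∀ (τ : ℝ), 0 < τ →
    KerBound (heatMul D τ) (C * kapSum τ) ∞ := by
  obtain ⟨C, hC, h⟩ := hD.kerBound P
  refine ⟨C, hC, fun τ hτ => ⟨hD.integrable_heatMul hτ, ?_, fun _ => le_top⟩⟩
  rw [kapSum, ← ENNReal.tsum_mul_left]
  have hs : ∀ x, HasSum (fun l => 𝓕⁻ (locSym P D l τ) x) (𝓕⁻ (heatMul D τ) x) := fun x => by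
    have h := hasSum_fourierInv_lpSym_mul P (hD.integrable_heatMul hτ)
      (by simp [heatMul, hD.apply_zero]) x
    refine h.congr_fun fun l => ?_
    rw [show locSym P D l τ = fun ξ => lpSym P l ξ * heatMul D τ ξ from
      funext fun ξ => by simp only [locSym, heatMul]; ring]
  calc ∫⁻ x, ‖𝓕⁻ (heatMul D τ) x‖ₑ ≤ ∫⁻ x, ∑' l, ‖𝓕⁻ (locSym P D l τ) x‖ₑ := by
        refine lintegral_mono fun x => ?_
        rw [← (hs x).tsum_eq]
        exact enorm_tsum_le_tsum_enorm
    _ = ∑' l, ∫⁻ x, ‖𝓕⁻ (locSym P D l τ) x‖ₑ :=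
        lintegral_tsum fun l => (h l τ hτ.le).measurable.enorm.aemeasurable
    _ ≤ _ := ENNReal.tsum_le_tsum fun l => (h l τ hτ.le).one

/-! ### Time integrals of the decay factor -/

theorem kap_le (x : ℝ) (hx : 0 ≤ x) : kap x ≤ ENNReal.ofReal (2 * (1 + x ^ 2)⁻¹) := by
  rcases le_total x 1 with h | h
  · refine (kap_le_one x).trans ?_
    rw [← ENNReal.ofReal_one]
    refine ENNReal.ofReal_le_ofReal ?_
    rw [← div_eq_mul_inv, le_div_iff₀ (by positivity)]
    nlinarith
  · refine (min_le_right _ _).trans ?_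
    rw [← ENNReal.ofReal_pow hx, ← ENNReal.ofReal_inv_of_pos (by positivity)]
    refine ENNReal.ofReal_le_ofReal ?_
    rw [← div_eq_mul_inv, le_div_iff₀ (by positivity), inv_mul_le_iff₀ (by positivity)]
    nlinarith

theorem lintegral_kap_le {c : ℝ} (hc : 0 < c) (T : ℝ) :
    ∫⁻ τ in Set.Ioo 0 T, kap (τ * c) ≤ ENNReal.ofReal (2 * Real.pi * c⁻¹) := by
  have hi : Integrable (fun x : ℝ => 2 * (1 + (x * c) ^ 2)⁻¹) :=
    (integrable_inv_one_add_sq.comp_mul_right' hc.ne').const_mul 2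
  calc ∫⁻ τ in Set.Ioo 0 T, kap (τ * c)
      ≤ ∫⁻ τ in Set.Ioo 0 T, ENNReal.ofReal (2 * (1 + (τ * c) ^ 2)⁻¹) :=
        setLIntegral_mono' measurableSet_Ioo fun τ hτ => kap_le _ (mul_nonneg hτ.1.le hc.le)
    _ ≤ ∫⁻ τ, ENNReal.ofReal (2 * (1 + (τ * c) ^ 2)⁻¹) := setLIntegral_le_lintegral _ _
    _ = ENNReal.ofReal (∫ τ, 2 * (1 + (τ * c) ^ 2)⁻¹) :=
        (ofReal_integral_eq_lintegral_ofReal hi (Eventually.of_forall fun x => by positivity)).symm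
    _ = _ := by
        congr 1
        rw [integral_const_mul, Measure.integral_comp_mul_right (fun x => (1 + x ^ 2)⁻¹),
          integral_univ_inv_one_add_sq, abs_of_pos (by positivity), smul_eq_mul]
        ring

theorem lintegral_kap_le_time {c : ℝ} (T : ℝ) :
    ∫⁻ τ in Set.Ioo 0 T, kap (τ * c) ≤ ENNReal.ofReal T := by
  calc ∫⁻ τ in Set.Ioo 0 T, kap (τ * c) ≤ ∫⁻ _ in Set.Ioo 0 T, 1 :=
        lintegral_mono fun _ => kap_le_one _
    _ = _ := by simp

theorem ofReal_four_zpow_inv (l : ℤ) :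
    ENNReal.ofReal (((4 : ℝ) ^ l)⁻¹) = 2 ^ (-((l : ℝ) * 2)) := by
  have : ((4 : ℝ) ^ l)⁻¹ = (2 : ℝ) ^ (-(l * 2)) := by
    rw [zpow_neg, mul_comm, zpow_mul]; norm_num
  rw [this, ofReal_two_zpow]
  push_cast; rfl

theorem lintegral_kap_four_le (l : ℤ) (T : ℝ) :
    ∫⁻ τ in Set.Ioo 0 T, kap (τ * 4 ^ l) ≤ ENNReal.ofReal (2 * Real.pi) * 2 ^ (-((l : ℝ) * 2)) := by
  refine (lintegral_kap_le (by positivity) T).trans (le_of_eq ?_)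
  rw [ENNReal.ofReal_mul (by positivity), ofReal_four_zpow_inv]

/-- This is the integrability of `τ^{-1/2}` at `0` in dyadic form: block `l` contributes `2^l min(T,
2π4^{-l})`, which decays geometrically in both directions. -/
theorem lintegral_kapSum_lt_top (T : ℝ) : ∫⁻ τ in Set.Ioo 0 T, kapSum τ < ∞ := by
  simp only [kapSum]
  rw [lintegral_tsum fun l => by
    have : Measurable fun τ : ℝ => kap (τ * 4 ^ l) := measurable_kap.comp (by fun_prop)
    exact (this.const_mul _).aemeasurable]
  refine tsum_int_lt_top (C := ENNReal.ofReal T + ENNReal.ofReal (2 * Real.pi)) (a := 1) (b := 1)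
    (ENNReal.add_lt_top.2 ⟨ENNReal.ofReal_lt_top, ENNReal.ofReal_lt_top⟩) one_pos one_pos (fun l => ?_) fun l => ?_
  · rw [lintegral_const_mul' _ _ (ennreal_two_rpow_ne_top _), mul_one, mul_comm]
    gcongr
    exact (lintegral_kap_le_time T).trans le_self_add
  · rw [lintegral_const_mul' _ _ (ennreal_two_rpow_ne_top _)]
    calc _ ≤ (2 : ℝ≥0∞) ^ (l : ℝ) * (ENNReal.ofReal (2 * Real.pi) * 2 ^ (-((l : ℝ) * 2))) := by
          gcongr; exact lintegral_kap_four_le l T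
      _ = ENNReal.ofReal (2 * Real.pi) * 2 ^ (-((l : ℝ) * 1)) := by
          rw [show -((l : ℝ) * 1) = l + -(l * 2) by ring, ennreal_two_rpow_add]; ring
      _ ≤ _ := by gcongr; exact le_add_self

end DegreeOne

/-! ### The symbol of `ℙ_{ij}∇_k` and the Oseen kernel -/

section Leray

variable {n : ℕ} (i j k : Fin n)

/-- The symbol of `ℙ_{ij}∇_k`. -/
def leraySym (ξ : Rn n) : ℂ := Complex.I * ((2 * Real.pi * ξ k : ℝ) : ℂ) * leraySymbol i j ξ

theorem norm_leraySymbol_le (ξ : Rn n) : ‖leraySymbol i j ξ‖ ≤ 2 := by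
  rw [leraySymbol, Complex.norm_real]
  have h1 : |ξ i * ξ j / ‖ξ‖ ^ 2| ≤ 1 := by
    rw [abs_div, abs_mul, abs_of_nonneg (by positivity : (0 : ℝ) ≤ ‖ξ‖ ^ 2)]
    refine div_le_one_of_le₀ ?_ (by positivity)
    rw [sq]
    exact mul_le_mul (PiLp.norm_apply_le ξ i) (PiLp.norm_apply_le ξ j) (abs_nonneg _)
      (norm_nonneg _)
  have h2 : |(if i = j then (1 : ℝ) else 0)| ≤ 1 := by split_ifs <;> simp
  exact (abs_sub _ _).trans (by linarith)

theorem contDiff_coord : ContDiff ℝ (⊤ : ℕ∞) (fun ξ : Rn n => ((ξ k : ℝ) : ℂ)) :=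
  Complex.ofRealCLM.contDiff.comp (EuclideanSpace.proj (𝕜 := ℝ) k).contDiff

theorem smoothOff_leraySymbol : SmoothOff (leraySymbol (n := n) i j) := by
  intro ξ hξ
  have e : leraySymbol (n := n) i j = fun ξ : Rn n => (if i = j then (1 : ℂ) else 0) -
      ((ξ i : ℝ) : ℂ) * ((ξ j : ℝ) : ℂ) * (((‖ξ‖ ^ 2)⁻¹ : ℝ) : ℂ) := by
    ext ξ
    rw [leraySymbol]
    split_ifs <;> push_cast <;> rfl
  rw [e]
  exact contDiffAt_const.sub (((contDiff_coord i).contDiffAt.mul (contDiff_coord j).contDiffAt).mul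
    (smoothOff_norm_sq_inv ξ hξ))

theorem measurable_leraySymbol : Measurable (leraySymbol (n := n) i j) := by
  have h : ∀ k : Fin n, Measurable fun ξ : Rn n => ξ k := fun k =>
    (EuclideanSpace.proj (𝕜 := ℝ) k).continuous.measurable
  exact Complex.measurable_ofReal.comp
    (measurable_const.sub (((h i).mul (h j)).div (measurable_norm.pow_const 2)))

theorem leraySymbol_smul {c : ℝ} (hc : c ≠ 0) (ξ : Rn n) :
    leraySymbol i j (c • ξ) = leraySymbol i j ξ := by
  simp only [leraySymbol, PiLp.smul_apply, smul_eq_mul, norm_smul, mul_pow, Real.norm_eq_abs,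
    sq_abs]
  congr 2
  rw [show c * ξ i * (c * ξ j) = c ^ 2 * (ξ i * ξ j) by ring, mul_div_mul_left _ _ (by positivity)]

theorem leraySymbol_neg (ξ : Rn n) : leraySymbol i j (-ξ) = leraySymbol i j ξ := by
  simpa using leraySymbol_smul i j (c := -1) (by norm_num) ξ

theorem leraySym_neg (ξ : Rn n) : leraySym i j k (-ξ) = -leraySym i j k ξ := by
  rw [leraySym, leraySym, leraySymbol_neg]
  simp only [PiLp.neg_apply]
  push_cast; ring

theorem sym1_leraySym : Sym1 (leraySym (n := n) i j k) where
  smooth := by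
    intro ξ hξ
    have e : leraySym (n := n) i j k = fun ξ : Rn n => Complex.I * (2 * Real.pi) *
        ((ξ k : ℝ) : ℂ) * leraySymbol i j ξ := by
      ext ξ; rw [leraySym]; push_cast; ring
    rw [e]
    exact (contDiffAt_const.mul (contDiff_coord k).contDiffAt).mul (smoothOff_leraySymbol i j ξ hξ)
  homog c hc ξ := by
    rw [leraySym, leraySym, leraySymbol_smul _ _ hc.ne']
    simp only [PiLp.smul_apply, smul_eq_mul]
    push_cast; ring
  herm ξ := by
    rw [leraySym_neg, leraySym, leraySymbol]
    simp only [map_mul, Complex.conj_I, Complex.conj_ofReal]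
    ring
  bound := by
    refine ⟨2 * Real.pi * 2, fun ξ => ?_⟩
    rw [leraySym, norm_mul, norm_mul, Complex.norm_I, one_mul, Complex.norm_real, Real.norm_eq_abs,
      abs_mul, abs_of_nonneg (by positivity : (0 : ℝ) ≤ 2 * Real.pi)]
    have h1 : |ξ k| ≤ ‖ξ‖ := PiLp.norm_apply_le ξ k
    have h2 := norm_leraySymbol_le i j ξ
    calc 2 * Real.pi * |ξ k| * ‖leraySymbol i j ξ‖ ≤ 2 * Real.pi * ‖ξ‖ * 2 := by gcongr
      _ = _ := by ring
  meas := by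
    have h : Measurable fun ξ : Rn n => ξ k :=
      (EuclideanSpace.proj (𝕜 := ℝ) k).continuous.measurable
    exact (measurable_const.mul (Complex.measurable_ofReal.comp (h.const_mul _))).mul
      (measurable_leraySymbol i j)

theorem heatMul_zero (D : Rn n → ℂ) : heatMul D 0 = D := by
  ext ξ; simp [heatMul, heatSymbol]

/-- `dual` applies the symbol between `𝓕⁻` and `𝓕`, whereas `lerayGrad` applies it between `𝓕` and
`𝓕⁻`. The two differ by the reflection of an odd symbol, and the resulting sign cancels the one in
`IsLerayDiv`. -/
theorem lerayGrad_eq (ψ : 𝓢(Rn n, ℂ)) (y : Rn n) :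
    lerayGrad i j k ψ y = -dual (leraySym i j k) ψ y := by
  rw [lerayGrad, Real.fourierInv_eq_fourier_comp_neg, dual, Real.fourier_eq, Real.fourier_eq,
    ← integral_neg]
  refine integral_congr_ae (Eventually.of_forall fun ξ => ?_)
  simp only [← smul_neg]
  congr 1
  rw [SchwartzMap.fourierInv_coe, Real.fourierInv_eq_fourier_neg]
  have := leraySym_neg i j k ξ
  rw [leraySym] at this
  rw [this, neg_mul]

theorem fourier_heatKernel {t : ℝ} (ht : 0 < t) : 𝓕 (heatKernel (n := n) t) = heatSymbol t := by
  have hb : 0 < (((4 * t)⁻¹ : ℝ) : ℂ).re := by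
    rw [Complex.ofReal_re]; positivity
  have h := fun w : Rn n => fourier_gaussian_innerProductSpace hb w
  have e : heatKernel (n := n) t = fun x => (((4 * Real.pi * t) ^ (-(n : ℝ) / 2) : ℝ) : ℂ) •
      Complex.exp (-(((4 * t)⁻¹ : ℝ) : ℂ) * (‖x‖ : ℂ) ^ 2) := by
    ext x
    rw [heatKernel, smul_eq_mul, Complex.ofReal_mul, Complex.ofReal_exp]
    congr 2
    push_cast
    field_simp
  ext w
  rw [e, show (fun x : Rn n => (((4 * Real.pi * t) ^ (-(n : ℝ) / 2) : ℝ) : ℂ) •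
      Complex.exp (-(((4 * t)⁻¹ : ℝ) : ℂ) * (‖x‖ : ℂ) ^ 2)) =
      (((4 * Real.pi * t) ^ (-(n : ℝ) / 2) : ℝ) : ℂ) • fun x : Rn n =>
      Complex.exp (-(((4 * t)⁻¹ : ℝ) : ℂ) * (‖x‖ : ℂ) ^ 2) from rfl]
  rw [Real.fourier_eq]
  simp only [Pi.smul_apply, smul_comm _ (((4 * Real.pi * t) ^ (-(n : ℝ) / 2) : ℝ) : ℂ)]
  rw [integral_smul, ← Real.fourier_eq, h w, finrank_euclideanSpace_fin]
  have e2 : ((Real.pi : ℂ) / (((4 * t)⁻¹ : ℝ) : ℂ)) = ((4 * Real.pi * t : ℝ) : ℂ) := by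
    push_cast
    rw [div_inv_eq_mul]; ring
  have e3 : ((n : ℂ) / 2) = (((n : ℝ) / 2 : ℝ) : ℂ) := by push_cast; rfl
  rw [e2, e3, ← Complex.ofReal_cpow (by positivity), smul_eq_mul, ← mul_assoc,
    ← Complex.ofReal_mul, ← Real.rpow_add (by positivity), heatSymbol, norm_two_pi_smul_sq]
  rw [show -(n : ℝ) / 2 + (n : ℝ) / 2 = 0 by ring, Real.rpow_zero, Complex.ofReal_one, one_mul,
    Complex.ofReal_exp]
  congr 1
  have : (t : ℂ) ≠ 0 := by exact_mod_cast ht.ne'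
  push_cast
  field_simp
  ring

/-- The gradient of the Oseen kernel is the kernel of `ℙ_{ij}∇_k e^{τΔ}`. -/
theorem gradOseen_eq {τ : ℝ} (hτ : 0 < τ) (x : Rn n) :
    gradOseen i j k τ x = 𝓕⁻ (heatMul (leraySym i j k) τ) x := by
  set f : Rn n → ℂ := fun ξ => leraySymbol i j ξ * heatSymbol τ ξ with hf
  set g := dilate √τ (Real.sqrt_pos.2 hτ).ne' (gauss n) with hg
  have hgf : ∀ ξ, g ξ = heatSymbol τ ξ := fun ξ => by rw [hg, dilate_apply, gauss_smul hτ.le]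
  have hfm : AEStronglyMeasurable f volume := by
    have : f = fun ξ => leraySymbol i j ξ * g ξ := by ext ξ; rw [hgf]
    rw [this]
    exact ((measurable_leraySymbol i j).mul g.continuous.measurable).aestronglyMeasurable
  have hfn : ∀ ξ, ‖f ξ‖ ≤ 2 * ‖g ξ‖ := fun ξ => by
    rw [hf, hgf, norm_mul]
    gcongr
    exact norm_leraySymbol_le i j ξ
  have hf1 : Integrable f :=
    (g.integrable.norm.const_mul 2).mono' hfm (Eventually.of_forall hfn)
  have hf2 : Integrable (fun ξ => ‖ξ‖ * ‖f ξ‖) := by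
    refine ((g.integrable_pow_mul volume 1).const_mul 2).mono'
      (continuous_norm.aestronglyMeasurable.mul hfm.norm) (Eventually.of_forall fun ξ => ?_)
    rw [norm_mul, norm_norm, norm_norm, pow_one]
    have := mul_le_mul_of_nonneg_left (hfn ξ) (norm_nonneg ξ)
    linarith
  have h1 : oseenKernel i j τ = fun x : Rn n => 𝓕 f (-x) := by
    ext x
    rw [oseenKernel, fourier_heatKernel hτ, Real.fourierInv_eq_fourier_neg]
  -- The symbol has a finite first moment thanks to the Gaussian, so one may differentiate under the
  -- Fourier integral. The inner map `x ↦ -x` turns `𝓕` into `𝓕⁻`.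
  have h2 := (Real.hasFDerivAt_fourier hf1 hf2 (-x)).comp x (hasFDerivAt_id (𝕜 := ℝ) x).neg
  have h3 : HasFDerivAt (oseenKernel i j τ)
      ((𝓕 (VectorFourier.fourierSMulRight (innerSL ℝ) f) (-x)).comp
        (-ContinuousLinearMap.id ℝ (Rn n))) x := by
    rw [h1]; exact h2
  have hint : Integrable (VectorFourier.fourierSMulRight (innerSL ℝ) f) volume := by
    refine (hf2.const_mul (2 * Real.pi * ‖innerSL ℝ (E := Rn n)‖)).mono'
      (hfm.fourierSMulRight (L := innerSL ℝ)) (Eventually.of_forall fun ξ => ?_)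
    refine (VectorFourier.norm_fourierSMulRight_le (innerSL ℝ) f ξ).trans (le_of_eq ?_)
    ring
  rw [gradOseen, h3.fderiv]
  simp only [ContinuousLinearMap.comp_apply, neg_apply,
    ContinuousLinearMap.id_apply, map_neg]
  have hint' := (Real.fourierIntegral_convergent_iff (-x)).2 hint
  rw [Real.fourier_eq, ContinuousLinearMap.integral_apply hint', Real.fourierInv_eq',
    ← integral_neg]
  refine integral_congr_ae (Eventually.of_forall fun ξ => ?_)
  have e1 : (Real.fourierChar (-inner ℝ ξ (-x)) • VectorFourier.fourierSMulRight (innerSL ℝ) f ξ)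
      (EuclideanSpace.single k 1) = Complex.exp (((2 * Real.pi * inner ℝ ξ x : ℝ) : ℂ) * Complex.I) *
        VectorFourier.fourierSMulRight (innerSL ℝ) f ξ (EuclideanSpace.single k 1) := by
    rw [Circle.smul_def, smul_apply, smul_eq_mul, Real.fourierChar_apply, inner_neg_right, neg_neg]
  have e2 : inner ℝ ξ (EuclideanSpace.single k (1 : ℝ)) = ξ k := by
    simp [EuclideanSpace.inner_single_right]
  simp only [e1, VectorFourier.fourierSMulRight_apply]
  rw [innerSL_apply_apply, e2, heatMul, leraySym]
  simp only [smul_eq_mul, Complex.real_smul, hf]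
  push_cast
  ring

end Leray

/-! ### Joint measurability -/

section Measurability

variable {n : ℕ}

theorem measurable_fourier_uncurry {m : ℝ → Rn n → ℂ} (hm : Measurable (Function.uncurry m)) :
    Measurable (fun z : ℝ × Rn n => 𝓕 (m z.1) z.2) := by
  simp only [Real.fourier_eq']
  have hc : Measurable fun z : (ℝ × Rn n) × Rn n =>
      Complex.exp (((-2 * Real.pi * inner ℝ z.2 z.1.2 : ℝ) : ℂ) * Complex.I) :=
    Continuous.measurable (by fun_prop)
  have hm' : Measurable fun z : (ℝ × Rn n) × Rn n => m z.1.1 z.2 :=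
    hm.comp ((measurable_fst.comp measurable_fst).prodMk measurable_snd)
  exact (StronglyMeasurable.integral_prod_right (f := fun (z : ℝ × Rn n) (ξ : Rn n) =>
    Complex.exp (((-2 * Real.pi * inner ℝ ξ z.2 : ℝ) : ℂ) * Complex.I) • m z.1 ξ)
    (hc.smul hm').stronglyMeasurable).measurable

theorem measurable_fourierInv_uncurry {m : ℝ → Rn n → ℂ} (hm : Measurable (Function.uncurry m)) :
    Measurable (fun z : ℝ × Rn n => 𝓕⁻ (m z.1) z.2) := by
  simp only [Real.fourierInv_eq_fourier_neg]
  have hg : Measurable fun z : ℝ × Rn n => (z.1, -z.2) := Continuous.measurable (by fun_prop)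
  have h := (measurable_fourier_uncurry hm).comp hg
  simpa only [Function.comp_def] using h

theorem measurable_dual_uncurry {m : ℝ → Rn n → ℂ} (hm : Measurable (Function.uncurry m))
    (ψ : 𝓢(Rn n, ℂ)) : Measurable (fun z : ℝ × Rn n => dual (m z.1) ψ z.2) := by
  have key : ∀ f : Rn n → ℂ, Measurable f →
      Measurable (fun z : ℝ × Rn n => 𝓕 (fun ξ => m z.1 ξ * f ξ) z.2) := fun f hf => by
    refine measurable_fourier_uncurry (m := fun τ ξ => m τ ξ * f ξ) ?_
    exact hm.mul (hf.comp measurable_snd)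
  exact key _ (𝓕⁻ ψ : 𝓢(Rn n, ℂ)).continuous.measurable

theorem measurable_heatMul {D : Rn n → ℂ} (hD : Measurable D) :
    Measurable (Function.uncurry (heatMul D)) :=
  (hD.comp measurable_snd).mul continuous_heatSymbol_uncurry.measurable

theorem measurable_locSym (P : LPPair n) {D : Rn n → ℂ} (hD : Measurable D) (l : ℤ) :
    Measurable (Function.uncurry (locSym P D l)) :=
  (((isAnnular_lpSym P l).smooth.continuous.measurable.comp measurable_snd).mul
    (hD.comp measurable_snd)).mul continuous_heatSymbol_uncurry.measurable

/-- The standard mollifier at scale `1/(k+1)`. -/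
def molBump (n k : ℕ) : ContDiffBump (0 : Rn n) where
  rIn := 1 / ((k : ℝ) + 1)
  rOut := 2 / ((k : ℝ) + 1)
  rIn_pos := by positivity
  rIn_lt_rOut := by gcongr; norm_num

/-- The translated mollifier as a Schwartz function. -/
def molTest (k : ℕ) (x : Rn n) : 𝓢(Rn n, ℂ) :=
  HasCompactSupport.toSchwartzMap
    (f := fun y => (((molBump n k).normed volume (x - y) : ℝ) : ℂ))
    (((molBump n k).hasCompactSupport_normed.comp_homeomorph
      (Homeomorph.subLeft x)).comp_left (g := fun r : ℝ => (r : ℂ)) rfl)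
    (Complex.ofRealCLM.contDiff.comp
      ((molBump n k).contDiff_normed.comp (contDiff_const.sub contDiff_id)))

theorem molTest_apply (k : ℕ) (x y : Rn n) :
    molTest k x y = (((molBump n k).normed volume (x - y) : ℝ) : ℂ) := rfl

/-- Testing against translated mollifiers is mollification. This recovers the representative from
the numbers `u ψ`, which are the only data known to be measurable in time. -/
theorem Represents.molTest_eq {u : TD n} {g : Rn n → ℂ} (hu : Represents u g) (k : ℕ) (x : Rn n) :
    u (molTest k x) = convolution ((molBump n k).normed volume) g
      (ContinuousLinearMap.lsmul ℝ ℝ) volume x := by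
  rw [(hu.2 _).2, convolution_eq_swap]
  refine integral_congr_ae (Eventually.of_forall fun y => ?_)
  simp [molTest_apply, mul_comm]

theorem Represents.continuous_molTest {u : TD n} {g : Rn n → ℂ} (hu : Represents u g) (k : ℕ) :
    Continuous (fun x => u (molTest k x)) := by
  simp_rw [hu.molTest_eq k]
  exact (molBump n k).hasCompactSupport_normed.continuous_convolution_left _
    (molBump n k).continuous_normed hu.1

theorem Represents.tendsto_molTest {u : TD n} {g : Rn n → ℂ} (hu : Represents u g) :
    ∀ᵐ x, Tendsto (fun k => u (molTest k x)) atTop (𝓝 (g x)) := by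
  simp_rw [hu.molTest_eq]
  -- The outer radius is always twice the inner one; this bounded ratio is what Lebesgue
  -- differentiation requires.
  refine ContDiffBump.ae_convolution_tendsto_right_of_locallyIntegrable (K := 2) ?_ ?_ hu.1
  · exact (tendsto_const_div_atTop_nhds_zero_nat 2).comp (tendsto_add_atTop_nat 1) |>.congr
      fun k => by simp [molBump]
  · refine Eventually.of_forall fun k => le_of_eq ?_
    simp only [molBump]; ring

/-- A weakly* measurable function whose values are (almost everywhere) given by functions of `x`
is given by a measurable function of `(t, x)`. -/
theorem exists_measurable_represents {T : ℝ} {u : ℝ → TD n}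
    (hm : ∀ ψ : 𝓢(Rn n, ℂ), Measurable (fun t : Set.Ioo (0 : ℝ) T => u t ψ))
    (hr : ∀ᵐ t ∂(timeMeasure T), ∃ g, Represents (u t) g) :
    ∃ U : ℝ → Rn n → ℂ, Measurable (Function.uncurry U) ∧
      ∀ᵐ t ∂(timeMeasure T), Represents (u t) (U t) := by
  classical
  rw [timeMeasure, ae_restrict_iff' measurableSet_Ioo] at hr
  -- Discarding a measurable null set leaves a measurable set of times at each of which a
  -- representative exists.
  obtain ⟨N, hsub, hN, hN0⟩ := exists_measurable_superset_of_null (ae_iff.1 hr)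
  set S : Set ℝ := Set.Ioo 0 T \ N with hS
  have hSm : MeasurableSet S := measurableSet_Ioo.diff hN
  have hrep : ∀ t ∈ S, ∃ g, Represents (u t) g := fun t ht => by
    by_contra hcon
    exact ht.2 (hsub fun h => hcon (h ht.1))
  let F : ℕ → Rn n → ℝ → ℂ := fun k x t => if t ∈ S then u t (molTest k x) else 0
  -- A Carathéodory function: continuous in `x` by mollification, measurable in `t` by weak*
  -- measurability, hence jointly measurable.
  have hF : ∀ k, StronglyMeasurable (Function.uncurry (F k)) := fun k => by
    refine stronglyMeasurable_uncurry_of_continuous_of_stronglyMeasurable (fun t => ?_) fun x => ?_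
    · by_cases ht : t ∈ S
      · obtain ⟨g, hg⟩ := hrep t ht
        simpa [F, ht] using hg.continuous_molTest k
      · simpa [F, ht] using continuous_const
    · have h1 : Measurable (fun t : S => u t (molTest k x)) :=
        (hm (molTest k x)).comp (measurable_inclusion Set.sdiff_subset)
      refine (Measurable.stronglyMeasurable ?_)
      refine measurable_of_restrict_of_restrict_compl hSm ?_ ?_
      · convert h1 using 1
        ext t; simp [F, t.2]
      · convert measurable_const (a := (0 : ℂ)) using 1
        ext t
        have : (t : ℝ) ∉ S := t.2
        simp [F, this]
  -- `limUnder` is a measurable total function; its default value is taken only where the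
  -- mollifications diverge, a null set of `x` for almost every `t` in `(0,T)`.
  refine ⟨fun t x => limUnder atTop fun k => F k x t, ?_, ?_⟩
  · have h1 : StronglyMeasurable fun z : Rn n × ℝ => limUnder atTop fun k => F k z.1 z.2 :=
      StronglyMeasurable.limUnder (f := fun k (z : Rn n × ℝ) => F k z.1 z.2) fun k => hF k
    have h2 := h1.measurable.comp (measurable_swap (α := ℝ) (β := Rn n))
    simpa only [Function.comp_def, Prod.fst_swap, Prod.snd_swap, Function.uncurry_def] using h2
  · rw [timeMeasure, ae_restrict_iff' measurableSet_Ioo]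
    have hN' : ∀ᵐ t, t ∉ N := measure_eq_zero_iff_ae_notMem.1 hN0
    filter_upwards [hN'] with t ht htT
    have htS : t ∈ S := ⟨htT, ht⟩
    obtain ⟨g, hg⟩ := hrep t htS
    refine hg.congr_ae ?_
    filter_upwards [hg.tendsto_molTest] with x hx
    simp only [F, htS, if_true]
    exact hx.limUnder_eq.symm

end Measurability

/-! ### Convergence of Littlewood-Paley decompositions -/

section Convergence

variable {n : ℕ} (P : LPPair n)

theorem lowSym_zero_eq_one {ξ : Rn n} (h : ‖(2 * Real.pi) • ξ‖ < 3 / 4) : lowSym P 0 ξ = 1 := by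
  have h1 := P.sum_nat ((2 * Real.pi) • ξ)
  have h2 : ∀ j : ℕ, P.φ ((2 : ℝ) ^ (-(j : ℤ)) • (2 * Real.pi) • ξ) = 0 := fun j => by
    by_contra hne
    have h3 := (P.supp_φ (subset_tsupport _ hne)).1
    rw [norm_smul, Real.norm_of_nonneg (by positivity)] at h3
    have h4 : (2 : ℝ) ^ (-(j : ℤ)) ≤ 1 := zpow_le_one_of_nonpos₀ (by norm_num) (by simp)
    nlinarith [norm_nonneg ((2 * Real.pi) • ξ)]
  simp_rw [h2] at h1
  have h5 := h1.unique hasSum_zero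
  have h6 : P.χ ((2 * Real.pi) • ξ) = 1 := by linarith
  simp [lowSym, h6]

theorem lowSym_eq (l : ℤ) (ξ : Rn n) : lowSym P l ξ = lowSym P 0 ((2 : ℝ) ^ (-l) • ξ) := by
  simp only [lowSym, neg_zero, zpow_zero, one_smul]
  rw [smul_comm]

/-- The derivatives of `χ(2⁻ᴶ·) - 1` are `O(2⁻ᴶ|ξ|)`. -/
theorem norm_iteratedFDeriv_lowSym_sub_one_le (i : ℕ) : ∃ C : ℝ, 0 ≤ C ∧ ∀ (J : ℕ) (ξ : Rn n),
    ‖iteratedFDeriv ℝ i (fun ξ => lowSym P J ξ - 1) ξ‖ ≤ C * (2 : ℝ) ^ (-(J : ℤ)) * ‖ξ‖ := by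
  set a : Rn n → ℂ := fun ξ => lowSym P 0 ξ - 1 with ha
  have hs : ContDiff ℝ (⊤ : ℕ∞) a := (contDiff_lowSym P 0).sub contDiff_const
  set g := (hasCompactSupport_lowSym P 0).toSchwartzMap (contDiff_lowSym P 0) with hg
  have hgb : ∀ ξ, ‖iteratedFDeriv ℝ i a ξ‖ ≤ SchwartzMap.seminorm ℝ 0 i g + 1 := fun ξ => by
    have e : iteratedFDeriv ℝ i a ξ = iteratedFDeriv ℝ i (lowSym P 0) ξ -
        iteratedFDeriv ℝ i (fun _ => (1 : ℂ)) ξ := by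
      refine iteratedFDeriv_sub_apply ?_ contDiff_const.contDiffAt
      exact ((contDiff_lowSym P 0).of_le (by exact_mod_cast le_top)).contDiffAt
    rw [e]
    refine (norm_sub_le _ _).trans (add_le_add ?_ ?_)
    · have := SchwartzMap.le_seminorm ℝ 0 i g ξ
      rw [pow_zero, one_mul] at this
      exact this
    · rcases Nat.eq_zero_or_pos i with rfl | hi
      · simp
      · rw [iteratedFDeriv_const_of_ne hi.ne']
        simp
  -- `χ - 1` vanishes near the origin, so each bounded derivative is also bounded by a multiple of
  -- `|ξ|`; the scaling `ξ ↦ 2⁻ᴶξ` then yields the factor `2⁻ᴶ`.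
  have hz : ∀ ξ : Rn n, ‖(2 * Real.pi) • ξ‖ < 3 / 4 → iteratedFDeriv ℝ i a ξ = 0 := fun ξ hξ => by
    have : a =ᶠ[𝓝 ξ] fun _ => 0 := by
      have ho : IsOpen {ξ : Rn n | ‖(2 * Real.pi) • ξ‖ < 3 / 4} :=
        isOpen_lt (by fun_prop) continuous_const
      filter_upwards [ho.mem_nhds hξ] with η hη
      simp [ha, lowSym_zero_eq_one P hη]
    rw [this.iteratedFDeriv ℝ i |>.eq_of_nhds]
    simp
  have hb : ∀ ξ, ‖iteratedFDeriv ℝ i a ξ‖ ≤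
      (SchwartzMap.seminorm ℝ 0 i g + 1) * (4 / 3 * (2 * Real.pi)) * ‖ξ‖ := fun ξ => by
    have h0 : 0 ≤ SchwartzMap.seminorm ℝ 0 i g := apply_nonneg _ _
    rcases lt_or_ge ‖(2 * Real.pi) • ξ‖ (3 / 4) with h | h
    · rw [hz ξ h, norm_zero]; positivity
    · rw [norm_smul, Real.norm_of_nonneg (by positivity)] at h
      refine (hgb ξ).trans ?_
      nlinarith
  refine ⟨(SchwartzMap.seminorm ℝ 0 i g + 1) * (4 / 3 * (2 * Real.pi)), ?_, fun J ξ => ?_⟩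
  · have h0 : 0 ≤ SchwartzMap.seminorm ℝ 0 i g := apply_nonneg _ _
    positivity
  have e : (fun ξ => lowSym P J ξ - 1) = fun ξ => a ((2 : ℝ) ^ (-(J : ℤ)) • ξ) := by
    ext ξ; rw [ha, lowSym_eq]
  have hs' : ContDiff ℝ i a := hs.of_le (by exact_mod_cast le_top)
  rw [e, iteratedFDeriv_comp_const_smul _ hs', norm_smul, norm_pow]
  have h1 : ‖(2 : ℝ) ^ (-(J : ℤ))‖ ^ i ≤ 1 := by
    rw [Real.norm_of_nonneg (by positivity)]
    exact pow_le_one₀ (by positivity) (zpow_le_one_of_nonpos₀ (by norm_num) (by simp))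
  refine (mul_le_of_le_one_left (norm_nonneg _) h1).trans ((hb _).trans (le_of_eq ?_))
  rw [norm_smul, Real.norm_of_nonneg (by positivity)]
  ring

/-- By Leibniz, each seminorm of `(χ(2⁻ᴶ·) - 1)h` is at most `2⁻ᴶ` times seminorms of `h` with one
more power of `|x|`. -/
theorem tendsto_smulLeftCLM_lowSym (h : 𝓢(Rn n, ℂ)) :
    Tendsto (fun J : ℕ => SchwartzMap.smulLeftCLM ℂ (lowSym P J) h) atTop (𝓝 h) := by
  rw [(schwartz_withSeminorms ℝ (Rn n) ℂ).tendsto_nhds _ _]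
  rintro ⟨k, l⟩ ε hε
  choose C hC0 hC using norm_iteratedFDeriv_lowSym_sub_one_le P
  set M : ℝ := ∑ i ∈ Finset.range (l + 1),
    (l.choose i : ℝ) * C i * SchwartzMap.seminorm ℝ (k + 1) (l - i) h with hM
  have hbound : ∀ J : ℕ, SchwartzMap.seminorm ℝ k l
      (SchwartzMap.smulLeftCLM ℂ (lowSym P J) h - h) ≤ M * (2 : ℝ) ^ (-(J : ℤ)) := fun J => by
    have hM0 : 0 ≤ M := Finset.sum_nonneg fun i _ =>
      mul_nonneg (mul_nonneg (by positivity) (hC0 i)) (apply_nonneg _ _)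
    refine SchwartzMap.seminorm_le_bound ℝ k l _ (by positivity) fun x => ?_
    have e : ⇑(SchwartzMap.smulLeftCLM ℂ (lowSym P J) h - h) =
        fun x => (lowSym P J x - 1) * h x := by
      ext x
      rw [sub_apply, SchwartzMap.smulLeftCLM_apply_apply
        (hasTemperateGrowth_lowSym P J), smul_eq_mul]
      ring
    rw [e]
    have h1 := norm_iteratedFDeriv_mul_le (𝕜 := ℝ) (N := ((⊤ : ℕ∞) : WithTop ℕ∞))
      ((contDiff_lowSym P J).sub (contDiff_const (c := (1 : ℂ)))) h.smooth' x (n := l)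
      (by exact_mod_cast le_top)
    calc ‖x‖ ^ k * ‖iteratedFDeriv ℝ l (fun x => (lowSym P J x - 1) * h x) x‖
        ≤ ‖x‖ ^ k * ∑ i ∈ Finset.range (l + 1), (l.choose i : ℝ) *
          ‖iteratedFDeriv ℝ i (fun ξ => lowSym P J ξ - 1) x‖ * ‖iteratedFDeriv ℝ (l - i) h x‖ := by
          gcongr
          exact h1
      _ ≤ M * (2 : ℝ) ^ (-(J : ℤ)) := by
          rw [Finset.mul_sum, hM, Finset.sum_mul]
          refine Finset.sum_le_sum fun i _ => ?_
          calc ‖x‖ ^ k * ((l.choose i : ℝ) * ‖iteratedFDeriv ℝ i (fun ξ => lowSym P J ξ - 1) x‖ *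
                ‖iteratedFDeriv ℝ (l - i) h x‖)
              ≤ ‖x‖ ^ k * ((l.choose i : ℝ) * (C i * (2 : ℝ) ^ (-(J : ℤ)) * ‖x‖) *
                ‖iteratedFDeriv ℝ (l - i) h x‖) := by
                gcongr
                exact hC i J x
            _ = (l.choose i : ℝ) * C i * (2 : ℝ) ^ (-(J : ℤ)) *
                (‖x‖ ^ (k + 1) * ‖iteratedFDeriv ℝ (l - i) h x‖) := by ring
            _ ≤ (l.choose i : ℝ) * C i * (2 : ℝ) ^ (-(J : ℤ)) *
                SchwartzMap.seminorm ℝ (k + 1) (l - i) h := by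
                have := hC0 i
                gcongr
                exact SchwartzMap.le_seminorm ℝ (k + 1) (l - i) h x
            _ = _ := by ring
  have hlim : Tendsto (fun J : ℕ => M * (2 : ℝ) ^ (-(J : ℤ))) atTop (𝓝 0) := by
    have h1 : Tendsto (fun J : ℕ => ((1 / 2 : ℝ)) ^ J) atTop (𝓝 0) :=
      tendsto_pow_atTop_nhds_zero_of_lt_one (by norm_num) (by norm_num)
    have h2 := h1.const_mul M
    rw [mul_zero] at h2
    refine h2.congr fun J => ?_
    rw [zpow_neg, zpow_natCast, one_div, inv_pow]
  filter_upwards [hlim.eventually_lt_const hε] with J hJ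
  exact (hbound J).trans_lt hJ

theorem tendsto_lowFreq_apply (u : TD n) (ψ : 𝓢(Rn n, ℂ)) :
    Tendsto (fun J : ℕ => lowFreq P J u ψ) atTop (𝓝 (u ψ)) := by
  have h1 := tendsto_smulLeftCLM_lowSym P (𝓕⁻ ψ : 𝓢(Rn n, ℂ))
  have h2 := ((FourierTransform.fourierCLM ℂ 𝓢(Rn n, ℂ)).continuous.tendsto _).comp h1
  have h3 := ((map_continuous u).tendsto _).comp h2
  have e : (FourierTransform.fourierCLM ℂ 𝓢(Rn n, ℂ)) (𝓕⁻ ψ) = ψ :=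
    (FourierTransform.fourierCLM_apply _).trans (FourierTransform.fourier_fourierInv_eq ψ)
  rw [e] at h3
  refine h3.congr fun J => ?_
  rw [lowFreq_eq, op_apply]
  rfl

theorem op_add {m m' : Rn n → ℂ} (hm : m.HasTemperateGrowth) (hm' : m'.HasTemperateGrowth)
    (u : TD n) : op (fun ξ => m ξ + m' ξ) u = op m u + op m' u := by
  ext ψ
  have e : dualS (fun ξ => m ξ + m' ξ) ψ = dualS m ψ + dualS m' ψ := by
    rw [dualS, dualS, dualS, ← FourierTransform.fourier_add]
    congr 1
    ext ξ
    have hadd : (fun ξ => m ξ + m' ξ).HasTemperateGrowth := hm.add hm'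
    rw [SchwartzMap.smulLeftCLM_apply_apply hadd, add_apply,
      SchwartzMap.smulLeftCLM_apply_apply hm, SchwartzMap.smulLeftCLM_apply_apply hm', add_smul]
  have e2 : (op m u + op m' u) ψ = op m u ψ + op m' u ψ := rfl
  rw [e2, op_apply, op_apply, op_apply, e, map_add]

theorem lowFreq_succ (j : ℤ) (u : TD n) : lowFreq P (j + 1) u = lowFreq P j u + lpProj P j u := by
  rw [lowFreq_eq, lowFreq_eq, lpProj_eq,
    ← op_add (hasTemperateGrowth_lowSym P j) (hasTemperateGrowth_lpSym P j)]
  congr 2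
  ext ξ
  exact lowSym_succ P j ξ

theorem sum_Ico_lpProj (u : TD n) (a : ℤ) (N : ℕ) :
    ∑ j ∈ Finset.Ico a (a + N), lpProj P j u = lowFreq P (a + N) u - lowFreq P a u := by
  induction N with
  | zero => simp
  | succ N ih =>
    have e : Finset.Ico a (a + (N + 1 : ℕ)) = insert (a + N : ℤ) (Finset.Ico a (a + N)) := by
      ext x; simp; omega
    rw [e, Finset.sum_insert (by simp), ih]
    push_cast
    rw [← add_assoc, lowFreq_succ]
    abel

theorem enorm_apply_le {q : ℝ≥0∞} (hq : 1 ≤ q) {u : TD n} (hu : lpNorm q u < ∞)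
    (ψ : 𝓢(Rn n, ℂ)) : ‖u ψ‖ₑ ≤ lpNorm q u * eLpNorm ψ (conjExp q) volume := by
  obtain ⟨g, hg, hg'⟩ := exists_represents hu
  rw [lpNorm_eq hg, (hg.2 ψ).2]
  exact enorm_integral_mul_le hq hg'.1 ψ.continuous.aestronglyMeasurable

theorem IsSh.tendsto_apply {u : TD n} (hu : IsSh P u) (ψ : 𝓢(Rn n, ℂ)) :
    Tendsto (fun j : ℤ => lowFreq P j u ψ) atBot (𝓝 0) := by
  rw [tendsto_zero_iff_enorm_tendsto_zero]
  have h5 : eLpNorm (⇑ψ) (conjExp ∞) volume < ∞ := (ψ.memLp (conjExp ∞) volume).2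
  have h1 : Tendsto (fun j : ℤ => lpNorm ∞ (lowFreq P j u) * eLpNorm ψ (conjExp ∞) volume)
      atBot (𝓝 0) := by
    have := ENNReal.Tendsto.mul_const (hu : Tendsto _ _ _) (Or.inr h5.ne)
    simpa using this
  refine tendsto_of_tendsto_of_tendsto_of_le_of_le' tendsto_const_nhds h1
    (Eventually.of_forall fun _ => zero_le) ?_
  filter_upwards [(hu : Tendsto _ _ _).eventually_lt_const ENNReal.zero_lt_top] with j hj
  exact enorm_apply_le le_top hj ψ

/-- `Ṡ_j u = ∑_{k<j} Δ̇_k u` for `u` in `𝓢'_h`, if the series converges absolutely. -/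
theorem hasSum_lpProj_lt {u : TD n} (hu : IsSh P u)
    (hs : ∀ ψ, Summable fun j => lpProj P j u ψ) (j : ℤ) :
    HasSum (fun k => if k < j then lpProj P k u else 0) (lowFreq P j u) := by
  rw [hasSum_TD_iff]
  intro ψ
  have hs' : Summable fun k => (if k < j then lpProj P k u else 0) ψ := by
    have := (hs ψ).indicator {k | k < j}
    refine this.congr fun k => ?_
    by_cases hk : k < j
    · simp [hk]
    · simp only [Set.indicator, Set.mem_ofPred_eq, hk, if_false]; rfl
  have h1 := hs'.hasSum.comp Finset.tendsto_Ico_neg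
  -- The series converges unconditionally, so its sum can be computed along the intervals `[-N, N)`,
  -- where it telescopes; the lower end tends to `0` because `u` lies in `𝓢'_h`.
  have h2 : Tendsto (fun N : ℕ => lowFreq P j u ψ - lowFreq P (-(N : ℤ)) u ψ) atTop
      (𝓝 (lowFreq P j u ψ - 0)) :=
    tendsto_const_nhds.sub ((hu.tendsto_apply P ψ).comp
      (tendsto_neg_atTop_atBot.comp tendsto_natCast_atTop_atTop))
  rw [sub_zero] at h2
  have h3 : lowFreq P j u ψ = ∑' k, (if k < j then lpProj P k u else 0) ψ := by
    refine tendsto_nhds_unique h2 (h1.congr' ?_)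
    filter_upwards [eventually_ge_atTop j.natAbs] with N hN
    have e1 : lowFreq P j u ψ - lowFreq P (-(N : ℤ)) u ψ =
        (∑ k ∈ Finset.Ico (-(N : ℤ)) j, lpProj P k u) ψ := by
      have h4 := sum_Ico_lpProj P u (-(N : ℤ)) (j + N).toNat
      rw [show -(N : ℤ) + ((j + N).toNat : ℤ) = j by omega] at h4
      rw [h4]; rfl
    rw [e1]
    simp only [Function.comp_apply]
    have e2 : (∑ k ∈ Finset.Ico (-(N : ℤ)) j, lpProj P k u) ψ =
        ∑ k ∈ Finset.Ico (-(N : ℤ)) j, lpProj P k u ψ := by simp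
    rw [e2]
    symm
    have hsub : Finset.Ico (-(N : ℤ)) j ⊆ Finset.Ico (-(N : ℤ)) N :=
      Finset.Ico_subset_Ico le_rfl (by omega)
    rw [← Finset.sum_subset hsub]
    · refine Finset.sum_congr rfl fun k hk => ?_
      rw [if_pos (Finset.mem_Ico.1 hk).2]
    · intro k hk hk'
      have : ¬ k < j := fun h => hk' (Finset.mem_Ico.2 ⟨(Finset.mem_Ico.1 hk).1, h⟩)
      rw [if_neg this]; rfl
  rw [h3]
  exact hs'.hasSum

/-- Telescoping at both ends: `Ṡ_N u → u` for every tempered `u`, and `Ṡ_{-N} u → 0` is exactly what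
`𝓢'_h` provides. -/
theorem hasSum_lpProj {u : TD n} (hu : IsSh P u)
    (hs : ∀ ψ, Summable fun j => lpProj P j u ψ) : HasSum (fun k => lpProj P k u) u := by
  rw [hasSum_TD_iff]
  intro ψ
  have h1 := (hs ψ).hasSum.comp Finset.tendsto_Ico_neg
  have h2 : Tendsto (fun N : ℕ => lowFreq P N u ψ - lowFreq P (-(N : ℤ)) u ψ) atTop
      (𝓝 (u ψ - 0)) :=
    (tendsto_lowFreq_apply P u ψ).sub ((hu.tendsto_apply P ψ).comp
      (tendsto_neg_atTop_atBot.comp tendsto_natCast_atTop_atTop))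
  rw [sub_zero] at h2
  have h3 : u ψ = ∑' k, lpProj P k u ψ := by
    refine tendsto_nhds_unique h2 (h1.congr fun N => ?_)
    have h4 := sum_Ico_lpProj P u (-(N : ℤ)) (2 * N)
    rw [show -(N : ℤ) + ((2 * N : ℕ) : ℤ) = N by push_cast; ring] at h4
    have e1 : lowFreq P N u ψ - lowFreq P (-(N : ℤ)) u ψ =
        (∑ k ∈ Finset.Ico (-(N : ℤ)) N, lpProj P k u) ψ := by rw [h4]; rfl
    rw [e1]
    simp
  rw [h3]
  exact (hs ψ).hasSum

theorem summable_apply_of_lpNorm {ι : Type*} {q : ℝ≥0∞} (hq : 1 ≤ q) {a : ι → TD n}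
    (h : ∑' k, lpNorm q (a k) < ∞) (ψ : 𝓢(Rn n, ℂ)) : Summable fun k => a k ψ := by
  have h5 : eLpNorm (⇑ψ) (conjExp q) volume < ∞ := (ψ.memLp (conjExp q) volume).2
  have h1 : ∑' k, ‖a k ψ‖ₑ < ∞ := by
    refine lt_of_le_of_lt (ENNReal.tsum_le_tsum fun k =>
      enorm_apply_le hq ((ENNReal.le_tsum k).trans_lt h) ψ) ?_
    rw [ENNReal.tsum_mul_right]
    exact ENNReal.mul_lt_top h h5
  have h2 : Summable fun k => ‖a k ψ‖ :=
    NNReal.summable_coe.2 (ENNReal.tsum_coe_ne_top_iff_summable.1 h1.ne)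
  exact h2.of_norm

end Convergence

/-! ### Bernstein inequalities and the class `𝓢'_h` -/

section Bernstein

variable {n : ℕ} (P : LPPair n)

theorem IsAnnular.add {a b : Rn n → ℂ} (ha : IsAnnular a) (hb : IsAnnular b) :
    IsAnnular (fun ξ => a ξ + b ξ) := by
  refine ⟨ha.smooth.add hb.smooth, ha.cpt.add hb.cpt, ?_⟩
  have h1 := ha.zero
  have h2 := hb.zero
  rw [notMem_tsupport_iff_eventuallyEq] at h1 h2 ⊢
  filter_upwards [h1, h2] with ξ h3 h4
  simp [h3, h4]

theorem isAnnular_fatSym (l : ℤ) : IsAnnular (fatSym P l) :=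
  ((isAnnular_lpSym P (l - 1)).add (isAnnular_lpSym P l)).add (isAnnular_lpSym P (l + 1))

theorem lpSym_add (k l : ℤ) (ξ : Rn n) : lpSym P (l + k) ξ = lpSym P k ((2 : ℝ) ^ (-l) • ξ) := by
  rw [lpSym, lpSym, smul_comm (2 * Real.pi) ((2 : ℝ) ^ (-l)), smul_smul ((2 : ℝ) ^ (-k)),
    ← zpow_add₀ (by norm_num), neg_add_rev]

theorem fatSym_eq (l : ℤ) (ξ : Rn n) : fatSym P l ξ = fatSym P 0 ((2 : ℝ) ^ (-l) • ξ) := by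
  have h1 := lpSym_add P (-1) l ξ
  have h2 := lpSym_add P 0 l ξ
  have h3 := lpSym_add P 1 l ξ
  rw [add_zero] at h2
  rw [fatSym, fatSym, zero_sub, zero_add, ← h1, ← h2, ← h3, sub_eq_add_neg]

theorem heat_zero (u : TD n) : heat 0 u = u := by
  ext ψ
  rw [heat_eq, op_apply]
  congr 1
  rw [dualS]
  have : heatSymbol (n := n) 0 = fun _ => 1 := by ext ξ; simp [heatSymbol]
  rw [this]
  simp

theorem op_comm {m m' : Rn n → ℂ} (hm : m.HasTemperateGrowth) (hm' : m'.HasTemperateGrowth)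
    (u : TD n) : op m (op m' u) = op m' (op m u) := by
  rw [op_op hm' hm, op_op hm hm']
  congr 2
  ext ξ; ring

/-- Since the block is unchanged by the fattened symbol, the heat flow acts on it through an annular
symbol, whose kernel decays in `τ4^l`. -/
theorem lpProj_heat {τ : ℝ} (hτ : 0 ≤ τ) (l : ℤ) (u : TD n) :
    lpProj P l (heat τ u) = op (fun ξ => fatSym P l ξ * heatSymbol τ ξ) (lpProj P l u) := by
  have h1 := hasTemperateGrowth_heatSymbol (n := n) hτ
  have h2 := hasTemperateGrowth_lpSym P l
  have h3 := (isAnnular_fatSym P l).hasTemperateGrowth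
  have h4 : (fun ξ => fatSym P l ξ * heatSymbol τ ξ).HasTemperateGrowth := h3.mul h1
  rw [lpProj_eq, heat_eq, op_op h1 h2, op_op h2 h4]
  congr 2
  ext ξ
  rw [← mul_assoc, lpSym_mul_fatSym, mul_comm]

theorem lpNorm_lpProj_heat_le : ∃ C : ℝ≥0∞, C < ∞ ∧ ∀ (l : ℤ) (τ : ℝ), 0 ≤ τ →
    ∀ (a b : ℝ≥0∞), 1 ≤ a → a ≤ b → ∀ u : TD n, lpNorm a (lpProj P l u) < ∞ →
      lpNorm b (lpProj P l (heat τ u)) ≤ C * kap (τ * 4 ^ l) *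
        2 ^ ((l : ℝ) * n * ((a⁻¹).toReal - (b⁻¹).toReal)) * lpNorm a (lpProj P l u) := by
  obtain ⟨C, hC, h⟩ := (isAnnular_fatSym P 0).kerBound
  refine ⟨C, hC, fun l τ hτ a b ha hab u hu => ?_⟩
  have h1 := h l τ hτ
  simp_rw [← fatSym_eq P l] at h1
  rw [lpProj_heat P hτ]
  exact lpNorm_op_le h1 (ENNReal.mul_lt_top hC ((kap_le_one _).trans_lt (by simp)))
    ((isAnnular_fatSym P l).hasTemperateGrowth.mul (hasTemperateGrowth_heatSymbol hτ)) ha hab hu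

/-- Bernstein's inequality. -/
theorem lpNorm_lpProj_le : ∃ C : ℝ≥0∞, C < ∞ ∧ ∀ (l : ℤ) (a b : ℝ≥0∞), 1 ≤ a → a ≤ b →
    ∀ u : TD n, lpNorm a (lpProj P l u) < ∞ →
      lpNorm b (lpProj P l u) ≤
        C * 2 ^ ((l : ℝ) * n * ((a⁻¹).toReal - (b⁻¹).toReal)) * lpNorm a (lpProj P l u) := by
  obtain ⟨C, hC, h⟩ := lpNorm_lpProj_heat_le P
  refine ⟨C, hC, fun l a b ha hab u hu => ?_⟩
  have := h l 0 le_rfl a b ha hab u hu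
  rw [heat_zero] at this
  simpa [kap] using this

theorem lpNorm_op_le_same {m : Rn n → ℂ} {A B : ℝ≥0∞} (h : KerBound m A B) (hA : A < ∞)
    (hm : m.HasTemperateGrowth) {a : ℝ≥0∞} (ha : 1 ≤ a) {u : TD n} (hu : lpNorm a u < ∞) :
    lpNorm a (op m u) ≤ A * lpNorm a u := by
  obtain ⟨f, hf, hf'⟩ := exists_represents hu
  rw [lpNorm_eq hf, lpNorm_eq (h.represents_op hA hm ha hf' hf)]
  refine (eLpNorm_kconv_le_same h.measurable hf'.1 ha).trans ?_
  gcongr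
  exact h.one

theorem kerBound_lowSym : ∃ C : ℝ≥0∞, C < ∞ ∧ ∀ l : ℤ, KerBound (lowSym P l) C ∞ := by
  obtain ⟨C, hC, h⟩ :=
    kerBound_dilate ((hasCompactSupport_lowSym P 0).toSchwartzMap (contDiff_lowSym P 0))
  refine ⟨C, hC, fun l => ?_⟩
  have h1 := (h ((2 : ℝ) ^ (-l)) (by positivity)).mono le_rfl le_top
  have e : lowSym P l = fun ξ => ((hasCompactSupport_lowSym P 0).toSchwartzMap
      (contDiff_lowSym P 0)) ((2 : ℝ) ^ (-l) • ξ) := by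
    ext ξ
    exact lowSym_eq P l ξ
  rw [e]
  exact h1

theorem kerBound_heatSymbol : ∃ C : ℝ≥0∞, C < ∞ ∧ ∀ τ : ℝ, 0 < τ →
    KerBound (heatSymbol (n := n) τ) C ∞ := by
  obtain ⟨C, hC, h⟩ := kerBound_dilate (gauss n)
  refine ⟨C, hC, fun τ hτ => ?_⟩
  have h1 := (h √τ (Real.sqrt_pos.2 hτ)).mono le_rfl le_top
  simp_rw [gauss_smul hτ.le] at h1
  exact h1

theorem lpNorm_lowFreq_le : ∃ C : ℝ≥0∞, C < ∞ ∧ ∀ (l : ℤ) (a : ℝ≥0∞), 1 ≤ a → ∀ u : TD n,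
    lpNorm a u < ∞ → lpNorm a (lowFreq P l u) ≤ C * lpNorm a u := by
  obtain ⟨C, hC, h⟩ := kerBound_lowSym P
  exact ⟨C, hC, fun l a ha u hu =>
    lpNorm_op_le_same (h l) hC (hasTemperateGrowth_lowSym P l) ha hu⟩

/-- The operator commutes with `Ṡ_j` and is bounded on `L^∞` by the `L¹` norm of its kernel. -/
theorem IsSh.op {m : Rn n → ℂ} {A B : ℝ≥0∞} (h : KerBound m A B) (hA : A < ∞)
    (hm : m.HasTemperateGrowth) {u : TD n} (hu : IsSh P u) : IsSh P (op m u) := by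
  have hu' : Tendsto (fun j : ℤ => lpNorm ∞ (lowFreq P j u)) atBot (𝓝 0) := hu
  have h1 : Tendsto (fun j : ℤ => A * lpNorm ∞ (lowFreq P j u)) atBot (𝓝 0) := by
    simpa using ENNReal.Tendsto.const_mul hu' (Or.inr hA.ne)
  refine tendsto_of_tendsto_of_tendsto_of_le_of_le' tendsto_const_nhds h1
    (Eventually.of_forall fun _ => zero_le) ?_
  filter_upwards [hu'.eventually_lt_const ENNReal.zero_lt_top] with j hj
  have e : lowFreq P j (BesovNS.op m u) = BesovNS.op m (lowFreq P j u) := by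
    rw [lowFreq_eq, op_comm (hasTemperateGrowth_lowSym P j) hm]
  rw [e]
  exact lpNorm_op_le_same h hA hm le_top hj

theorem IsSh.add {u v : TD n} (hu : IsSh P u) (hv : IsSh P v) : IsSh P (u + v) := by
  have h := Tendsto.add (f := fun j : ℤ => lpNorm ∞ (lowFreq P j u)) hu hv
  rw [add_zero] at h
  refine tendsto_of_tendsto_of_tendsto_of_le_of_le tendsto_const_nhds h
    (fun _ => zero_le) fun j => ?_
  simp only [map_add]
  exact lpNorm_add_le le_top _ _

theorem IsSh.neg {u : TD n} (hu : IsSh P u) : IsSh P (-u) := by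
  have hu' : Tendsto (fun j : ℤ => lpNorm ∞ (lowFreq P j u)) atBot (𝓝 0) := hu
  unfold IsSh
  simpa only [map_neg, lpNorm_neg] using hu'

theorem IsSh.sub {u v : TD n} (hu : IsSh P u) (hv : IsSh P v) : IsSh P (u - v) := by
  rw [sub_eq_add_neg]; exact hu.add P (hv.neg P)

theorem isSh_zero : IsSh P 0 := by
  unfold IsSh
  simpa only [map_zero, lpNorm_zero] using tendsto_const_nhds

theorem IsSh.sum {ι : Type*} (s : Finset ι) {u : ι → TD n} (hu : ∀ i ∈ s, IsSh P (u i)) :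
    IsSh P (∑ i ∈ s, u i) := by
  classical
  induction s using Finset.induction_on with
  | empty => simpa using isSh_zero P
  | insert i s hi ih =>
    rw [Finset.sum_insert hi]
    exact (hu i (by simp)).add P (ih fun j hj => hu j (by simp [hj]))

theorem lowFreq_lpProj_eq_zero {j l : ℤ} (h : j + 1 ≤ l) (u : TD n) :
    lowFreq P j (lpProj P l u) = 0 := by
  rw [lowFreq_eq, lpProj_eq, op_op (hasTemperateGrowth_lpSym P l) (hasTemperateGrowth_lowSym P j)]
  simp_rw [lpSym_mul_lowSym P h]
  ext ψ
  rw [op_apply, dualS]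
  simp

/-- A series of dyadic blocks whose low frequencies decay geometrically in `L^∞` lies in `𝓢'_h`. -/
theorem isSh_of_hasSum {u : TD n} (hs : HasSum (fun l => lpProj P l u) u) {M : ℝ≥0∞} (hM : M < ∞)
    {c : ℝ} (hc : 0 < c) (hb : ∀ l : ℤ, lpNorm ∞ (lpProj P l u) ≤ M * 2 ^ ((l : ℝ) * c)) :
    IsSh P u := by
  obtain ⟨C, hC, h⟩ := lpNorm_lowFreq_le P
  -- The exponent `c` is split in two halves: one makes the sum over `l ≤ j` converge, the other
  -- provides the decay in `j`.
  set S : ℝ≥0∞ := ∑' l : ℤ, min ((2 : ℝ≥0∞) ^ ((l : ℝ) * (c / 2))) (2 ^ (-((l : ℝ) * (c / 2))))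
    with hS
  have hSfin : S < ∞ := tsum_int_lt_top (C := 1) (a := c / 2) (b := c / 2) (by simp)
    (by positivity) (by positivity) (fun l => by rw [one_mul]; exact min_le_left _ _)
    (fun l => by rw [one_mul]; exact min_le_right _ _)
  have hlim : Tendsto (fun j : ℤ => C * M * S * 2 ^ ((j : ℝ) * (c / 2))) atBot (𝓝 0) := by
    have h1 : Tendsto (fun j : ℤ => (j : ℝ) * (c / 2)) atBot atBot :=
      (tendsto_intCast_atBot_iff.2 tendsto_id).atBot_mul_const (by positivity)
    have h2 := (ENNReal.tendsto_rpow_atBot_of_one_lt_base (b := 2) (by norm_num)).comp h1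
    have h3 := ENNReal.Tendsto.const_mul h2
      (Or.inr (ENNReal.mul_lt_top (ENNReal.mul_lt_top hC hM) hSfin).ne)
    simpa using h3
  refine tendsto_of_tendsto_of_tendsto_of_le_of_le' tendsto_const_nhds hlim
    (Eventually.of_forall fun _ => zero_le) ?_
  filter_upwards [eventually_le_atBot 0] with j hj
  have h1 : HasSum (fun l => lowFreq P j (lpProj P l u)) (lowFreq P j u) :=
    hs.map (lowFreq P j) (lowFreq P j).continuous
  refine (lpNorm_le_tsum_of_hasSum le_top h1).trans ?_
  rw [mul_right_comm, hS, ← ENNReal.tsum_mul_left]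
  refine ENNReal.tsum_le_tsum fun l => ?_
  rcases lt_or_ge j l with hl | hl
  · rw [lowFreq_lpProj_eq_zero P (by omega), lpNorm_zero]
    exact zero_le
  · have hfin : lpNorm ∞ (lpProj P l u) < ∞ := (hb l).trans_lt
      (ENNReal.mul_lt_top hM (ennreal_two_rpow_ne_top _).lt_top)
    have hl' : (l : ℝ) ≤ j := by exact_mod_cast hl
    have hj' : (j : ℝ) ≤ 0 := by exact_mod_cast hj
    have e : min ((2 : ℝ≥0∞) ^ ((l : ℝ) * (c / 2))) (2 ^ (-((l : ℝ) * (c / 2)))) =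
        2 ^ ((l : ℝ) * (c / 2)) :=
      min_eq_left (ENNReal.rpow_le_rpow_of_exponent_le (by norm_num) (by nlinarith))
    rw [e]
    calc lpNorm ∞ (lowFreq P j (lpProj P l u)) ≤ C * (M * 2 ^ ((l : ℝ) * c)) :=
          (h j ∞ le_top _ hfin).trans (by gcongr; exact hb l)
      _ = C * M * 2 ^ ((l : ℝ) * (c / 2)) * 2 ^ ((l : ℝ) * (c / 2)) := by
          rw [show (l : ℝ) * c = l * (c / 2) + l * (c / 2) by ring, ennreal_two_rpow_add]; ring
      _ ≤ _ := by
          gcongr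
          norm_num

theorem isReal_lowFreq {u : TD n} (hu : IsReal u) (l : ℤ) : IsReal (lowFreq P l u) :=
  hu.op (m := lowSym P l) (hasTemperateGrowth_lowSym P l) fun ξ => by
    rw [lowSym_neg, lowSym, Complex.conj_ofReal]

theorem isReal_heat {u : TD n} (hu : IsReal u) {τ : ℝ} (hτ : 0 ≤ τ) : IsReal (heat τ u) :=
  hu.op (m := heatSymbol τ) (hasTemperateGrowth_heatSymbol hτ) fun ξ => by
    rw [heatSymbol_neg, heatSymbol, Complex.conj_ofReal]

end Bernstein

/-! ### Integrals over time of functions with values in `Lᵖ` -/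

section TimeIntegral

variable {n : ℕ}

instance instSFiniteTimeMeasure (T : ℝ) : SFinite (timeMeasure T) := by
  unfold timeMeasure; infer_instance

theorem ae_mem_timeMeasure (T : ℝ) : ∀ᵐ t ∂(timeMeasure T), t ∈ Set.Ioo 0 T :=
  ae_restrict_mem measurableSet_Ioo

theorem timeMeasure_mono {t T : ℝ} (h : t ≤ T) : timeMeasure t ≤ timeMeasure T :=
  Measure.restrict_mono (Set.Ioo_subset_Ioo_right h) le_rfl

theorem ae_timeMeasure_mono {t T : ℝ} (h : t ≤ T) {p : ℝ → Prop} (hp : ∀ᵐ s ∂(timeMeasure T), p s) :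
    ∀ᵐ s ∂(timeMeasure t), p s :=
  ae_mono (timeMeasure_mono h) hp

theorem intervalIntegral_eq_timeMeasure {t : ℝ} (ht : 0 ≤ t) (f : ℝ → ℂ) :
    ∫ s in (0 : ℝ)..t, f s = ∫ s, f s ∂(timeMeasure t) := by
  rw [intervalIntegral.integral_of_le ht, integral_Ioc_eq_integral_Ioo, timeMeasure]

theorem intervalIntegrable_iff_timeMeasure {t : ℝ} (ht : 0 ≤ t) (f : ℝ → ℂ) :
    IntervalIntegrable f volume 0 t ↔ Integrable f (timeMeasure t) := by
  rw [intervalIntegrable_iff_integrableOn_Ioo_of_le ht, IntegrableOn, timeMeasure]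

theorem hasSum_integral_of_tsum_lintegral {X : Type*} [MeasurableSpace X] {μ : Measure X}
    {ι : Type*} [Countable ι] {F : ι → X → ℂ} {f : X → ℂ} (hm : ∀ l, AEStronglyMeasurable (F l) μ)
    (h : ∑' l, ∫⁻ x, ‖F l x‖ₑ ∂μ < ∞) (hs : ∀ᵐ x ∂μ, HasSum (fun l => F l x) (f x)) :
    HasSum (fun l => ∫ x, F l x ∂μ) (∫ x, f x ∂μ) := by
  have hint : ∀ l, Integrable (F l) μ := fun l => ⟨hm l, (ENNReal.le_tsum l).trans_lt h⟩
  have h1 : Summable fun l => ∫ x, ‖F l x‖ ∂μ := by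
    refine (ENNReal.summable_toReal h.ne).congr fun l => ?_
    rw [integral_norm_eq_lintegral_enorm (hint l).1]
  have h2 := hasSum_integral_of_summable_integral_norm hint h1
  have e : ∫ x, f x ∂μ = ∫ x, ∑' l, F l x ∂μ := by
    refine integral_congr_ae ?_
    filter_upwards [hs] with x hx
    exact hx.tsum_eq.symm
  rw [e]
  exact h2

/-- Minkowski gives convergence for almost every `x` and the norm; Fubini, justified by Hölder
against a test function, identifies the distribution. -/
theorem integral_minkowski {ν : Measure ℝ} [SFinite ν] {H : ℝ → Rn n → ℂ}
    (hH : Measurable (Function.uncurry H)) {b : ℝ≥0∞} (hb : 1 ≤ b)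
    (hfin : ∫⁻ s, eLpNorm (H s) b volume ∂ν < ∞) :
    (∀ᵐ x, Integrable (fun s => H s x) ν) ∧ MemLp (fun x => ∫ s, H s x ∂ν) b volume ∧
      eLpNorm (fun x => ∫ s, H s x ∂ν) b volume ≤ ∫⁻ s, eLpNorm (H s) b volume ∂ν ∧
      ∀ ψ : 𝓢(Rn n, ℂ), ∫ x, (∫ s, H s x ∂ν) * ψ x = ∫ s, (∫ x, H s x * ψ x) ∂ν := by
  have hHs : ∀ s, Measurable (H s) := fun s => hH.comp measurable_prodMk_left
  have hHx : ∀ x, Measurable (fun s => H s x) := fun x => hH.comp measurable_prodMk_right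
  have h1 : eLpNorm (fun x => ∫⁻ s, ‖H s x‖ₑ ∂ν) b volume ≤
      ∫⁻ s, eLpNorm (H s) b volume ∂ν := by
    have := eLpNorm_lintegral_le (μ := ν) (ν := (volume : Measure (Rn n)))
      (F := fun s x => ‖H s x‖ₑ) hH.enorm hb
    simpa only [eLpNorm_enorm] using this
  have hLm : Measurable (fun x => ∫⁻ s, ‖H s x‖ₑ ∂ν) :=
    Measurable.lintegral_prod_left (f := fun s x => ‖H s x‖ₑ) hH.enorm
  have hae : ∀ᵐ x, Integrable (fun s => H s x) ν := by
    filter_upwards [ae_lt_top_of_eLpNorm_lt_top (zero_lt_one.trans_le hb).ne' hLm.aemeasurable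
      (h1.trans_lt hfin)] with x hx
    exact ⟨(hHx x).aestronglyMeasurable, hx⟩
  have hm : StronglyMeasurable (fun x => ∫ s, H s x ∂ν) :=
    StronglyMeasurable.integral_prod_left (f := H) hH.stronglyMeasurable
  have hle : eLpNorm (fun x => ∫ s, H s x ∂ν) b volume ≤ ∫⁻ s, eLpNorm (H s) b volume ∂ν := by
    refine le_trans (eLpNorm_mono_enorm fun x => ?_) h1
    simpa using enorm_integral_le_lintegral_enorm (fun s => H s x)
  refine ⟨hae, ⟨hm.aestronglyMeasurable, hle.trans_lt hfin⟩, hle, fun ψ => ?_⟩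
  have h5 : eLpNorm (⇑ψ) (conjExp b) volume < ∞ := (ψ.memLp (conjExp b) volume).2
  have hmeas : Measurable (Function.uncurry fun (s : ℝ) (x : Rn n) => H s x * ψ x) :=
    hH.mul (ψ.continuous.measurable.comp measurable_snd)
  have hint : Integrable (Function.uncurry fun (s : ℝ) (x : Rn n) => H s x * ψ x)
      (ν.prod volume) := by
    refine ⟨hmeas.aestronglyMeasurable, ?_⟩
    rw [HasFiniteIntegral, lintegral_prod _ hmeas.enorm.aemeasurable]
    refine lt_of_le_of_lt (lintegral_mono fun s => lintegral_mul_le_eLpNorm_mul_eLpNorm hb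
      (hHs s).aestronglyMeasurable ψ.continuous.aestronglyMeasurable) ?_
    rw [lintegral_mul_const' _ _ h5.ne]
    exact ENNReal.mul_lt_top hfin h5
  rw [integral_integral_swap hint]
  refine integral_congr_ae (Eventually.of_forall fun x => ?_)
  simp only
  rw [integral_mul_const]

theorem measurable_kconv_uncurry {K ω : ℝ → Rn n → ℂ}
    (hK : Measurable (fun z : ℝ × Rn n => K z.1 z.2)) (hω : Measurable (Function.uncurry ω)) :
    Measurable (fun z : (ℝ × ℝ) × Rn n => kconv (K (z.1.1 - z.1.2)) (ω z.1.2) z.2) := by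
  have h1 : Measurable fun z : ((ℝ × ℝ) × Rn n) × Rn n => (z.1.1.1 - z.1.1.2, z.1.2 - z.2) :=
    Continuous.measurable (by fun_prop)
  have h2 : Measurable fun z : ((ℝ × ℝ) × Rn n) × Rn n => (z.1.1.2, z.2) :=
    Continuous.measurable (by fun_prop)
  have h3 : StronglyMeasurable (Function.uncurry fun (z : (ℝ × ℝ) × Rn n) (y : Rn n) =>
      K (z.1.1 - z.1.2) (z.2 - y) * ω z.1.2 y) :=
    ((hK.comp h1).mul (hω.comp h2)).stronglyMeasurable
  exact h3.integral_prod_right.measurable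

/-- The pairing `∫ ω(s) dual (m (t-s)) ψ`. -/
def pairInt (m : ℝ → Rn n → ℂ) (ω : ℝ → Rn n → ℂ) (t : ℝ) (ψ : 𝓢(Rn n, ℂ)) (s : ℝ) : ℂ :=
  ∫ y, ω s y * dual (m (t - s)) ψ y

theorem measurable_pairInt {m ω : ℝ → Rn n → ℂ} (hm : Measurable (Function.uncurry m))
    (hω : Measurable (Function.uncurry ω)) (ψ : 𝓢(Rn n, ℂ)) :
    Measurable (fun z : ℝ × ℝ => pairInt m ω z.1 ψ z.2) := by
  have h1 : Measurable fun z : (ℝ × ℝ) × Rn n => (z.1.1 - z.1.2, z.2) :=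
    Continuous.measurable (by fun_prop)
  have h2 : Measurable fun z : (ℝ × ℝ) × Rn n => (z.1.2, z.2) :=
    Continuous.measurable (by fun_prop)
  have h3 : StronglyMeasurable (Function.uncurry fun (z : ℝ × ℝ) (y : Rn n) =>
      ω z.2 y * dual (m (z.1 - z.2)) ψ y) :=
    ((hω.comp h2).mul ((measurable_dual_uncurry hm ψ).comp h1)).stronglyMeasurable
  exact h3.integral_prod_right.measurable

/-- A time integral of pairings is represented by the time integral of the convolutions. -/
theorem represents_timeIntegral {m : ℝ → Rn n → ℂ} (hm : Measurable (Function.uncurry m))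
    {A B : ℝ → ℝ≥0∞} (hA : ∀ τ, 0 < τ → A τ < ∞) (hker : ∀ τ, 0 < τ → KerBound (m τ) (A τ) (B τ))
    {ω : ℝ → Rn n → ℂ} (hω : Measurable (Function.uncurry ω)) {r : ℝ≥0∞} (hr : 1 ≤ r) {t : ℝ}
    (hωr : ∀ᵐ s ∂(timeMeasure t), eLpNorm (ω s) r volume < ∞) {b : ℝ≥0∞} (hb : 1 ≤ b)
    (hfin : ∫⁻ s, eLpNorm (kconv (𝓕⁻ (m (t - s))) (ω s)) b volume ∂(timeMeasure t) < ∞)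
    {u : TD n} (hu : ∀ ψ, u ψ = ∫ s, pairInt m ω t ψ s ∂(timeMeasure t)) :
    Represents u (fun x => ∫ s, kconv (𝓕⁻ (m (t - s))) (ω s) x ∂(timeMeasure t)) ∧
      (∀ᵐ x, Integrable (fun s => kconv (𝓕⁻ (m (t - s))) (ω s) x) (timeMeasure t)) ∧
      lpNorm b u ≤
        ∫⁻ s, eLpNorm (kconv (𝓕⁻ (m (t - s))) (ω s)) b volume ∂(timeMeasure t) := by
  have hH : Measurable (Function.uncurry fun (s : ℝ) (x : Rn n) =>
      kconv (𝓕⁻ (m (t - s))) (ω s) x) := by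
    have h1 : Measurable fun z : ℝ × Rn n => ((t, z.1), z.2) :=
      Continuous.measurable (by fun_prop)
    have h2 := measurable_kconv_uncurry (K := fun τ => 𝓕⁻ (m τ))
      (measurable_fourierInv_uncurry hm) hω
    simpa only [Function.comp_def, Function.uncurry_def] using h2.comp h1
  obtain ⟨h1, h2, h3, h4⟩ := integral_minkowski hH hb hfin
  have hrep := represents_of_memLp hb h2 (u := u) fun ψ => by
    rw [hu, h4]
    refine integral_congr_ae ?_
    filter_upwards [hωr, ae_mem_timeMeasure t] with s hs hst
    have hτ : 0 < t - s := by linarith [hst.2]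
    exact (hker _ hτ).integral_mul_dual (hA _ hτ) hr
      ⟨(hω.comp measurable_prodMk_left).aestronglyMeasurable, hs⟩ ψ
  refine ⟨hrep, h1, ?_⟩
  rw [lpNorm_eq hrep]
  exact h3

/-- Young's inequality for convolutions in time. -/
theorem eLpNorm_timeConv_le_of_le {k N : ℝ → ℝ≥0∞} (hk : Measurable k) (hN : Measurable N) (T : ℝ)
    {a b M : ℝ≥0∞} (ha : 1 ≤ a) (hab : a ≤ b) (hkM : ∀ τ, k τ ≤ M) :
    eLpNorm (fun t => ∫⁻ s, k (t - s) * N s ∂(timeMeasure t)) b (timeMeasure T) ≤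
      (∫⁻ τ in Set.Ioo 0 T, k τ) ^ (1 - ((a⁻¹).toReal - (b⁻¹).toReal)) *
        M ^ ((a⁻¹).toReal - (b⁻¹).toReal) * eLpNorm N a (timeMeasure T) := by
  -- Extended by zero outside `(0,T)`, the causal integral over `(0,t)` is dominated by a
  -- convolution on the whole line, to which Young applies.
  set k' := (Set.Ioo 0 T).indicator k with hk'
  set N' := (Set.Ioo 0 T).indicator N with hN'
  have hkm : Measurable k' := hk.indicator measurableSet_Ioo
  have hNm : Measurable N' := hN.indicator measurableSet_Ioo
  have h := eLpNorm_lconv_le (μ := (volume : Measure ℝ)) hNm hkm ha hab (M := M) fun τ => by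
    rw [hk']
    exact Set.indicator_le' (fun x _ => hkM x) (fun x _ => zero_le) τ
  rw [hk', lintegral_indicator measurableSet_Ioo] at h
  have e1 : eLpNorm N' a volume = eLpNorm N a (timeMeasure T) := by
    rw [hN', eLpNorm_indicator_eq_eLpNorm_restrict measurableSet_Ioo]; rfl
  rw [e1] at h
  refine le_trans ?_ h
  refine le_trans (eLpNorm_ennreal_mono_ae b ?_) (eLpNorm_mono_measure _ Measure.restrict_le_self)
  filter_upwards [ae_mem_timeMeasure T] with t ht
  rw [timeMeasure, ← lintegral_indicator measurableSet_Ioo]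
  refine lintegral_mono fun s => ?_
  by_cases hs : s ∈ Set.Ioo 0 t
  · have h1 : t - s ∈ Set.Ioo 0 T := ⟨by linarith [hs.2], by linarith [hs.1, ht.2]⟩
    have h2 : s ∈ Set.Ioo 0 T := ⟨hs.1, hs.2.trans ht.2⟩
    rw [Set.indicator_of_mem hs, Set.indicator_of_mem h1, hN', Set.indicator_of_mem h2]
  · rw [Set.indicator_of_notMem hs]; exact zero_le

theorem eLpNorm_timeConv_le {k N : ℝ → ℝ≥0∞} (hk : Measurable k) (hN : Measurable N) (T : ℝ)
    {a b : ℝ≥0∞} (ha : 1 ≤ a) (hab : a ≤ b) (hk1 : ∀ τ, k τ ≤ 1) :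
    eLpNorm (fun t => ∫⁻ s, k (t - s) * N s ∂(timeMeasure t)) b (timeMeasure T) ≤
      (∫⁻ τ in Set.Ioo 0 T, k τ) ^ (1 - ((a⁻¹).toReal - (b⁻¹).toReal)) *
        eLpNorm N a (timeMeasure T) := by
  simpa using eLpNorm_timeConv_le_of_le hk hN T ha hab hk1

theorem lintegral_timeConv_le {k N : ℝ → ℝ≥0∞} (hk : Measurable k) (hN : Measurable N) (T : ℝ) :
    ∫⁻ t, ∫⁻ s, k (t - s) * N s ∂(timeMeasure t) ∂(timeMeasure T) ≤
      (∫⁻ τ in Set.Ioo 0 T, k τ) * ∫⁻ s, N s ∂(timeMeasure T) := by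
  simpa [eLpNorm_one_eq_lintegral_enorm] using
    eLpNorm_timeConv_le_of_le hk hN T le_rfl le_rfl (M := ∞) fun _ => le_top

theorem measurable_lintegral_timeMeasure {X : Type*} [MeasurableSpace X] {f : ℝ × X → ℝ → ℝ≥0∞}
    (hf : Measurable (Function.uncurry f)) :
    Measurable fun z : ℝ × X => ∫⁻ s, f z s ∂(timeMeasure z.1) := by
  have hS : MeasurableSet {z : (ℝ × X) × ℝ | 0 < z.2 ∧ z.2 < z.1.1} :=
    (measurableSet_lt measurable_const measurable_snd).inter
      (measurableSet_lt measurable_snd (measurable_fst.comp measurable_fst))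
  have e : (fun z : ℝ × X => ∫⁻ s, f z s ∂(timeMeasure z.1)) = fun z : ℝ × X =>
      ∫⁻ s, {z : (ℝ × X) × ℝ | 0 < z.2 ∧ z.2 < z.1.1}.indicator (Function.uncurry f) (z, s) := by
    ext z
    rw [timeMeasure, ← lintegral_indicator measurableSet_Ioo]
    rfl
  rw [e]
  exact (hf.indicator hS).lintegral_prod_right'

end TimeIntegral

/-! ### Scalar Duhamel integrals -/

section Pairing

variable {n : ℕ} (P : LPPair n) {D : Rn n → ℂ}

theorem Sym1.dual_add (hD : Sym1 D) {τ : ℝ} (hτ : 0 ≤ τ) (ψ₁ ψ₂ : 𝓢(Rn n, ℂ)) (y : Rn n) :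
    dual (heatMul D τ) (ψ₁ + ψ₂) y = dual (heatMul D τ) ψ₁ y + dual (heatMul D τ) ψ₂ y := by
  have h1 := (Real.fourierIntegral_convergent_iff y).2
    (hD.integrable_heatMul_mul hτ (𝓕⁻ ψ₁ : 𝓢(Rn n, ℂ)))
  have h2 := (Real.fourierIntegral_convergent_iff y).2
    (hD.integrable_heatMul_mul hτ (𝓕⁻ ψ₂ : 𝓢(Rn n, ℂ)))
  rw [dual, dual, dual, FourierTransform.fourierInv_add, Real.fourier_eq, Real.fourier_eq,
    Real.fourier_eq, ← integral_add h1 h2]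
  refine integral_congr_ae (Eventually.of_forall fun ξ => ?_)
  simp only [add_apply, ← smul_add, mul_add]

theorem dual_smul (m : Rn n → ℂ) (c : ℂ) (ψ : 𝓢(Rn n, ℂ)) (y : Rn n) :
    dual m (c • ψ) y = c * dual m ψ y := by
  rw [dual, dual, FourierTransform.fourierInv_smul, Real.fourier_eq', Real.fourier_eq',
    ← integral_const_mul]
  refine integral_congr_ae (Eventually.of_forall fun ξ => ?_)
  simp only [smul_apply, smul_eq_mul]
  ring

theorem Sym1.memLp_dual (P : LPPair n) (hD : Sym1 D) {τ : ℝ} (hτ : 0 ≤ τ) {q : ℝ≥0∞} (hq : 1 ≤ q)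
    (ψ : 𝓢(Rn n, ℂ)) : MemLp (dual (heatMul D τ) ψ) q volume := by
  obtain ⟨C, hC, h⟩ := hD.eLpNorm_dual_heatMul_le P
  exact ⟨(hD.continuous_dual_heatMul hτ ψ).aestronglyMeasurable,
    (h τ hτ q hq ψ).trans_lt (ENNReal.mul_lt_top hC (testNorm_lt_top q ψ))⟩

theorem Sym1.integrable_mul_dual (P : LPPair n) (hD : Sym1 D) {τ : ℝ} (hτ : 0 ≤ τ) {r : ℝ≥0∞}
    (hr : 1 ≤ r) {h : Rn n → ℂ} (hh : MemLp h r volume) (ψ : 𝓢(Rn n, ℂ)) :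
    Integrable (fun y => h y * dual (heatMul D τ) ψ y) :=
  integrable_mul_of_eLpNorm hr hh (hD.memLp_dual P hτ (one_le_conjExp r) ψ)

/-- The constants in the estimates of the pairings, uniformly in time. -/
theorem Sym1.pairing_bounds (hD : Sym1 D) : ∃ C : ℝ≥0∞, C < ∞ ∧ ∀ (τ : ℝ), 0 ≤ τ →
    ∀ r : ℝ≥0∞, 1 ≤ r → ∀ h : Rn n → ℂ, MemLp h r volume → ∀ ψ : 𝓢(Rn n, ℂ),
      ‖∫ y, h y * dual (heatMul D τ) ψ y‖ₑ ≤ C * eLpNorm h r volume * testNorm (conjExp r) ψ ∧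
      ∑' l, ‖∫ y, h y * dual (locSym P D l τ) ψ y‖ₑ ≤
        C * eLpNorm h r volume * testNorm (conjExp r) ψ ∧
      HasSum (fun l => ∫ y, h y * dual (locSym P D l τ) ψ y)
        (∫ y, h y * dual (heatMul D τ) ψ y) := by
  obtain ⟨C₁, hC₁, h₁⟩ := hD.eLpNorm_dual_heatMul_le P
  obtain ⟨C₂, hC₂, h₂⟩ := hD.tsum_eLpNorm_dual_le P
  obtain ⟨C₃, hC₃, h₃⟩ := hD.kerBound P
  refine ⟨C₁ + C₂, by simp [hC₁, hC₂], fun τ hτ r hr h hh ψ => ?_⟩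
  have hm : ∀ l, AEStronglyMeasurable (dual (locSym P D l τ) ψ) volume := fun l => by
    rw [dual_eq_kconv (h₃ l τ hτ).int]
    exact (stronglyMeasurable_kconv ((h₃ l τ hτ).measurable.comp measurable_neg)
      ψ.continuous.aestronglyMeasurable).aestronglyMeasurable
  have hq := one_le_conjExp r
  have hsum : ∑' l, ∫⁻ y, ‖h y * dual (locSym P D l τ) ψ y‖ₑ ≤
      C₂ * eLpNorm h r volume * testNorm (conjExp r) ψ := by
    refine (ENNReal.tsum_le_tsum fun l =>
      lintegral_mul_le_eLpNorm_mul_eLpNorm hr hh.1 (hm l)).trans ?_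
    rw [ENNReal.tsum_mul_left]
    calc _ ≤ eLpNorm h r volume * (C₂ * testNorm (conjExp r) ψ) := by
          gcongr; exact h₂ τ hτ _ hq ψ
      _ = _ := by ring
  refine ⟨?_, ?_, ?_⟩
  · refine (enorm_integral_mul_le hr hh.1
      (hD.continuous_dual_heatMul hτ ψ).aestronglyMeasurable).trans ?_
    calc _ ≤ eLpNorm h r volume * (C₁ * testNorm (conjExp r) ψ) := by
          gcongr; exact h₁ τ hτ _ hq ψ
      _ = C₁ * eLpNorm h r volume * testNorm (conjExp r) ψ := by ring
      _ ≤ _ := by gcongr; exact le_self_add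
  · refine (ENNReal.tsum_le_tsum fun l => enorm_integral_le_lintegral_enorm _).trans
      (hsum.trans ?_)
    gcongr
    exact le_add_self
  · refine hasSum_integral_of_tsum_lintegral (fun l => hh.1.mul (hm l)) (hsum.trans_lt
      (ENNReal.mul_lt_top (ENNReal.mul_lt_top hC₂ hh.2) (testNorm_lt_top _ ψ)))
      (Eventually.of_forall fun y => (hD.hasSum_dual P hτ ψ y).mul_left _)

end Pairing

/-! ### Duhamel integrals of one scalar component -/

section Duhamel

variable {n : ℕ} (P : LPPair n) {D : Rn n → ℂ} {T : ℝ} {ω : ℝ → Rn n → ℂ} {g : ℝ → TD n}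

/-- `g(t) = ∫₀ᵗ D e^{(t-s)Δ} ω(s) ds` on `(0,T)`, in the sense of distributions. -/
def IsScalarDuhamel (D : Rn n → ℂ) (T : ℝ) (ω : ℝ → Rn n → ℂ) (g : ℝ → TD n) : Prop :=
  ∀ t ∈ Set.Ioo 0 T, ∀ ψ, g t ψ = ∫ s, pairInt (heatMul D) ω t ψ s ∂(timeMeasure t)

/-- Measurable functions with values in `L^r` that are integrable in time. -/
structure TimeInt (T : ℝ) (r : ℝ≥0∞) (ω : ℝ → Rn n → ℂ) : Prop where
  meas : Measurable (Function.uncurry ω)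
  one_le : 1 ≤ r
  fin : ∫⁻ s, eLpNorm (ω s) r volume ∂(timeMeasure T) < ∞

namespace TimeInt

variable {r : ℝ≥0∞} (h : TimeInt T r ω)
include h

theorem measurable_norm : Measurable fun s => eLpNorm (ω s) r volume := by
  have := measurable_eLpNorm_of_uncurry (ν := (volume : Measure (Rn n)))
    (F := fun s x => ‖ω s x‖ₑ) h.meas.enorm r
  simpa only [eLpNorm_enorm] using this

theorem ae_memLp : ∀ᵐ s ∂(timeMeasure T), MemLp (ω s) r volume := by
  filter_upwards [ae_lt_top h.measurable_norm h.fin.ne] with s hs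
  exact ⟨(h.meas.comp measurable_prodMk_left).aestronglyMeasurable, hs⟩

theorem ae_memLp_of_mem {t : ℝ} (ht : t ∈ Set.Ioo 0 T) :
    ∀ᵐ s ∂(timeMeasure t), MemLp (ω s) r volume :=
  ae_timeMeasure_mono ht.2.le h.ae_memLp

end TimeInt

variable {r : ℝ≥0∞}

theorem Sym1.lintegral_pairInt_le (hD : Sym1 D) (h : TimeInt T r ω) :
    ∃ C : ℝ≥0∞, C < ∞ ∧ ∀ t ∈ Set.Ioo 0 T, ∀ ψ : 𝓢(Rn n, ℂ),
      ∫⁻ s, ‖pairInt (heatMul D) ω t ψ s‖ₑ ∂(timeMeasure t) ≤ C * testNorm (conjExp r) ψ ∧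
      ∑' l, ∫⁻ s, ‖pairInt (locSym P D l) ω t ψ s‖ₑ ∂(timeMeasure t) ≤
        C * testNorm (conjExp r) ψ := by
  obtain ⟨C, hC, hb⟩ := hD.pairing_bounds P
  refine ⟨C * ∫⁻ s, eLpNorm (ω s) r volume ∂(timeMeasure T), ENNReal.mul_lt_top hC h.fin,
    fun t ht ψ => ?_⟩
  have key : ∫⁻ s, C * eLpNorm (ω s) r volume * testNorm (conjExp r) ψ ∂(timeMeasure t) ≤
      C * (∫⁻ s, eLpNorm (ω s) r volume ∂(timeMeasure T)) * testNorm (conjExp r) ψ := by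
    rw [lintegral_mul_const' _ _ (testNorm_lt_top _ ψ).ne, lintegral_const_mul' _ _ hC.ne]
    gcongr
    exact timeMeasure_mono ht.2.le
  have hae := h.ae_memLp_of_mem ht
  refine ⟨le_trans (lintegral_mono_ae ?_) key, ?_⟩
  · filter_upwards [hae, ae_mem_timeMeasure t] with s hs hst
    exact (hb (t - s) (by linarith [hst.2]) r h.one_le _ hs ψ).1
  · rw [← lintegral_tsum]
    · refine le_trans (lintegral_mono_ae ?_) key
      filter_upwards [hae, ae_mem_timeMeasure t] with s hs hst
      exact (hb (t - s) (by linarith [hst.2]) r h.one_le _ hs ψ).2.1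
    · intro l
      have := measurable_pairInt (measurable_locSym P hD.meas l) h.meas ψ
      exact (this.comp measurable_prodMk_left).enorm.aemeasurable

theorem Sym1.integrable_pairInt (P : LPPair n) (hD : Sym1 D) (h : TimeInt T r ω) {t : ℝ}
    (ht : t ∈ Set.Ioo 0 T) (ψ : 𝓢(Rn n, ℂ)) :
    Integrable (pairInt (heatMul D) ω t ψ) (timeMeasure t) := by
  obtain ⟨C, hC, hb⟩ := hD.lintegral_pairInt_le P h
  have hm := (measurable_pairInt (measurable_heatMul hD.meas) h.meas ψ).comp
    (measurable_prodMk_left (x := t))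
  exact ⟨hm.aestronglyMeasurable,
    (hb t ht ψ).1.trans_lt (ENNReal.mul_lt_top hC (testNorm_lt_top _ ψ))⟩

/-- The time integral of the pairings is a linear functional of `ψ` bounded by `testNorm`, uniformly
in `t`. At times outside `(0,T)` any value will do. -/
theorem Sym1.exists_isScalarDuhamel (P : LPPair n) (hD : Sym1 D) (h : TimeInt T r ω) :
    ∃ g, IsScalarDuhamel D T ω g := by
  obtain ⟨C, hC, hb⟩ := hD.lintegral_pairInt_le P h
  have key : ∀ t, ∃ w : TD n, t ∈ Set.Ioo 0 T →
      ∀ ψ, w ψ = ∫ s, pairInt (heatMul D) ω t ψ s ∂(timeMeasure t) := fun t => by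
    by_cases ht : t ∈ Set.Ioo 0 T; swap
    · exact ⟨0, fun h => absurd h ht⟩
    have hae := h.ae_memLp_of_mem ht
    obtain ⟨w, hw⟩ := exists_TD_of_bound (one_le_conjExp r) hC
      (Λ := fun ψ => ∫ s, pairInt (heatMul D) ω t ψ s ∂(timeMeasure t))
      (fun ψ₁ ψ₂ => by
        rw [← integral_add (hD.integrable_pairInt P h ht ψ₁) (hD.integrable_pairInt P h ht ψ₂)]
        refine integral_congr_ae ?_
        filter_upwards [hae, ae_mem_timeMeasure t] with s hs hst
        have hτ : 0 ≤ t - s := by linarith [hst.2]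
        simp only [pairInt]
        rw [← integral_add (hD.integrable_mul_dual P hτ h.one_le hs ψ₁)
          (hD.integrable_mul_dual P hτ h.one_le hs ψ₂)]
        refine integral_congr_ae (Eventually.of_forall fun y => ?_)
        simp only [hD.dual_add hτ, mul_add])
      (fun c ψ => by
        simp only [pairInt, dual_smul]
        rw [← integral_const_mul]
        refine integral_congr_ae (Eventually.of_forall fun s => ?_)
        simp only
        rw [← integral_const_mul]
        refine integral_congr_ae (Eventually.of_forall fun y => ?_)
        simp only
        ring)
      (fun ψ => (enorm_integral_le_lintegral_enorm _).trans (hb t ht ψ).1)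
    exact ⟨w, fun _ => hw⟩
  choose g hg using key
  exact ⟨g, fun t ht => hg t ht⟩

theorem measurable_integral_timeMeasure {X : Type*} [MeasurableSpace X] {f : ℝ × X → ℝ → ℂ}
    (hf : Measurable (Function.uncurry f)) :
    Measurable fun z : ℝ × X => ∫ s, f z s ∂(timeMeasure z.1) := by
  have hS : MeasurableSet {z : (ℝ × X) × ℝ | 0 < z.2 ∧ z.2 < z.1.1} :=
    (measurableSet_lt measurable_const measurable_snd).inter
      (measurableSet_lt measurable_snd (measurable_fst.comp measurable_fst))
  have h1 := ((hf.indicator hS).stronglyMeasurable).integral_prod_right' (ν := volume)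
  have e : (fun z : ℝ × X => ∫ s, f z s ∂(timeMeasure z.1)) = fun z : ℝ × X =>
      ∫ s, {z : (ℝ × X) × ℝ | 0 < z.2 ∧ z.2 < z.1.1}.indicator (Function.uncurry f) (z, s) := by
    ext z
    rw [timeMeasure, ← integral_indicator measurableSet_Ioo]
    rfl
  rw [e]
  exact h1.measurable

theorem IsScalarDuhamel.measurable (hD : Sym1 D) (h : TimeInt T r ω)
    (hg : IsScalarDuhamel D T ω g) (ψ : 𝓢(Rn n, ℂ)) :
    Measurable (fun t : Set.Ioo (0 : ℝ) T => g t ψ) := by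
  have hm := measurable_pairInt (measurable_heatMul hD.meas) h.meas ψ
  have h1 : Measurable fun z : (ℝ × Unit) × ℝ => (z.1.1, z.2) := by fun_prop
  have h2 := measurable_integral_timeMeasure (X := Unit)
    (f := fun z s => pairInt (heatMul D) ω z.1 ψ s) (hm.comp h1)
  have h3 : Measurable fun t : Set.Ioo (0 : ℝ) T => ((t : ℝ), ()) := by fun_prop
  have e : (fun t : Set.Ioo (0 : ℝ) T => g t ψ) =
      fun t : Set.Ioo (0 : ℝ) T => ∫ s, pairInt (heatMul D) ω t ψ s ∂(timeMeasure t) := by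
    ext t; exact hg t t.2 ψ
  rw [e]
  exact h2.comp h3

theorem IsScalarDuhamel.isReal (hD : Sym1 D) (hg : IsScalarDuhamel D T ω g)
    (hω : ∀ᵐ s ∂(timeMeasure T), ∀ᵐ y, (ω s y).im = 0) {t : ℝ} (ht : t ∈ Set.Ioo 0 T) :
    IsReal (g t) := by
  intro ψ hψ
  have key : ∀ {X : Type} [MeasurableSpace X] (μ : Measure X) (f : X → ℂ),
      (∀ᵐ x ∂μ, (f x).im = 0) → (∫ x, f x ∂μ).im = 0 := fun μ f hf => by
    refine Complex.conj_eq_iff_im.1 ?_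
    rw [← integral_conj]
    refine integral_congr_ae ?_
    filter_upwards [hf] with x hx
    exact Complex.conj_eq_iff_im.2 hx
  rw [hg t ht]
  refine key _ _ ?_
  filter_upwards [ae_timeMeasure_mono ht.2.le hω] with s hs
  refine key _ _ ?_
  filter_upwards [hs] with y hy
  have hc : ∀ ξ, heatMul D (t - s) (-ξ) = starRingEnd ℂ (heatMul D (t - s) ξ) := fun ξ => by
    rw [heatMul, heatMul, hD.herm, heatSymbol_neg, map_mul, heatSymbol, Complex.conj_ofReal]
  simp [Complex.mul_im, hy, conj_dual hc hψ y]

/-- The projection moves onto the test function and from there into the symbol, so a block of a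
Duhamel integral is a Duhamel integral for the localised symbol. -/
theorem IsScalarDuhamel.lpProj_apply (hg : IsScalarDuhamel D T ω g) (l : ℤ) {t : ℝ}
    (ht : t ∈ Set.Ioo 0 T) (ψ : 𝓢(Rn n, ℂ)) :
    lpProj P l (g t) ψ = ∫ s, pairInt (locSym P D l) ω t ψ s ∂(timeMeasure t) := by
  rw [lpProj_eq, op_apply, hg t ht]
  refine integral_congr_ae (Eventually.of_forall fun s => ?_)
  simp only [pairInt]
  rw [dual_dualS (hasTemperateGrowth_lpSym P l)]
  have e : (fun ξ => heatMul D (t - s) ξ * lpSym P l ξ) = locSym P D l (t - s) := by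
    ext ξ; simp only [heatMul, locSym]; ring
  rw [e]

/-- The dyadic decomposition of the test function is summable in the dual Lebesgue space uniformly
in `t - s`, so sum and time integral may be exchanged. -/
theorem IsScalarDuhamel.hasSum (hD : Sym1 D) (h : TimeInt T r ω) (hg : IsScalarDuhamel D T ω g)
    {t : ℝ} (ht : t ∈ Set.Ioo 0 T) : HasSum (fun l => lpProj P l (g t)) (g t) := by
  obtain ⟨C, hC, hb⟩ := hD.lintegral_pairInt_le P h
  obtain ⟨C', hC', hb'⟩ := hD.pairing_bounds P
  rw [hasSum_TD_iff]
  intro ψ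
  simp_rw [fun l => hg.lpProj_apply P l ht ψ, hg t ht ψ]
  refine hasSum_integral_of_tsum_lintegral (fun l => ?_)
    ((hb t ht ψ).2.trans_lt (ENNReal.mul_lt_top hC (testNorm_lt_top _ ψ))) ?_
  · have := measurable_pairInt (measurable_locSym P hD.meas l) h.meas ψ
    exact (this.comp measurable_prodMk_left).aestronglyMeasurable
  · filter_upwards [h.ae_memLp_of_mem ht, ae_mem_timeMeasure t] with s hs hst
    exact (hb' (t - s) (by linarith [hst.2]) r h.one_le _ hs ψ).2.2

/-- Bounds for the dyadic blocks of a Duhamel integral. -/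
theorem Sym1.lpNorm_lpProj_duhamel_le (hD : Sym1 D) : ∃ C : ℝ≥0∞, C < ∞ ∧
    ∀ (T : ℝ) (r b : ℝ≥0∞) (ω : ℝ → Rn n → ℂ) (g : ℝ → TD n), TimeInt T r ω →
      IsScalarDuhamel D T ω g → r ≤ b → ∀ t ∈ Set.Ioo 0 T, ∀ l : ℤ,
      lpNorm b (lpProj P l (g t)) ≤
        C * 2 ^ ((l : ℝ) * (1 + n * ((r⁻¹).toReal - (b⁻¹).toReal))) *
          ∫⁻ s, kap ((t - s) * 4 ^ l) * eLpNorm (ω s) r volume ∂(timeMeasure t) := by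
  obtain ⟨C, hC, hk⟩ := hD.kerBound P
  refine ⟨C, hC, fun T r b ω g h hg hrb t ht l => ?_⟩
  set θ := (r⁻¹).toReal - (b⁻¹).toReal with hθ
  have hae := h.ae_memLp_of_mem ht
  have hbound : ∫⁻ s, eLpNorm (kconv (𝓕⁻ (locSym P D l (t - s))) (ω s)) b volume
      ∂(timeMeasure t) ≤ C * 2 ^ ((l : ℝ) * (1 + n * θ)) *
          ∫⁻ s, kap ((t - s) * 4 ^ l) * eLpNorm (ω s) r volume ∂(timeMeasure t) := by
    rw [← lintegral_const_mul' _ _ (ENNReal.mul_lt_top hC (ennreal_two_rpow_ne_top _).lt_top).ne]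
    refine lintegral_mono_ae ?_
    filter_upwards [hae, ae_mem_timeMeasure t] with s hs hst
    have h1 := (hk l (t - s) (by linarith [hst.2])).eLpNorm_kconv_le hs.1 h.one_le hrb
    refine h1.trans (le_of_eq ?_)
    rw [show (l : ℝ) * (1 + n * θ) = l + l * n * θ by ring, ennreal_two_rpow_add]
    ring
  have hfin : ∫⁻ s, kap ((t - s) * 4 ^ l) * eLpNorm (ω s) r volume ∂(timeMeasure t) < ∞ := by
    refine lt_of_le_of_lt (lintegral_mono fun s => mul_le_of_le_one_left' (kap_le_one _)) ?_
    exact lt_of_le_of_lt (lintegral_mono' (timeMeasure_mono ht.2.le) le_rfl) h.fin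
  refine le_trans ?_ hbound
  exact (represents_timeIntegral (measurable_locSym P hD.meas l)
    (A := fun τ => C * (2 ^ (l : ℝ) * kap (τ * 4 ^ l)))
    (fun τ _ => ENNReal.mul_lt_top hC (ENNReal.mul_lt_top (ennreal_two_rpow_ne_top _).lt_top
      ((kap_le_one _).trans_lt (by simp))))
    (fun τ hτ => hk l τ hτ.le) h.meas h.one_le (hae.mono fun s hs => hs.2)
    (h.one_le.trans hrb) (hbound.trans_lt (ENNReal.mul_lt_top
      (ENNReal.mul_lt_top hC (ennreal_two_rpow_ne_top _).lt_top) hfin))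
    (hg.lpProj_apply P l ht)).2.2

/-- In `L^∞`, block `l` is `O(2^{l(1+n/r)})`. The derivative contributes the `1`, so the exponent is
positive even for `r = ∞`. -/
theorem IsScalarDuhamel.isSh (hD : Sym1 D) (h : TimeInt T r ω) (hg : IsScalarDuhamel D T ω g)
    {t : ℝ} (ht : t ∈ Set.Ioo 0 T) : IsSh P (g t) := by
  obtain ⟨C, hC, hb⟩ := hD.lpNorm_lpProj_duhamel_le P
  refine isSh_of_hasSum P (hg.hasSum P hD h ht)
    (M := C * ∫⁻ s, eLpNorm (ω s) r volume ∂(timeMeasure T)) (ENNReal.mul_lt_top hC h.fin)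
    (c := 1 + n * (r⁻¹).toReal) (by positivity) fun l => ?_
  refine (hb T r ∞ ω g h hg le_top t ht l).trans ?_
  simp only [ENNReal.inv_top, ENNReal.toReal_zero, sub_zero]
  rw [mul_right_comm]
  gcongr
  · exact timeMeasure_mono ht.2.le
  · exact mul_le_of_le_one_left' (kap_le_one _)

/-- The smoothing effect of Duhamel's integral in Chemin-Lerner spaces. -/
theorem IsScalarDuhamel.cheminLernerNorm_lt_top (hD : Sym1 D) (h : TimeInt T r ω)
    (hg : IsScalarDuhamel D T ω g) {b β α : ℝ≥0∞} (hrb : r ≤ b) (hβ : 1 ≤ β) (hβα : β ≤ α)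
    (hN : eLpNorm (fun s => eLpNorm (ω s) r volume) β (timeMeasure T) < ∞)
    (hexp : 1 + n * ((r⁻¹).toReal - (b⁻¹).toReal) -
      2 * (1 - ((β⁻¹).toReal - (α⁻¹).toReal)) < 0) :
    cheminLernerNorm P T α 0 b 1 g < ∞ := by
  obtain ⟨C, hC, hb⟩ := hD.lpNorm_lpProj_duhamel_le P
  set θ := (r⁻¹).toReal - (b⁻¹).toReal with hθ
  set σ := 1 - ((β⁻¹).toReal - (α⁻¹).toReal) with hσ
  set N := eLpNorm (fun s => eLpNorm (ω s) r volume) β (timeMeasure T) with hNdef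
  have hθ0 : 0 ≤ θ := by
    have : (b⁻¹).toReal ≤ (r⁻¹).toReal := ENNReal.toReal_mono
      (ENNReal.inv_ne_top.2 (zero_lt_one.trans_le h.one_le).ne') (ENNReal.inv_le_inv.2 hrb)
    linarith
  have hσ0 : 0 ≤ σ := by
    have h1 : (β⁻¹).toReal ≤ 1 := by
      rw [← ENNReal.toReal_one]
      exact ENNReal.toReal_mono (by simp) (by simpa using hβ)
    have h2 : 0 ≤ (α⁻¹).toReal := ENNReal.toReal_nonneg
    linarith
  have hblock : ∀ l : ℤ, timeLpNorm T α b (fun t => lpProj P l (g t)) ≤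
      C * 2 ^ ((l : ℝ) * (1 + n * θ)) * ((∫⁻ τ in Set.Ioo 0 T, kap (τ * 4 ^ l)) ^ σ * N) := by
    intro l
    have hkm : Measurable fun τ : ℝ => kap (τ * 4 ^ l) := measurable_kap.comp (by fun_prop)
    refine (eLpNorm_ennreal_mono_ae α (g := fun t => C * 2 ^ ((l : ℝ) * (1 + n * θ)) *
      ∫⁻ s, kap ((t - s) * 4 ^ l) * eLpNorm (ω s) r volume ∂(timeMeasure t)) ?_).trans ?_
    · filter_upwards [ae_mem_timeMeasure T] with t ht
      exact hb T r b ω g h hg hrb t ht l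
    · have hmeas : Measurable fun t => ∫⁻ s, kap ((t - s) * 4 ^ l) * eLpNorm (ω s) r volume
          ∂(timeMeasure t) := by
        have hf : Measurable fun z : (ℝ × Unit) × ℝ =>
            kap ((z.1.1 - z.2) * 4 ^ l) * eLpNorm (ω z.2) r volume :=
          (measurable_kap.comp (by fun_prop)).mul (h.measurable_norm.comp measurable_snd)
        exact (measurable_lintegral_timeMeasure (X := Unit) (f := fun z s =>
          kap ((z.1 - s) * 4 ^ l) * eLpNorm (ω s) r volume) hf).comp
          (measurable_prodMk_right (y := ()))
      refine (eLpNorm_ennreal_const_mul _ hmeas.aemeasurable).trans ?_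
      gcongr
      exact eLpNorm_timeConv_le hkm h.measurable_norm T hβ hβα fun τ => kap_le_one _
  have hsum : cheminLernerNorm P T α 0 b 1 g =
      ∑' l : ℤ, timeLpNorm T α b (fun t => lpProj P l (g t)) := by
    simp [cheminLernerNorm, eLpNorm_one_eq_lintegral_enorm, lintegral_count]
  rw [hsum]
  -- For low frequencies the time integral of `kap` is bounded by `T`, leaving the positive exponent
  -- `1+nθ`. For high frequencies it is bounded by a multiple of `4^{-l}`, and its power `σ` wins by
  -- the assumption on the exponents.
  refine tsum_int_lt_top (C := C * N * (ENNReal.ofReal T ^ σ + ENNReal.ofReal (2 * Real.pi) ^ σ))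
    (a := 1 + n * θ) (b := 2 * σ - (1 + n * θ)) ?_ (by positivity) (by linarith)
    (fun l => (hblock l).trans ?_) fun l => (hblock l).trans ?_
  · refine ENNReal.mul_lt_top (ENNReal.mul_lt_top hC hN) (ENNReal.add_lt_top.2 ⟨?_, ?_⟩)
    · exact ENNReal.rpow_lt_top_of_nonneg hσ0 ENNReal.ofReal_ne_top
    · exact ENNReal.rpow_lt_top_of_nonneg hσ0 ENNReal.ofReal_ne_top
  · calc _ ≤ C * 2 ^ ((l : ℝ) * (1 + n * θ)) * (ENNReal.ofReal T ^ σ * N) := by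
          gcongr
          exact lintegral_kap_le_time T
      _ = C * N * ENNReal.ofReal T ^ σ * 2 ^ ((l : ℝ) * (1 + n * θ)) := by ring
      _ ≤ _ := by gcongr; exact le_self_add
  · calc _ ≤ C * 2 ^ ((l : ℝ) * (1 + n * θ)) *
          ((ENNReal.ofReal (2 * Real.pi) * 2 ^ (-((l : ℝ) * 2))) ^ σ * N) := by
          gcongr
          exact lintegral_kap_four_le l T
      _ = C * N * ENNReal.ofReal (2 * Real.pi) ^ σ * 2 ^ (-((l : ℝ) * (2 * σ - (1 + n * θ)))) := by
          rw [ENNReal.mul_rpow_of_nonneg _ _ hσ0, ← ENNReal.rpow_mul,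
            show -((l : ℝ) * (2 * σ - (1 + n * θ))) = l * (1 + n * θ) + -(l * 2) * σ by ring,
            ennreal_two_rpow_add]
          ring
      _ ≤ _ := by gcongr; exact le_add_self

end Duhamel

/-! ### Uniqueness of the partially defined operators -/

section Unique

variable {n : ℕ} {P : LPPair n} {u v w u' v' w' : TD n}

theorem hasSum_TD_unique {ι : Type*} {a : ι → TD n} (h : HasSum a u) (h' : HasSum a v) : u = v := by
  ext ψ
  exact (hasSum_TD_iff.1 h ψ).unique (hasSum_TD_iff.1 h' ψ)

theorem IsPointwiseProduct.unique (h : IsPointwiseProduct u v w) (h' : IsPointwiseProduct u v w') :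
    w = w' := by
  obtain ⟨g, k, hg, hk, hw⟩ := h
  obtain ⟨g', k', hg', hk', hw'⟩ := h'
  refine hw.eq (hw'.congr_ae ?_)
  filter_upwards [hg'.ae_eq hg, hk'.ae_eq hk] with x h1 h2
  rw [h1, h2]

theorem IsPointwiseProduct.symm (h : IsPointwiseProduct u v w) : IsPointwiseProduct v u w := by
  obtain ⟨g, k, hg, hk, hw⟩ := h
  exact ⟨k, g, hk, hg, by simpa only [mul_comm] using hw⟩

theorem IsPointwiseProduct.add_left (h : IsPointwiseProduct u v w)
    (h' : IsPointwiseProduct u' v w') : IsPointwiseProduct (u + u') v (w + w') := by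
  obtain ⟨g, k, hg, hk, hw⟩ := h
  obtain ⟨g', k', hg', hk', hw'⟩ := h'
  refine ⟨_, k, hg.add hg', hk, (hw.add hw').congr_ae ?_⟩
  filter_upwards [hk'.ae_eq hk] with x h2
  rw [h2, add_mul]

theorem IsPointwiseProduct.add_right (h : IsPointwiseProduct u v w)
    (h' : IsPointwiseProduct u v' w') : IsPointwiseProduct u (v + v') (w + w') :=
  (h.symm.add_left h'.symm).symm

theorem IsParaproduct.unique (h : IsParaproduct P u v w) (h' : IsParaproduct P u v w') :
    w = w' := by
  obtain ⟨τ, hτ, hs⟩ := h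
  obtain ⟨τ', hτ', hs'⟩ := h'
  have : τ = τ' := funext fun j => (hτ j).unique (hτ' j)
  exact hasSum_TD_unique hs (this ▸ hs')

theorem IsParaproduct.add_left (h : IsParaproduct P u v w) (h' : IsParaproduct P u' v w') :
    IsParaproduct P (u + u') v (w + w') := by
  obtain ⟨τ, hτ, hs⟩ := h
  obtain ⟨τ', hτ', hs'⟩ := h'
  refine ⟨fun j => τ j + τ' j, fun j => ?_, hs.add hs'⟩
  rw [map_add]
  exact (hτ j).add_left (hτ' j)

theorem IsParaproduct.add_right (h : IsParaproduct P u v w) (h' : IsParaproduct P u v' w') :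
    IsParaproduct P u (v + v') (w + w') := by
  obtain ⟨τ, hτ, hs⟩ := h
  obtain ⟨τ', hτ', hs'⟩ := h'
  refine ⟨fun j => τ j + τ' j, fun j => ?_, hs.add hs'⟩
  rw [map_add]
  exact (hτ j).add_right (hτ' j)

theorem IsRemainder.unique (h : IsRemainder P u v w) (h' : IsRemainder P u v w') :
    w = w' := by
  obtain ⟨ρ, hρ, hs⟩ := h
  obtain ⟨ρ', hρ', hs'⟩ := h'
  have : (fun j => ∑ ν ∈ Finset.Icc (-1 : ℤ) 1, ρ j ν) =
      fun j => ∑ ν ∈ Finset.Icc (-1 : ℤ) 1, ρ' j ν :=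
    funext fun j => Finset.sum_congr rfl fun ν hν => (hρ j ν hν).unique (hρ' j ν hν)
  exact hasSum_TD_unique hs (this ▸ hs')

theorem IsRemainder.add_left (h : IsRemainder P u v w) (h' : IsRemainder P u' v w') :
    IsRemainder P (u + u') v (w + w') := by
  obtain ⟨ρ, hρ, hs⟩ := h
  obtain ⟨ρ', hρ', hs'⟩ := h'
  refine ⟨fun j ν => ρ j ν + ρ' j ν, fun j ν hν => ?_, ?_⟩
  · rw [map_add]
    exact (hρ j ν hν).add_left (hρ' j ν hν)
  · simpa only [Finset.sum_add_distrib] using hs.add hs'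

theorem IsRemainder.add_right (h : IsRemainder P u v w) (h' : IsRemainder P u v' w') :
    IsRemainder P u (v + v') (w + w') := by
  obtain ⟨ρ, hρ, hs⟩ := h
  obtain ⟨ρ', hρ', hs'⟩ := h'
  refine ⟨fun j ν => ρ j ν + ρ' j ν, fun j ν hν => ?_, ?_⟩
  · rw [map_add]
    exact (hρ j ν hν).add_right (hρ' j ν hν)
  · simpa only [Finset.sum_add_distrib] using hs.add hs'

theorem IsBony.unique (h : IsBony P u v w) (h' : IsBony P u v w') : w = w' := by
  obtain ⟨a, b, c, ha, hb, hc, rfl⟩ := h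
  obtain ⟨a', b', c', ha', hb', hc', rfl⟩ := h'
  rw [ha.unique ha', hb.unique hb', hc.unique hc']

theorem IsBony.add_left (h : IsBony P u v w) (h' : IsBony P u' v w') :
    IsBony P (u + u') v (w + w') := by
  obtain ⟨a, b, c, ha, hb, hc, rfl⟩ := h
  obtain ⟨a', b', c', ha', hb', hc', rfl⟩ := h'
  exact ⟨_, _, _, ha.add_left ha', hb.add_right hb', hc.add_left hc', by abel⟩

theorem IsBony.add_right (h : IsBony P u v w) (h' : IsBony P u v' w') :
    IsBony P u (v + v') (w + w') := by
  obtain ⟨a, b, c, ha, hb, hc, rfl⟩ := h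
  obtain ⟨a', b', c', ha', hb', hc', rfl⟩ := h'
  exact ⟨_, _, _, ha.add_right ha', hb.add_left hb', hc.add_right hc', by abel⟩

theorem IsLerayDiv.unique {W : Fin n → Fin n → TD n} {z z' : Fin n → TD n} (h : IsLerayDiv W z)
    (h' : IsLerayDiv W z') : z = z' := by
  obtain ⟨g, hg, hz⟩ := h
  obtain ⟨g', hg', hz'⟩ := h'
  ext i ψ
  rw [(hz i ψ).2, (hz' i ψ).2]
  congr 1
  refine Finset.sum_congr rfl fun j _ => Finset.sum_congr rfl fun k _ => integral_congr_ae ?_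
  filter_upwards [(hg j k).ae_eq (hg' j k)] with y hy
  rw [hy]

theorem IsLerayDivLP.unique {W : Fin n → Fin n → TD n} {z z' : Fin n → TD n}
    (h : IsLerayDivLP P W z) (h' : IsLerayDivLP P W z') : z = z' := by
  obtain ⟨y, hy, hs⟩ := h
  obtain ⟨y', hy', hs'⟩ := h'
  have : y = y' := funext fun l => (hy l).unique (hy' l)
  exact funext fun i => hasSum_TD_unique (hs i) (this ▸ hs' i)

end Unique

/-! ### The operator `ℙ∇·` on sums of Lebesgue spaces -/

section Leray

variable {n : ℕ} (P : LPPair n)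

theorem exists_kerBound_lpSym (l : ℤ) : ∃ A B : ℝ≥0∞, A < ∞ ∧ KerBound (lpSym P l) A B := by
  obtain ⟨C, hC, h⟩ := (isAnnular_lpSym P l).kerBound
  refine ⟨_, _, ?_, by simpa [heatSymbol] using h 0 0 le_rfl⟩
  exact ENNReal.mul_lt_top hC ((kap_le_one _).trans_lt (by simp))

/-- Here the singular symbol `D` acts first, so `dual D ψ` need not be a test function and
`dual_dualS` does not apply. Instead the kernel of `m` plays the role of the integrable function,
and inversion recovers `m` from it. -/
theorem integral_fourierInv_mul_dual {m D : Rn n → ℂ} {A B : ℝ≥0∞} (hm : KerBound m A B)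
    (hA : A < ∞) (hmc : Continuous m) (ψ : 𝓢(Rn n, ℂ))
    (hD : Integrable (fun ξ => D ξ * (𝓕⁻ ψ : 𝓢(Rn n, ℂ)) ξ)) (y : Rn n) :
    ∫ x, 𝓕⁻ m (x - y) * dual D ψ x = dual (fun ξ => D ξ * m ξ) ψ y := by
  have hk : Integrable (𝓕⁻ m) :=
    ⟨hm.measurable.aestronglyMeasurable, hm.one.trans_lt hA⟩
  have h := fourier_mul_fourier hD hk y
  have hk' : Integrable (𝓕 m) := by
    refine hk.comp_neg.congr (Eventually.of_forall fun x => ?_)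
    simp only [Real.fourierInv_eq_fourier_neg, neg_neg]
  rw [hmc.fourier_fourierInv_eq hm.int hk'] at h
  have e : (fun ξ => D ξ * m ξ * (𝓕⁻ ψ : 𝓢(Rn n, ℂ)) ξ) =
      fun ξ => D ξ * (𝓕⁻ ψ : 𝓢(Rn n, ℂ)) ξ * m ξ := by ext; ring
  rw [dual, dual, e, h, ← integral_sub_right_eq_self
    (fun x => 𝓕 (fun ξ => D ξ * (𝓕⁻ ψ : 𝓢(Rn n, ℂ)) ξ) (x + y) * 𝓕⁻ m x) y]
  refine integral_congr_ae (Eventually.of_forall fun x => ?_)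
  simp only [sub_add_cancel]
  ring

/-- The distribution `W` is given by the function `h`, and all the first order operators `D` and
their dyadic blocks act on it in the expected way. -/
structure ActedOn (W : TD n) (h : Rn n → ℂ) : Prop where
  rep : Represents W h
  blocks : ∃ k : ℤ → Rn n → ℂ, (∀ l, Represents (lpProj P l W) (k l)) ∧
    ∀ D, Sym1 D →
      (∀ τ, 0 ≤ τ → ∀ ψ, Integrable fun y => h y * dual (heatMul D τ) ψ y) ∧
      (∀ l ψ, Integrable fun y => k l y * dual D ψ y) ∧
      ∃ w : TD n, (∀ τ, 0 ≤ τ → ∀ ψ, heat τ w ψ = ∫ y, h y * dual (heatMul D τ) ψ y) ∧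
        (∀ l ψ, lpProj P l w ψ = ∫ y, k l y * dual D ψ y) ∧ HasSum (fun l => lpProj P l w) w

theorem Sym1.exists_TD (P : LPPair n) {D : Rn n → ℂ} (hD : Sym1 D) {r : ℝ≥0∞} (hr : 1 ≤ r) {h : Rn n → ℂ}
    (hh : MemLp h r volume) : ∃ w : TD n, ∀ ψ, w ψ = ∫ y, h y * dual D ψ y := by
  obtain ⟨C, hC, hb⟩ := hD.pairing_bounds P
  have e := heatMul_zero D
  refine exists_TD_of_bound (one_le_conjExp r) (C := C * eLpNorm h r volume)
    (ENNReal.mul_lt_top hC hh.2) (fun ψ₁ ψ₂ => ?_) (fun c ψ => ?_) fun ψ => ?_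
  · have h1 := hD.integrable_mul_dual P le_rfl hr hh ψ₁
    have h2 := hD.integrable_mul_dual P le_rfl hr hh ψ₂
    have h3 := hD.dual_add le_rfl ψ₁ ψ₂
    rw [e] at h1 h2 h3
    rw [← integral_add h1 h2]
    simp only [h3, mul_add]
  · rw [← integral_const_mul]
    simp only [dual_smul]
    refine integral_congr_ae (Eventually.of_forall fun x => ?_)
    simp only
    ring
  · simpa only [e] using (hb 0 le_rfl r hr h hh ψ).1

/-- The content is that a block of `D W` equals `D` applied to the same block of `W`. Both sides are
pairings of `h` with `dual` of the product symbol: one by composing symbols, the other by Fubini and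
`integral_fourierInv_mul_dual`. -/
theorem actedOn_of_memLp {r : ℝ≥0∞} (hr : 1 ≤ r) {h : Rn n → ℂ} (hh : MemLp h r volume) {W : TD n}
    (hW : Represents W h) : ActedOn P W h := by
  refine ⟨hW, fun l => kconv (𝓕⁻ (lpSym P l)) h, fun l => ?_, fun D hD => ?_⟩
  · obtain ⟨A, B, hA, hk⟩ := exists_kerBound_lpSym P l
    exact hk.represents_op hA (hasTemperateGrowth_lpSym P l) hr hh hW
  obtain ⟨C, hC, hb⟩ := hD.pairing_bounds P
  obtain ⟨w, hw⟩ := hD.exists_TD P hr hh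
  have hmem := fun ψ => hD.memLp_dual P le_rfl (one_le_conjExp r) ψ
  rw [heatMul_zero] at hmem
  have hblock : ∀ l ψ, lpProj P l w ψ = ∫ y, h y * dual (locSym P D l 0) ψ y := fun l ψ => by
    rw [lpProj_eq, op_apply, hw, dual_dualS (hasTemperateGrowth_lpSym P l)]
    have e : (fun ξ => D ξ * lpSym P l ξ) = locSym P D l 0 := by
      ext ξ; simp only [locSym, heatSymbol]; simp; ring
    rw [e]
  refine ⟨fun τ hτ ψ => hD.integrable_mul_dual P hτ hr hh ψ, fun l ψ => ?_, w, fun τ hτ ψ => ?_,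
    fun l ψ => ?_, ?_⟩
  · obtain ⟨A, B, hA, hk⟩ := exists_kerBound_lpSym P l
    exact integrable_mul_of_eLpNorm hr (hk.memLp_kconv hA hr hh) (hmem ψ)
  · rw [heat_eq, op_apply, hw, dual_dualS (hasTemperateGrowth_heatSymbol hτ)]
    rfl
  · obtain ⟨A, B, hA, hk⟩ := exists_kerBound_lpSym P l
    rw [lpProj_eq, op_apply, hw, dual_dualS (hasTemperateGrowth_lpSym P l),
      ← integral_kconv_mul hk.measurable (hk.one.trans_lt hA) hr hh (hmem ψ)]
    have hi := hD.integrable_heatMul_mul le_rfl (𝓕⁻ ψ : 𝓢(Rn n, ℂ))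
    rw [heatMul_zero] at hi
    simp only [integral_fourierInv_mul_dual hk hA (isAnnular_lpSym P l).smooth.continuous ψ hi]
  · rw [hasSum_TD_iff]
    intro ψ
    have h1 := (hb 0 le_rfl r hr h hh ψ).2.2
    rw [heatMul_zero] at h1
    simpa only [hblock, hw] using h1

/-- Additivity is the purpose of `ActedOn`: a product of two split fields is a sum of terms in
different `L^r`, and need not lie in any single one. -/
theorem ActedOn.add {W W' : TD n} {h h' : Rn n → ℂ} (H : ActedOn P W h) (H' : ActedOn P W' h') :
    ActedOn P (W + W') (fun x => h x + h' x) := by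
  obtain ⟨k, hk, hD⟩ := H.blocks
  obtain ⟨k', hk', hD'⟩ := H'.blocks
  refine ⟨H.rep.add H'.rep, fun l x => k l x + k' l x, fun l => ?_, fun D hSym => ?_⟩
  · rw [map_add]; exact (hk l).add (hk' l)
  obtain ⟨h1, h2, w, h3, h4, h5⟩ := hD D hSym
  obtain ⟨h1', h2', w', h3', h4', hsum'⟩ := hD' D hSym
  simp only [add_mul]
  refine ⟨fun τ hτ ψ => (h1 τ hτ ψ).add (h1' τ hτ ψ), fun l ψ => (h2 l ψ).add (h2' l ψ), w + w',
    fun τ hτ ψ => ?_, fun l ψ => ?_, ?_⟩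
  · rw [integral_add (h1 τ hτ ψ) (h1' τ hτ ψ), ← h3 τ hτ ψ, ← h3' τ hτ ψ, map_add]
    rfl
  · rw [integral_add (h2 l ψ) (h2' l ψ), ← h4 l ψ, ← h4' l ψ, map_add]
    rfl
  · simpa only [map_add] using h5.add hsum'

/-- `ℙ∇·W` and its Littlewood-Paley series exist and agree; the heat flow acts on the result by
integration against the Oseen symbol. -/
theorem exists_isLerayDiv {W : Fin n → Fin n → TD n} {h : Fin n → Fin n → Rn n → ℂ}
    (H : ∀ j k, ActedOn P (W j k) (h j k)) :
    ∃ w : Fin n → TD n, IsLerayDiv W w ∧ IsLerayDivLP P W w ∧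
      ∀ i τ, 0 ≤ τ → ∀ ψ, heat τ (w i) ψ =
        ∑ j, ∑ k, ∫ y, h j k y * dual (heatMul (leraySym i j k) τ) ψ y := by
  choose κ hκ hD using fun j k => (H j k).blocks
  have hL := fun i j k => hD j k (leraySym i j k) (sym1_leraySym i j k)
  choose h1 h2 w h3 h4 h5 using hL
  have sumapp : ∀ (a : Fin n → Fin n → TD n) ψ, (∑ j, ∑ k, a j k) ψ = ∑ j, ∑ k, a j k ψ := by
    intro a ψ
    simp
  refine ⟨fun i => ∑ j, ∑ k, w i j k, ⟨h, fun j k => (H j k).rep, fun i ψ => ⟨fun j k => ?_, ?_⟩⟩,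
    ⟨fun l i => ∑ j, ∑ k, lpProj P l (w i j k), fun l => ⟨fun j k => κ j k l,
      fun j k => hκ j k l, fun i ψ => ⟨fun j k => ?_, ?_⟩⟩, fun i => ?_⟩, fun i τ hτ ψ => ?_⟩
  · have := (h1 i j k 0 le_rfl ψ).neg
    rw [heatMul_zero] at this
    refine this.congr (Eventually.of_forall fun y => ?_)
    simp [lerayGrad_eq]
  · rw [sumapp]
    simp only [lerayGrad_eq, mul_neg, integral_neg, Finset.sum_neg_distrib, neg_neg]
    refine Finset.sum_congr rfl fun j _ => Finset.sum_congr rfl fun k _ => ?_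
    have := h3 i j k 0 le_rfl ψ
    rwa [heat_zero, heatMul_zero] at this
  · refine (h2 i j k l ψ).neg.congr (Eventually.of_forall fun y => ?_)
    simp [lerayGrad_eq]
  · rw [sumapp]
    simp only [lerayGrad_eq, mul_neg, integral_neg, Finset.sum_neg_distrib, neg_neg]
    exact Finset.sum_congr rfl fun j _ => Finset.sum_congr rfl fun k _ => h4 i j k l ψ
  · exact hasSum_sum fun j _ => hasSum_sum fun k _ => h5 i j k
  · rw [map_sum, ← Finset.sum_congr rfl fun j _ => Finset.sum_congr rfl fun k _ => h3 i j k τ hτ ψ,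
      ← sumapp]
    simp only [map_sum]

end Leray

/-! ### Bony's decomposition of a product -/

section Bony

/-- The index set `ℤ × ℤ` is the disjoint union of `k < l - 1`, `l < k - 1` and `|k - l| ≤ 1`, and
the double series of products converges absolutely. -/
theorem tsum_bony {a b : ℤ → ℂ} (ha : Summable fun k => ‖a k‖) (hb : Summable fun k => ‖b k‖) :
    ∑' l, (∑' k, if k < l - 1 then a k else 0) * b l +
      ∑' l, (∑' k, if k < l - 1 then b k else 0) * a l +
      ∑' l, ∑ ν ∈ Finset.Icc (-1 : ℤ) 1, a l * b (l - ν) = (∑' k, a k) * ∑' k, b k := by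
  have hF : Summable fun z : ℤ × ℤ => a z.1 * b z.2 := summable_mul_of_summable_norm ha hb
  have hF' : Summable fun z : ℤ × ℤ => b z.1 * a z.2 := summable_mul_of_summable_norm hb ha
  have key : ∀ a b : ℤ → ℂ, (Summable fun z : ℤ × ℤ => b z.1 * a z.2) →
      Summable (fun z : ℤ × ℤ => if z.2 < z.1 - 1 then a z.2 * b z.1 else 0) ∧
      ∑' l, (∑' k, if k < l - 1 then a k else 0) * b l =
        ∑' z : ℤ × ℤ, if z.2 < z.1 - 1 then a z.2 * b z.1 else 0 := by
    intro a b h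
    have hs : Summable (fun z : ℤ × ℤ => if z.2 < z.1 - 1 then a z.2 * b z.1 else 0) := by
      refine (h.indicator {z | z.2 < z.1 - 1}).congr fun z => ?_
      simp [Set.indicator_apply, mul_comm]
    refine ⟨hs, ?_⟩
    rw [hs.tsum_prod]
    refine tsum_congr fun l => ?_
    rw [← tsum_mul_right]
    exact tsum_congr fun k => by simp [ite_mul]
  obtain ⟨hs1, e1⟩ := key a b hF'
  obtain ⟨hs2, e2⟩ := key b a hF
  have hs3 : Summable fun z : ℤ × ℤ => if z.1 - z.2 ∈ Finset.Icc (-1 : ℤ) 1 then a z.1 * b z.2 else 0 := by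
    refine (hF.indicator {z | z.1 - z.2 ∈ Finset.Icc (-1 : ℤ) 1}).congr fun z => ?_
    simp [Set.indicator_apply]
  have e3 : ∑' l, ∑ ν ∈ Finset.Icc (-1 : ℤ) 1, a l * b (l - ν) =
      ∑' z : ℤ × ℤ, if z.1 - z.2 ∈ Finset.Icc (-1 : ℤ) 1 then a z.1 * b z.2 else 0 := by
    rw [hs3.tsum_prod]
    refine tsum_congr fun l => ?_
    rw [← (Equiv.subLeft l).tsum_eq, tsum_eq_sum (s := Finset.Icc (-1 : ℤ) 1)]
    · refine Finset.sum_congr rfl fun ν hν => ?_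
      simp only [Equiv.subLeft_apply, sub_sub_cancel, if_pos hν]
    · intro ν hν
      simp only [Equiv.subLeft_apply, sub_sub_cancel, if_neg hν]
  have hs1' : Summable fun z : ℤ × ℤ => if (Equiv.prodComm ℤ ℤ z).2 < (Equiv.prodComm ℤ ℤ z).1 - 1
      then a (Equiv.prodComm ℤ ℤ z).2 * b (Equiv.prodComm ℤ ℤ z).1 else 0 :=
    hs1.comp_injective (Equiv.prodComm ℤ ℤ).injective
  rw [e1, e2, e3, ← (Equiv.prodComm ℤ ℤ).tsum_eq, tsum_mul_tsum_of_summable_norm ha hb,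
    ← Summable.tsum_add hs1' hs2, ← Summable.tsum_add (hs1'.add hs2) hs3]
  refine tsum_congr fun z => ?_
  obtain ⟨x, y⟩ := z
  change (if x < y - 1 then a x * b y else 0) + (if y < x - 1 then b y * a x else 0) +
    (if x - y ∈ Finset.Icc (-1 : ℤ) 1 then a x * b y else 0) = a x * b y
  split_ifs with h1 h2 h3 h3 h2 h3 h3 <;> simp only [Finset.mem_Icc] at * <;>
    first | omega | ring

variable {n : ℕ} (P : LPPair n)

theorem eLpNorm_mul_le_of_inv {p q r : ℝ≥0∞} (hp : 1 ≤ p) (hq : 1 ≤ q)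
    (hr : 1 ≤ r) (hpqr : r⁻¹ = p⁻¹ + q⁻¹) {f g : Rn n → ℂ} (hf : AEStronglyMeasurable f volume)
    (hg : AEStronglyMeasurable g volume) :
    eLpNorm (fun x => f x * g x) r volume ≤ eLpNorm f p volume * eLpNorm g q volume := by
  have h := eLpNorm_ennreal_mul_le hp hq hr hpqr hf.enorm hg.enorm
  rw [eLpNorm_enorm, eLpNorm_enorm] at h
  refine le_trans (le_of_eq ?_) h
  rw [← eLpNorm_enorm]
  simp only [enorm_mul]

/-- Absolute convergence in `L^r` bounds the sum of the pairings by `testNorm`, so the limit exists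
as a tempered distribution and equals the pointwise sum. -/
theorem exists_hasSum_of_tsum_eLpNorm {r : ℝ≥0∞} (hr : 1 ≤ r) {F : ℤ → Rn n → ℂ} {τ : ℤ → TD n}
    (hτ : ∀ l, Represents (τ l) (F l)) (hs : ∑' l, eLpNorm (F l) r volume < ∞) :
    ∃ a : TD n, HasSum τ a ∧ Represents a (fun x => ∑' l, F l x) := by
  have hn : ∑' l, lpNorm r (τ l) < ∞ := by
    simpa only [fun l => lpNorm_eq (hτ l) r] using hs
  have hsum := summable_apply_of_lpNorm hr hn
  obtain ⟨a, ha⟩ := exists_TD_of_bound (one_le_conjExp r) hn (Λ := fun ψ => ∑' l, τ l ψ)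
    (fun ψ₁ ψ₂ => by simp only [map_add]; exact (hsum ψ₁).tsum_add (hsum ψ₂))
    (fun c ψ => by simp only [map_smul, smul_eq_mul, tsum_mul_left]) fun ψ => by
      refine enorm_tsum_le_tsum_enorm.trans ?_
      rw [← ENNReal.tsum_mul_right]
      refine ENNReal.tsum_le_tsum fun l => ?_
      refine (enorm_apply_le hr ((ENNReal.le_tsum l).trans_lt hn) ψ).trans ?_
      gcongr
      exact le_self_add
  have hsa : HasSum τ a := hasSum_TD_iff.2 fun ψ => by rw [ha]; exact (hsum ψ).hasSum
  exact ⟨a, hsa, (represents_of_hasSum hr hτ hs hsa).1⟩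

/-- Distributions in `𝓢'_h` whose Littlewood-Paley series converges absolutely in `L^q`. -/
def AbsSummable (q : ℝ≥0∞) (u : TD n) : Prop :=
  IsSh P u ∧ ∑' j, lpNorm q (lpProj P j u) < ∞

theorem AbsSummable.exists_represents {q : ℝ≥0∞} (hq : 1 ≤ q) {u : TD n}
    (hu : AbsSummable P q u) : ∃ g : ℤ → Rn n → ℂ,
      (∀ j, Represents (lpProj P j u) (g j)) ∧ ∑' j, eLpNorm (g j) q volume < ∞ ∧
      (∀ᵐ x, Summable fun j => ‖g j x‖) ∧
      Represents u (fun x => ∑' j, g j x) ∧ MemLp (fun x => ∑' j, g j x) q volume ∧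
      ∀ l, Represents (lowFreq P l u) (fun x => ∑' j, if j < l then g j x else 0) ∧
        eLpNorm (fun x => ∑' j, if j < l then g j x else 0) q volume ≤
          ∑' j, eLpNorm (g j) q volume := by
  choose g hg hg' using fun j => BesovNS.exists_represents
    (lt_of_le_of_lt (ENNReal.le_tsum (f := fun j => lpNorm q (lpProj P j u)) j) hu.2)
  have hs : ∑' j, eLpNorm (g j) q volume < ∞ := by
    simpa only [fun l => lpNorm_eq (hg l) q] using hu.2
  have hsum := summable_apply_of_lpNorm hq hu.2
  obtain ⟨h1, h2, -, h4⟩ := represents_of_hasSum hq hg hs (hasSum_lpProj P hu.1 hsum)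
  refine ⟨g, hg, hs, h4, h1, h2, fun l => ?_⟩
  have h5 : ∑' j, eLpNorm (fun x => if j < l then g j x else 0) q volume ≤
      ∑' j, eLpNorm (g j) q volume := ENNReal.tsum_le_tsum fun j => by
    by_cases h : j < l <;> simp [h]
  have h8 : ∀ j, Represents (if j < l then lpProj P j u else 0)
      (fun x => if j < l then g j x else 0) := fun j => by
    by_cases h : j < l
    · simpa [h] using hg j
    · simpa [h] using represents_zero
  obtain ⟨h6, -, h7, -⟩ := represents_of_hasSum hq h8 (h5.trans_lt hs)
    (hasSum_lpProj_lt P hu.1 hsum l)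
  exact ⟨h6, h7.trans h5⟩

/-- Products of absolutely summable distributions are given by Bony's decomposition. -/
theorem AbsSummable.isBony {q₁ q₂ r : ℝ≥0∞} (h₁ : 1 ≤ q₁) (h₂ : 1 ≤ q₂) (hr : 1 ≤ r)
    (hqr : r⁻¹ = q₁⁻¹ + q₂⁻¹) {u v : TD n} (hu : AbsSummable P q₁ u) (hv : AbsSummable P q₂ v) :
    ∃ (w : TD n) (g h : Rn n → ℂ), Represents u g ∧ Represents v h ∧
      Represents w (fun x => g x * h x) ∧ MemLp (fun x => g x * h x) r volume ∧
      IsBony P u v w := by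
  obtain ⟨g, hg, hgs, hgx, hgu, hgm, hgl⟩ := hu.exists_represents P h₁
  obtain ⟨h, hh, hhs, hhx, hhv, hhm, hhl⟩ := hv.exists_represents P h₂
  have hm : ∀ {u : TD n} {f}, Represents u f → AEStronglyMeasurable f volume :=
    fun h => h.1.aestronglyMeasurable
  have holder : ∀ {f k : Rn n → ℂ}, AEStronglyMeasurable f volume →
      AEStronglyMeasurable k volume → eLpNorm (fun x => f x * k x) r volume ≤
        eLpNorm f q₁ volume * eLpNorm k q₂ volume :=
    fun hf hk => eLpNorm_mul_le_of_inv h₁ h₂ hr hqr hf hk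
  have hprod : ∀ {f k : Rn n → ℂ}, AEStronglyMeasurable f volume → AEStronglyMeasurable k volume →
      eLpNorm f q₁ volume < ∞ → eLpNorm k q₂ volume < ∞ →
      ∃ w : TD n, Represents w (fun x => f x * k x) := fun hf hk h1 h2 =>
    exists_TD_of_memLp hr ⟨hf.mul hk, (holder hf hk).trans_lt (ENNReal.mul_lt_top h1 h2)⟩
  set N₁ := ∑' j, eLpNorm (g j) q₁ volume with hN₁
  set N₂ := ∑' j, eLpNorm (h j) q₂ volume with hN₂
  have hgj : ∀ j, eLpNorm (g j) q₁ volume ≤ N₁ := fun j => ENNReal.le_tsum j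
  have hhj : ∀ j, eLpNorm (h j) q₂ volume ≤ N₂ := fun j => ENNReal.le_tsum j
  obtain ⟨w, hw⟩ := hprod (hm hgu) (hm hhv) hgm.2 hhm.2
  have hwm : MemLp (fun x => (∑' j, g j x) * ∑' j, h j x) r volume :=
    ⟨(hm hgu).mul (hm hhv), (holder (hm hgu) (hm hhv)).trans_lt (ENNReal.mul_lt_top hgm.2 hhm.2)⟩
  have hpara1 : ∀ l, eLpNorm
      (fun x => (∑' k, if k < l - 1 then g k x else 0) * h l x) r volume ≤
      N₁ * eLpNorm (h l) q₂ volume := fun l =>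
    (holder (hm (hgl (l - 1)).1) (hm (hh l))).trans (by gcongr; exact (hgl (l - 1)).2)
  have hpara2 : ∀ l, eLpNorm
      (fun x => (∑' k, if k < l - 1 then h k x else 0) * g l x) r volume ≤
      eLpNorm (g l) q₁ volume * N₂ := fun l => by
    simp only [mul_comm _ (g l _)]
    exact (holder (hm (hg l)) (hm (hhl (l - 1)).1)).trans (by gcongr; exact (hhl (l - 1)).2)
  choose τ hτ using fun l => hprod (hm (hgl (l - 1)).1) (hm (hh l))
    ((hgl (l - 1)).2.trans_lt hgs) ((hhj l).trans_lt hhs)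
  have hτ'ex : ∀ l, ∃ w : TD n,
      Represents w (fun x => (∑' k, if k < l - 1 then h k x else 0) * g l x) := fun l => by
    simpa only [mul_comm] using hprod (hm (hg l)) (hm (hhl (l - 1)).1)
      ((hgj l).trans_lt hgs) ((hhl (l - 1)).2.trans_lt hhs)
  choose τ' hτ' using hτ'ex
  choose ρ hρ using fun l ν => hprod (hm (hg l)) (hm (hh (l - ν)))
    ((hgj l).trans_lt hgs) ((hhj (l - ν)).trans_lt hhs)
  obtain ⟨a, has, ha⟩ := exists_hasSum_of_tsum_eLpNorm hr hτ (by
    refine (ENNReal.tsum_le_tsum hpara1).trans_lt ?_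
    rw [ENNReal.tsum_mul_left]
    exact ENNReal.mul_lt_top hgs hhs)
  obtain ⟨b, hbs, hb⟩ := exists_hasSum_of_tsum_eLpNorm hr hτ' (by
    refine (ENNReal.tsum_le_tsum hpara2).trans_lt ?_
    rw [ENNReal.tsum_mul_right]
    exact ENNReal.mul_lt_top hgs hhs)
  obtain ⟨c, hcs, hc⟩ := exists_hasSum_of_tsum_eLpNorm hr
    (τ := fun l => ∑ ν ∈ Finset.Icc (-1 : ℤ) 1, ρ l ν)
    (fun l => Represents.sum _ fun ν _ => hρ l ν) (by
    -- The factor `3` counts the shifts `ν` in `{-1, 0, 1}`, each bounded by the full sum `N₂`.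
    refine (ENNReal.tsum_le_tsum (g := fun l => eLpNorm (g l) q₁ volume * (3 * N₂))
      fun l => ?_).trans_lt ?_
    · have hle := eLpNorm_sum_le (s := Finset.Icc (-1 : ℤ) 1) (p := r)
        (f := fun (ν : ℤ) x => g l x * h (l - ν) x)
        (fun ν _ => (hm (hg l)).mul (hm (hh (l - ν)))) hr
      refine (le_of_eq ?_).trans (hle.trans ?_)
      · congr 1
      · refine (Finset.sum_le_sum fun ν _ => (holder (hm (hg l)) (hm (hh (l - ν)))).trans
          (mul_le_mul_right (hhj (l - ν)) _)).trans (le_of_eq ?_)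
        rw [Finset.sum_const]
        rw [Int.card_Icc, nsmul_eq_mul, show (1 + 1 - (-1) : ℤ).toNat = 3 from rfl]
        push_cast
        ring
    · rw [ENNReal.tsum_mul_right]
      exact ENNReal.mul_lt_top hgs (ENNReal.mul_lt_top (by simp) hhs))
  refine ⟨w, _, _, hgu, hhv, hw, hwm, a, b, c, ⟨τ, fun l => ⟨_, _, (hgl (l - 1)).1, hh l, hτ l⟩,
    has⟩, ⟨τ', fun l => ⟨_, _, (hhl (l - 1)).1, hg l, hτ' l⟩, hbs⟩,
    ⟨ρ, fun l ν _ => ⟨_, _, hg l, hh (l - ν), hρ l ν⟩, hcs⟩, ?_⟩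
  refine hw.eq (((ha.add hb).add hc).congr_ae ?_)
  -- At almost every `x` both scalar Littlewood-Paley series converge absolutely, and Bony's formula
  -- is an identity between numbers.
  filter_upwards [hgx, hhx] with x h1 h2
  exact tsum_bony h1 h2

end Bony

/-! ### Time-dependent distributions with absolutely convergent Littlewood-Paley series -/

section TimeDependent

variable {n : ℕ} (P : LPPair n) {T : ℝ}

theorem measurable_eLpNorm_section {U : ℝ → Rn n → ℂ} (hU : Measurable (Function.uncurry U))
    (p : ℝ≥0∞) : Measurable fun t => eLpNorm (U t) p volume := by
  have := measurable_eLpNorm_of_uncurry (ν := (volume : Measure (Rn n)))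
    (F := fun s x => ‖U s x‖ₑ) hU.enorm p
  simpa only [eLpNorm_enorm] using this

theorem aemeasurable_lpNorm {p : ℝ≥0∞} {u : ℝ → TD n}
    (hm : ∀ ψ : 𝓢(Rn n, ℂ), Measurable (fun t : Set.Ioo (0 : ℝ) T => u t ψ))
    (hr : ∀ᵐ t ∂(timeMeasure T), lpNorm p (u t) < ∞) :
    AEMeasurable (fun t => lpNorm p (u t)) (timeMeasure T) := by
  obtain ⟨U, hU, hrep⟩ := exists_measurable_represents hm
    (hr.mono fun t ht => (exists_represents ht).imp fun g hg => hg.1)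
  refine ⟨_, measurable_eLpNorm_section hU p, ?_⟩
  filter_upwards [hrep] with t ht
  exact lpNorm_eq ht p

theorem cheminLernerNorm_zero_one (α p : ℝ≥0∞) (u : ℝ → TD n) :
    cheminLernerNorm P T α 0 p 1 u = ∑' l : ℤ, timeLpNorm T α p (fun t => lpProj P l (u t)) := by
  simp [cheminLernerNorm, eLpNorm_one_eq_lintegral_enorm, lintegral_count]

theorem measurable_op_apply {u : ℝ → TD n}
    (hm : ∀ ψ : 𝓢(Rn n, ℂ), Measurable (fun t : Set.Ioo (0 : ℝ) T => u t ψ)) (m : Rn n → ℂ)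
    (ψ : 𝓢(Rn n, ℂ)) : Measurable (fun t : Set.Ioo (0 : ℝ) T => op m (u t) ψ) := by
  simpa only [op_apply] using hm (dualS m ψ)

/-- A jointly measurable representative with values in `L^q`, of class `L^α` in time. -/
structure TimeRep (T : ℝ) (α q : ℝ≥0∞) (u : ℝ → TD n) (U : ℝ → Rn n → ℂ) : Prop where
  meas : Measurable (Function.uncurry U)
  rep : ∀ᵐ t ∂(timeMeasure T), Represents (u t) (U t) ∧ MemLp (U t) q volume
  fin : eLpNorm (fun t => eLpNorm (U t) q volume) α (timeMeasure T) < ∞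

theorem exists_timeRep {α q : ℝ≥0∞} {u : ℝ → TD n}
    (hm : ∀ ψ : 𝓢(Rn n, ℂ), Measurable (fun t : Set.Ioo (0 : ℝ) T => u t ψ))
    (hr : ∀ᵐ t ∂(timeMeasure T), lpNorm q (u t) < ∞) (hfin : timeLpNorm T α q u < ∞) :
    ∃ U, TimeRep T α q u U := by
  obtain ⟨U, hU, hrep⟩ := exists_measurable_represents hm
    (hr.mono fun t ht => (exists_represents ht).imp fun g hg => hg.1)
  refine ⟨U, hU, ?_, ?_⟩
  · filter_upwards [hrep, hr] with t ht ht'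
    rw [lpNorm_eq ht] at ht'
    exact ⟨ht, ht.1.aestronglyMeasurable, ht'⟩
  · refine lt_of_le_of_lt (eLpNorm_ennreal_mono_ae α ?_) hfin
    filter_upwards [hrep] with t ht
    rw [lpNorm_eq ht]

/-- With third index `1`, the triangle inequality in `L^α_T` bounds the sum of the block norms in
`L^α_T`. Hence this sum is finite for almost every `t`. -/
theorem MemCheminLerner.absSummable {α q : ℝ≥0∞} (hα : 1 ≤ α) (hq : 1 ≤ q) {u : ℝ → TD n}
    (h : MemCheminLerner P T α 0 q 1 u) :
    (∀ᵐ t ∂(timeMeasure T), AbsSummable P q (u t)) ∧ ∃ U, TimeRep T α q u U := by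
  obtain ⟨⟨-, hm⟩, hsh, hfin, hN⟩ := h
  rw [cheminLernerNorm_zero_one] at hN
  have hmeas : ∀ j, AEMeasurable (fun t => lpNorm q (lpProj P j (u t))) (timeMeasure T) := fun j =>
    aemeasurable_lpNorm (measurable_op_apply hm _) (hfin j)
  have hle := (eLpNorm_tsum_le hmeas hα).trans_lt hN
  have hae := ae_lt_top_of_eLpNorm_lt_top (zero_lt_one.trans_le hα).ne'
    (AEMeasurable.tsum hmeas) hle
  have habs : ∀ᵐ t ∂(timeMeasure T), AbsSummable P q (u t) := by
    filter_upwards [hae, hsh] with t h1 h2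
    exact ⟨h2, h1⟩
  have hbd : ∀ᵐ t ∂(timeMeasure T), lpNorm q (u t) ≤ ∑' j, lpNorm q (lpProj P j (u t)) := by
    filter_upwards [habs] with t ht
    exact lpNorm_le_tsum_of_hasSum hq (hasSum_lpProj P ht.1 (summable_apply_of_lpNorm hq ht.2))
  refine ⟨habs, exists_timeRep hm ?_ ((eLpNorm_ennreal_mono_ae α hbd).trans_lt hle)⟩
  filter_upwards [hbd, hae] with t h1 h2
  exact h1.trans_lt h2

/-- The exponent of a product. -/
def holderExp (p q : ℝ≥0∞) : ℝ≥0∞ := (p⁻¹ + q⁻¹)⁻¹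

theorem inv_holderExp (p q : ℝ≥0∞) : (holderExp p q)⁻¹ = p⁻¹ + q⁻¹ := inv_inv _

/-- This is where exponents at least `2` are needed: the product must lie in a Lebesgue space with
exponent at least `1`. -/
theorem one_le_holderExp {p q : ℝ≥0∞} (hp : 2 ≤ p) (hq : 2 ≤ q) : 1 ≤ holderExp p q := by
  rw [holderExp, ENNReal.one_le_inv]
  calc p⁻¹ + q⁻¹ ≤ 2⁻¹ + 2⁻¹ := add_le_add (ENNReal.inv_le_inv.2 hp) (ENNReal.inv_le_inv.2 hq)
    _ = 1 := ENNReal.inv_two_add_inv_two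

theorem lintegral_timeMeasure_lt_top {β : ℝ≥0∞} (hβ : 1 ≤ β) {N : ℝ → ℝ≥0∞} (hm : Measurable N)
    (h : eLpNorm N β (timeMeasure T) < ∞) : ∫⁻ s, N s ∂(timeMeasure T) < ∞ := by
  have h1 := eLpNorm_ennreal_mul_le (ν := timeMeasure T) hβ (one_le_conjExp β) le_rfl
    (by rw [inv_add_inv_conjExp hβ, inv_one]) hm.aemeasurable
    (aemeasurable_const (b := (1 : ℝ≥0∞)))
  simp only [mul_one, eLpNorm_one_eq_lintegral_enorm, enorm_eq_self] at h1
  refine h1.trans_lt (ENNReal.mul_lt_top h ?_)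
  have : IsFiniteMeasure (timeMeasure T) := ⟨by simp [timeMeasure]⟩
  have h2 := (memLp_const (μ := timeMeasure T) (p := conjExp β) (1 : ℝ)).2
  rw [← eLpNorm_enorm] at h2
  simpa using h2

theorem TimeRep.mul {α₁ α₂ q₁ q₂ : ℝ≥0∞} (hα₁ : 2 ≤ α₁) (hα₂ : 2 ≤ α₂) (hq₁ : 2 ≤ q₁)
    (hq₂ : 2 ≤ q₂) {u v : ℝ → TD n} {U V : ℝ → Rn n → ℂ} (hU : TimeRep T α₁ q₁ u U)
    (hV : TimeRep T α₂ q₂ v V) :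
    TimeInt T (holderExp q₁ q₂) (fun t x => U t x * V t x) ∧
      eLpNorm (fun t => eLpNorm (fun x => U t x * V t x) (holderExp q₁ q₂) volume)
        (holderExp α₁ α₂) (timeMeasure T) < ∞ := by
  have one_le : ∀ {x : ℝ≥0∞}, 2 ≤ x → 1 ≤ x := fun h => le_trans (by norm_num) h
  have hmeas : Measurable (Function.uncurry fun t x => U t x * V t x) := hU.meas.mul hV.meas
  have hfin : eLpNorm (fun t => eLpNorm (fun x => U t x * V t x) (holderExp q₁ q₂) volume)
      (holderExp α₁ α₂) (timeMeasure T) < ∞ := by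
    refine lt_of_le_of_lt (eLpNorm_ennreal_mono_ae _ (g := fun t =>
      eLpNorm (U t) q₁ volume * eLpNorm (V t) q₂ volume) ?_) (lt_of_le_of_lt
      (eLpNorm_ennreal_mul_le (one_le hα₁) (one_le hα₂) (one_le_holderExp hα₁ hα₂)
        (inv_holderExp _ _) (measurable_eLpNorm_section hU.meas _).aemeasurable
        (measurable_eLpNorm_section hV.meas _).aemeasurable) (ENNReal.mul_lt_top hU.fin hV.fin))
    filter_upwards [hU.rep, hV.rep] with t h1 h2
    exact eLpNorm_mul_le_of_inv (one_le hq₁) (one_le hq₂) (one_le_holderExp hq₁ hq₂)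
      (inv_holderExp _ _) h1.2.1 h2.2.1
  exact ⟨⟨hmeas, one_le_holderExp hq₁ hq₂, lintegral_timeMeasure_lt_top
    (one_le_holderExp hα₁ hα₂) (measurable_eLpNorm_section hmeas _) hfin⟩, hfin⟩

/-- Vector fields that are the sum of two fields in Chemin-Lerner spaces. -/
def IsSplit (T : ℝ) (α q : Bool → ℝ≥0∞) (u : ℝ → Fin n → TD n) : Prop :=
  ∃ a : Bool → ℝ → Fin n → TD n,
    (∀ c i, MemCheminLerner P T (α c) 0 (q c) 1 (fun t => a c t i)) ∧
    ∀ᵐ t ∂(timeMeasure T), u t = a true t + a false t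

theorem MemSum.isSplit {α₁ p₁ α₂ p₂ : ℝ≥0∞} {u : ℝ → Fin n → TD n}
    (h : MemSum P T α₁ p₁ α₂ p₂ u) :
    IsSplit P T (fun c => bif c then α₁ else α₂) (fun c => bif c then p₁ else p₂) u := by
  obtain ⟨-, a, b, ha, hb, hu⟩ := h
  refine ⟨fun c => bif c then a else b, fun c i => ?_, hu⟩
  cases c
  · exact hb i
  · exact ha i

/-- The pieces of a tensor product, together with the distributions obtained from them. -/
structure ProductData (P : LPPair n) (T : ℝ) {ι : Type*} [Fintype ι] (r β : ι → ℝ≥0∞)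
    (u v : ℝ → Fin n → TD n) (ω : ι → Fin n → Fin n → ℝ → Rn n → ℂ) : Prop where
  timeInt : ∀ c j k, TimeInt T (r c) (ω c j k)
  fin : ∀ c j k, eLpNorm (fun t => eLpNorm (ω c j k t) (r c) volume) (β c) (timeMeasure T) < ∞
  ex : ∀ᵐ t ∂(timeMeasure T), ∃ W : Fin n → Fin n → TD n,
    (∀ i j, IsPointwiseProduct (u t i) (v t j) (W i j)) ∧
    ∃ w : Fin n → TD n, IsLerayDiv W w ∧ IsLerayDivLP P W w ∧
      ∀ i τ, 0 ≤ τ → ∀ ψ, heat τ (w i) ψ =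
        ∑ c, ∑ j, ∑ k, ∫ y, ω c j k t y * dual (heatMul (leraySym i j k) τ) ψ y

/-- Bilinearity: each of the four products of summands satisfies Bony's formula and lies in its own
Lebesgue space, and every relation involved is additive. -/
theorem IsSplit.exists_productData {α q : Bool → ℝ≥0∞} (hα : ∀ c, 2 ≤ α c) (hq : ∀ c, 2 ≤ q c)
    {u v : ℝ → Fin n → TD n} (hu : IsSplit P T α q u) (hv : IsSplit P T α q v) :
    (∃ ω, ProductData P T (ι := Bool × Bool) (fun c => holderExp (q c.1) (q c.2))
      (fun c => holderExp (α c.1) (α c.2)) u v ω) ∧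
    ∀ᵐ t ∂(timeMeasure T), ∀ i j, ∃ w, IsPointwiseProduct (u t i) (v t j) w ∧
      IsBony P (u t i) (v t j) w := by
  have one_le : ∀ {x : ℝ≥0∞}, 2 ≤ x → 1 ≤ x := fun h => le_trans (by norm_num) h
  obtain ⟨a, ha, hua⟩ := hu
  obtain ⟨b, hb, hvb⟩ := hv
  have ha' := fun c i => (ha c i).absSummable P (one_le (hα c)) (one_le (hq c))
  have hb' := fun c i => (hb c i).absSummable P (one_le (hα c)) (one_le (hq c))
  choose haA U hU using ha'
  choose hbA V hV using hb'
  have hmul := fun (c : Bool × Bool) j k =>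
    (hU c.1 j).mul (hα c.1) (hα c.2) (hq c.1) (hq c.2) (hV c.2 k)
  have hpieces : ∀ᵐ t ∂(timeMeasure T), ∀ c d i j, ∃ w,
      IsPointwiseProduct (a c t i) (b d t j) w ∧ IsBony P (a c t i) (b d t j) w ∧
      Represents w (fun x => U c i t x * V d j t x) ∧
      MemLp (fun x => U c i t x * V d j t x) (holderExp (q c) (q d)) volume := by
    simp only [eventually_all]
    intro c d i j
    filter_upwards [haA c i, hbA d j, (hU c i).rep, (hV d j).rep] with t h1 h2 h3 h4
    obtain ⟨w, g, h, hg, hh, hw, hwm, hB⟩ := h1.isBony P (one_le (hq c)) (one_le (hq d))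
      (one_le_holderExp (hq c) (hq d)) (inv_holderExp _ _) h2
    have e : (fun x => g x * h x) =ᵐ[volume] fun x => U c i t x * V d j t x := by
      filter_upwards [hg.ae_eq h3.1, hh.ae_eq h4.1] with x e1 e2
      rw [e1, e2]
    exact ⟨w, ⟨g, h, hg, hh, hw⟩, hB, hw.congr_ae e, hwm.ae_eq e⟩
  refine ⟨⟨fun c j k t x => U c.1 j t x * V c.2 k t x, fun c j k => (hmul c j k).1,
    fun c j k => (hmul c j k).2, ?_⟩, ?_⟩
  · filter_upwards [hpieces, hua, hvb] with t ht hut hvt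
    choose w hw hB hr hm using ht
    refine ⟨fun i j => w true true i j + w true false i j +
      (w false true i j + w false false i j), fun i j => ?_, ?_⟩
    · rw [hut, hvt]
      exact ((hw true true i j).add_right (hw true false i j)).add_left
        ((hw false true i j).add_right (hw false false i j))
    · have hact := fun c d i j => actedOn_of_memLp P (one_le_holderExp (hq c) (hq d))
        (hm c d i j) (hr c d i j)
      obtain ⟨z, h1, h2, h3⟩ := exists_isLerayDiv P fun i j =>
        ((hact true true i j).add P (hact true false i j)).add P
        ((hact false true i j).add P (hact false false i j))
      refine ⟨z, h1, h2, fun i τ hτ ψ => ?_⟩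
      rw [h3 i τ hτ ψ]
      have hint := fun c d j k => (sym1_leraySym i j k).integrable_mul_dual P hτ
        (one_le_holderExp (hq c) (hq d)) (hm c d j k) ψ
      rw [Fintype.sum_prod_type, Fintype.sum_bool, Fintype.sum_bool, Fintype.sum_bool]
      simp only [← Finset.sum_add_distrib]
      refine Finset.sum_congr rfl fun j _ => Finset.sum_congr rfl fun k _ => ?_
      simp only [add_mul]
      refine (integral_add ((hint true true j k).add (hint true false j k))
          ((hint false true j k).add (hint false false j k))).trans ?_
      exact congrArg₂ (· + ·) (integral_add (hint true true j k) (hint true false j k))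
        (integral_add (hint false true j k) (hint false false j k))
  · filter_upwards [hpieces, hua, hvb] with t ht hut hvt i j
    choose w hw hB hr hm using ht
    rw [hut, hvt]
    exact ⟨_, ((hw true true i j).add_right (hw true false i j)).add_left
        ((hw false true i j).add_right (hw false false i j)),
      ((hB true true i j).add_right (hB true false i j)).add_left
        ((hB false true i j).add_right (hB false false i j))⟩

end TimeDependent

/-! ### Duhamel integrals of sums of pieces -/

section DuhamelPieces

variable {n : ℕ} (P : LPPair n) {T : ℝ}

theorem IsDuhamel.unique {w g g' : ℝ → TD n} (h : IsDuhamel T w g) (h' : IsDuhamel T w g') {t : ℝ}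
    (ht : t ∈ Set.Ioo 0 T) : g t = g' t := by
  ext ψ
  rw [(h t ht ψ).2, (h' t ht ψ).2]

theorem sum_TD_apply {κ : Type*} (s : Finset κ) (a : κ → TD n) (ψ : 𝓢(Rn n, ℂ)) :
    (∑ c ∈ s, a c) ψ = ∑ c ∈ s, a c ψ := by
  simp

/-- The scalar Duhamel integrals depend only on the functions `ω`. One choice therefore serves every
`w` on which the heat flow acts through these functions. -/
theorem exists_isDuhamel_sum (P : LPPair n) {ι : Type*} [Fintype ι] {r : ι → ℝ≥0∞}
    {ω : ι → Fin n → Fin n → ℝ → Rn n → ℂ} (hω : ∀ c j k, TimeInt T (r c) (ω c j k)) :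
    ∃ g : ι → Fin n → Fin n → Fin n → ℝ → TD n,
      (∀ c i j k, IsScalarDuhamel (leraySym i j k) T (ω c j k) (g c i j k)) ∧
      ∀ w : ℝ → Fin n → TD n, (∀ᵐ s ∂(timeMeasure T), ∀ i τ, 0 ≤ τ → ∀ ψ, heat τ (w s i) ψ =
        ∑ c, ∑ j, ∑ k, ∫ y, ω c j k s y * dual (heatMul (leraySym i j k) τ) ψ y) →
      ∀ i, IsDuhamel T (fun t => w t i) (fun t => ∑ c, ∑ j, ∑ k, g c i j k t) := by
  choose g hg using fun c i j k => (sym1_leraySym i j k).exists_isScalarDuhamel P (hω c j k)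
  refine ⟨g, hg, fun w hw i t ht ψ => ?_⟩
  rw [intervalIntegrable_iff_timeMeasure ht.1.le, intervalIntegral_eq_timeMeasure ht.1.le]
  have hint := fun c j k => (sym1_leraySym i j k).integrable_pairInt P (hω c j k) ht ψ
  have e : (fun s => heat (t - s) (w s i) ψ) =ᵐ[timeMeasure t]
      fun s => ∑ c, ∑ j, ∑ k, pairInt (heatMul (leraySym i j k)) (ω c j k) t ψ s := by
    filter_upwards [ae_timeMeasure_mono ht.2.le hw, ae_mem_timeMeasure t] with s hs hst
    exact hs i (t - s) (by linarith [hst.2]) ψ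
  have hI : Integrable (fun s => ∑ c, ∑ j, ∑ k, pairInt (heatMul (leraySym i j k)) (ω c j k) t ψ s)
      (timeMeasure t) := integrable_finsetSum _ fun c _ => integrable_finsetSum _ fun j _ =>
    integrable_finsetSum _ fun k _ => hint c j k
  refine ⟨hI.congr e.symm, ?_⟩
  rw [integral_congr_ae e, integral_finsetSum _ fun c _ => integrable_finsetSum _ fun j _ =>
    integrable_finsetSum _ fun k _ => hint c j k]
  simp only [sum_TD_apply]
  refine Finset.sum_congr rfl fun c _ => ?_
  rw [integral_finsetSum _ fun j _ => integrable_finsetSum _ fun k _ => hint c j k]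
  refine Finset.sum_congr rfl fun j _ => ?_
  rw [integral_finsetSum _ fun k _ => hint c j k]
  exact Finset.sum_congr rfl fun k _ => hg c i j k t ht ψ

/-- `B[u,v]` exists, and is a sum of scalar Duhamel integrals. -/
theorem ProductData.exists_isB {ι : Type*} [Fintype ι] {r β : ι → ℝ≥0∞}
    {u v : ℝ → Fin n → TD n} {ω : ι → Fin n → Fin n → ℝ → Rn n → ℂ}
    (h : ProductData P T r β u v ω) : ∃ g : ι → Fin n → Fin n → Fin n → ℝ → TD n,
      (∀ c i j k, IsScalarDuhamel (leraySym i j k) T (ω c j k) (g c i j k)) ∧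
      IsB T u v (fun t i => ∑ c, ∑ j, ∑ k, g c i j k t) ∧
      ∀ b, IsB T u v b → ∀ t ∈ Set.Ioo 0 T, ∀ i, b t i = ∑ c, ∑ j, ∑ k, g c i j k t := by
  obtain ⟨g, hg, hw⟩ := exists_isDuhamel_sum P h.timeInt
  refine ⟨g, hg, ?_, ?_⟩
  · have hex : ∀ t, ∃ W : Fin n → Fin n → TD n, ∃ w : Fin n → TD n,
        (∃ W : Fin n → Fin n → TD n,
          (∀ i j, IsPointwiseProduct (u t i) (v t j) (W i j)) ∧
          ∃ w : Fin n → TD n, IsLerayDiv W w ∧ IsLerayDivLP P W w ∧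
            ∀ i τ, 0 ≤ τ → ∀ ψ, heat τ (w i) ψ =
              ∑ c, ∑ j, ∑ k, ∫ y, ω c j k t y * dual (heatMul (leraySym i j k) τ) ψ y) →
          (∀ i j, IsPointwiseProduct (u t i) (v t j) (W i j)) ∧ IsLerayDiv W w ∧
            ∀ i τ, 0 ≤ τ → ∀ ψ, heat τ (w i) ψ =
              ∑ c, ∑ j, ∑ k, ∫ y, ω c j k t y * dual (heatMul (leraySym i j k) τ) ψ y := by
      intro t
      by_cases H : ∃ W : Fin n → Fin n → TD n,
          (∀ i j, IsPointwiseProduct (u t i) (v t j) (W i j)) ∧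
          ∃ w : Fin n → TD n, IsLerayDiv W w ∧ IsLerayDivLP P W w ∧
            ∀ i τ, 0 ≤ τ → ∀ ψ, heat τ (w i) ψ =
              ∑ c, ∑ j, ∑ k, ∫ y, ω c j k t y * dual (heatMul (leraySym i j k) τ) ψ y
      · obtain ⟨W, h1, w, h2, -, h4⟩ := H
        exact ⟨W, w, fun _ => ⟨h1, h2, h4⟩⟩
      · exact ⟨0, 0, fun h => absurd h H⟩
    choose W w hWw using hex
    have hall := h.ex.mono hWw
    exact ⟨W, hall.mono fun t ht => ht.1, w, hall.mono fun t ht => ht.2.1,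
      hw w (hall.mono fun t ht => ht.2.2)⟩
  · rintro b ⟨W, hW, w, hL, hb⟩ t ht i
    refine (hb i).unique (hw w ?_ i) ht
    filter_upwards [h.ex, hW, hL] with s ⟨W', h1, w', h2, _, h4⟩ h5 h6
    have e : W s = W' := funext fun i => funext fun j => (h5 i j).unique (h1 i j)
    rw [e] at h6
    rw [h6.unique h2]
    exact h4

/-- Product, Bony product, `ℙ∇·` and its dyadic version are all single-valued. For almost every `t`
they exist and agree, so the witnesses for one operator serve the other with the same Duhamel
integral. -/
theorem ProductData.isB_iff {ι : Type*} [Fintype ι] {r β : ι → ℝ≥0∞}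
    {u v : ℝ → Fin n → TD n} {ω : ι → Fin n → Fin n → ℝ → Rn n → ℂ}
    (h : ProductData P T r β u v ω)
    (hB : ∀ᵐ t ∂(timeMeasure T), ∀ i j, ∃ w, IsPointwiseProduct (u t i) (v t j) w ∧
      IsBony P (u t i) (v t j) w) (b : ℝ → Fin n → TD n) : IsB T u v b ↔ IsBTilde P T u v b := by
  have key : ∀ᵐ t ∂(timeMeasure T), ∃ W : Fin n → Fin n → TD n,
      (∀ i j, IsPointwiseProduct (u t i) (v t j) (W i j) ∧ IsBony P (u t i) (v t j) (W i j)) ∧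
      ∃ w : Fin n → TD n, IsLerayDiv W w ∧ IsLerayDivLP P W w := by
    filter_upwards [h.ex, hB] with t ⟨W, h1, w, h2, h3, _⟩ h4
    refine ⟨W, fun i j => ⟨h1 i j, ?_⟩, w, h2, h3⟩
    obtain ⟨z, hz1, hz2⟩ := h4 i j
    rwa [(h1 i j).unique hz1]
  constructor
  · rintro ⟨W, hW, w, hL, hb⟩
    refine ⟨W, w, ?_, ?_, hb⟩
    · filter_upwards [key, hW] with t ⟨W', h1, _⟩ h5 i j
      rw [(h5 i j).unique (h1 i j).1]
      exact (h1 i j).2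
    · filter_upwards [key, hW, hL] with t ⟨W', h1, w', h2, h3⟩ h5 h6
      have e : W t = W' := funext fun i => funext fun j => (h5 i j).unique (h1 i j).1
      rw [e] at h6 ⊢
      rwa [h6.unique h2]
  · rintro ⟨W, w, hW, hL, hb⟩
    refine ⟨W, ?_, w, ?_, hb⟩
    · filter_upwards [key, hW] with t ⟨W', h1, _⟩ h5 i j
      rw [(h5 i j).unique (h1 i j).2]
      exact (h1 i j).1
    · filter_upwards [key, hW, hL] with t ⟨W', h1, w', h2, h3⟩ h5 h6
      have e : W t = W' := funext fun i => funext fun j => (h5 i j).unique (h1 i j).2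
      rw [e] at h6 ⊢
      rwa [h6.unique h3]

/-- The products and the bilinear operators are well defined on sums of Chemin-Lerner spaces. -/
theorem IsSplit.bilinear {α q : Bool → ℝ≥0∞} (hα : ∀ c, 2 ≤ α c) (hq : ∀ c, 2 ≤ q c)
    {u v : ℝ → Fin n → TD n} (hu : IsSplit P T α q u) (hv : IsSplit P T α q v) :
    (∀ᵐ t ∂(timeMeasure T), ∃ W : Fin n → Fin n → TD n,
      (∀ i j, IsPointwiseProduct (u t i) (v t j) (W i j) ∧ IsBony P (u t i) (v t j) (W i j)) ∧
      ∃ w : Fin n → TD n, IsLerayDiv W w ∧ IsLerayDivLP P W w) ∧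
    (∃ b, IsB T u v b) ∧ ∀ b, IsB T u v b ↔ IsBTilde P T u v b := by
  obtain ⟨⟨ω, hω⟩, hB⟩ := hu.exists_productData P hα hq hv
  obtain ⟨g, -, hg, -⟩ := hω.exists_isB P
  refine ⟨?_, ⟨_, hg⟩, hω.isB_iff P hB⟩
  filter_upwards [hω.ex, hB] with t ⟨W, h1, w, h2, h3, _⟩ h4
  refine ⟨W, fun i j => ⟨h1 i j, ?_⟩, w, h2, h3⟩
  obtain ⟨z, hz1, hz2⟩ := h4 i j
  rwa [(h1 i j).unique hz1]

end DuhamelPieces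

/-! ### The Oseen kernel and Duhamel integrals of integrable matrix fields -/

theorem kap_mul_four_zpow_le {τ : ℝ} (hτ : 0 < τ) (l : ℤ) :
    kap (τ * 4 ^ l) ≤ (ENNReal.ofReal τ ^ 2)⁻¹ * 2 ^ (-((l : ℝ) * 4)) := by
  refine (min_le_right _ _).trans (le_of_eq ?_)
  have h4 : (0 : ℝ) < 4 ^ l := by positivity
  rw [ENNReal.ofReal_mul hτ.le, mul_pow, ENNReal.mul_inv (Or.inr (by simp)) (Or.inl (by simp)),
    ENNReal.inv_pow (a := ENNReal.ofReal (4 ^ l)), ← ENNReal.ofReal_inv_of_pos h4,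
    ofReal_four_zpow_inv, show -((l : ℝ) * 4) = -(l * 2) + -(l * 2) by ring,
    ennreal_two_rpow_add, sq (2 ^ (-((l : ℝ) * 2)))]

theorem kapSum_lt_top {τ : ℝ} (hτ : 0 < τ) : kapSum τ < ∞ := by
  have h0 : ENNReal.ofReal τ ≠ 0 := by simpa using hτ
  refine tsum_int_lt_top (C := 1 + (ENNReal.ofReal τ ^ 2)⁻¹) (a := 1) (b := 3) ?_ one_pos
    (by norm_num) (fun l => ?_) fun l => ?_
  · exact ENNReal.add_lt_top.2 ⟨by simp, ENNReal.inv_lt_top.2 (ENNReal.pow_pos (pos_iff_ne_zero.2 h0) 2)⟩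
  · rw [mul_one, mul_comm]
    gcongr
    exact (kap_le_one _).trans le_self_add
  · have h1 := kap_mul_four_zpow_le hτ l
    calc _ ≤ (2 : ℝ≥0∞) ^ (l : ℝ) * ((ENNReal.ofReal τ ^ 2)⁻¹ * 2 ^ (-((l : ℝ) * 4))) := by gcongr
      _ = (ENNReal.ofReal τ ^ 2)⁻¹ * 2 ^ (-((l : ℝ) * 3)) := by
          rw [show -((l : ℝ) * 3) = l + -(l * 4) by ring, ennreal_two_rpow_add]; ring
      _ ≤ _ := by gcongr; exact le_add_self

/-! ### Absolute convergence of the integral with the kernel of `D e^{τΔ}` -/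

section Scalar

variable {n : ℕ} {D : Rn n → ℂ} {T : ℝ} {ω : ℝ → Rn n → ℂ} {g : ℝ → TD n} {p : ℝ≥0∞}

/-- The integral `∫ |K(t-s,x-y)| |ω(s,y)| dy`, where `K(τ)` is the kernel of `D e^{τΔ}`. -/
def absConv (D : Rn n → ℂ) (ω : ℝ → Rn n → ℂ) (t : ℝ) (x : Rn n) (s : ℝ) : ℝ≥0∞ :=
  ∫⁻ y, ‖𝓕⁻ (heatMul D (t - s)) (x - y)‖ₑ * ‖ω s y‖ₑ

theorem measurable_absConv (hD : Measurable D) (hω : Measurable (Function.uncurry ω)) :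
    Measurable fun z : (ℝ × Rn n) × ℝ => absConv D ω z.1.1 z.1.2 z.2 := by
  have h1 : Measurable fun z : ((ℝ × Rn n) × ℝ) × Rn n => (z.1.1.1 - z.1.2, z.1.1.2 - z.2) :=
    Continuous.measurable (by fun_prop)
  have h2 : Measurable fun z : ((ℝ × Rn n) × ℝ) × Rn n => (z.1.2, z.2) :=
    Continuous.measurable (by fun_prop)
  have h3 := (measurable_fourierInv_uncurry (measurable_heatMul hD)).comp h1
  exact (h3.enorm.mul (hω.comp h2).enorm).lintegral_prod_right'

/-- The potential theory of the kernel of `D e^{τΔ}` on integrable functions of time. -/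
theorem Sym1.exists_absConv_bound (P : LPPair n) (hD : Sym1 D) (h : TimeInt T p ω) :
    ∃ Φ : ℝ → ℝ≥0∞, Measurable Φ ∧ ∫⁻ t, Φ t ∂(timeMeasure T) < ∞ ∧
      ∀ t ∈ Set.Ioo 0 T, ∫⁻ s, eLpNorm (fun x => absConv D ω t x s) p volume ∂(timeMeasure t) ≤
        Φ t := by
  obtain ⟨C, hC, hk⟩ := hD.kerBound_heatMul P
  have hm : Measurable fun τ => C * kapSum τ := measurable_kapSum.const_mul C
  refine ⟨fun t => ∫⁻ s, C * kapSum (t - s) * eLpNorm (ω s) p volume ∂(timeMeasure t), ?_, ?_,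
    fun t ht => lintegral_mono_ae ?_⟩
  · have hf : Measurable fun z : (ℝ × Unit) × ℝ =>
        C * kapSum (z.1.1 - z.2) * eLpNorm (ω z.2) p volume :=
      (hm.comp (by fun_prop)).mul (h.measurable_norm.comp measurable_snd)
    exact (measurable_lintegral_timeMeasure (X := Unit) (f := fun z s =>
      C * kapSum (z.1 - s) * eLpNorm (ω s) p volume) hf).comp (measurable_prodMk_right (y := ()))
  · refine (lintegral_timeConv_le hm h.measurable_norm T).trans_lt (ENNReal.mul_lt_top ?_ h.fin)
    rw [lintegral_const_mul _ measurable_kapSum]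
    exact ENNReal.mul_lt_top hC (lintegral_kapSum_lt_top T)
  · filter_upwards [ae_mem_timeMeasure t] with s hs
    have hτ : 0 < t - s := by linarith [hs.2]
    have hωs : Measurable (ω s) := h.meas.comp measurable_prodMk_left
    refine (eLpNorm_lconv_le_lintegral_mul (μ := (volume : Measure (Rn n))) hωs.enorm
      (hk _ hτ).measurable.enorm h.one_le).trans ?_
    rw [eLpNorm_enorm]
    gcongr
    exact (hk _ hτ).one

/-- Apply Minkowski in `x` for almost every fixed `t`. Joint measurability of the inner integral
then allows passing from almost every `t` and almost every `x` to almost every `(t,x)`. -/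
theorem Sym1.ae_absConv_lt_top (P : LPPair n) (hD : Sym1 D) (h : TimeInt T p ω) :
    ∀ᵐ z ∂((timeMeasure T).prod (volume : Measure (Rn n))),
      ∫⁻ s, absConv D ω z.1 z.2 s ∂(timeMeasure z.1) < ∞ := by
  have hmeas := measurable_absConv hD.meas h.meas
  have hm := measurable_lintegral_timeMeasure
    (f := fun (z : ℝ × Rn n) s => absConv D ω z.1 z.2 s) hmeas
  rw [Measure.ae_prod_iff_ae_ae (measurableSet_lt hm measurable_const)]
  obtain ⟨Φ, hΦm, hΦ, hb⟩ := hD.exists_absConv_bound P h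
  filter_upwards [ae_lt_top hΦm hΦ.ne, ae_mem_timeMeasure T] with t hfin ht
  have h1 : Measurable fun z : ℝ × Rn n => ((t, z.2), z.1) := Continuous.measurable (by fun_prop)
  have h3 : Measurable (Function.uncurry fun s x => absConv D ω t x s) := by
    simpa only [Function.comp_def, Function.uncurry_def] using hmeas.comp h1
  have h2 := eLpNorm_lintegral_le (μ := timeMeasure t) (ν := (volume : Measure (Rn n))) h3 h.one_le
  have h4 : Measurable fun x => ∫⁻ s, absConv D ω t x s ∂(timeMeasure t) := by
    simpa only [Function.comp_def] using hm.comp (measurable_prodMk_left (x := t))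
  exact ae_lt_top_of_eLpNorm_lt_top (zero_lt_one.trans_le h.one_le).ne' h4.aemeasurable
    ((h2.trans (hb t ht)).trans_lt hfin)

theorem integrable_of_absConv (hD : Measurable D) (h : TimeInt T p ω) {t : ℝ} {x : Rn n}
    (hfin : ∫⁻ s, absConv D ω t x s ∂(timeMeasure t) < ∞) :
    (∀ᵐ s ∂(timeMeasure t),
      Integrable fun y => 𝓕⁻ (heatMul D (t - s)) (x - y) * ω s y) ∧
    Integrable (fun s => kconv (𝓕⁻ (heatMul D (t - s))) (ω s) x) (timeMeasure t) := by
  have hK := measurable_fourierInv_uncurry (measurable_heatMul hD)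
  constructor
  · have hm : Measurable fun s => absConv D ω t x s := by
      simpa only [Function.comp_def] using
        (measurable_absConv hD h.meas).comp (measurable_prodMk_left (x := (t, x)))
    filter_upwards [ae_lt_top hm hfin.ne] with s hs
    have h1 : Measurable fun y : Rn n => (t - s, x - y) := Continuous.measurable (by fun_prop)
    have h2 : Measurable fun y => 𝓕⁻ (heatMul D (t - s)) (x - y) := by
      simpa only [Function.comp_def] using hK.comp h1
    have h3 : Measurable (ω s) := h.meas.comp measurable_prodMk_left
    refine ⟨(h2.mul h3).aestronglyMeasurable, ?_⟩
    simp only [HasFiniteIntegral, enorm_mul]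
    exact hs
  · have h1 : Measurable fun s : ℝ => ((t, s), x) := Continuous.measurable (by fun_prop)
    have h2 : Measurable fun s => kconv (𝓕⁻ (heatMul D (t - s))) (ω s) x := by
      simpa only [Function.comp_def] using
        (measurable_kconv_uncurry (K := fun τ => 𝓕⁻ (heatMul D τ)) hK h.meas).comp h1
    refine ⟨h2.aestronglyMeasurable, lt_of_le_of_lt (lintegral_mono fun s => ?_) hfin⟩
    exact enorm_kconv_le _ _ _

/-- For almost every `t` the bound `Φ t` is finite, so the distributional Duhamel integral is the
function given by convolutions, with norm at most `Φ t`; and `Φ` is integrable on `(0,T)`. -/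
theorem IsScalarDuhamel.represents (P : LPPair n) (hD : Sym1 D) (h : TimeInt T p ω)
    (hg : IsScalarDuhamel D T ω g) :
    (∀ᵐ t ∂(timeMeasure T), lpNorm p (g t) < ∞ ∧ Represents (g t)
      (fun x => ∫ s, kconv (𝓕⁻ (heatMul D (t - s))) (ω s) x ∂(timeMeasure t))) ∧
    timeLpNorm T 1 p g < ∞ := by
  obtain ⟨C, hC, hk⟩ := hD.kerBound_heatMul P
  obtain ⟨Φ, hΦm, hΦ, hb⟩ := hD.exists_absConv_bound P h
  have key : ∀ᵐ t ∂(timeMeasure T), Φ t < ∞ ∧ lpNorm p (g t) ≤ Φ t ∧ Represents (g t)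
      (fun x => ∫ s, kconv (𝓕⁻ (heatMul D (t - s))) (ω s) x ∂(timeMeasure t)) := by
    filter_upwards [ae_lt_top hΦm hΦ.ne, ae_mem_timeMeasure T] with t hfin ht
    have hle : ∫⁻ s, eLpNorm (kconv (𝓕⁻ (heatMul D (t - s))) (ω s)) p volume ∂(timeMeasure t) ≤
        Φ t := by
      refine (lintegral_mono fun s => ?_).trans (hb t ht)
      exact eLpNorm_mono_enorm fun x => by simpa [absConv] using enorm_kconv_le _ _ _
    obtain ⟨h1, -, h3⟩ := represents_timeIntegral (measurable_heatMul hD.meas)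
      (fun τ hτ => ENNReal.mul_lt_top hC (kapSum_lt_top hτ)) hk h.meas h.one_le
      ((h.ae_memLp_of_mem ht).mono fun s hs => hs.2) h.one_le (hle.trans_lt hfin) (hg t ht)
    exact ⟨hfin, h3.trans hle, h1⟩
  refine ⟨key.mono fun t ht => ⟨ht.2.1.trans_lt ht.1, ht.2.2⟩, ?_⟩
  refine lt_of_le_of_lt (eLpNorm_ennreal_mono_ae 1 (key.mono fun t ht => ht.2.1)) ?_
  simpa [eLpNorm_one_eq_lintegral_enorm] using hΦ

end Scalar

/-! ### Finite sums of Duhamel integrals and the Oseen integral -/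

section Oseen

variable {n : ℕ} {T : ℝ}

theorem isReal_zero : IsReal (0 : TD n) := fun ψ _ => by simp

theorem IsReal.sum {κ : Type*} {s : Finset κ} {a : κ → TD n} (h : ∀ c ∈ s, IsReal (a c)) :
    IsReal (∑ c ∈ s, a c) :=
  Finset.sum_induction a IsReal (fun _ _ => IsReal.add) isReal_zero h

theorem eLpNorm_finsetSum_le_of_aemeasurable {κ : Type*} {s : Finset κ} {f : κ → ℝ → ℝ≥0∞} {α : ℝ≥0∞}
    (hα : 1 ≤ α) (hf : ∀ c ∈ s, AEMeasurable (f c) (timeMeasure T)) :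
    eLpNorm (fun t => ∑ c ∈ s, f c t) α (timeMeasure T) ≤
      ∑ c ∈ s, eLpNorm (f c) α (timeMeasure T) := by
  have := eLpNorm_sum_le (fun c hc => (hf c hc).aestronglyMeasurable) hα
  refine le_trans (le_of_eq ?_) this
  congr 1
  ext t
  simp

theorem timeLpNorm_sum_le {κ : Type*} {s : Finset κ} {g : κ → ℝ → TD n} {α p : ℝ≥0∞}
    (hα : 1 ≤ α) (hp : 1 ≤ p)
    (hm : ∀ c ∈ s, ∀ ψ : 𝓢(Rn n, ℂ), Measurable (fun t : Set.Ioo (0 : ℝ) T => g c t ψ))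
    (hfin : ∀ c ∈ s, ∀ᵐ t ∂(timeMeasure T), lpNorm p (g c t) < ∞) :
    timeLpNorm T α p (fun t => ∑ c ∈ s, g c t) ≤ ∑ c ∈ s, timeLpNorm T α p (g c) := by
  refine le_trans (eLpNorm_ennreal_mono_ae α (g := fun t => ∑ c ∈ s, lpNorm p (g c t))
    (Eventually.of_forall fun t => lpNorm_sum_le hp s fun c => g c t)) ?_
  exact eLpNorm_finsetSum_le_of_aemeasurable hα fun c hc => aemeasurable_lpNorm (hm c hc) (hfin c hc)

theorem measurable_sum_TD_apply {κ : Type*} {s : Finset κ} {g : κ → ℝ → TD n}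
    (hm : ∀ c ∈ s, ∀ ψ : 𝓢(Rn n, ℂ), Measurable (fun t : Set.Ioo (0 : ℝ) T => g c t ψ))
    (ψ : 𝓢(Rn n, ℂ)) : Measurable (fun t : Set.Ioo (0 : ℝ) T => (∑ c ∈ s, g c t) ψ) := by
  simp only [sum_TD_apply]
  exact Finset.measurable_sum _ fun c hc => hm c hc ψ

/-- For `s < t` the gradient of the Oseen kernel is the kernel of the symbol `leraySym` times the
heat factor, and changing `ω` on null sets does not affect the inner integrals. -/
theorem oseenInner_ae_eq {ω : ℝ → Fin n → Fin n → Rn n → ℂ} {ω' : Fin n → Fin n → ℝ → Rn n → ℂ}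
    {t : ℝ} (h : ∀ᵐ s ∂(timeMeasure t), ∀ j k, ω s j k =ᵐ[volume] ω' j k s) (i : Fin n)
    (x : Rn n) : oseenInner ω i t x =ᵐ[timeMeasure t]
      fun s => ∑ j, ∑ k, kconv (𝓕⁻ (heatMul (leraySym i j k) (t - s))) (ω' j k s) x := by
  filter_upwards [h, ae_mem_timeMeasure t] with s hs hst
  have hτ : 0 < t - s := by linarith [hst.2]
  refine Finset.sum_congr rfl fun j _ => Finset.sum_congr rfl fun k _ => ?_
  rw [kconv]
  refine integral_congr_ae ?_
  filter_upwards [hs j k] with y hy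
  rw [gradOseen_eq i j k hτ, hy]

/-- `G ℙ∇·W` for integrable functions of time with values in `L^p`. -/
theorem duhamel_lerayDiv (P : LPPair n) {p : ℝ≥0∞} (hp : 1 ≤ p) {W : ℝ → Fin n → Fin n → TD n}
    (hW : ∀ j k, MemTimeLp T 1 p (fun t => W t j k)) :
    ∃ g : ℝ → Fin n → TD n, IsDuhamelLerayDiv T W g ∧
      (∀ i, MemTimeLp T 1 p (fun t => g t i)) ∧
      ∀ ω : ℝ → Fin n → Fin n → Rn n → ℂ,
        (∀ᵐ s ∂(timeMeasure T), ∀ j k, Represents (W s j k) (ω s j k)) →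
          ∀ i,
            (∀ᵐ z ∂((timeMeasure T).prod (volume : Measure (Rn n))),
              (∀ᵐ s ∂(timeMeasure z.1), ∀ j k,
                Integrable (fun y => gradOseen i j k (z.1 - s) (z.2 - y) * ω s j k y)) ∧
              IntervalIntegrable (oseenInner ω i z.1 z.2) volume 0 z.1) ∧
            AEStronglyMeasurable (fun z : ℝ × Rn n => oseenIntegral ω i z.1 z.2)
              ((timeMeasure T).prod volume) ∧
            ∀ᵐ t ∂(timeMeasure T), Represents (g t i) (oseenIntegral ω i t) := by
  choose ω₀ hω₀ using fun j k => exists_timeRep (hW j k).1.2 (hW j k).2.1 (hW j k).2.2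
  have hTI : ∀ j k, TimeInt T p (ω₀ j k) := fun j k => ⟨(hω₀ j k).meas, hp, by
    simpa [eLpNorm_one_eq_lintegral_enorm] using (hω₀ j k).fin⟩
  obtain ⟨G, hG, hDuh⟩ := exists_isDuhamel_sum P (ι := Unit) (r := fun _ => p)
    (ω := fun _ => ω₀) fun _ => hTI
  have hS := fun i j k => sym1_leraySym (n := n) i j k
  have hrep : ∀ᵐ t ∂(timeMeasure T), ∀ j k, Represents (W t j k) (ω₀ j k t) ∧
      MemLp (ω₀ j k t) p volume := by
    simp only [eventually_all]
    exact fun j k => (hω₀ j k).rep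
  have hwex : ∀ t, ∃ w : Fin n → TD n, (∀ j k, Represents (W t j k) (ω₀ j k t) ∧
      MemLp (ω₀ j k t) p volume) → IsLerayDiv (W t) w ∧ ∀ i τ, 0 ≤ τ → ∀ ψ, heat τ (w i) ψ =
        ∑ j, ∑ k, ∫ y, ω₀ j k t y * dual (heatMul (leraySym i j k) τ) ψ y := fun t => by
    by_cases H : ∀ j k, Represents (W t j k) (ω₀ j k t) ∧ MemLp (ω₀ j k t) p volume
    · obtain ⟨w, h1, -, h3⟩ := exists_isLerayDiv P fun j k =>
        actedOn_of_memLp P hp (H j k).2 (H j k).1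
      exact ⟨w, fun _ => ⟨h1, h3⟩⟩
    · exact ⟨0, fun h => absurd h H⟩
  choose w hw using hwex
  have hw' := hrep.mono hw
  have hscal := fun i j k => (hG () i j k).represents P (hS i j k) (hTI j k)
  have hmeas := fun i j k => (hG () i j k).measurable (hS i j k) (hTI j k)
  have hmS' : ∀ i j (ψ : 𝓢(Rn n, ℂ)),
      Measurable (fun t : Set.Ioo (0 : ℝ) T => (∑ k, G () i j k t) ψ) := fun i j =>
    measurable_sum_TD_apply fun k _ => hmeas i j k
  have hmS : ∀ i (ψ : 𝓢(Rn n, ℂ)),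
      Measurable (fun t : Set.Ioo (0 : ℝ) T => (∑ j, ∑ k, G () i j k t) ψ) := fun i =>
    measurable_sum_TD_apply (g := fun j t => ∑ k, G () i j k t) fun j _ => hmS' i j
  refine ⟨fun t i => ∑ j, ∑ k, G () i j k t, ⟨w, hw'.mono fun t ht => ht.1, fun i => ?_⟩,
    fun i => ⟨⟨fun t ht => ?_, ?_⟩, ?_, ?_⟩, fun ω hω i => ?_⟩
  · simpa using hDuh w (hw'.mono fun t ht => by simpa using ht.2) i
  · refine IsReal.sum fun j _ => IsReal.sum fun k _ => (hG () i j k).isReal (hS i j k) ?_ ht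
    filter_upwards [hrep, ae_mem_timeMeasure T] with s hs hsT
    exact ((hW j k).1.1 s hsT).ae_im_eq_zero (hs j k).1
  · exact hmS i
  · have : ∀ᵐ t ∂(timeMeasure T), ∀ j k, lpNorm p (G () i j k t) < ∞ := by
      simp only [eventually_all]
      exact fun j k => (hscal i j k).1.mono fun t ht => ht.1
    filter_upwards [this] with t ht
    refine (lpNorm_sum_le hp _ _).trans_lt (ENNReal.sum_lt_top.2 fun j _ => ?_)
    exact (lpNorm_sum_le hp _ _).trans_lt (ENNReal.sum_lt_top.2 fun k _ => ht j k)
  · have hfin : ∀ j, ∀ᵐ t ∂(timeMeasure T), lpNorm p (∑ k, G () i j k t) < ∞ := fun j => by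
      have : ∀ᵐ t ∂(timeMeasure T), ∀ k, lpNorm p (G () i j k t) < ∞ := by
        simp only [eventually_all]
        exact fun k => (hscal i j k).1.mono fun t ht => ht.1
      filter_upwards [this] with t ht
      exact (lpNorm_sum_le hp _ _).trans_lt (ENNReal.sum_lt_top.2 fun k _ => ht k)
    refine (timeLpNorm_sum_le le_rfl hp (fun j _ => hmS' i j)
      fun j _ => hfin j).trans_lt (ENNReal.sum_lt_top.2 fun j _ => ?_)
    exact (timeLpNorm_sum_le le_rfl hp (fun k _ => hmeas i j k) fun k _ =>
      (hscal i j k).1.mono fun t ht => ht.1).trans_lt (ENNReal.sum_lt_top.2 fun k _ =>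
        (hscal i j k).2)
  -- The given `ω` need not be jointly measurable; it agrees with the measurable choice `ω₀` in
  -- almost every time slice, which is all that the iterated integrals see.
  have hωae : ∀ᵐ s ∂(timeMeasure T), ∀ j k, ω s j k =ᵐ[volume] ω₀ j k s := by
    filter_upwards [hω, hrep] with s h1 h2 j k
    exact (h1 j k).ae_eq (h2 j k).1
  have hωt : ∀ t ∈ Set.Ioo 0 T, ∀ᵐ s ∂(timeMeasure t), ∀ j k, ω s j k =ᵐ[volume] ω₀ j k s :=
    fun t ht => ae_timeMeasure_mono ht.2.le hωae
  have hIeq : ∀ t ∈ Set.Ioo 0 T, ∀ x, oseenIntegral ω i t x =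
      ∫ s, ∑ j, ∑ k, kconv (𝓕⁻ (heatMul (leraySym i j k) (t - s))) (ω₀ j k s) x
        ∂(timeMeasure t) := fun t ht x => by
    rw [oseenIntegral, intervalIntegral_eq_timeMeasure ht.1.le]
    exact integral_congr_ae (oseenInner_ae_eq (hωt t ht) i x)
  have hfinz : ∀ᵐ z ∂((timeMeasure T).prod (volume : Measure (Rn n))), ∀ j k,
      ∫⁻ s, absConv (leraySym i j k) (ω₀ j k) z.1 z.2 s ∂(timeMeasure z.1) < ∞ := by
    simp only [eventually_all]
    exact fun j k => (hS i j k).ae_absConv_lt_top P (hTI j k)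
  have hzT : ∀ᵐ z ∂((timeMeasure T).prod (volume : Measure (Rn n))), z.1 ∈ Set.Ioo 0 T :=
    Measure.quasiMeasurePreserving_fst.ae (ae_mem_timeMeasure T)
  refine ⟨?_, ?_, ?_⟩
  · filter_upwards [hfinz, hzT] with z hz hzt
    have hI := fun j k => integrable_of_absConv (hS i j k).meas (hTI j k) (hz j k)
    constructor
    · have h1 : ∀ᵐ s ∂(timeMeasure z.1), ∀ j k, Integrable fun y =>
          𝓕⁻ (heatMul (leraySym i j k) (z.1 - s)) (z.2 - y) * ω₀ j k s y := by
        simp only [eventually_all]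
        exact fun j k => (hI j k).1
      filter_upwards [h1, hωt z.1 hzt, ae_mem_timeMeasure z.1] with s h2 h3 h4 j k
      refine (h2 j k).congr ?_
      filter_upwards [h3 j k] with y hy
      rw [gradOseen_eq i j k (by linarith [h4.2]), hy]
    · rw [intervalIntegrable_iff_timeMeasure hzt.1.le]
      refine Integrable.congr ?_ (oseenInner_ae_eq (hωt z.1 hzt) i z.2).symm
      exact integrable_finsetSum _ fun j _ => integrable_finsetSum _ fun k _ => (hI j k).2
  · have hf : Measurable fun z : (ℝ × Rn n) × ℝ => ∑ j, ∑ k,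
        kconv (𝓕⁻ (heatMul (leraySym i j k) (z.1.1 - z.2))) (ω₀ j k z.2) z.1.2 := by
      refine Finset.measurable_sum _ fun j _ => Finset.measurable_sum _ fun k _ => ?_
      have h1 : Measurable fun z : (ℝ × Rn n) × ℝ => ((z.1.1, z.2), z.1.2) :=
        Continuous.measurable (by fun_prop)
      have h2 := (measurable_kconv_uncurry (K := fun τ => 𝓕⁻ (heatMul (leraySym i j k) τ))
        (measurable_fourierInv_uncurry (measurable_heatMul (hS i j k).meas)) (hTI j k).meas).comp h1
      simpa only [Function.comp_def] using h2
    have hf' := measurable_integral_timeMeasure (f := fun (z : ℝ × Rn n) s => ∑ j, ∑ k,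
      kconv (𝓕⁻ (heatMul (leraySym i j k) (z.1 - s))) (ω₀ j k s) z.2)
      (by simpa only [Function.uncurry_def] using hf)
    refine ⟨_, hf'.stronglyMeasurable, ?_⟩
    filter_upwards [hzT] with z hz
    exact hIeq z.1 hz z.2
  · have hrepG : ∀ᵐ t ∂(timeMeasure T), ∀ j k, Represents (G () i j k t) (fun x =>
        ∫ s, kconv (𝓕⁻ (heatMul (leraySym i j k) (t - s))) (ω₀ j k s) x ∂(timeMeasure t)) := by
      simp only [eventually_all]
      exact fun j k => (hscal i j k).1.mono fun t ht => ht.2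
    filter_upwards [hrepG, Measure.ae_ae_of_ae_prod hfinz, ae_mem_timeMeasure T] with t h1 h2 ht
    refine (Represents.sum _ fun j _ => Represents.sum _ fun k _ => h1 j k).congr_ae ?_
    filter_upwards [h2] with x hx
    have hI := fun j k => (integrable_of_absConv (hS i j k).meas (hTI j k) (hx j k)).2
    rw [hIeq t ht x, integral_finsetSum _ fun j _ => integrable_finsetSum _ fun k _ => hI j k]
    refine Finset.sum_congr rfl fun j _ => ?_
    rw [integral_finsetSum _ fun k _ => hI j k]

end Oseen

/-! ### The heat flow of Besov data -/

section HeatFlow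

variable {n : ℕ} (P : LPPair n) {T : ℝ}

theorem le_of_eLpNorm_top_count {F : ℤ → ℝ≥0∞} (j : ℤ) : F j ≤ eLpNorm F ∞ Measure.count := by
  rw [eLpNorm_exponent_top, eLpNormEssSup_count]
  exact le_iSup (fun j => ‖F j‖ₑ) j

theorem le_two_rpow_neg_mul {x M : ℝ≥0∞} {a : ℝ} (h : 2 ^ a * x ≤ M) : x ≤ M * 2 ^ (-a) := by
  calc x = 2 ^ (-a) * (2 ^ a * x) := by
        rw [← mul_assoc, ← ennreal_two_rpow_add, neg_add_cancel, ENNReal.rpow_zero, one_mul]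
    _ ≤ _ := by rw [mul_comm]; gcongr

/-- Since `kap ≤ 1`, its square is at most `kap`. -/
theorem eLpNorm_two_kap_le (l : ℤ) :
    eLpNorm (fun t : ℝ => kap (t * 4 ^ l)) 2 (timeMeasure T) ≤
      (∫⁻ τ in Set.Ioo 0 T, kap (τ * 4 ^ l)) ^ (1 / 2 : ℝ) := by
  rw [eLpNorm_ennreal_eq (by norm_num) (by norm_num)]
  simp only [ENNReal.toReal_ofNat]
  refine ENNReal.rpow_le_rpow (lintegral_mono fun t => ?_) (by norm_num)
  simp only [ENNReal.rpow_ofNat]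
  exact pow_le_of_le_one zero_le (kap_le_one _) (by norm_num)

theorem measurable_heat_apply_of_represents {u : TD n} {p : ℝ≥0∞} (hp : lpNorm p u < ∞)
    (ψ : 𝓢(Rn n, ℂ)) : Measurable fun t : Set.Ioo (0 : ℝ) T => heat t u ψ := by
  obtain ⟨g, hg, -⟩ := exists_represents hp
  have hgm := hg.1.aestronglyMeasurable
  have h1 : Measurable fun z : ℝ × Rn n => hgm.mk g z.2 * dual (heatSymbol z.1) ψ z.2 :=
    (hgm.stronglyMeasurable_mk.measurable.comp measurable_snd).mul
      (measurable_dual_uncurry continuous_heatSymbol_uncurry.measurable ψ)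
  have h2 := h1.stronglyMeasurable.integral_prod_right' (ν := (volume : Measure (Rn n)))
  have e : (fun t : Set.Ioo (0 : ℝ) T => heat t u ψ) = fun t : Set.Ioo (0 : ℝ) T =>
      ∫ y, hgm.mk g y * dual (heatSymbol t) ψ y := by
    ext t
    rw [heat_eq, op_apply, (hg.2 _).2, dualS_coe (hasTemperateGrowth_heatSymbol t.2.1.le)]
    refine integral_congr_ae ?_
    filter_upwards [hgm.ae_eq_mk] with y hy
    rw [hy]
  rw [e]
  exact h2.measurable.comp measurable_subtype_coe

/-- The smoothing effect of the heat flow on Besov data of negative regularity. -/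
theorem MemBesov.memCheminLerner_heat {s₀ : ℝ} {p₀ : ℝ≥0∞} (hp₀ : 1 ≤ p₀) (hs₁ : -1 < s₀)
    (hs₀ : s₀ < 0) {f : TD n} (hf : MemBesov P s₀ p₀ ∞ f) :
    MemCheminLerner P T 2 0 p₀ 1 (fun t => heat t f) := by
  obtain ⟨hreal, hsh, hN⟩ := hf
  set M := besovNorm P s₀ p₀ ∞ f with hM
  have hblock : ∀ l, lpNorm p₀ (lpProj P l f) ≤ M * 2 ^ (-((l : ℝ) * s₀)) := fun l =>
    le_two_rpow_neg_mul (le_of_eLpNorm_top_count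
      (F := fun j : ℤ => (2 : ℝ≥0∞) ^ ((j : ℝ) * s₀) * lpNorm p₀ (lpProj P j f)) l)
  have hfin : ∀ l, lpNorm p₀ (lpProj P l f) < ∞ := fun l =>
    (hblock l).trans_lt (ENNReal.mul_lt_top hN (ennreal_two_rpow_ne_top _).lt_top)
  obtain ⟨C, hC, hheat⟩ := lpNorm_lpProj_heat_le P
  have hb : ∀ (l : ℤ) (t : ℝ), 0 ≤ t → lpNorm p₀ (lpProj P l (heat t f)) ≤
      C * M * 2 ^ (-((l : ℝ) * s₀)) * kap (t * 4 ^ l) := fun l t ht => by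
    have h := hheat l t ht p₀ p₀ hp₀ le_rfl f (hfin l)
    rw [sub_self, mul_zero, ENNReal.rpow_zero, mul_one] at h
    calc _ ≤ C * kap (t * 4 ^ l) * (M * 2 ^ (-((l : ℝ) * s₀))) := h.trans (by gcongr; exact hblock l)
      _ = _ := by ring
  have hCM : C * M < ∞ := ENNReal.mul_lt_top hC hN
  obtain ⟨C', hC', hker⟩ := kerBound_heatSymbol (n := n)
  have hSh : ∀ t : ℝ, 0 < t → IsSh P (heat t f) := fun t ht =>
    hsh.op P (hker t ht) hC' (hasTemperateGrowth_heatSymbol ht.le)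
  refine ⟨⟨fun t ht => isReal_heat hreal ht.1.le, fun ψ => ?_⟩, ?_, fun l => ?_, ?_⟩
  -- Measurability in time is clear for blocks, which are given by functions, but `f` itself need
  -- not be one. For `t > 0` the blocks of the heat flow are absolutely summable, so the pairing is
  -- a limit of measurable functions.
  · have hlim : ∀ t : Set.Ioo (0 : ℝ) T,
        HasSum (fun l => lpProj P l (heat t f) ψ) (heat t f ψ) := fun t => by
      have hsum : ∑' l, lpNorm p₀ (lpProj P l (heat t f)) < ∞ := by
        have h0 : ENNReal.ofReal (t : ℝ) ≠ 0 := by simpa using t.2.1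
        refine tsum_int_lt_top (C := C * M * (1 + (ENNReal.ofReal t ^ 2)⁻¹)) (a := -s₀)
          (b := 4 + s₀) (ENNReal.mul_lt_top hCM (ENNReal.add_lt_top.2 ⟨by simp,
            ENNReal.inv_lt_top.2 (ENNReal.pow_pos (pos_iff_ne_zero.2 h0) 2)⟩)) (by linarith)
          (by linarith) (fun l => (hb l t t.2.1.le).trans ?_) fun l => (hb l t t.2.1.le).trans ?_
        · rw [mul_right_comm, mul_neg]
          gcongr
          exact (kap_le_one _).trans le_self_add
        · calc _ ≤ C * M * 2 ^ (-((l : ℝ) * s₀)) *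
                ((ENNReal.ofReal t ^ 2)⁻¹ * 2 ^ (-((l : ℝ) * 4))) := by
                gcongr; exact kap_mul_four_zpow_le t.2.1 l
            _ = C * M * (ENNReal.ofReal t ^ 2)⁻¹ * 2 ^ (-((l : ℝ) * (4 + s₀))) := by
                rw [show -((l : ℝ) * (4 + s₀)) = -(l * s₀) + -(l * 4) by ring,
                  ennreal_two_rpow_add]
                ring
            _ ≤ _ := by gcongr; exact le_add_self
      exact hasSum_TD_iff.1 (hasSum_lpProj P (hSh t t.2.1)
        (summable_apply_of_lpNorm hp₀ hsum)) ψ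
    have hmeas : ∀ l, Measurable fun t : Set.Ioo (0 : ℝ) T => lpProj P l (heat t f) ψ := fun l => by
      have h1 := measurable_heat_apply_of_represents (T := T) (hfin l) ψ
      have e : (fun t : Set.Ioo (0 : ℝ) T => lpProj P l (heat t f) ψ) =
          fun t : Set.Ioo (0 : ℝ) T => heat t (lpProj P l f) ψ := by
        ext t
        rw [lpProj_eq, heat_eq, op_comm (hasTemperateGrowth_lpSym P l)
          (hasTemperateGrowth_heatSymbol t.2.1.le)]
      rw [e]
      exact h1
    refine measurable_of_tendsto_metrizable' atTop
      (f := fun (s : Finset ℤ) (t : Set.Ioo (0 : ℝ) T) => ∑ l ∈ s, lpProj P l (heat t f) ψ)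
      (fun s => Finset.measurable_sum _ fun l _ => hmeas l) (tendsto_pi_nhds.2 fun t => hlim t)
  · filter_upwards [ae_mem_timeMeasure T] with t ht
    exact hSh t ht.1
  · filter_upwards [ae_mem_timeMeasure T] with t ht
    refine (hb l t ht.1.le).trans_lt (ENNReal.mul_lt_top (ENNReal.mul_lt_top hCM
      (ennreal_two_rpow_ne_top _).lt_top) ((kap_le_one _).trans_lt (by simp)))
  · rw [cheminLernerNorm_zero_one]
    have hkm : ∀ l : ℤ, Measurable fun τ : ℝ => kap (τ * 4 ^ l) := fun l =>
      measurable_kap.comp (by fun_prop)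
    have hbl : ∀ l : ℤ, timeLpNorm T 2 p₀ (fun t => lpProj P l (heat t f)) ≤
        C * M * 2 ^ (-((l : ℝ) * s₀)) *
          (∫⁻ τ in Set.Ioo 0 T, kap (τ * 4 ^ l)) ^ (1 / 2 : ℝ) := fun l => by
      refine (eLpNorm_ennreal_mono_ae 2 ?_).trans ((eLpNorm_ennreal_const_mul _
        (hkm l).aemeasurable).trans (mul_le_mul_right (eLpNorm_two_kap_le l) _))
      filter_upwards [ae_mem_timeMeasure T] with t ht
      exact hb l t ht.1.le
    -- Low frequencies decay with exponent `-s₀ > 0`. High frequencies gain `2^{-l}` from the square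
    -- root of the time integral and decay with exponent `1+s₀ > 0`.
    refine tsum_int_lt_top (C := C * M * (ENNReal.ofReal T ^ (1 / 2 : ℝ) +
      ENNReal.ofReal (2 * Real.pi) ^ (1 / 2 : ℝ))) (a := -s₀) (b := 1 + s₀) ?_ (by linarith)
      (by linarith) (fun l => (hbl l).trans ?_) fun l => (hbl l).trans ?_
    · exact ENNReal.mul_lt_top hCM (ENNReal.add_lt_top.2
        ⟨ENNReal.rpow_lt_top_of_nonneg (by norm_num) ENNReal.ofReal_ne_top,
          ENNReal.rpow_lt_top_of_nonneg (by norm_num) ENNReal.ofReal_ne_top⟩)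
    · rw [mul_right_comm, mul_neg]
      gcongr
      exact (ENNReal.rpow_le_rpow (lintegral_kap_le_time T) (by norm_num)).trans le_self_add
    · calc _ ≤ C * M * 2 ^ (-((l : ℝ) * s₀)) *
            (ENNReal.ofReal (2 * Real.pi) * 2 ^ (-((l : ℝ) * 2))) ^ (1 / 2 : ℝ) := by
            gcongr; exact lintegral_kap_four_le l T
        _ = C * M * ENNReal.ofReal (2 * Real.pi) ^ (1 / 2 : ℝ) * 2 ^ (-((l : ℝ) * (1 + s₀))) := by
            rw [ENNReal.mul_rpow_of_nonneg _ _ (by norm_num), ← ENNReal.rpow_mul,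
              show -((l : ℝ) * (1 + s₀)) = -(l * s₀) + -(l * 2) * (1 / 2) by ring,
              ennreal_two_rpow_add]
            ring
        _ ≤ _ := by gcongr; exact le_add_self

end HeatFlow

/-! ### Splitting into low and high frequencies -/

section Splitting

variable {n : ℕ} (P : LPPair n) {T : ℝ}

/-- For `l ≤ -2` the block lives in `|ξ| < (8/3)/4 = 2/3 < 3/4`, where `χ = 1`. -/
theorem lowFreq_zero_lpProj {l : ℤ} (h : l ≤ -2) (u : TD n) :
    lowFreq P 0 (lpProj P l u) = lpProj P l u := by
  rw [lowFreq_eq, lpProj_eq, op_op (hasTemperateGrowth_lpSym P l) (hasTemperateGrowth_lowSym P 0)]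
  have e : (fun ξ => lpSym P l ξ * lowSym P 0 ξ) = lpSym P l := by
    ext ξ
    by_cases h0 : lpSym P l ξ = 0
    · rw [h0, zero_mul]
    · rw [lowSym_zero_eq_one P, mul_one]
      refine (lpSym_ne_zero P h0).2.trans_le ?_
      have : (2 : ℝ) ^ l ≤ 2 ^ (-2 : ℤ) := zpow_le_zpow_right₀ (by norm_num) h
      norm_num at this ⊢
      linarith
  rw [e]

theorem lpProj_lowFreq (l j : ℤ) (u : TD n) :
    lpProj P l (lowFreq P j u) = lowFreq P j (lpProj P l u) := by
  rw [lpProj_eq, lowFreq_eq, op_comm (hasTemperateGrowth_lpSym P l) (hasTemperateGrowth_lowSym P j)]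

/-- The blocks of an element of a Chemin-Lerner space with third index `∞`, in better Lebesgue
spaces. -/
theorem MemCheminLerner.block_le {α a b : ℝ≥0∞} {σ : ℝ} (ha : 1 ≤ a) (hab : a ≤ b) {u : ℝ → TD n}
    (hu : MemCheminLerner P T α σ a ∞ u) : ∃ C : ℝ≥0∞, C < ∞ ∧ ∀ l : ℤ,
      (∀ᵐ t ∂(timeMeasure T), lpNorm b (lpProj P l (u t)) < ∞) ∧
      timeLpNorm T α b (fun t => lpProj P l (u t)) ≤
        C * 2 ^ ((l : ℝ) * (n * ((a⁻¹).toReal - (b⁻¹).toReal) - σ)) := by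
  obtain ⟨⟨-, hm⟩, -, hfin, hN⟩ := hu
  obtain ⟨C, hC, hB⟩ := lpNorm_lpProj_le P
  set M := cheminLernerNorm P T α σ a ∞ u with hM
  set θ := (a⁻¹).toReal - (b⁻¹).toReal with hθ
  refine ⟨C * M, ENNReal.mul_lt_top hC hN, fun l => ?_⟩
  have hpt : ∀ᵐ t ∂(timeMeasure T), lpNorm b (lpProj P l (u t)) ≤
      C * 2 ^ ((l : ℝ) * n * θ) * lpNorm a (lpProj P l (u t)) := by
    filter_upwards [hfin l] with t ht
    exact hB l a b ha hab (u t) ht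
  constructor
  · filter_upwards [hpt, hfin l] with t h1 h2
    exact h1.trans_lt (ENNReal.mul_lt_top (ENNReal.mul_lt_top hC
      (ennreal_two_rpow_ne_top _).lt_top) h2)
  · have hbl : timeLpNorm T α a (fun t => lpProj P l (u t)) ≤ M * 2 ^ (-((l : ℝ) * σ)) :=
      le_two_rpow_neg_mul (le_of_eLpNorm_top_count (F := fun j : ℤ =>
        (2 : ℝ≥0∞) ^ ((j : ℝ) * σ) * timeLpNorm T α a (fun t => lpProj P j (u t))) l)
    refine (eLpNorm_ennreal_mono_ae α hpt).trans ((eLpNorm_ennreal_const_mul _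
      (aemeasurable_lpNorm (measurable_op_apply hm _) (hfin l))).trans ?_)
    calc _ ≤ C * 2 ^ ((l : ℝ) * n * θ) * (M * 2 ^ (-((l : ℝ) * σ))) := by gcongr; exact hbl
      _ = C * M * 2 ^ ((l : ℝ) * (n * θ - σ)) := by
        rw [show (l : ℝ) * (n * θ - σ) = l * n * θ + -(l * σ) by ring, ennreal_two_rpow_add]
        ring

theorem measurable_lowFreq_apply {u : ℝ → TD n}
    (hm : ∀ ψ : 𝓢(Rn n, ℂ), Measurable (fun t : Set.Ioo (0 : ℝ) T => u t ψ)) (j : ℤ)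
    (ψ : 𝓢(Rn n, ℂ)) : Measurable (fun t : Set.Ioo (0 : ℝ) T => lowFreq P j (u t) ψ) := by
  rw [lowFreq_eq]
  exact measurable_op_apply hm _ ψ

theorem measurable_lpProj_apply {u : ℝ → TD n}
    (hm : ∀ ψ : 𝓢(Rn n, ℂ), Measurable (fun t : Set.Ioo (0 : ℝ) T => u t ψ)) (j : ℤ)
    (ψ : 𝓢(Rn n, ℂ)) : Measurable (fun t : Set.Ioo (0 : ℝ) T => lpProj P j (u t) ψ) := by
  rw [lpProj_eq]
  exact measurable_op_apply hm _ ψ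

theorem timeLpNorm_lowFreq_le : ∃ C : ℝ≥0∞, C < ∞ ∧ ∀ (j : ℤ) (α q : ℝ≥0∞), 1 ≤ q →
    ∀ v : ℝ → TD n, (∀ ψ : 𝓢(Rn n, ℂ), Measurable (fun t : Set.Ioo (0 : ℝ) T => v t ψ)) →
      (∀ᵐ t ∂(timeMeasure T), lpNorm q (v t) < ∞) →
      (∀ᵐ t ∂(timeMeasure T), lpNorm q (lowFreq P j (v t)) < ∞) ∧
      timeLpNorm T α q (fun t => lowFreq P j (v t)) ≤ C * timeLpNorm T α q v := by
  obtain ⟨C, hC, h⟩ := lpNorm_lowFreq_le P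
  refine ⟨C, hC, fun j α q hq v hm hfin => ?_⟩
  have hpt : ∀ᵐ t ∂(timeMeasure T), lpNorm q (lowFreq P j (v t)) ≤ C * lpNorm q (v t) := by
    filter_upwards [hfin] with t ht
    exact h j q hq (v t) ht
  refine ⟨?_, (eLpNorm_ennreal_mono_ae α hpt).trans
    (eLpNorm_ennreal_const_mul _ (aemeasurable_lpNorm hm hfin))⟩
  filter_upwards [hpt, hfin] with t h1 h2
  exact h1.trans_lt (ENNReal.mul_lt_top hC h2)

theorem timeLpNorm_zero (α p : ℝ≥0∞) : timeLpNorm T α p (fun _ => (0 : TD n)) = 0 := by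
  simp [timeLpNorm, lpNorm_zero]

theorem isSh_lowFreq (j : ℤ) {u : TD n} (hu : IsSh P u) : IsSh P (lowFreq P j u) := by
  obtain ⟨C, hC, h⟩ := kerBound_lowSym P
  exact hu.op P (h j) hC (hasTemperateGrowth_lowSym P j)

/-- In `L^q` the blocks are `O(2^{ld})` with `d > 0`, and those with `l ≥ 1` are removed by the
cutoff. So the third index improves from `∞` to `1`. -/
theorem MemCheminLerner.low {α a q : ℝ≥0∞} {σ d : ℝ} (ha : 1 ≤ a) (haq : a ≤ q) (hd : 0 < d)
    {u : ℝ → TD n} (hu : MemCheminLerner P T α σ a ∞ u)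
    (hexp : n * ((a⁻¹).toReal - (q⁻¹).toReal) - σ = d) :
    MemCheminLerner P T α 0 q 1 (fun t => lowFreq P 0 (u t)) := by
  obtain ⟨C, hC, hb⟩ := hu.block_le P ha haq
  obtain ⟨C', hC', hlow⟩ := timeLpNorm_lowFreq_le P (T := T)
  have hl := fun l => hlow 0 α q (ha.trans haq) (fun t => lpProj P l (u t))
    (measurable_lpProj_apply P hu.1.2 l) (hb l).1
  rw [hexp] at hb
  refine ⟨⟨fun t ht => isReal_lowFreq P (hu.1.1 t ht) 0, measurable_lowFreq_apply P hu.1.2 0⟩,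
    hu.2.1.mono fun t ht => isSh_lowFreq P 0 ht, fun l => ?_, ?_⟩
  · simp only [lpProj_lowFreq]
    exact (hl l).1
  · rw [cheminLernerNorm_zero_one]
    simp only [lpProj_lowFreq]
    have h1 : ∀ l : ℤ, timeLpNorm T α q (fun t => lowFreq P 0 (lpProj P l (u t))) ≤
        C' * C * 2 ^ ((l : ℝ) * d) := fun l => (hl l).2.trans (by
      rw [mul_assoc]; gcongr; exact (hb l).2)
    refine tsum_int_lt_top (ENNReal.mul_lt_top hC' hC) hd hd h1 fun l => ?_
    rcases le_or_gt l 0 with hl0 | hl0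
    · refine (h1 l).trans ?_
      gcongr
      · norm_num
      · have : (l : ℝ) ≤ 0 := by exact_mod_cast hl0
        nlinarith
    · simp only [lowFreq_lpProj_eq_zero P (show (0 : ℤ) + 1 ≤ l by omega), timeLpNorm_zero]
      exact zero_le

/-- The mirror image of the low-frequency case: blocks with `l ≤ -2` cancel, and the others are
`O(2^{-ld})`. -/
theorem MemCheminLerner.high {α a q : ℝ≥0∞} {σ d : ℝ} (hα : 1 ≤ α) (ha : 1 ≤ a) (haq : a ≤ q) (hd : 0 < d)
    {u : ℝ → TD n} (hu : MemCheminLerner P T α σ a ∞ u)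
    (hexp : n * ((a⁻¹).toReal - (q⁻¹).toReal) - σ = -d) :
    MemCheminLerner P T α 0 q 1 (fun t => u t - lowFreq P 0 (u t)) := by
  have hq := ha.trans haq
  obtain ⟨C, hC, hb⟩ := hu.block_le P ha haq
  obtain ⟨C', hC', hlow⟩ := timeLpNorm_lowFreq_le P (T := T)
  have hl := fun l => hlow 0 α q hq (fun t => lpProj P l (u t))
    (measurable_lpProj_apply P hu.1.2 l) (hb l).1
  rw [hexp] at hb
  refine ⟨⟨fun t ht => (hu.1.1 t ht).sub (isReal_lowFreq P (hu.1.1 t ht) 0), fun ψ =>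
    (hu.1.2 ψ).sub (measurable_lowFreq_apply P hu.1.2 0 ψ)⟩,
    hu.2.1.mono fun t ht => ht.sub P (isSh_lowFreq P 0 ht), fun l => ?_, ?_⟩
  · simp only [map_sub, lpProj_lowFreq]
    filter_upwards [(hl l).1, (hb l).1] with t h1 h2
    exact (lpNorm_sub_le hq _ _).trans_lt (ENNReal.add_lt_top.2 ⟨h2, h1⟩)
  · rw [cheminLernerNorm_zero_one]
    simp only [map_sub, lpProj_lowFreq]
    have h1 : ∀ l : ℤ, timeLpNorm T α q
        (fun t => lpProj P l (u t) - lowFreq P 0 (lpProj P l (u t))) ≤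
        (1 + C') * C * 2 ^ ((l : ℝ) * -d) := fun l => by
      have hm1 : AEMeasurable (fun t => lpNorm q (lpProj P l (u t))) (timeMeasure T) :=
        aemeasurable_lpNorm (measurable_lpProj_apply P hu.1.2 l) (hb l).1
      have hm2 : AEMeasurable (fun t => lpNorm q (lowFreq P 0 (lpProj P l (u t))))
          (timeMeasure T) := aemeasurable_lpNorm (u := fun t => lowFreq P 0 (lpProj P l (u t)))
        (measurable_lowFreq_apply P (u := fun t => lpProj P l (u t))
          (measurable_lpProj_apply P hu.1.2 l) 0) (hl l).1
      have hadd := eLpNorm_add_le hm1.aestronglyMeasurable hm2.aestronglyMeasurable hα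
      have hle : timeLpNorm T α q
          (fun t => lpProj P l (u t) - lowFreq P 0 (lpProj P l (u t))) ≤
          timeLpNorm T α q (fun t => lpProj P l (u t)) +
            timeLpNorm T α q (fun t => lowFreq P 0 (lpProj P l (u t))) := by
        refine le_trans (eLpNorm_ennreal_mono_ae α (Eventually.of_forall fun t => ?_)) hadd
        exact lpNorm_sub_le hq _ _
      refine hle.trans ((add_le_add le_rfl (hl l).2).trans ?_)
      rw [← one_add_mul, mul_assoc]
      gcongr
      exact (hb l).2
    -- The factor `2^{2d}` makes `2^{-ld} ≤ 2^{2d} 2^{ld}` for all `l ≥ -1`, the only indices at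
    -- which the growing bound still has to be checked.
    have hfac : (1 : ℝ≥0∞) ≤ 2 ^ (2 * d) := by
      rw [← ENNReal.rpow_zero (x := 2)]
      exact ENNReal.rpow_le_rpow_of_exponent_le (by norm_num) (by linarith)
    refine tsum_int_lt_top (C := (1 + C') * C * 2 ^ (2 * d)) (ENNReal.mul_lt_top
      (ENNReal.mul_lt_top (by simp [hC']) hC) (ennreal_two_rpow_ne_top _).lt_top) hd hd
      (fun l => ?_) fun l => ?_
    · rcases le_or_gt l (-2) with hl0 | hl0
      · simp only [lowFreq_zero_lpProj P hl0, sub_self, timeLpNorm_zero]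
        exact zero_le
      · refine (h1 l).trans ?_
        rw [mul_assoc _ (2 ^ (2 * d)), ← ennreal_two_rpow_add]
        gcongr
        · norm_num
        · have : (-1 : ℝ) ≤ l := by exact_mod_cast (show (-1 : ℤ) ≤ l by omega)
          nlinarith
    · refine (h1 l).trans ?_
      rw [mul_neg]
      exact mul_le_mul_left (le_mul_of_one_le_right' hfac) _

end Splitting

/-! ### Mild solutions -/

section Mild

variable {n : ℕ} (P : LPPair n) {T : ℝ}

theorem memCheminLerner_neg_sum {κ : Type*} [Fintype κ] {α p : ℝ≥0∞} (hα : 1 ≤ α) (hp : 1 ≤ p)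
    {w : ℝ → TD n} {G : κ → ℝ → TD n} (hw : WeakStarMeasurable T w)
    (heq : ∀ t ∈ Set.Ioo 0 T, w t = -∑ z, G z t)
    (hmeas : ∀ z (ψ : 𝓢(Rn n, ℂ)), Measurable (fun t : Set.Ioo (0 : ℝ) T => G z t ψ))
    (hfin : ∀ z (l : ℤ), ∀ t ∈ Set.Ioo 0 T, lpNorm p (lpProj P l (G z t)) < ∞)
    (hsh : ∀ z, ∀ t ∈ Set.Ioo 0 T, IsSh P (G z t))
    (hG : ∀ z, cheminLernerNorm P T α 0 p 1 (G z) < ∞) : MemCheminLerner P T α 0 p 1 w := by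
  refine ⟨hw, ?_, fun l => ?_, ?_⟩
  · filter_upwards [ae_mem_timeMeasure T] with t ht
    rw [heq t ht]
    exact (IsSh.sum P _ fun z _ => hsh z t ht).neg P
  · filter_upwards [ae_mem_timeMeasure T] with t ht
    rw [heq t ht, map_neg, lpNorm_neg, map_sum]
    exact (lpNorm_sum_le hp _ _).trans_lt (ENNReal.sum_lt_top.2 fun z _ => hfin z l t ht)
  · rw [cheminLernerNorm_zero_one]
    have hle : ∀ l, timeLpNorm T α p (fun t => lpProj P l (w t)) ≤
        ∑ z, timeLpNorm T α p (fun t => lpProj P l (G z t)) := fun l => by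
      refine le_trans (eLpNorm_ennreal_mono_ae α (g := fun t =>
        lpNorm p (∑ z, lpProj P l (G z t))) ?_) (timeLpNorm_sum_le (s := Finset.univ)
        (g := fun z t => lpProj P l (G z t)) hα hp
        (fun z _ => measurable_lpProj_apply P (hmeas z) l) fun z _ => ?_)
      · filter_upwards [ae_mem_timeMeasure T] with t ht
        rw [heq t ht, map_neg, lpNorm_neg, map_sum]
      · filter_upwards [ae_mem_timeMeasure T] with t ht
        exact hfin z l t ht
    refine (ENNReal.tsum_le_tsum hle).trans_lt ?_
    rw [Summable.tsum_finsetSum fun z _ => ENNReal.summable]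
    refine ENNReal.sum_lt_top.2 fun z _ => ?_
    rw [← cheminLernerNorm_zero_one]
    exact hG z

theorem WeakStarMeasurable.sub {u v : ℝ → TD n} (hu : WeakStarMeasurable T u)
    (hv : WeakStarMeasurable T v) : WeakStarMeasurable T (fun t => u t - v t) := by
  refine ⟨fun t ht => (hu.1 t ht).sub (hv.1 t ht), fun ψ => ?_⟩
  have h := (hu.2 ψ).sub (hv.2 ψ)
  exact h

/-- The two summands are the free evolution and `-B[u,u]`. The latter is a finite sum of scalar
Duhamel integrals, each smoothed into third index `1`. -/
theorem ProductData.memSum {ι : Type*} [Fintype ι] {r β : ι → ℝ≥0∞} {u : ℝ → Fin n → TD n}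
    {ω : ι → Fin n → Fin n → ℝ → Rn n → ℂ} (h : ProductData P T r β u u ω) {α p p₀ : ℝ≥0∞}
    (hα : 1 ≤ α) (hp : 1 ≤ p) (hr : ∀ c, r c ≤ p) (hβ : ∀ c, 1 ≤ β c) (hβα : ∀ c, β c ≤ α)
    (hexp : ∀ c, 1 + n * (((r c)⁻¹).toReal - (p⁻¹).toReal) -
      2 * (1 - (((β c)⁻¹).toReal - (α⁻¹).toReal)) < 0)
    {f : Fin n → TD n} (hf : ∀ i, MemCheminLerner P T 2 0 p₀ 1 (fun t => heat t (f i)))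
    (hu : ∀ i, WeakStarMeasurable T (fun t => u t i)) {b : ℝ → Fin n → TD n} (hb : IsB T u u b)
    (heq : ∀ t ∈ Set.Ioo 0 T, ∀ i, u t i = heat t (f i) - b t i) : MemSum P T 2 p₀ α p u := by
  obtain ⟨g, hg, -, hgb⟩ := h.exists_isB P
  have hS := fun i j k => sym1_leraySym (n := n) i j k
  have hfin : ∀ i (z : ι × Fin n × Fin n) (l : ℤ), ∀ t ∈ Set.Ioo 0 T,
      lpNorm p (lpProj P l (g z.1 i z.2.1 z.2.2 t)) < ∞ :=
    fun i z l t ht => by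
      obtain ⟨C, hC, hbd⟩ := (hS i z.2.1 z.2.2).lpNorm_lpProj_duhamel_le P
      have hT := h.timeInt z.1 z.2.1 z.2.2
      refine (hbd T _ p _ _ hT (hg z.1 i z.2.1 z.2.2) (hr z.1) t ht l).trans_lt
        (ENNReal.mul_lt_top (ENNReal.mul_lt_top hC (ennreal_two_rpow_ne_top _).lt_top) ?_)
      refine lt_of_le_of_lt (lintegral_mono fun s => mul_le_of_le_one_left' (kap_le_one _)) ?_
      exact lt_of_le_of_lt (lintegral_mono' (timeMeasure_mono ht.2.le) le_rfl) hT.fin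
  have hrest : ∀ i, MemCheminLerner P T α 0 p 1 (fun t => u t i - heat t (f i)) := fun i => by
    refine memCheminLerner_neg_sum P (κ := ι × Fin n × Fin n)
      (G := fun z => g z.1 i z.2.1 z.2.2) hα hp ((hu i).sub (hf i).1) (fun t ht => ?_)
      (fun z => (hg z.1 i z.2.1 z.2.2).measurable (hS i z.2.1 z.2.2) (h.timeInt z.1 z.2.1 z.2.2))
      (hfin i) (fun z t ht => (hg z.1 i z.2.1 z.2.2).isSh P (hS i z.2.1 z.2.2)
        (h.timeInt z.1 z.2.1 z.2.2) ht) fun z =>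
      (hg z.1 i z.2.1 z.2.2).cheminLernerNorm_lt_top P (hS i z.2.1 z.2.2)
        (h.timeInt z.1 z.2.1 z.2.2) (hr z.1) (hβ z.1) (hβα z.1) (h.fin z.1 z.2.1 z.2.2)
        (hexp z.1)
    rw [heq t ht i, hgb b hb t ht i, sub_sub_cancel_left, Fintype.sum_prod_type]
    simp only [Fintype.sum_prod_type]
  have hadd : ∀ t, u t = (fun i => heat t (f i)) + fun i => u t i - heat t (f i) := fun t =>
    funext fun i => (add_sub_cancel (heat t (f i)) (u t i)).symm
  exact ⟨hu, _, _, hf, hrest, Eventually.of_forall hadd⟩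

/-- The tensor square of a field in `L^α_T L^p`. -/
theorem exists_productData_of_memTimeLp {α p : ℝ≥0∞} (hα : 2 ≤ α) (hp : 2 ≤ p)
    {u : ℝ → Fin n → TD n} (hu : ∀ i, MemTimeLp T α p (fun t => u t i)) :
    ∃ ω, ProductData P T (ι := Unit) (fun _ => holderExp p p) (fun _ => holderExp α α) u u ω := by
  choose U hU using fun i => exists_timeRep (hu i).1.2 (hu i).2.1 (hu i).2.2
  have hmul := fun j k => (hU j).mul hα hα hp hp (hU k)
  refine ⟨fun _ j k t x => U j t x * U k t x, fun _ j k => (hmul j k).1,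
    fun _ j k => (hmul j k).2, ?_⟩
  have hrep : ∀ᵐ t ∂(timeMeasure T), ∀ i, Represents (u t i) (U i t) ∧
      MemLp (U i t) p volume := by
    simp only [eventually_all]
    exact fun i => (hU i).rep
  have hp1 : 1 ≤ p := le_trans (by norm_num) hp
  filter_upwards [hrep] with t ht
  have hm : ∀ j k, MemLp (fun x => U j t x * U k t x) (holderExp p p) volume := fun j k =>
    ⟨(ht j).2.1.mul (ht k).2.1, (eLpNorm_mul_le_of_inv hp1 hp1 (one_le_holderExp hp hp)
      (inv_holderExp _ _) (ht j).2.1 (ht k).2.1).trans_lt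
      (ENNReal.mul_lt_top (ht j).2.2 (ht k).2.2)⟩
  choose W hW using fun j k => exists_TD_of_memLp (one_le_holderExp hp hp) (hm j k)
  refine ⟨W, fun i j => ⟨_, _, (ht i).1, (ht j).1, hW i j⟩, ?_⟩
  obtain ⟨w, h1, h2, h3⟩ := exists_isLerayDiv P fun j k =>
    actedOn_of_memLp P (one_le_holderExp hp hp) (hm j k) (hW j k)
  exact ⟨w, h1, h2, fun i τ hτ ψ => by simpa using h3 i τ hτ ψ⟩

/-! #### Exponents -/

theorem le_of_inv_toReal_le {x y : ℝ≥0∞} (hx : x ≠ 0) (hy : y ≠ 0)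
    (h : (y⁻¹).toReal ≤ (x⁻¹).toReal) : x ≤ y := by
  rw [ENNReal.toReal_le_toReal (ENNReal.inv_ne_top.2 hy) (ENNReal.inv_ne_top.2 hx)] at h
  exact ENNReal.inv_le_inv.1 h

theorem inv_toReal_lt {x y : ℝ≥0∞} (hx : x ≠ 0) (h : x < y) : (y⁻¹).toReal < (x⁻¹).toReal :=
  ENNReal.toReal_strict_mono (ENNReal.inv_ne_top.2 hx) (ENNReal.inv_lt_inv.2 h)

theorem sExp_eq (n : ℕ) (l : ℝ≥0∞) : sExp n l = -1 + n * (l⁻¹).toReal := by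
  rw [sExp, div_eq_mul_inv, ENNReal.toReal_mul, ENNReal.toReal_natCast]

theorem aExp_eq (α : ℝ≥0∞) (ε : ℝ) : aExp α ε = ε + 2 * (α⁻¹).toReal := by
  rw [aExp, div_eq_mul_inv, ENNReal.toReal_mul, ENNReal.toReal_ofNat]

theorem mul_inv_pExp {n : ℕ} (hn : 1 ≤ n) {α : ℝ≥0∞} {ε : ℝ} (h : aExp α ε ≤ 1) :
    n * ((pExp n α ε)⁻¹).toReal = 1 - aExp α ε := by
  have hn0 : (n : ℝ≥0∞) ≠ 0 := by exact_mod_cast (by omega : n ≠ 0)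
  have hn1 : (n : ℝ) ≠ 0 := by exact_mod_cast (by omega : n ≠ 0)
  rw [pExp, ENNReal.inv_div (Or.inl ENNReal.ofReal_ne_top) (Or.inr hn0), ENNReal.toReal_div,
    ENNReal.toReal_ofReal (by linarith), ENNReal.toReal_natCast]
  field_simp

theorem pExp_ne_zero {n : ℕ} (hn : 1 ≤ n) (α : ℝ≥0∞) (ε : ℝ) : pExp n α ε ≠ 0 := by
  have hn0 : (n : ℝ≥0∞) ≠ 0 := by exact_mod_cast (by omega : n ≠ 0)
  simp [pExp, hn0, ENNReal.div_eq_zero_iff]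

theorem Admissible.aExp_le_one {n : ℕ} {α l : ℝ≥0∞} {ε : ℝ} (h : Admissible n α l ε) :
    aExp α ε ≤ 1 := by
  obtain ⟨-, -, -, -, h | h⟩ := h
  · exact h.2.2
  · exact h.2.2.le

theorem inv_two_toReal : ((2 : ℝ≥0∞)⁻¹).toReal = 1 / 2 := by
  rw [ENNReal.toReal_inv, ENNReal.toReal_ofNat]; norm_num

/-- `α ≥ 2` follows from `ε + 2/α ≤ 1` and `ε > 0`; `p ≥ 2` is the condition `-s₂ ≤ ε + 2/α`
rewritten as `n/p ≤ n/2`. -/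
theorem Admissible.two_le {n : ℕ} (hn : 1 ≤ n) {α l : ℝ≥0∞} {ε : ℝ} (h : Admissible n α l ε) :
    2 ≤ α ∧ 2 ≤ pExp n α ε := by
  have hA := h.aExp_le_one
  have hp := mul_inv_pExp hn hA
  obtain ⟨hα, -, hε, -, h⟩ := h
  have hA2 : -sExp n 2 ≤ aExp α ε := by
    rcases h with h | h
    · exact h.2.1
    · exact h.2.1.le
  have hn1 : (1 : ℝ) ≤ n := by exact_mod_cast hn
  rw [sExp_eq, inv_two_toReal] at hA2
  constructor
  · refine le_of_inv_toReal_le (by norm_num) (zero_lt_one.trans_le hα).ne' ?_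
    rw [inv_two_toReal]
    rw [aExp_eq] at hA
    linarith
  · refine le_of_inv_toReal_le (by norm_num) (pExp_ne_zero hn α ε) ?_
    rw [inv_two_toReal]
    by_contra! hlt
    nlinarith

theorem toReal_inv_holderExp {p q : ℝ≥0∞} (hp : p ≠ 0) (hq : q ≠ 0) :
    ((holderExp p q)⁻¹).toReal = (p⁻¹).toReal + (q⁻¹).toReal := by
  rw [inv_holderExp, ENNReal.toReal_add (ENNReal.inv_ne_top.2 hp) (ENNReal.inv_ne_top.2 hq)]

theorem holderExp_le_left {p q : ℝ≥0∞} : holderExp p q ≤ p := by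
  rw [← ENNReal.inv_le_inv, inv_holderExp]
  exact le_self_add

theorem toReal_inv_inv_ofReal {x : ℝ} (hx : 0 ≤ x) :
    (((ENNReal.ofReal x)⁻¹)⁻¹).toReal = x := by
  rw [inv_inv, ENNReal.toReal_ofReal hx]

/-- Mild solutions belong to `L̃²_T Ḃ⁰_{p₀,1} + L̃^α_T Ḃ⁰_{p,1}`. -/
theorem IsMildSolution.memSum (hn : 1 ≤ n) {α l : ℝ≥0∞} {ε : ℝ} (hadm : Admissible n α l ε)
    {p₀ : ℝ≥0∞} {s₀ : ℝ} (hp₀ : 2 ≤ p₀) (hs₁ : -1 < s₀) (hs₀ : s₀ < 0) {f : Fin n → TD n}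
    (hf : ∀ i, MemBesov P s₀ p₀ ∞ (f i)) {u : ℝ → Fin n → TD n} (hX : MemX P T α l ε u)
    (hu : IsMildSolution P T α l ε f u) : MemSum P T 2 p₀ α (pExp n α ε) u := by
  obtain ⟨hα2, hp2⟩ := hadm.two_le hn
  have hA := hadm.aExp_le_one
  have hp := mul_inv_pExp hn hA
  have hn1 : (1 : ℝ) ≤ n := by exact_mod_cast hn
  have hne : ∀ {x : ℝ≥0∞}, 2 ≤ x → x ≠ 0 := fun h => (lt_of_lt_of_le (by norm_num) h).ne'
  have hone : ∀ {x : ℝ≥0∞}, 2 ≤ x → 1 ≤ x := fun h => le_trans (by norm_num) h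
  have hheat := fun i => (hf i).memCheminLerner_heat P (T := T) (hone hp₀) hs₁ hs₀
  obtain ⟨-, hl1, hε, -, hcase⟩ := hadm
  have hl0 : l ≠ 0 := (zero_lt_one.trans_le hl1).ne'
  set p := pExp n α ε with hpdef
  rw [aExp_eq] at hp
  obtain ⟨b, ⟨rfl, hB⟩ | ⟨hlp, hB⟩, heq⟩ := hu
  · have hzero : sExp n p + aExp α ε = 0 := by rw [sExp_eq, aExp_eq]; linarith
    rcases hX with ⟨-, hX⟩ | ⟨hX, -⟩
    · obtain ⟨ω, hω⟩ := exists_productData_of_memTimeLp P hα2 hp2 hX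
      refine hω.memSum P (hone hα2) (hone hp2) (fun _ => holderExp_le_left)
        (fun _ => one_le_holderExp hα2 hα2) (fun _ => holderExp_le_left) (fun _ => ?_) hheat
        (fun i => (hX i).1) hB heq
      -- The exponent is `1 + n/p - 2(1 - 1/α) = -ε`.
      rw [toReal_inv_holderExp (hne hp2) (hne hp2), toReal_inv_holderExp (hne hα2) (hne hα2)]
      linarith
    · linarith
  · have hlt := inv_toReal_lt hl0 hlp
    have hpos : 0 < sExp n l + aExp α ε := by
      rw [sExp_eq, aExp_eq]
      nlinarith
    obtain ⟨-, hs2, hA1⟩ : 0 < sExp n l + aExp α ε ∧ -sExp n 2 < aExp α ε ∧ aExp α ε < 1 := by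
      rcases hcase with h | h
      · linarith [h.1]
      · exact h
    rcases hX with ⟨hX, -⟩ | ⟨-, hX⟩
    · linarith
    set x := (p⁻¹).toReal with hx
    set y := (l⁻¹).toReal with hy
    have hx0 : 0 < x := by
      rw [aExp_eq] at hA1
      by_contra! hle
      nlinarith
    have hx2 : x < 1 / 2 := by
      rw [sExp_eq, inv_two_toReal, aExp_eq] at hs2
      by_contra! hle
      nlinarith
    -- With `x = 1/p` and `y = 1/ℓ`, the exponents used are `1/q = x ∓ δ`. The bounds on `δ` ensure,
    -- in order, that products of two pieces lie in `L^r` with `r ≤ p`, that `q ≥ 2`, that `ℓ ≤ q`,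
    -- and that the loss `2nδ` stays below `ε`.
    obtain ⟨δ, hδ0, hδx, hδ2, hδy, hδε⟩ : ∃ δ : ℝ, 0 < δ ∧ 2 * δ ≤ x ∧ x + δ ≤ 1 / 2 ∧
        x + δ ≤ y ∧ 2 * (n * δ) < ε := by
      refine ⟨min (min (x / 2) (1 / 2 - x)) (min (y - x) (ε / (4 * n))), ?_, ?_, ?_, ?_, ?_⟩
      · have : 0 < ε / (4 * n) := by positivity
        simp only [lt_min_iff]
        exact ⟨⟨by linarith, by linarith⟩, by linarith, this⟩
      · linarith [(min_le_left (min (x / 2) (1 / 2 - x)) (min (y - x) (ε / (4 * n)))).trans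
          (min_le_left _ _)]
      · linarith [(min_le_left (min (x / 2) (1 / 2 - x)) (min (y - x) (ε / (4 * n)))).trans
          (min_le_right _ _)]
      · linarith [(min_le_right (min (x / 2) (1 / 2 - x)) (min (y - x) (ε / (4 * n)))).trans
          (min_le_left _ _)]
      · have h1 := (min_le_right (min (x / 2) (1 / 2 - x)) (min (y - x) (ε / (4 * n)))).trans
          (min_le_right _ _)
        have h2 : (n : ℝ) * (ε / (4 * n)) = ε / 4 := by field_simp
        have h3 := mul_le_mul_of_nonneg_left h1 (by linarith : (0 : ℝ) ≤ n)
        linarith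
    set q : Bool → ℝ≥0∞ := fun c => bif c then (ENNReal.ofReal (x - δ))⁻¹
      else (ENNReal.ofReal (x + δ))⁻¹ with hq
    have hqt : ((q true)⁻¹).toReal = x - δ := toReal_inv_inv_ofReal (by linarith)
    have hqf : ((q false)⁻¹).toReal = x + δ := toReal_inv_inv_ofReal (by linarith)
    have hq0 : ∀ c, q c ≠ 0 := fun c => by cases c <;> simp [hq]
    have hqb : ∀ c, x - δ ≤ ((q c)⁻¹).toReal ∧ ((q c)⁻¹).toReal ≤ x + δ := fun c => by
      cases c
      · rw [hqf]; exact ⟨by linarith, le_rfl⟩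
      · rw [hqt]; exact ⟨le_rfl, by linarith⟩
    have hq2 : ∀ c, 2 ≤ q c := fun c => le_of_inv_toReal_le (by norm_num) (hq0 c) (by
      rw [inv_two_toReal]; linarith [(hqb c).2])
    have hlq : ∀ c, l ≤ q c := fun c => le_of_inv_toReal_le hl0 (hq0 c) (by
      linarith [(hqb c).2])
    -- The regularity is exactly the loss in Bernstein's inequality from `L^ℓ` to `L^p`, so moving
    -- `1/q` by `∓δ` leaves block exponents `±nδ`.
    have hσ : sExp n l + aExp α ε = n * (y - x) := by
      rw [sExp_eq, aExp_eq, mul_sub]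
      linarith
    have hnδ : 0 < n * δ := by positivity
    have hsplit : IsSplit P T (fun _ => α) q u := by
      refine ⟨fun c t i => bif c then lowFreq P 0 (u t i) else u t i - lowFreq P 0 (u t i),
        fun c i => ?_, Eventually.of_forall fun t => funext fun i => ?_⟩
      · cases c
        · refine (hX i).high P (hone hα2) hl1 (hlq false) hnδ ?_
          rw [hqf, hσ, ← hy]; ring
        · refine (hX i).low P hl1 (hlq true) hnδ ?_
          rw [hqt, hσ, ← hy]; ring
      · exact (add_sub_cancel (lowFreq P 0 (u t i)) (u t i)).symm
    obtain ⟨⟨ω, hω⟩, hBony⟩ := hsplit.exists_productData P (fun _ => hα2) hq2 hsplit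
    -- The splitting justifies Bony's formula for `u` itself, so `B̃[u,u]` may be replaced by
    -- `B[u,u]` and the Duhamel estimates apply.
    have hB' := (hω.isB_iff P hBony b).2 hB
    refine hω.memSum P (hone hα2) (hone hp2) (fun c => ?_)
      (fun _ => one_le_holderExp hα2 hα2) (fun _ => holderExp_le_left) (fun c => ?_) hheat
      (fun i => (hX i).1) hB' heq
    · refine le_of_inv_toReal_le (zero_lt_one.trans_le (one_le_holderExp (hq2 c.1) (hq2 c.2))).ne' (hne hp2) ?_
      rw [toReal_inv_holderExp (hq0 _) (hq0 _)]
      linarith [(hqb c.1).1, (hqb c.2).1]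
    · rw [toReal_inv_holderExp (hq0 _) (hq0 _), toReal_inv_holderExp (hne hα2) (hne hα2)]
      have h1 : (n : ℝ) * (((q c.1)⁻¹).toReal + ((q c.2)⁻¹).toReal - x) ≤ n * (x + 2 * δ) :=
        mul_le_mul_of_nonneg_left (by linarith [(hqb c.1).2, (hqb c.2).2]) (by linarith)
      have h2 : (n : ℝ) * (x + 2 * δ) = n * x + 2 * (n * δ) := by ring
      linarith

end Mild

end BesovNS

end

theorem mainTheorem5 (n : ℕ) (hn : 1 ≤ n) (P : LPPair n) (T : ℝ) (hT : 0 < T) :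
    -- (i)
    (∀ (α l : ℝ≥0∞) (ε : ℝ), Admissible n α l ε →
      ∀ (p₀ : ℝ≥0∞) (s₀ : ℝ), 2 ≤ p₀ → -1 < s₀ → s₀ < 0 →
        (∀ f : Fin n → TD n, (∀ i, MemBesov P s₀ p₀ ∞ (f i)) →
          ∀ u : ℝ → Fin n → TD n, MemX P T α l ε u → IsMildSolution P T α l ε f u →
            MemSum P T 2 p₀ α (pExp n α ε) u) ∧
        (∀ u v : ℝ → Fin n → TD n,
          MemSum P T 2 p₀ α (pExp n α ε) u → MemSum P T 2 p₀ α (pExp n α ε) v →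
            (∀ᵐ t ∂(timeMeasure T), ∃ W : Fin n → Fin n → TD n,
              (∀ i j, IsPointwiseProduct (u t i) (v t j) (W i j) ∧
                IsBony P (u t i) (v t j) (W i j)) ∧
              ∃ w : Fin n → TD n, IsLerayDiv W w ∧ IsLerayDivLP P W w) ∧
            (∃ b, IsB T u v b) ∧ ∀ b, IsB T u v b ↔ IsBTilde P T u v b)) ∧
    -- (ii)
    (∀ p : ℝ≥0∞, 1 ≤ p → ∀ W : ℝ → Fin n → Fin n → TD n,
      (∀ j k, MemTimeLp T 1 p (fun t => W t j k)) →
        ∃ g : ℝ → Fin n → TD n, IsDuhamelLerayDiv T W g ∧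
          (∀ i, MemTimeLp T 1 p (fun t => g t i)) ∧
          ∀ ω : ℝ → Fin n → Fin n → Rn n → ℂ,
            (∀ᵐ s ∂(timeMeasure T), ∀ j k, Represents (W s j k) (ω s j k)) →
              ∀ i,
                (∀ᵐ z ∂((timeMeasure T).prod (volume : Measure (Rn n))),
                  (∀ᵐ s ∂(timeMeasure z.1), ∀ j k,
                    Integrable (fun y => gradOseen i j k (z.1 - s) (z.2 - y) * ω s j k y)) ∧
                  IntervalIntegrable (oseenInner ω i z.1 z.2) volume 0 z.1) ∧
                AEStronglyMeasurable (fun z : ℝ × Rn n => oseenIntegral ω i z.1 z.2)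
                  ((timeMeasure T).prod volume) ∧
                ∀ᵐ t ∂(timeMeasure T), Represents (g t i) (oseenIntegral ω i t)) := by
  refine ⟨fun α l ε hadm p₀ s₀ hp₀ hs₁ hs₀ =>
    ⟨fun f hf u hX hu => hu.memSum P hn hadm hp₀ hs₁ hs₀ hf hX, fun u v hu hv => ?_⟩,
    fun p hp W hW => duhamel_lerayDiv P hp hW⟩
  -- In both summands the time exponents `2`, `α` and the space exponents `p₀`, `p` are at least
  -- `2`, which is all that the product theory needs.
  obtain ⟨hα, hp⟩ := hadm.two_le hn
  exact (hu.isSplit P).bilinear P (fun c => by cases c <;> simp [hα])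
    (fun c => by cases c <;> simp [hp, hp₀]) (hv.isSplit P)
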